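/- Let \(m\ge 0\) and \([m]=\{1,\dots,m\}\). For a simplicial complex \(\Sigma\) on \([m]\) (a set of subsets of \([m]\) that contains \(\emptyset\) and is closed under passing to subsets; not every \(\{i\}\) has to belong to \(\Sigma\)), consider the following differential graded coalgebras (dgcs) over \(\mathbb{Z}\). (a) \(C(\mathcal{Z}(\Sigma))\), the normalized singular chains with integral coefficients, with the Alexander–Whitney diagonal \(\Delta x=\sum_{k=0}^{n}x(0\dots k)\otimes x(k\dots n)\) for a singular \(n\)-simplex \(x\), on the moment-angle complex \[ \mathcal{Z}(\Sigma)=\bigcup_{\sigma\in\Sigma}\{(z_1,\dots,z_m)\in (D^2)^m \mid z_i\in S^1 \text{ if } i\notin\sigma\}. \] (b) \(\mathbf{K}(\Sigma)=\mathbb{Z}\langle\Sigma\rangle\otimes\bigwedge(v_1,\dots,v_m)\), the tensor product of the Stanley–Reisner coalgebra \(\mathbb{Z}\langle\Sigma\rangle\) and an exterior coalgebra. Here \(\mathbb{Z}\langle\Sigma\rangle\) has as basis the elements \(u_\alpha\) of degree \(2(\alpha_1+\dots+\alpha_m)\) for all \(\alpha\in\mathbb{N}^m\) with \(\operatorname{supp}\alpha=\{i\mid\alpha_i>0\}\in\Sigma\),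 with \(\Delta u_\alpha=\sum_{\beta+\gamma=\alpha}u_\beta\otimes u_\gamma\), \(\epsilon(u_0)=1\) and \(\epsilon(u_\alpha)=0\) for \(\alpha\ne0\). The \(v_i\) are primitive of degree \(1\), \(v_\tau=v_{i_1}\wedge\dots\wedge v_{i_k}\) for \(\tau=\{i_1<\dots<i_k\}\subset[m]\), and the differential is \[ d(u_\alpha\otimes v_\tau)=\sum_{\alpha_i>0}u_{\alpha-i}\otimes v_i\wedge v_\tau , \] where \(\alpha-i\) is obtained from \(\alpha\) by decreasing the \(i\)-th component by \(1\). (c) \(\mathbf{L}(\Sigma)\subset\mathbf{K}(\Sigma)\), the sub-dgc spanned by the elements \(u_\sigma\otimes v_\tau\) for disjoint \(\sigma\in\Sigma\) and \(\tau\subset[m]\), where \(u_\sigma=u_\alpha\) for the indicator function \(\alpha\) of \(\sigma\). Then the dgcs \(C(\mathcal{Z}(\Sigma))\), \(\mathbf{K}(\Sigma)\) and \(\mathbf{L}(\Sigma)\) are quasi-isomorphic, naturally with respect to inclusions of subcomplexes: as functors of \(\Sigma\) (on the set of simplicial complexes on \([m]\), ordered by inclusion), any two of them are connected by a zigzag of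 natural transformations consisting of quasi-isomorphisms of dgcs. More precisely, the inclusion \(\mathbf{L}(\Sigma)\hookrightarrow\mathbf{K}(\Sigma)\) is a quasi-isomorphism of dgcs for every \(\Sigma\), and there are quasi-isomorphisms of dgcs \(\Psi(\Sigma)\colon\mathbf{L}(\Sigma)\to C(\mathcal{Z}(\Sigma))\) that are natural with respect to inclusions of subcomplexes. -/

import Mathlib

open CategoryTheory

section MomentAngleComplexes

open Simplicial Opposite
open scoped TensorProduct

/-! ## Differential graded coalgebras -/

/-- The involution of a graded module that is multiplication by `(-1) ^ n` in degree `n`. -/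
noncomputable def degreeSign {R A : Type} [CommRing R] [AddCommGroup A] [Module R A]
    (deg : ℕ → Submodule R A) (h : DirectSum.IsInternal deg) : A →ₗ[R] A :=
  (DirectSum.toModule R ℕ A fun n => ((-1 : R) ^ n) • (deg n).subtype) ∘ₗ
    (LinearEquiv.ofBijective (DirectSum.coeLinearMap deg) h).symm.toLinearMap

theorem degreeSign_of_mem {R A : Type} [CommRing R] [AddCommGroup A] [Module R A]
    (deg : ℕ → Submodule R A) (h : DirectSum.IsInternal deg) {n : ℕ} {x : A} (hx : x ∈ deg n) :
    degreeSign deg h x = ((-1 : R) ^ n) • x := by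
  have : (LinearEquiv.ofBijective (DirectSum.coeLinearMap deg) h).symm x
      = DirectSum.lof R ℕ (fun i => deg i) n ⟨x, hx⟩ := by
    rw [LinearEquiv.symm_apply_eq]
    exact (DirectSum.coeLinearMap_lof deg n ⟨x, hx⟩).symm
  rw [degreeSign, LinearMap.comp_apply, LinearEquiv.coe_coe, this, DirectSum.toModule_lof]
  simp

/-- The part of degree `n` of the tensor square of a graded module, generated by the tensors
`a ⊗ b` with `|a| + |b| = n`. -/
def tensorDegree {R A : Type} [CommRing R] [AddCommGroup A] [Module R A]
    (deg : ℕ → Submodule R A) (n : ℕ) : Submodule R (A ⊗[R] A) :=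
  Submodule.span R {t | ∃ p q : ℕ, p + q = n ∧ ∃ a ∈ deg p, ∃ b ∈ deg q, t = a ⊗ₜ[R] b}

theorem tmul_mem_tensorDegree {R A : Type} [CommRing R] [AddCommGroup A] [Module R A]
    {deg : ℕ → Submodule R A} {n p q : ℕ} (h : p + q = n) {a b : A} (ha : a ∈ deg p)
    (hb : b ∈ deg q) : a ⊗ₜ[R] b ∈ tensorDegree deg n :=
  Submodule.subset_span ⟨p, q, h, a, ha, b, hb, rfl⟩

/-- A differential graded coalgebra (dgc) over a commutative ring `R`: a non-negatively graded
module `C = ⨁ C_n` with a coassociative counital diagonal and augmentation of degree `0`, and a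
differential of degree `-1` for which both of them are chain maps, where
`d (a ⊗ b) = d a ⊗ b + (-1) ^ |a| a ⊗ d b` on `C ⊗ C`. -/
structure DGCoalgebra (R : Type) [CommRing R] : Type 1 where
  carrier : Type
  [addCommGroup : AddCommGroup carrier]
  [module : Module R carrier]
  [coalgebra : Coalgebra R carrier]
  /-- the homogeneous part of a given degree -/
  deg : ℕ → Submodule R carrier
  isInternal : DirectSum.IsInternal deg
  /-- the differential -/
  d : carrier →ₗ[R] carrier
  d_mem : ∀ n, ∀ x ∈ deg (n + 1), d x ∈ deg n
  d_deg_zero : ∀ x ∈ deg 0, d x = 0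
  d_d : ∀ x, d (d x) = 0
  comul_mem : ∀ n, ∀ x ∈ deg n, Coalgebra.comul (R := R) x ∈ tensorDegree deg n
  counit_of_pos : ∀ n, 0 < n → ∀ x ∈ deg n, Coalgebra.counit (R := R) x = 0
  comul_d : ∀ x, Coalgebra.comul (R := R) (d x) =
    TensorProduct.map d LinearMap.id (Coalgebra.comul (R := R) x) +
      TensorProduct.map (degreeSign deg isInternal) d (Coalgebra.comul (R := R) x)
  counit_d : ∀ x, Coalgebra.counit (R := R) (d x) = 0

namespace DGCoalgebra

attribute [instance] DGCoalgebra.addCommGroup DGCoalgebra.module DGCoalgebra.coalgebra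

variable {R : Type} [CommRing R]

/-- Morphisms of dgcs: maps of coalgebras of degree `0` that commute with the differentials. -/
@[ext]
structure Hom (C D : DGCoalgebra R) where
  toCoalgHom : C.carrier →ₗc[R] D.carrier
  map_deg : ∀ n, ∀ x ∈ C.deg n, toCoalgHom x ∈ D.deg n
  map_d : ∀ x, toCoalgHom (C.d x) = D.d (toCoalgHom x)

instance : Category (DGCoalgebra R) where
  Hom := Hom
  id C := ⟨CoalgHom.id R C.carrier, fun _ _ h => h, fun _ => rfl⟩
  comp f g := ⟨g.toCoalgHom.comp f.toCoalgHom,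
    fun n x h => g.map_deg n _ (f.map_deg n x h), fun x => by simp [f.map_d, g.map_d]⟩

/-- The underlying chain complex of a dgc. -/
noncomputable def toChainComplex (C : DGCoalgebra R) : ChainComplex (ModuleCat R) ℕ :=
  ChainComplex.of (fun n => ModuleCat.of R (C.deg n))
    (fun n => ModuleCat.ofHom (C.d.restrict (C.d_mem n)))
    (fun n => by
      ext x : 2
      exact Subtype.ext (C.d_d x.1))

/-- The chain map underlying a morphism of dgcs. -/
noncomputable def mapChainComplex {C D : DGCoalgebra R} (f : C ⟶ D) :
    C.toChainComplex ⟶ D.toChainComplex :=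
  ChainComplex.ofHom
    (fun n => ModuleCat.ofHom (f.toCoalgHom.toLinearMap.restrict (f.map_deg n)))
    (fun n => by
      simp only [toChainComplex, ChainComplex.of_d]
      ext x : 2
      exact Subtype.ext (f.map_d x.1).symm)

/-- A morphism of dgcs is a quasi-isomorphism if it induces an isomorphism in homology. -/
def IsQuasiIso {C D : DGCoalgebra R} (f : C ⟶ D) : Prop :=
  QuasiIso (mapChainComplex f)

/-- Two functors with values in dgcs are naturally quasi-isomorphic if they can be connected by a
zigzag of natural transformations consisting of quasi-isomorphisms of dgcs. -/
def NaturallyQuasiIsomorphic {J : Type} [Category.{0} J] (F G : J ⥤ DGCoalgebra R) : Prop :=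
  Relation.EqvGen (fun F' G' : J ⥤ DGCoalgebra R => ∃ φ : F' ⟶ G', ∀ j, IsQuasiIso (φ.app j)) F G

end DGCoalgebra

/-- A family of submodules is a grading as soon as it generates and has degree projections. -/
theorem isInternal_of_proj {R A : Type} [CommRing R] [AddCommGroup A] [Module R A]
    (deg : ℕ → Submodule R A)
    (p : ℕ → A →ₗ[R] A) (h1 : ∀ n, ∀ x ∈ deg n, p n x = x)
    (h2 : ∀ n k, k ≠ n → ∀ x ∈ deg k, p n x = 0) (htop : ⨆ n, deg n = ⊤) :
    DirectSum.IsInternal deg := by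
  rw [DirectSum.isInternal_submodule_iff_iSupIndep_and_iSup_eq_top]
  refine ⟨fun n => ?_, htop⟩
  rw [Submodule.disjoint_def]
  intro x hx hx'
  have : (⨆ j, ⨆ (_ : j ≠ n), deg j) ≤ LinearMap.ker (p n) :=
    iSup₂_le fun k hk y hy => h2 n k hk y hy
  rw [← h1 n x hx]
  exact this hx'

/-! ## Normalized chains -/

section Normalized

variable (R : Type) [CommRing R]

/-- Non-normalized chains on a simplicial set (of all dimensions). -/
abbrev AllChains (X : SSet.{0}) : Type := (Σ n : ℕ, X _⦋n⦌) →₀ R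

/-- The submodule generated by the degenerate simplices. -/
noncomputable def degenerateChains (X : SSet.{0}) : Submodule R (AllChains R X) :=
  Submodule.span R {c | ∃ (n : ℕ) (x : X _⦋n⦌), x ∈ X.degenerate n ∧ c = Finsupp.single ⟨n, x⟩ 1}

/-- Normalized chains on a simplicial set: chains modulo degenerate ones. -/
def NormalizedChains (X : SSet.{0}) : Type := AllChains R X ⧸ degenerateChains R X

namespace NormalizedChains

noncomputable instance (X : SSet.{0}) : AddCommGroup (NormalizedChains R X) :=
  inferInstanceAs (AddCommGroup (AllChains R X ⧸ degenerateChains R X))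

noncomputable instance (X : SSet.{0}) : Module R (NormalizedChains R X) :=
  inferInstanceAs (Module R (AllChains R X ⧸ degenerateChains R X))

variable {X Y : SSet.{0}} {M : Type} [AddCommGroup M] [Module R M]

/-- The normalized chain represented by a simplex. -/
noncomputable def of {n : ℕ} (x : X _⦋n⦌) : NormalizedChains R X :=
  (degenerateChains R X).mkQ (Finsupp.single ⟨n, x⟩ 1)

theorem of_degenerate {n : ℕ} {x : X _⦋n⦌} (hx : x ∈ X.degenerate n) : of R x = 0 :=
  (Submodule.Quotient.mk_eq_zero _).2 (Submodule.subset_span ⟨n, x, hx, rfl⟩)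

variable {R}

/-- The linear map on normalized chains with given values on simplices. -/
noncomputable def lift (f : ∀ n : ℕ, X _⦋n⦌ → M)
    (hf : ∀ (n : ℕ) (x : X _⦋n⦌), x ∈ X.degenerate n → f n x = 0) : NormalizedChains R X →ₗ[R] M :=
  (degenerateChains R X).liftQ (Finsupp.lift M R (Σ n : ℕ, X _⦋n⦌) fun s => f s.1 s.2) (by
    rw [degenerateChains, Submodule.span_le]
    rintro _ ⟨n, x, hx, rfl⟩
    simp [Finsupp.sum_single_index, hf n x hx])

@[simp]
theorem lift_of (f : ∀ n : ℕ, X _⦋n⦌ → M) (hf) {n : ℕ} (x : X _⦋n⦌) :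
    lift f hf (of R x) = f n x := by
  unfold lift of
  erw [Submodule.liftQ_apply]
  simp [Finsupp.sum_single_index]

theorem hom_ext {f g : NormalizedChains R X →ₗ[R] M}
    (h : ∀ (n : ℕ) (x : X _⦋n⦌), f (of R x) = g (of R x)) : f = g := by
  refine Submodule.linearMap_qext (degenerateChains R X) ?_
  ext ⟨n, x⟩
  exact h n x

variable (R X)

/-- Normalized chains of degree `n`. -/
noncomputable def deg (n : ℕ) : Submodule R (NormalizedChains R X) :=
  Submodule.span R (Set.range fun x : X _⦋n⦌ => of R x)

variable {X}

theorem of_mem {n : ℕ} (x : X _⦋n⦌) : of R x ∈ deg R X n := Submodule.subset_span ⟨x, rfl⟩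

variable {R}

theorem deg_le {n : ℕ} {N : Submodule R (NormalizedChains R X)}
    (h : ∀ x : X _⦋n⦌, of R x ∈ N) : deg R X n ≤ N := by
  rw [deg, Submodule.span_le]
  rintro _ ⟨x, rfl⟩
  exact h x

variable (R X)

open Classical in
theorem isInternal : DirectSum.IsInternal (deg R X) := by
  refine isInternal_of_proj _
    (fun n => lift (fun k x => if k = n then of R x else 0) ?_) ?_ ?_ ?_
  · intro k x hx
    simp [of_degenerate R hx]
  · intro n x hx
    refine deg_le (N := LinearMap.eqLocus _ LinearMap.id) ?_ hx
    intro x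
    simp
  · intro n k hk x hx
    refine deg_le (N := LinearMap.ker _) ?_ hx
    intro x
    simp [hk]
  · rw [eq_top_iff]
    have : (⨆ n, deg R X n).mkQ = 0 := hom_ext fun n x => by
      simpa using Submodule.mem_iSup_of_mem n (of_mem R x)
    intro x _
    simpa using LinearMap.congr_fun this x

end NormalizedChains
end Normalized

namespace NormalizedChains

section

variable (R : Type) [CommRing R] {X Y : SSet.{0}}

/-- The boundary of a simplex. -/
noncomputable def boundary (n : ℕ) (x : X _⦋n⦌) : NormalizedChains R X :=
  match n, x with
  | 0, _ => 0
  | n + 1, x => ∑ i : Fin (n + 2), ((-1 : R) ^ (i : ℕ)) • of R (X.δ i x)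

/-- The Alexander-Whitney diagonal of an `n`-simplex `x`: the sum over all `0 ≤ k ≤ n` of
`x(0 … k) ⊗ x(k … n)`. -/
noncomputable def diagonal (n : ℕ) (x : X _⦋n⦌) : NormalizedChains R X ⊗[R] NormalizedChains R X :=
  ∑ k : Fin (n + 1),
    of R (X.map (SimplexCategory.subinterval 0 k.1 (by omega)).op x) ⊗ₜ[R]
      of R (X.map (SimplexCategory.subinterval k.1 (n - k.1) (by omega)).op x)

theorem map_degenerate {n m : ℕ} (f : ⦋n⦌ ⟶ ⦋m⦌) (hf : ¬ Function.Injective f.toOrderHom)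
    (x : X _⦋m⦌) : X.map f.op x ∈ X.degenerate n := by
  cases n with
  | zero => exact absurd (fun a b _ => Subsingleton.elim (α := Fin 1) a b) hf
  | succ n =>
    obtain ⟨i, θ, rfl⟩ := SimplexCategory.eq_σ_comp_of_not_injective f hf
    refine ⟨n, Nat.lt_succ_self n, SimplexCategory.σ i, X.map θ.op x, ?_⟩
    simp

theorem of_map {n m : ℕ} (f : ⦋n⦌ ⟶ ⦋m⦌) (hf : ¬ Function.Injective f.toOrderHom)
    (x : X _⦋m⦌) : of R (X.map f.op x) = 0 :=
  of_degenerate R (map_degenerate f hf x)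

theorem exists_σ {n : ℕ} {x : X _⦋n⦌} (hx : x ∈ X.degenerate n) :
    ∃ (k : ℕ) (h : n = k + 1) (j : Fin (k + 1)) (y : X _⦋k⦌), h ▸ x = X.map (SimplexCategory.σ j).op y := by
  cases n with
  | zero => simp at hx
  | succ n =>
    rw [SSet.degenerate_eq_iUnion_range_σ] at hx
    obtain ⟨i, y, rfl⟩ := Set.mem_iUnion.1 hx
    exact ⟨n, rfl, i, y, rfl⟩

theorem boundary_degenerate {n : ℕ} {x : X _⦋n⦌} (hx : x ∈ X.degenerate n) :
    boundary R n x = 0 := by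
  obtain ⟨k, rfl, j, y, hy⟩ := exists_σ hx
  obtain rfl : x = X.map (SimplexCategory.σ j).op y := hy
  have key : ∀ i : Fin (k + 2), of R (X.δ i (X.map (SimplexCategory.σ j).op y)) =
      of R (X.map (SimplexCategory.δ i ≫ SimplexCategory.σ j).op y) := fun i => by
    simp [SimplicialObject.δ]
  simp only [boundary, key]
  rw [Fintype.sum_eq_add j.castSucc j.succ Fin.castSucc_lt_succ.ne]
  · rw [SimplexCategory.δ_comp_σ_self, SimplexCategory.δ_comp_σ_succ]
    simp [pow_succ]
  · rintro i ⟨h1, h2⟩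
    rw [of_map, smul_zero]
    intro hinj
    have h3 : ∀ a b : Fin (k + 1), SimplexCategory.Hom.toOrderHom (SimplexCategory.δ i ≫ SimplexCategory.σ j) a
      = SimplexCategory.Hom.toOrderHom (SimplexCategory.δ i ≫ SimplexCategory.σ j) b → a = b := fun a b h => hinj h
    have hval : ∀ a : Fin (k+1), SimplexCategory.Hom.toOrderHom (SimplexCategory.δ i ≫ SimplexCategory.σ j) a
       = j.predAbove (i.succAbove a) := fun a => rfl
    simp only [hval] at h3
    obtain ⟨a, ha⟩ := Fin.exists_succAbove_eq h1.symm
    obtain ⟨b, hb⟩ := Fin.exists_succAbove_eq h2.symm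
    have := h3 a b (by rw [ha, hb]; simp)
    subst this
    rw [ha] at hb
    exact Fin.castSucc_lt_succ.ne hb

theorem diagonal_degenerate {n : ℕ} {x : X _⦋n⦌} (hx : x ∈ X.degenerate n) :
    diagonal R n x = 0 := by
  obtain ⟨k, rfl, j, y, hy⟩ := exists_σ hx
  obtain rfl : x = X.map (SimplexCategory.σ j).op y := hy
  refine Finset.sum_eq_zero fun i _ => ?_
  have key : ∀ {l : ℕ} (f : ⦋l⦌ ⟶ ⦋k + 1⦌), X.map f.op (X.map (SimplexCategory.σ j).op y) =
      X.map (f ≫ SimplexCategory.σ j).op y := fun f => by simp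
  rw [key, key]
  rcases lt_or_ge j.1 i.1 with h | h
  · rw [of_map, TensorProduct.zero_tmul]
    intro hinj
    have := @hinj (⟨j.1, by omega⟩ : Fin (i.1 + 1)) (⟨j.1 + 1, by omega⟩ : Fin (i.1 + 1)) (by
      change j.predAbove ⟨_, _⟩ = j.predAbove ⟨_, _⟩
      simp [Fin.predAbove, Fin.ext_iff, Fin.lt_def])
    simp at this
  · rw [of_map R (SimplexCategory.subinterval i.1 _ _ ≫ _), TensorProduct.tmul_zero]
    intro hinj
    have := @hinj (⟨j.1 - i.1, by omega⟩ : Fin (k + 1 - i.1 + 1))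
      (⟨j.1 - i.1 + 1, by omega⟩ : Fin (k + 1 - i.1 + 1)) (by
      change j.predAbove ⟨_, _⟩ = j.predAbove ⟨_, _⟩
      simp [Fin.predAbove, Fin.ext_iff, Fin.lt_def]
      split_ifs <;> simp <;> omega)
    simp at this

variable (X)

/-- The differential of normalized chains, given by the alternating sum of the faces. -/
noncomputable def differential : NormalizedChains R X →ₗ[R] NormalizedChains R X :=
  lift (boundary R) fun _ _ => boundary_degenerate R

theorem counit_degenerate (n : ℕ) (x : X _⦋n⦌) (hx : x ∈ X.degenerate n) :
    (if n = 0 then (1 : R) else 0) = 0 := by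
  cases n with
  | zero => simp at hx
  | succ n => simp

/-- The diagonal is the Alexander-Whitney map, the augmentation sends `0`-simplices to `1`. -/
noncomputable instance : CoalgebraStruct R (NormalizedChains R X) where
  comul := lift (diagonal R) fun _ _ => diagonal_degenerate R
  counit := lift (fun n _ => if n = 0 then 1 else 0) (counit_degenerate R X)

end
end NormalizedChains

namespace NormalizedChains

section

variable {R : Type} [CommRing R] {X Y : SSet.{0}}

theorem differential_of {n : ℕ} (x : X _⦋n⦌) : differential R X (of R x) = boundary R n x :=
  lift_of _ _ x

theorem comul_of {n : ℕ} (x : X _⦋n⦌) :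
    CoalgebraStruct.comul (R := R) (of R x) = diagonal R n x :=
  lift_of _ _ x

theorem counit_of {n : ℕ} (x : X _⦋n⦌) :
    CoalgebraStruct.counit (R := R) (of R x) = if n = 0 then 1 else 0 :=
  lift_of _ _ x

variable (R)

/-- The face of `x` with vertices `a, …, a + l`; auxiliary. -/
noncomputable def seg {n : ℕ} (x : X _⦋n⦌) (a l : ℕ) : NormalizedChains R X :=
  if h : a + l ≤ n then of R (X.map (SimplexCategory.subinterval a l h).op x) else 0

/-- The `i`-th face of the face of `x` with vertices `a, …, a + l + 1`; auxiliary. -/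
noncomputable def skip {n : ℕ} (x : X _⦋n⦌) (a l i : ℕ) : NormalizedChains R X :=
  if h : a + (l + 1) ≤ n ∧ i < l + 2 then
    of R (X.map (SimplexCategory.δ (⟨i, h.2⟩ : Fin (l + 2)) ≫
      SimplexCategory.subinterval a (l + 1) h.1).op x) else 0

theorem of_map_congr {n m : ℕ} {f g : ⦋n⦌ ⟶ ⦋m⦌} (x : X _⦋m⦌)
    (h : ∀ i : Fin (n + 1), (f.toOrderHom i).1 = (g.toOrderHom i).1) :
    of R (X.map f.op x) = of R (X.map g.op x) := by
  have : f = g := by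
    ext i : 3
    exact Fin.ext (h i)
  rw [this]

theorem diagonal_eq {n : ℕ} (x : X _⦋n⦌) :
    diagonal R n x = ∑ k ∈ Finset.range (n + 1), seg R x 0 k ⊗ₜ[R] seg R x k (n - k) := by
  rw [diagonal, Finset.sum_range]
  refine Finset.sum_congr rfl fun k _ => ?_
  rw [seg, seg, dif_pos (by omega), dif_pos (by omega)]

theorem map_map_op {n m l : ℕ} (f : ⦋n⦌ ⟶ ⦋m⦌) (g : ⦋m⦌ ⟶ ⦋l⦌) (x : X _⦋l⦌) :
    X.map f.op (X.map g.op x) = X.map (f ≫ g).op x := by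
  simp

theorem diagonal_seg {n : ℕ} (x : X _⦋n⦌) (a l : ℕ) (h : a + l ≤ n) :
    CoalgebraStruct.comul (R := R) (seg R x a l) =
      ∑ j ∈ Finset.range (l + 1), seg R x a j ⊗ₜ[R] seg R x (a + j) (l - j) := by
  rw [seg, dif_pos h, comul_of, diagonal, Finset.sum_range]
  refine Finset.sum_congr rfl fun k _ => ?_
  rw [seg, seg, dif_pos (by omega), dif_pos (by omega), map_map_op, map_map_op]
  refine congrArg₂ (· ⊗ₜ[R] ·) ?_ ?_
  · refine of_map_congr R x fun i => ?_
    change (i.1 + 0) + a = i.1 + a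
    omega
  · refine of_map_congr R x fun i => ?_
    change (i.1 + k.1) + a = i.1 + (a + k.1)
    omega

theorem seg_degree {n : ℕ} (x : X _⦋n⦌) (a l : ℕ) : seg R x a l ∈ deg R X l := by
  unfold seg
  split_ifs
  · exact of_mem R _
  · exact zero_mem _

theorem counit_seg {n : ℕ} (x : X _⦋n⦌) (a l : ℕ) (h : a + l ≤ n) :
    CoalgebraStruct.counit (R := R) (seg R x a l) = if l = 0 then 1 else 0 := by
  rw [seg, dif_pos h, counit_of]

theorem seg_self {n : ℕ} (x : X _⦋n⦌) : seg R x 0 n = of R x := by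
  rw [seg, dif_pos (by omega), of_map_congr R (g := 𝟙 _) x]
  · simp
  · intro i
    rfl

theorem differential_seg_zero {n : ℕ} (x : X _⦋n⦌) (a : ℕ) :
    differential R X (seg R x a 0) = 0 := by
  unfold seg
  split_ifs
  · rw [differential_of]; rfl
  · simp

theorem differential_seg_succ {n : ℕ} (x : X _⦋n⦌) (a l : ℕ) (h : a + (l + 1) ≤ n) :
    differential R X (seg R x a (l + 1)) =
      ∑ i ∈ Finset.range (l + 2), ((-1 : R) ^ i) • skip R x a l i := by
  rw [seg, dif_pos h, differential_of, boundary, Finset.sum_range]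
  refine Finset.sum_congr rfl fun i _ => ?_
  rw [skip, dif_pos ⟨h, i.2⟩, SimplicialObject.δ, map_map_op]

theorem skip_zero {n : ℕ} (x : X _⦋n⦌) (a l : ℕ) (h : a + (l + 1) ≤ n) :
    skip R x a l 0 = seg R x (a + 1) l := by
  rw [skip, dif_pos ⟨h, by omega⟩, seg, dif_pos (by omega)]
  refine of_map_congr R x fun i => ?_
  change ((Fin.succAbove 0 i : Fin (l + 2)) : ℕ) + a = i.1 + (a + 1)
  simp
  omega

theorem skip_last {n : ℕ} (x : X _⦋n⦌) (a l : ℕ) (h : a + (l + 1) ≤ n) :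
    skip R x a l (l + 1) = seg R x a l := by
  rw [skip, dif_pos ⟨h, by omega⟩, seg, dif_pos (by omega)]
  refine of_map_congr R x fun i => ?_
  change ((Fin.succAbove (Fin.last (l + 1)) i : Fin (l + 2)) : ℕ) + a = i.1 + a
  simp

theorem succAbove_val {n : ℕ} (i : Fin (n + 1)) (j : Fin n) :
    (i.succAbove j : ℕ) = if j.1 < i.1 then j.1 else j.1 + 1 := by
  simp only [Fin.succAbove, Fin.lt_def, Fin.val_castSucc]
  split_ifs <;> simp

theorem seg_δ_front {n : ℕ} (x : X _⦋n + 1⦌) (i : Fin (n + 2)) (k : ℕ) (hk : k ≤ n) :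
    seg R (X.δ i x) 0 k = if i.1 ≤ k then skip R x 0 k i.1 else seg R x 0 k := by
  rw [seg, dif_pos (by omega), SimplicialObject.δ, map_map_op]
  split_ifs with h
  · rw [skip, dif_pos ⟨by omega, by omega⟩]
    refine of_map_congr R x fun j => ?_
    change (i.succAbove ⟨j.1 + 0, by omega⟩ : ℕ) =
      ((⟨i.1, by omega⟩ : Fin (k + 2)).succAbove j : ℕ) + 0
    simp only [succAbove_val, Nat.add_zero]
  · rw [seg, dif_pos (by omega)]
    refine of_map_congr R x fun j => ?_
    change (i.succAbove ⟨j.1 + 0, _⟩ : ℕ) = j.1 + 0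
    have : j.1 < k + 1 := j.2
    simp only [succAbove_val]
    split_ifs <;> omega

theorem seg_δ_back {n : ℕ} (x : X _⦋n + 1⦌) (i : Fin (n + 2)) (k : ℕ) (hk : k ≤ n) :
    seg R (X.δ i x) k (n - k) =
      if i.1 ≤ k then seg R x (k + 1) (n - k) else skip R x k (n - k) (i.1 - k) := by
  rw [seg, dif_pos (by omega), SimplicialObject.δ, map_map_op]
  split_ifs with h
  · rw [seg, dif_pos (by omega)]
    refine of_map_congr R x fun j => ?_
    change (i.succAbove ⟨j.1 + k, _⟩ : ℕ) = j.1 + (k + 1)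
    simp only [succAbove_val]
    split_ifs <;> omega
  · rw [skip, dif_pos ⟨by omega, by omega⟩]
    refine of_map_congr R x fun j => ?_
    change (i.succAbove ⟨j.1 + k, _⟩ : ℕ) =
      ((⟨i.1 - k, by omega⟩ : Fin (n - k + 2)).succAbove j : ℕ) + k
    simp only [succAbove_val]
    split_ifs <;> omega

noncomputable instance : Coalgebra R (NormalizedChains R X) where
  coassoc := by
    refine hom_ext fun n x => ?_
    simp only [LinearMap.comp_apply, comul_of, diagonal_eq, map_sum, LinearMap.rTensor_tmul,
      LinearMap.lTensor_tmul, LinearEquiv.coe_coe]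
    have h1 : ∀ k ∈ Finset.range (n + 1), TensorProduct.assoc R _ _ _
        (CoalgebraStruct.comul (R := R) (seg R x 0 k) ⊗ₜ[R] seg R x k (n - k)) =
        ∑ j ∈ Finset.range (k + 1),
          seg R x 0 j ⊗ₜ[R] (seg R x j (k - j) ⊗ₜ[R] seg R x k (n - k)) := by
      intro k hk
      rw [Finset.mem_range] at hk
      rw [diagonal_seg R x 0 k (by omega), TensorProduct.sum_tmul, map_sum]
      simp
    have h2 : ∀ k ∈ Finset.range (n + 1),
        seg R x 0 k ⊗ₜ[R] CoalgebraStruct.comul (R := R) (seg R x k (n - k)) =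
        ∑ j ∈ Finset.range (n - k + 1),
          seg R x 0 k ⊗ₜ[R] (seg R x k j ⊗ₜ[R] seg R x (k + j) (n - k - j)) := by
      intro k hk
      rw [Finset.mem_range] at hk
      rw [diagonal_seg R x k (n - k) (by omega), TensorProduct.tmul_sum]
    rw [Finset.sum_congr rfl h1, Finset.sum_congr rfl h2, Finset.sum_sigma', Finset.sum_sigma']
    refine Finset.sum_nbij' (fun p => ⟨p.2, p.1 - p.2⟩) (fun p => ⟨p.1 + p.2, p.1⟩) ?_ ?_ ?_ ?_ ?_
    · rintro ⟨a, b⟩ h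
      simp at h ⊢
      omega
    · rintro ⟨a, b⟩ h
      simp at h ⊢
      omega
    · rintro ⟨a, b⟩ h
      simp at h ⊢
      omega
    · rintro ⟨a, b⟩ h
      simp at h ⊢
    · rintro ⟨a, b⟩ h
      simp only [Finset.mem_sigma, Finset.mem_range] at h
      have e1 : b + (a - b) = a := by omega
      have e2 : n - b - (a - b) = n - a := by omega
      simp only [e1, e2]
  rTensor_counit_comp_comul := by
    refine hom_ext fun n x => ?_
    simp only [LinearMap.comp_apply, comul_of, diagonal_eq, map_sum, LinearMap.rTensor_tmul]
    rw [Finset.sum_eq_single 0]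
    · rw [counit_seg R x 0 0 (by omega), Nat.sub_zero, seg_self]
      simp
    · intro k hk hk0
      rw [Finset.mem_range] at hk
      rw [counit_seg R x 0 k (by omega), if_neg hk0, TensorProduct.zero_tmul]
    · simp
  lTensor_counit_comp_comul := by
    refine hom_ext fun n x => ?_
    simp only [LinearMap.comp_apply, comul_of, diagonal_eq, map_sum, LinearMap.lTensor_tmul]
    rw [Finset.sum_eq_single n]
    · rw [counit_seg R x n (n - n) (by omega), seg_self]
      simp
    · intro k hk hk0
      rw [Finset.mem_range] at hk
      rw [counit_seg R x k (n - k) (by omega), if_neg (by omega), TensorProduct.tmul_zero]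
    · simp

variable (X)

theorem differential_mem (n : ℕ) (c : NormalizedChains R X) (hc : c ∈ deg R X (n + 1)) :
    differential R X c ∈ deg R X n := by
  refine deg_le (N := (deg R X n).comap (differential R X)) (fun x => ?_) hc
  rw [Submodule.mem_comap, differential_of]
  exact Submodule.sum_mem _ fun i _ => Submodule.smul_mem _ _ (of_mem R _)

theorem differential_deg_zero (c : NormalizedChains R X) (hc : c ∈ deg R X 0) :
    differential R X c = 0 := by
  refine deg_le (N := LinearMap.ker (differential R X)) (fun x => ?_) hc
  rw [LinearMap.mem_ker, differential_of]
  rfl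

theorem differential_differential (c : NormalizedChains R X) :
    differential R X (differential R X c) = 0 := by
  have : differential R X ∘ₗ differential R X = 0 := by
    refine hom_ext fun n x => ?_
    rw [LinearMap.comp_apply, differential_of]
    rcases n with _ | _ | n
    · simp [boundary]
    · simp [boundary, differential_of]
    · simp only [boundary, map_sum, map_smul, differential_of, Finset.smul_sum, smul_smul]
      rw [Finset.sum_comm, ← Finset.sum_product']
      let P := Fin (n + 2) × Fin (n + 3)
      let S : Finset P := Finset.univ.filter fun ij => (ij.2 : ℕ) ≤ (ij.1 : ℕ)
      rw [Finset.univ_product_univ, ← Finset.sum_add_sum_compl S, LinearMap.zero_apply,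
        ← eq_neg_iff_add_eq_zero, ← Finset.sum_neg_distrib]
      refine Finset.sum_bij (fun (ij : P) hij =>
        ((Fin.castLT ij.2 (lt_of_le_of_lt (Finset.mem_filter.mp hij).right (Fin.is_lt ij.1)),
          ij.1.succ) : P)) ?_ ?_ ?_ ?_
      · intro ij hij
        simp_rw [S, Finset.compl_filter, Finset.mem_filter_univ, Fin.val_succ,
          Fin.val_castLT] at hij ⊢
        omega
      · rintro ⟨i, j⟩ hij ⟨i', j'⟩ hij' h
        have h1 : (j : ℕ) = j' := by simpa using congrArg Fin.val (Prod.mk.inj h).1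
        have h2 : (i : ℕ) + 1 = i' + 1 := by simpa using congrArg Fin.val (Prod.mk.inj h).2
        exact Prod.ext (Fin.ext (by simpa using h2)) (Fin.ext h1)
      · rintro ⟨i', j'⟩ hij'
        simp_rw [S, Finset.compl_filter, Finset.mem_filter_univ, not_le] at hij'
        refine ⟨(j'.pred ?_, Fin.castSucc i'), ?_, ?_⟩
        · rintro rfl
          simp only [Fin.val_zero, not_lt_zero] at hij'
        · simpa [S] using Nat.le_sub_one_of_lt hij'
        · simp only [Fin.castLT_castSucc, Fin.succ_pred]
      · rintro ⟨i, j⟩ hij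
        have hij' : (j : ℕ) ≤ i := (Finset.mem_filter.mp hij).right
        rw [← neg_smul]
        congr 1
        · simp only [Fin.val_succ, Fin.val_castLT]
          ring
        · congr 1
          have := congr_arg (fun f : X _⦋n + 2⦌ ⟶ X _⦋n⦌ => f x)
            (CategoryTheory.SimplicialObject.δ_comp_δ'' (X := X) (i := j) (j := i) hij')
          simpa using this.symm
  exact LinearMap.congr_fun this c

theorem comul_mem (n : ℕ) (c : NormalizedChains R X) (hc : c ∈ deg R X n) :
    Coalgebra.comul (R := R) c ∈ tensorDegree (deg R X) n := by
  refine deg_le (N := (tensorDegree (deg R X) n).comap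
    (Coalgebra.comul (R := R) (A := NormalizedChains R X))) (fun x => ?_) hc
  rw [Submodule.mem_comap]
  erw [comul_of]
  rw [diagonal_eq]
  refine Submodule.sum_mem _ fun k hk => ?_
  rw [Finset.mem_range] at hk
  exact tmul_mem_tensorDegree (by omega) (seg_degree R x 0 k) (seg_degree R x k (n - k))

theorem counit_of_pos (n : ℕ) (hn : 0 < n) (c : NormalizedChains R X) (hc : c ∈ deg R X n) :
    Coalgebra.counit (R := R) c = 0 := by
  refine deg_le (N := LinearMap.ker (Coalgebra.counit (R := R))) (fun x => ?_) hc
  rw [LinearMap.mem_ker]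
  erw [counit_of]
  rw [if_neg (by omega)]

theorem counit_differential (c : NormalizedChains R X) :
    Coalgebra.counit (R := R) (differential R X c) = 0 := by
  have : Coalgebra.counit (R := R) ∘ₗ differential R X = 0 := by
    refine hom_ext fun n x => ?_
    rw [LinearMap.comp_apply, differential_of]
    rcases n with _ | _ | n
    · simp [boundary]
    · simp only [boundary, map_sum, map_smul]
      erw [Fin.sum_univ_two, counit_of, counit_of]
      simp
    · simp only [boundary, map_sum, map_smul]
      refine Finset.sum_eq_zero fun i _ => ?_
      erw [counit_of]
      simp
  exact LinearMap.congr_fun this c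

theorem comul_differential (c : NormalizedChains R X) :
    Coalgebra.comul (R := R) (differential R X c) =
      TensorProduct.map (differential R X) LinearMap.id (Coalgebra.comul (R := R) c) +
        TensorProduct.map (degreeSign (deg R X) (isInternal R X)) (differential R X)
          (Coalgebra.comul (R := R) c) := by
  have : Coalgebra.comul (R := R) ∘ₗ differential R X =
      TensorProduct.map (differential R X) LinearMap.id ∘ₗ Coalgebra.comul (R := R) +
        TensorProduct.map (degreeSign (deg R X) (isInternal R X)) (differential R X) ∘ₗ
          Coalgebra.comul (R := R) := by
    refine hom_ext fun n x => ?_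
    simp only [LinearMap.comp_apply, LinearMap.add_apply, differential_of]
    have e : Coalgebra.comul (R := R) (of R x) = diagonal R n x := comul_of x
    rw [e, diagonal_eq]
    simp only [map_sum, TensorProduct.map_tmul, LinearMap.id_apply,
      degreeSign_of_mem _ (isInternal R X) (seg_degree R x _ _)]
    rcases n with _ | n
    · simp [boundary, differential_seg_zero]
    · rw [Finset.sum_range_succ' (fun k => differential R X (seg R x 0 k) ⊗ₜ[R] _),
        Finset.sum_range_succ (fun k => _ ⊗ₜ[R] differential R X (seg R x k _))]
      simp only [differential_seg_zero, Nat.sub_self, TensorProduct.zero_tmul,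
        TensorProduct.tmul_zero, add_zero]
      have e1 : Coalgebra.comul (R := R) (boundary R (n + 1) x) =
          ∑ k ∈ Finset.range (n + 1), ∑ i ∈ Finset.range (n + 2), ((-1 : R) ^ i) •
            (if i ≤ k then skip R x 0 k i ⊗ₜ[R] seg R x (k + 1) (n - k)
              else seg R x 0 k ⊗ₜ[R] skip R x k (n - k) (i - k)) := by
        simp only [boundary, map_sum, map_smul]
        rw [Finset.sum_comm, Finset.sum_range]
        refine Finset.sum_congr rfl fun i _ => ?_
        erw [comul_of]
        rw [diagonal_eq, Finset.smul_sum]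
        refine Finset.sum_congr rfl fun k hk => ?_
        rw [Finset.mem_range] at hk
        rw [seg_δ_front R x i k (by omega), seg_δ_back R x i k (by omega)]
        split_ifs <;> rfl
      rw [e1, ← Finset.sum_add_distrib]
      refine Finset.sum_congr rfl fun k hk => ?_
      rw [Finset.mem_range] at hk
      have e2 : n + 1 - (k + 1) = n - k := by omega
      have e3 : n + 1 - k = n - k + 1 := by omega
      have e4 : n + 2 = (k + 1) + (n - k + 1) := by omega
      rw [e2, e3, differential_seg_succ R x 0 k (by omega),
        differential_seg_succ R x k (n - k) (by omega), e4, Finset.sum_range_add,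
        Finset.sum_range_succ _ (k + 1), Finset.sum_range_succ' _ (n - k + 1),
        skip_zero R x k (n - k) (by omega), skip_last R x 0 k (by omega)]
      have e5 : ∑ i ∈ Finset.range (k + 1), ((-1 : R) ^ i) •
            (if i ≤ k then skip R x 0 k i ⊗ₜ[R] seg R x (k + 1) (n - k)
              else seg R x 0 k ⊗ₜ[R] skip R x k (n - k) (i - k)) =
          (∑ i ∈ Finset.range (k + 1), ((-1 : R) ^ i) • skip R x 0 k i) ⊗ₜ[R]
            seg R x (k + 1) (n - k) := by
        rw [TensorProduct.sum_tmul]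
        refine Finset.sum_congr rfl fun i hi => ?_
        rw [Finset.mem_range] at hi
        rw [if_pos (by omega), TensorProduct.smul_tmul']
      have e6 : ∑ i ∈ Finset.range (n - k + 1), ((-1 : R) ^ (k + 1 + i)) •
            (if k + 1 + i ≤ k then skip R x 0 k (k + 1 + i) ⊗ₜ[R] seg R x (k + 1) (n - k)
              else seg R x 0 k ⊗ₜ[R] skip R x k (n - k) (k + 1 + i - k)) =
          (((-1 : R) ^ k) • seg R x 0 k) ⊗ₜ[R]
            (∑ i ∈ Finset.range (n - k + 1), ((-1 : R) ^ (i + 1)) •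
              skip R x k (n - k) (i + 1)) := by
        rw [TensorProduct.tmul_sum]
        refine Finset.sum_congr rfl fun i hi => ?_
        rw [if_neg (by omega), TensorProduct.smul_tmul_smul, ← pow_add]
        have e7 : k + 1 + i - k = i + 1 := by omega
        have e8 : k + 1 + i = k + (i + 1) := by omega
        rw [e7, e8]
      rw [e5, e6]
      simp only [TensorProduct.add_tmul, TensorProduct.tmul_add, TensorProduct.smul_tmul',
        TensorProduct.smul_tmul_smul, pow_succ, pow_zero]
      simp only [mul_neg, mul_one, neg_smul, TensorProduct.neg_tmul]
      abel
  exact LinearMap.congr_fun this c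

/-- The dgc of normalized chains on a simplicial set. -/
noncomputable def dgc : DGCoalgebra R where
  carrier := NormalizedChains R X
  deg := deg R X
  isInternal := isInternal R X
  d := differential R X
  d_mem := differential_mem R X
  d_deg_zero := differential_deg_zero R X
  d_d := differential_differential R X
  comul_mem := comul_mem R X
  counit_of_pos := counit_of_pos R X
  comul_d := comul_differential R X
  counit_d := counit_differential R X

variable {X}

theorem degenerate_app (f : X ⟶ Y) {n : ℕ} {x : X _⦋n⦌} (hx : x ∈ X.degenerate n) :
    f.app _ x ∈ Y.degenerate n := by
  obtain ⟨m, hm, g, y, rfl⟩ := hx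
  exact ⟨m, hm, g, f.app _ y, by simp⟩

/-- The map of normalized chains induced by a map of simplicial sets. -/
noncomputable def map (f : X ⟶ Y) : NormalizedChains R X →ₗ[R] NormalizedChains R Y :=
  lift (fun _ x => of R (f.app _ x)) fun _ _ hx => of_degenerate R (degenerate_app f hx)

theorem map_of (f : X ⟶ Y) {n : ℕ} (x : X _⦋n⦌) : map R f (of R x) = of R (f.app _ x) :=
  lift_of _ _ x

theorem map_differential (f : X ⟶ Y) (c : NormalizedChains R X) :
    map R f (differential R X c) = differential R Y (map R f c) := by
  have : map R f ∘ₗ differential R X = differential R Y ∘ₗ map R f := by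
    refine hom_ext fun n x => ?_
    rw [LinearMap.comp_apply, LinearMap.comp_apply, map_of, differential_of, differential_of]
    cases n with
    | zero => simp [boundary]
    | succ n => simp [boundary, map_of, SimplicialObject.δ]
  exact LinearMap.congr_fun this c

theorem map_diagonal (f : X ⟶ Y) {n : ℕ} (x : X _⦋n⦌) :
    TensorProduct.map (map R f) (map R f) (diagonal R n x) = diagonal R n (f.app _ x) := by
  simp [diagonal, map_of]

theorem map_mem (f : X ⟶ Y) (n : ℕ) (c : NormalizedChains R X) (hc : c ∈ deg R X n) :
    map R f c ∈ deg R Y n := by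
  refine deg_le (N := (deg R Y n).comap (map R f)) (fun x => ?_) hc
  rw [Submodule.mem_comap, map_of]
  exact of_mem R _

/-- The map of normalized chains induced by a map of simplicial sets, as a map of coalgebras. -/
noncomputable def coalgMap (f : X ⟶ Y) : NormalizedChains R X →ₗc[R] NormalizedChains R Y :=
  { map R f with
    counit_comp := hom_ext fun _ x =>
      (congrArg _ (map_of R f x)).trans ((counit_of _).trans (counit_of x).symm)
    map_comp_comul := hom_ext fun _ x =>
      (congrArg _ (comul_of x)).trans ((map_diagonal R f x).trans
        ((comul_of _).symm.trans (congrArg _ (map_of R f x).symm))) }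

/-- The map of normalized chains induced by a map of simplicial sets, as a map of dgcs. -/
noncomputable def dgcMap (f : X ⟶ Y) : dgc R X ⟶ dgc R Y :=
  DGCoalgebra.Hom.mk (C := dgc R X) (D := dgc R Y) (coalgMap R f) (map_mem R f)
    (map_differential R f)

/-- Normalized chains as a functor from simplicial sets to dgcs. -/
noncomputable def functor : SSet.{0} ⥤ DGCoalgebra R where
  obj X := dgc R X
  map f := dgcMap R f
  map_id X := by
    refine DGCoalgebra.Hom.ext (CoalgHom.coe_linearMap_injective ?_)
    exact hom_ext fun _ x => map_of R (𝟙 X) x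
  map_comp {X Y Z} f g := by
    refine DGCoalgebra.Hom.ext (CoalgHom.coe_linearMap_injective ?_)
    exact hom_ext fun _ x => (map_of R (f ≫ g) x).trans
      ((map_of R g _).symm.trans (congrArg _ (map_of R f x).symm))

end
end NormalizedChains

/-! ## Sub-dgcs -/

namespace DGCoalgebra

/-- A submodule `N` of a dgc `C`, together with a degree-preserving projection `r : C → N`, spans a
sub-dgc if it is closed under the differential and if the diagonal maps `N` to `N ⊗ N`. -/
structure IsSubDGC {R : Type} [CommRing R] (C : DGCoalgebra R) (N : Submodule R C.carrier)
    (r : C.carrier →ₗ[R] N) : Prop where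
  proj_coe : ∀ x : N, r x = x
  proj_deg : ∀ n, ∀ x ∈ C.deg n, (r x : C.carrier) ∈ C.deg n
  d_mem : ∀ x ∈ N, C.d x ∈ N
  comul_mem : ∀ x ∈ N, Coalgebra.comul (R := R) x ∈
    LinearMap.range (TensorProduct.map N.subtype N.subtype)

namespace IsSubDGC

variable {R : Type} [CommRing R] {C D : DGCoalgebra R} {N : Submodule R C.carrier}
  {r : C.carrier →ₗ[R] N} {N' : Submodule R D.carrier} {r' : D.carrier →ₗ[R] N'}

/-- The restriction `N → N ⊗ N` of the diagonal of `C`. As `N` is a direct summand of `C`, the map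
`N ⊗ N → C ⊗ C` is injective; `r ⊗ r` is its inverse on the image. -/
noncomputable def comul (N : Submodule R C.carrier) (r : C.carrier →ₗ[R] N) : N →ₗ[R] N ⊗[R] N :=
  TensorProduct.map r r ∘ₗ Coalgebra.comul ∘ₗ N.subtype

theorem map_comul (h : IsSubDGC C N r) (x : N) :
    TensorProduct.map N.subtype N.subtype (comul N r x) = Coalgebra.comul (R := R) (x : C.carrier) := by
  obtain ⟨t, ht⟩ := h.comul_mem x x.2
  have hr : r ∘ₗ N.subtype = LinearMap.id := LinearMap.ext h.proj_coe
  simp only [comul, LinearMap.comp_apply, Submodule.subtype_apply]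
  rw [← ht]
  congr 1
  rw [← LinearMap.comp_apply, ← TensorProduct.map_comp, hr, TensorProduct.map_id,
    LinearMap.id_apply]

theorem map_injective {P Q : Type} [AddCommGroup P] [Module R P] [AddCommGroup Q] [Module R Q]
    {f : P →ₗ[R] Q} {g : Q →ₗ[R] P} (hgf : g ∘ₗ f = LinearMap.id) {P' Q' : Type} [AddCommGroup P']
    [Module R P'] [AddCommGroup Q'] [Module R Q'] {f' : P' →ₗ[R] Q'} {g' : Q' →ₗ[R] P'}
    (hgf' : g' ∘ₗ f' = LinearMap.id) :
    TensorProduct.map g g' ∘ₗ TensorProduct.map f f' = LinearMap.id := by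
  rw [← TensorProduct.map_comp, hgf, hgf', TensorProduct.map_id]

theorem eq_of_map_eq {P Q : Type} [AddCommGroup P] [Module R P] [AddCommGroup Q] [Module R Q]
    {f : P →ₗ[R] Q} {g : Q →ₗ[R] P} (hgf : g ∘ₗ f = LinearMap.id) {x y : P} (h : f x = f y) :
    x = y := by
  have := congrArg g h
  rwa [← LinearMap.comp_apply, ← LinearMap.comp_apply, hgf] at this

/-- The coalgebra structure of a sub-dgc. -/
noncomputable abbrev coalgebra (h : IsSubDGC C N r) : Coalgebra R N where
  comul := comul N r
  counit := Coalgebra.counit ∘ₗ N.subtype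
  coassoc := by
    have hr : r ∘ₗ N.subtype = LinearMap.id := LinearMap.ext h.proj_coe
    have hc : TensorProduct.map N.subtype N.subtype ∘ₗ comul N r =
      Coalgebra.comul ∘ₗ N.subtype := LinearMap.ext h.map_comul
    ext x : 1
    refine eq_of_map_eq (map_injective hr (map_injective hr hr)) ?_
    have e1 : TensorProduct.map N.subtype (TensorProduct.map N.subtype N.subtype) ∘ₗ
        (TensorProduct.assoc R N N N).toLinearMap =
        (TensorProduct.assoc R C.carrier C.carrier C.carrier).toLinearMap ∘ₗ
          TensorProduct.map (TensorProduct.map N.subtype N.subtype) N.subtype := by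
      ext; rfl
    have e2 : TensorProduct.map (TensorProduct.map N.subtype N.subtype) N.subtype ∘ₗ
        (comul N r).rTensor N = (Coalgebra.comul (R := R) (A := C.carrier)).rTensor C.carrier ∘ₗ
          TensorProduct.map N.subtype N.subtype := by
      rw [LinearMap.rTensor, LinearMap.rTensor, ← TensorProduct.map_comp, hc,
        ← TensorProduct.map_comp]
      rfl
    have e3 : TensorProduct.map N.subtype (TensorProduct.map N.subtype N.subtype) ∘ₗ
        (comul N r).lTensor N = (Coalgebra.comul (R := R) (A := C.carrier)).lTensor C.carrier ∘ₗ
          TensorProduct.map N.subtype N.subtype := by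
      rw [LinearMap.lTensor, LinearMap.lTensor, ← TensorProduct.map_comp, hc,
        ← TensorProduct.map_comp]
      rfl
    have l : TensorProduct.map N.subtype (TensorProduct.map N.subtype N.subtype) ∘ₗ
        ((TensorProduct.assoc R N N N).toLinearMap ∘ₗ (comul N r).rTensor N ∘ₗ comul N r) =
        ((TensorProduct.assoc R C.carrier C.carrier C.carrier).toLinearMap ∘ₗ
          (Coalgebra.comul (R := R) (A := C.carrier)).rTensor C.carrier ∘ₗ
            Coalgebra.comul (R := R)) ∘ₗ N.subtype := by
      rw [← LinearMap.comp_assoc, e1, LinearMap.comp_assoc, ← LinearMap.comp_assoc (comul N r), e2,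
        LinearMap.comp_assoc, hc]
      rfl
    have l' : TensorProduct.map N.subtype (TensorProduct.map N.subtype N.subtype) ∘ₗ
        ((comul N r).lTensor N ∘ₗ comul N r) =
        ((Coalgebra.comul (R := R) (A := C.carrier)).lTensor C.carrier ∘ₗ
            Coalgebra.comul (R := R)) ∘ₗ N.subtype := by
      rw [← LinearMap.comp_assoc, e3, LinearMap.comp_assoc, hc]
      rfl
    rw [← Coalgebra.coassoc, ← l] at l'
    exact (LinearMap.congr_fun l' x).symm
  rTensor_counit_comp_comul := by
    have hr : r ∘ₗ N.subtype = LinearMap.id := LinearMap.ext h.proj_coe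
    ext x : 1
    refine eq_of_map_eq (map_injective (f := LinearMap.id) (g := LinearMap.id) rfl hr) ?_
    have e : TensorProduct.map LinearMap.id N.subtype ∘ₗ
        (Coalgebra.counit (R := R) ∘ₗ N.subtype).rTensor N =
        (Coalgebra.counit (R := R) (A := C.carrier)).rTensor C.carrier ∘ₗ
          TensorProduct.map N.subtype N.subtype := by
      rw [LinearMap.rTensor, LinearMap.rTensor, ← TensorProduct.map_comp, ← TensorProduct.map_comp]
      rfl
    rw [← LinearMap.comp_apply, ← LinearMap.comp_assoc, e, LinearMap.comp_apply,
      LinearMap.comp_apply, h.map_comul]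
    simp
  lTensor_counit_comp_comul := by
    have hr : r ∘ₗ N.subtype = LinearMap.id := LinearMap.ext h.proj_coe
    ext x : 1
    refine eq_of_map_eq (map_injective hr (f' := LinearMap.id) (g' := LinearMap.id) rfl) ?_
    have e : TensorProduct.map N.subtype LinearMap.id ∘ₗ
        (Coalgebra.counit (R := R) ∘ₗ N.subtype).lTensor N =
        (Coalgebra.counit (R := R) (A := C.carrier)).lTensor C.carrier ∘ₗ
          TensorProduct.map N.subtype N.subtype := by
      rw [LinearMap.lTensor, LinearMap.lTensor, ← TensorProduct.map_comp, ← TensorProduct.map_comp]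
      rfl
    rw [← LinearMap.comp_apply, ← LinearMap.comp_assoc, e, LinearMap.comp_apply,
      LinearMap.comp_apply, h.map_comul]
    simp

theorem isInternal (h : IsSubDGC C N r) :
    DirectSum.IsInternal fun n => (C.deg n).comap N.subtype := by
  rw [DirectSum.isInternal_submodule_iff_iSupIndep_and_iSup_eq_top]
  constructor
  · intro n
    rw [Submodule.disjoint_def]
    intro x hx hx'
    have hd := (Submodule.disjoint_def.1 (C.isInternal.submodule_iSupIndep n)) x hx
    refine Subtype.ext (hd ?_)
    have hle : (⨆ j, ⨆ (_ : j ≠ n), (C.deg j).comap N.subtype) ≤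
        (⨆ j, ⨆ (_ : j ≠ n), C.deg j).comap N.subtype :=
      iSup₂_le fun j hj => Submodule.comap_mono (le_iSup₂_of_le j hj le_rfl)
    exact hle hx'
  · rw [eq_top_iff]
    intro x _
    have hle : (⊤ : Submodule R C.carrier) ≤
        (⨆ n, (C.deg n).comap N.subtype).comap r := by
      rw [← C.isInternal.submodule_iSup_eq_top]
      exact iSup_le fun n y hy => Submodule.mem_iSup_of_mem n (h.proj_deg n y hy)
    have := hle (Submodule.mem_top (x := (x : C.carrier)))
    rwa [Submodule.mem_comap, h.proj_coe] at this

theorem degreeSign_coe (h : IsSubDGC C N r) (x : N) :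
    (degreeSign (fun n => (C.deg n).comap N.subtype) h.isInternal x : C.carrier) =
      degreeSign C.deg C.isInternal x := by
  have hx : x ∈ ⨆ n, (C.deg n).comap N.subtype := by
    rw [h.isInternal.submodule_iSup_eq_top]; trivial
  have hle : (⨆ n, (C.deg n).comap N.subtype) ≤ LinearMap.eqLocus
      (N.subtype ∘ₗ degreeSign (fun n => (C.deg n).comap N.subtype) h.isInternal)
      (degreeSign C.deg C.isInternal ∘ₗ N.subtype) := by
    refine iSup_le fun n y hy => ?_
    exact (congrArg N.subtype (degreeSign_of_mem _ h.isInternal hy)).trans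
      (degreeSign_of_mem C.deg C.isInternal (x := y.1) hy).symm
  exact hle hx

theorem comul_d (h : IsSubDGC C N r) (x : N) : comul N r (C.d.restrict h.d_mem x) =
    TensorProduct.map (C.d.restrict h.d_mem) LinearMap.id (comul N r x) +
      TensorProduct.map (degreeSign (fun n => (C.deg n).comap N.subtype) h.isInternal)
        (C.d.restrict h.d_mem) (comul N r x) := by
  have hr : r ∘ₗ N.subtype = LinearMap.id := LinearMap.ext h.proj_coe
  refine eq_of_map_eq (map_injective hr hr) ?_
  have e1 : TensorProduct.map N.subtype N.subtype ∘ₗ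
      TensorProduct.map (C.d.restrict h.d_mem) LinearMap.id =
      TensorProduct.map C.d LinearMap.id ∘ₗ TensorProduct.map N.subtype N.subtype := by
    rw [← TensorProduct.map_comp, ← TensorProduct.map_comp]
    rfl
  have e0 : N.subtype ∘ₗ degreeSign (fun n => (C.deg n).comap N.subtype) h.isInternal =
      degreeSign C.deg C.isInternal ∘ₗ N.subtype := LinearMap.ext h.degreeSign_coe
  have e2 : TensorProduct.map N.subtype N.subtype ∘ₗ
      TensorProduct.map (degreeSign (fun n => (C.deg n).comap N.subtype) h.isInternal)
        (C.d.restrict h.d_mem) =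
      TensorProduct.map (degreeSign C.deg C.isInternal) C.d ∘ₗ
        TensorProduct.map N.subtype N.subtype := by
    rw [← TensorProduct.map_comp, ← TensorProduct.map_comp, e0]
    rfl
  refine (h.map_comul _).trans ((C.comul_d x).trans ?_)
  rw [map_add, ← h.map_comul]
  exact congrArg₂ (· + ·) (LinearMap.congr_fun e1 _).symm (LinearMap.congr_fun e2 _).symm

theorem restrict_comul (h : IsSubDGC C N r) (h' : IsSubDGC D N' r') (f : C.carrier →ₗc[R] D.carrier)
    (hf : ∀ x ∈ N, f x ∈ N') (x : N) :
    TensorProduct.map (f.toLinearMap.restrict hf) (f.toLinearMap.restrict hf) (comul N r x) =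
      comul N' r' (f.toLinearMap.restrict hf x) := by
  have hr : r' ∘ₗ N'.subtype = LinearMap.id := LinearMap.ext h'.proj_coe
  refine eq_of_map_eq (map_injective hr hr) ?_
  have e1 : TensorProduct.map N'.subtype N'.subtype ∘ₗ TensorProduct.map
      (f.toLinearMap.restrict hf) (f.toLinearMap.restrict hf) =
      TensorProduct.map f.toLinearMap f.toLinearMap ∘ₗ
        TensorProduct.map N.subtype N.subtype := by
    rw [← TensorProduct.map_comp, ← TensorProduct.map_comp]
    rfl
  refine (LinearMap.congr_fun e1 _).trans ?_
  rw [LinearMap.comp_apply, h.map_comul, h'.map_comul]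
  exact LinearMap.congr_fun f.map_comp_comul x.1

/-- The sub-dgc of `C` with underlying module `N`. -/
noncomputable def dgc (h : IsSubDGC C N r) : DGCoalgebra R :=
  letI := h.coalgebra
  { carrier := N
    coalgebra := h.coalgebra
    deg := fun n => (C.deg n).comap N.subtype
    isInternal := h.isInternal
    d := C.d.restrict h.d_mem
    d_mem := fun n x hx => C.d_mem n x hx
    d_deg_zero := fun x hx => Subtype.ext (C.d_deg_zero x hx)
    d_d := fun x => Subtype.ext (C.d_d x)
    comul_mem := fun n x hx => by
      have h1 : tensorDegree C.deg n ≤ (tensorDegree (fun n => (C.deg n).comap N.subtype) n).comap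
          (TensorProduct.map r r) := by
        rw [tensorDegree, Submodule.span_le]
        rintro _ ⟨p, q, hpq, a, ha, b, hb, rfl⟩
        exact tmul_mem_tensorDegree (R := R) (deg := fun n => (C.deg n).comap N.subtype) hpq
          (h.proj_deg p a ha) (h.proj_deg q b hb)
      exact h1 (C.comul_mem n x hx)
    counit_of_pos := fun n hn x hx => C.counit_of_pos n hn x hx
    comul_d := h.comul_d
    counit_d := fun x => C.counit_d x }

/-- The inclusion of a sub-dgc. -/
noncomputable def incl (h : IsSubDGC C N r) : h.dgc ⟶ C :=
  letI := h.coalgebra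
  DGCoalgebra.Hom.mk (C := h.dgc) (D := C)
    { N.subtype with
      counit_comp := rfl
      map_comp_comul := LinearMap.ext h.map_comul }
    (fun _ _ hx => hx) (fun _ => rfl)

/-- The restriction of a morphism of dgcs to sub-dgcs. -/
noncomputable def restrict (h : IsSubDGC C N r) (h' : IsSubDGC D N' r') (f : C ⟶ D)
    (hf : ∀ x ∈ N, f.toCoalgHom x ∈ N') : h.dgc ⟶ h'.dgc :=
  letI := h.coalgebra
  letI := h'.coalgebra
  DGCoalgebra.Hom.mk (C := h.dgc) (D := h'.dgc)
    { f.toCoalgHom.toLinearMap.restrict hf with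
      counit_comp := LinearMap.ext fun x => LinearMap.congr_fun f.toCoalgHom.counit_comp x.1
      map_comp_comul := LinearMap.ext (restrict_comul h h' f.toCoalgHom hf) }
    (fun n x hx => f.map_deg n (N.subtype x) hx) (fun x => Subtype.ext (f.map_d (N.subtype x)))

end IsSubDGC
end DGCoalgebra

/-! ## Simplicial complexes on `[m]` -/

/-- A simplicial complex on the vertex set `[m]`. It contains the empty simplex; not every
one-point subset has to be a simplex ("ghost vertices" are allowed). -/
@[ext]
structure SimplicialComplexOn (m : ℕ) : Type where
  faces : Set (Finset (Fin m))
  empty_mem : ∅ ∈ faces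
  down_closed : ∀ {σ τ : Finset (Fin m)}, σ ∈ faces → τ ⊆ σ → τ ∈ faces

/-- Simplicial complexes on `[m]` are ordered by inclusion. -/
instance (m : ℕ) : PartialOrder (SimplicialComplexOn m) :=
  PartialOrder.lift SimplicialComplexOn.faces fun _ _ h => SimplicialComplexOn.ext h

/-! ## The Stanley-Reisner coalgebra -/

/-- The Stanley-Reisner coalgebra of `Σ`, with basis the `u_α` for all `α ∈ ℕ^m` whose support is a
simplex of `Σ`. -/
def StanleyReisnerCoalgebra (R : Type) [CommRing R] {m : ℕ} (S : SimplicialComplexOn m) : Type :=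
  {α : Fin m →₀ ℕ // α.support ∈ S.faces} →₀ R

namespace StanleyReisnerCoalgebra

noncomputable instance (R : Type) [CommRing R] {m : ℕ} (S : SimplicialComplexOn m) :
    AddCommGroup (StanleyReisnerCoalgebra R S) :=
  inferInstanceAs (AddCommGroup ({α : Fin m →₀ ℕ // α.support ∈ S.faces} →₀ R))

noncomputable instance (R : Type) [CommRing R] {m : ℕ} (S : SimplicialComplexOn m) :
    Module R (StanleyReisnerCoalgebra R S) :=
  inferInstanceAs (Module R ({α : Fin m →₀ ℕ // α.support ∈ S.faces} →₀ R))

section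

variable (R : Type) [CommRing R] {m : ℕ} (S S' : SimplicialComplexOn m)

open Classical in
/-- The basis element `u_α` for an allowed multi-index `α`; by convention `0` if `α` is not
allowed. -/
noncomputable def u (α : Fin m →₀ ℕ) : StanleyReisnerCoalgebra R S :=
  if h : α.support ∈ S.faces then Finsupp.single ⟨α, h⟩ (1 : R) else 0

variable {R S S'} {M : Type} [AddCommGroup M] [Module R M]

/-- The linear map with given values on the basis. -/
noncomputable def lift (f : (Fin m →₀ ℕ) → M) : StanleyReisnerCoalgebra R S →ₗ[R] M :=
  Finsupp.lift M R {α : Fin m →₀ ℕ // α.support ∈ S.faces} fun α => f α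

theorem lift_u (f : (Fin m →₀ ℕ) → M) {α : Fin m →₀ ℕ} (h : α.support ∈ S.faces) :
    lift f (u R S α) = f α := by
  refine (congrArg (lift f) (dif_pos h)).trans ?_
  refine (Finsupp.lift_apply _ _ _ _ _).trans ?_
  exact (Finsupp.sum_single_index (by simp)).trans (by simp)

theorem hom_ext {f g : StanleyReisnerCoalgebra R S →ₗ[R] M}
    (h : ∀ α : Fin m →₀ ℕ, α.support ∈ S.faces → f (u R S α) = g (u R S α)) : f = g := by
  refine Finsupp.lhom_ext' fun α => LinearMap.ext_ring ?_
  exact (congrArg f (dif_pos α.2)).symm.trans ((h α.1 α.2).trans (congrArg g (dif_pos α.2)))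

theorem allowed_mono {α β : Fin m →₀ ℕ} (h : α.support ∈ S.faces) (hle : β ≤ α) :
    β.support ∈ S.faces :=
  S.down_closed h (Finsupp.support_mono hle)

theorem allowed_fst {α : Fin m →₀ ℕ} (h : α.support ∈ S.faces) {p : (Fin m →₀ ℕ) × (Fin m →₀ ℕ)}
    (hp : p ∈ Finset.HasAntidiagonal.antidiagonal α) : p.1.support ∈ S.faces :=
  allowed_mono h (by rw [← Finset.HasAntidiagonal.mem_antidiagonal.1 hp]; exact le_self_add)

theorem allowed_snd {α : Fin m →₀ ℕ} (h : α.support ∈ S.faces) {p : (Fin m →₀ ℕ) × (Fin m →₀ ℕ)}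
    (hp : p ∈ Finset.HasAntidiagonal.antidiagonal α) : p.2.support ∈ S.faces :=
  allowed_mono h (by rw [← Finset.HasAntidiagonal.mem_antidiagonal.1 hp]; exact le_add_self)

variable (R S) in
/-- `Δ u_α = ∑_{β + γ = α} u_β ⊗ u_γ` -/
noncomputable def diagonal (α : Fin m →₀ ℕ) :
    StanleyReisnerCoalgebra R S ⊗[R] StanleyReisnerCoalgebra R S :=
  ∑ p ∈ Finset.HasAntidiagonal.antidiagonal α, u R S p.1 ⊗ₜ[R] u R S p.2

noncomputable instance : CoalgebraStruct R (StanleyReisnerCoalgebra R S) where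
  comul := lift (diagonal R S)
  counit := lift fun α => if α = 0 then 1 else 0

theorem comul_u {α : Fin m →₀ ℕ} (h : α.support ∈ S.faces) :
    CoalgebraStruct.comul (R := R) (u R S α) = diagonal R S α := lift_u _ h

theorem counit_u {α : Fin m →₀ ℕ} (h : α.support ∈ S.faces) :
    CoalgebraStruct.counit (R := R) (u R S α) = if α = 0 then 1 else 0 := lift_u _ h

noncomputable instance : Coalgebra R (StanleyReisnerCoalgebra R S) where
  coassoc := by
    refine hom_ext fun α h => ?_
    simp only [LinearMap.comp_apply, comul_u h, diagonal, map_sum, LinearMap.rTensor_tmul,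
      LinearMap.lTensor_tmul, LinearEquiv.coe_coe]
    have h1 : ∀ p ∈ Finset.HasAntidiagonal.antidiagonal α, TensorProduct.assoc R _ _ _
        (CoalgebraStruct.comul (R := R) (u R S p.1) ⊗ₜ[R] u R S p.2) =
        ∑ q ∈ Finset.HasAntidiagonal.antidiagonal p.1,
          u R S q.1 ⊗ₜ[R] (u R S q.2 ⊗ₜ[R] u R S p.2) := fun p hp => by
      rw [comul_u (allowed_fst h hp), diagonal, TensorProduct.sum_tmul, map_sum]
      simp
    have h2 : ∀ p ∈ Finset.HasAntidiagonal.antidiagonal α,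
        u R S p.1 ⊗ₜ[R] CoalgebraStruct.comul (R := R) (u R S p.2) =
        ∑ q ∈ Finset.HasAntidiagonal.antidiagonal p.2,
          u R S p.1 ⊗ₜ[R] (u R S q.1 ⊗ₜ[R] u R S q.2) := fun p hp => by
      rw [comul_u (allowed_snd h hp), diagonal, TensorProduct.tmul_sum]
    rw [Finset.sum_congr rfl h1, Finset.sum_congr rfl h2, Finset.sum_sigma', Finset.sum_sigma']
    refine Finset.sum_nbij' (fun p => ⟨(p.2.1, p.2.2 + p.1.2), (p.2.2, p.1.2)⟩)
      (fun p => ⟨(p.1.1 + p.2.1, p.2.2), (p.1.1, p.2.1)⟩) ?_ ?_ ?_ ?_ ?_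
    · rintro ⟨⟨a, b⟩, ⟨c, d⟩⟩ hp
      simp at hp ⊢
      rw [← hp.1, ← hp.2, add_assoc]
    · rintro ⟨⟨a, b⟩, ⟨c, d⟩⟩ hp
      simp at hp ⊢
      rw [← hp.1, ← hp.2, add_assoc]
    · rintro ⟨⟨a, b⟩, ⟨c, d⟩⟩ hp
      simp at hp ⊢
      exact hp.2
    · rintro ⟨⟨a, b⟩, ⟨c, d⟩⟩ hp
      simp at hp ⊢
      exact hp.2
    · rintro ⟨⟨a, b⟩, ⟨c, d⟩⟩ hp
      rfl
  rTensor_counit_comp_comul := by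
    refine hom_ext fun α h => ?_
    simp only [LinearMap.comp_apply, comul_u h, diagonal, map_sum, LinearMap.rTensor_tmul]
    rw [Finset.sum_eq_single (0, α)]
    · simp only
      rw [counit_u (by simpa using S.empty_mem)]
      simp
    · rintro ⟨a, b⟩ hp hne
      rw [counit_u (allowed_fst h hp), if_neg, TensorProduct.zero_tmul]
      rintro rfl
      simp at hp
      exact hne (by rw [hp])
    · simp
  lTensor_counit_comp_comul := by
    refine hom_ext fun α h => ?_
    simp only [LinearMap.comp_apply, comul_u h, diagonal, map_sum, LinearMap.lTensor_tmul]
    rw [Finset.sum_eq_single (α, 0)]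
    · simp only
      rw [counit_u (by simpa using S.empty_mem)]
      simp
    · rintro ⟨a, b⟩ hp hne
      rw [counit_u (allowed_snd h hp), if_neg, TensorProduct.tmul_zero]
      rintro rfl
      simp at hp
      exact hne (by rw [hp])
    · simp

/-- The map `u_α ↦ u_{α - i}` (if `α_i > 0`) and `u_α ↦ 0` (otherwise). -/
noncomputable def lower (i : Fin m) : StanleyReisnerCoalgebra R S →ₗ[R] StanleyReisnerCoalgebra R S :=
  lift fun α => if 0 < α i then u R S (α - Finsupp.single i 1) else 0

theorem lower_u {α : Fin m →₀ ℕ} (h : α.support ∈ S.faces) (i : Fin m) :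
    lower i (u R S α) = if 0 < α i then u R S (α - Finsupp.single i 1) else 0 := lift_u _ h

theorem lower_lower (i j : Fin m) (x : StanleyReisnerCoalgebra R S) :
    lower i (lower j x) = lower j (lower i x) := by
  have : (lower i ∘ₗ lower j : StanleyReisnerCoalgebra R S →ₗ[R] _) = lower j ∘ₗ lower i := by
    refine hom_ext fun α h => ?_
    simp only [LinearMap.comp_apply, lower_u h]
    have key : ∀ i j : Fin m, lower i (if 0 < α j then u R S (α - Finsupp.single j 1) else 0) =
        if Finsupp.single i 1 + Finsupp.single j 1 ≤ α then
          u R S (α - (Finsupp.single i 1 + Finsupp.single j 1)) else 0 := by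
      intro i j
      split_ifs with h1 h2 h2
      · rw [lower_u (allowed_mono h tsub_le_self), if_pos, add_comm, tsub_add_eq_tsub_tsub]
        have := h2 i
        simp at this ⊢
        omega
      · rw [lower_u (allowed_mono h tsub_le_self), if_neg]
        intro h3
        apply h2
        intro k
        simp only [Finsupp.coe_add, Finsupp.coe_tsub, Pi.add_apply, Pi.sub_apply,
          Finsupp.single_apply] at h3 ⊢
        by_cases hik : i = k <;> by_cases hjk : j = k <;> by_cases hij : i = j <;>
          simp_all <;> omega
      · exfalso
        have := h2 j
        simp at this
        omega
      · simp
    rw [key, key, add_comm]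
  exact LinearMap.congr_fun this x

theorem sum_ite_lower {P : Type} [AddCommMonoid P] (α : Fin m →₀ ℕ) (i : Fin m)
    (f : (Fin m →₀ ℕ) → (Fin m →₀ ℕ) → P) :
    (if 0 < α i then
      ∑ p ∈ Finset.HasAntidiagonal.antidiagonal (α - Finsupp.single i 1), f p.1 p.2 else 0) =
    ∑ p ∈ Finset.HasAntidiagonal.antidiagonal α,
      if 0 < p.1 i then f (p.1 - Finsupp.single i 1) p.2 else 0 := by
  have hle : ∀ {β : Fin m →₀ ℕ}, 0 < β i → Finsupp.single i 1 ≤ β := fun {β} hβ => by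
    simpa using! hβ
  split_ifs with h
  · rw [← Finset.sum_filter]
    refine Finset.sum_nbij' (fun p => (p.1 + Finsupp.single i 1, p.2))
      (fun p => (p.1 - Finsupp.single i 1, p.2)) ?_ ?_ ?_ ?_ ?_
    · rintro ⟨a, b⟩ hp
      simp at hp ⊢
      rw [add_right_comm, hp, tsub_add_cancel_of_le (hle h)]
    · rintro ⟨a, b⟩ hp
      simp at hp ⊢
      rw [← hp.1, tsub_add_eq_add_tsub (hle hp.2)]
    · rintro ⟨a, b⟩ hp
      simp
    · rintro ⟨a, b⟩ hp
      simp at hp ⊢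
      rw [tsub_add_cancel_of_le (hle hp.2)]
    · rintro ⟨a, b⟩ hp
      simp
  · symm
    refine Finset.sum_eq_zero fun p hp => if_neg ?_
    have := DFunLike.congr_fun (Finset.HasAntidiagonal.mem_antidiagonal.1 hp) i
    simp at this
    omega

theorem comul_lower_left (i : Fin m) (x : StanleyReisnerCoalgebra R S) :
    Coalgebra.comul (R := R) (lower i x) =
      TensorProduct.map (lower i) LinearMap.id (Coalgebra.comul (R := R) x) := by
  have : Coalgebra.comul (R := R) ∘ₗ lower i = TensorProduct.map (lower i) LinearMap.id ∘ₗ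
      Coalgebra.comul (R := R) (A := StanleyReisnerCoalgebra R S) := by
    refine hom_ext fun α h => ?_
    rw [LinearMap.comp_apply, LinearMap.comp_apply, lower_u h, comul_u h, diagonal, map_sum]
    refine Eq.trans ?_ ((sum_ite_lower α i fun β γ => u R S β ⊗ₜ[R] u R S γ).trans
      (Finset.sum_congr rfl fun p hp => ?_))
    · split_ifs with h1
      · exact comul_u (allowed_mono h tsub_le_self)
      · simp
    · rw [TensorProduct.map_tmul, lower_u (allowed_fst h hp)]
      split_ifs <;> simp
  exact LinearMap.congr_fun this x

theorem comul_lower_right (i : Fin m) (x : StanleyReisnerCoalgebra R S) :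
    Coalgebra.comul (R := R) (lower i x) =
      TensorProduct.map LinearMap.id (lower i) (Coalgebra.comul (R := R) x) := by
  have : Coalgebra.comul (R := R) ∘ₗ lower i = TensorProduct.map LinearMap.id (lower i) ∘ₗ
      Coalgebra.comul (R := R) (A := StanleyReisnerCoalgebra R S) := by
    refine hom_ext fun α h => ?_
    rw [LinearMap.comp_apply, LinearMap.comp_apply, lower_u h, comul_u h, diagonal, map_sum]
    rw [← Finset.sum_equiv (Equiv.prodComm _ _)
      (s := Finset.HasAntidiagonal.antidiagonal α)
      (f := fun p => TensorProduct.map LinearMap.id (lower i) (u R S p.2 ⊗ₜ[R] u R S p.1))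
      (by rintro ⟨a, b⟩; simp [add_comm]) (by rintro ⟨a, b⟩ _; rfl)]
    refine Eq.trans ?_ ((sum_ite_lower α i fun β γ => u R S γ ⊗ₜ[R] u R S β).trans
      (Finset.sum_congr rfl fun p hp => ?_))
    · split_ifs with h1
      · refine (comul_u (allowed_mono h tsub_le_self)).trans ?_
        exact Finset.sum_equiv (Equiv.prodComm _ _)
          (by rintro ⟨a, b⟩; simp [add_comm]) (by rintro ⟨a, b⟩ _; rfl)
      · simp
    · rw [TensorProduct.map_tmul, lower_u (allowed_fst h hp)]
      split_ifs <;> simp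
  exact LinearMap.congr_fun this x

/-- The inclusion of Stanley-Reisner coalgebras induced by an inclusion of simplicial complexes. -/
noncomputable def map (h : S ≤ S') : StanleyReisnerCoalgebra R S →ₗc[R] StanleyReisnerCoalgebra R S' :=
  { lift (u R S') with
    counit_comp := hom_ext fun α hα => by
      change CoalgebraStruct.counit (R := R) (lift (u R S') (u R S α)) = _
      rw [lift_u _ hα, counit_u hα, counit_u (h hα)]
    map_comp_comul := hom_ext fun α hα => by
      change TensorProduct.map (lift (u R S')) (lift (u R S'))
        (CoalgebraStruct.comul (R := R) (u R S α)) =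
          CoalgebraStruct.comul (R := R) (lift (u R S') (u R S α))
      rw [lift_u _ hα, comul_u hα, comul_u (h hα), diagonal, diagonal, map_sum]
      refine Finset.sum_congr rfl fun p hp => ?_
      rw [TensorProduct.map_tmul, lift_u _ (allowed_fst hα hp), lift_u _ (allowed_snd hα hp)] }

theorem map_u (h : S ≤ S') {α : Fin m →₀ ℕ} (hα : α.support ∈ S.faces) :
    map h (u R S α) = u R S' α := lift_u _ hα

end
end StanleyReisnerCoalgebra

/-! ## The exterior coalgebra -/

/-- The exterior coalgebra `⋀(v_1, …, v_m)`, with basis `v_τ = v_{i_1} ∧ ⋯ ∧ v_{i_k}` for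
`τ = {i_1 < ⋯ < i_k} ⊆ [m]`. -/
def ExteriorCoalgebra (R : Type) [CommRing R] (m : ℕ) : Type := Finset (Fin m) →₀ R

namespace ExteriorCoalgebra

noncomputable instance (R : Type) [CommRing R] (m : ℕ) : AddCommGroup (ExteriorCoalgebra R m) :=
  inferInstanceAs (AddCommGroup (Finset (Fin m) →₀ R))

noncomputable instance (R : Type) [CommRing R] (m : ℕ) : Module R (ExteriorCoalgebra R m) :=
  inferInstanceAs (Module R (Finset (Fin m) →₀ R))

/-- The number of pairs `(a, b) ∈ A × B` with `b < a`. -/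
def inversions {m : ℕ} (A B : Finset (Fin m)) : ℕ :=
  ((A ×ˢ B).filter fun p => p.2 < p.1).card

theorem inversions_union_left {m : ℕ} {A B : Finset (Fin m)} (C : Finset (Fin m))
    (h : Disjoint A B) : inversions (A ∪ B) C = inversions A C + inversions B C := by
  rw [inversions, Finset.union_product, Finset.filter_union, Finset.card_union_of_disjoint]
  · rfl
  · exact Finset.disjoint_filter_filter (Finset.disjoint_product.2 (Or.inl h))

theorem inversions_union_right {m : ℕ} {B C : Finset (Fin m)} (A : Finset (Fin m))
    (h : Disjoint B C) : inversions A (B ∪ C) = inversions A B + inversions A C := by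
  rw [inversions, Finset.product_union, Finset.filter_union, Finset.card_union_of_disjoint]
  · rfl
  · exact Finset.disjoint_filter_filter (Finset.disjoint_product.2 (Or.inr h))

theorem inversions_swap {m : ℕ} {A B : Finset (Fin m)} (h : Disjoint A B) :
    inversions A B + inversions B A = A.card * B.card := by
  rw [← Finset.card_product, ← Finset.card_filter_add_card_filter_not (s := A ×ˢ B)
    (fun p => p.2 < p.1)]
  congr 1
  refine Finset.card_nbij' Prod.swap Prod.swap ?_ ?_ ?_ ?_
  · rintro ⟨a, b⟩ hp
    simp at hp ⊢
    exact ⟨hp.1.symm, hp.2.le⟩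
  · rintro ⟨a, b⟩ hp
    simp at hp ⊢
    refine ⟨hp.1.symm, lt_of_le_of_ne hp.2 ?_⟩
    rintro rfl
    exact Finset.disjoint_left.1 h hp.1.1 hp.1.2
  · rintro ⟨a, b⟩ _; rfl
  · rintro ⟨a, b⟩ _; rfl

section

variable (R : Type) [CommRing R] {m : ℕ}

/-- The basis element `v_τ`. -/
noncomputable def v (τ : Finset (Fin m)) : ExteriorCoalgebra R m := Finsupp.single τ (1 : R)

/-- The sign with `v_A ∧ v_B = sign A B • v_{A ∪ B}` for disjoint `A` and `B`. -/
def sign (A B : Finset (Fin m)) : R := (-1) ^ inversions A B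

variable {R}

theorem sign_mul_self (A B : Finset (Fin m)) : sign R A B * sign R A B = 1 := by
  rw [sign, ← pow_add, ← two_mul, pow_mul]
  simp

theorem sign_union_left {A B : Finset (Fin m)} (C : Finset (Fin m)) (h : Disjoint A B) :
    sign R (A ∪ B) C = sign R A C * sign R B C := by
  rw [sign, inversions_union_left C h, pow_add, sign, sign]

theorem sign_union_right {B C : Finset (Fin m)} (A : Finset (Fin m)) (h : Disjoint B C) :
    sign R A (B ∪ C) = sign R A B * sign R A C := by
  rw [sign, inversions_union_right A h, pow_add, sign, sign]

theorem sign_swap {A B : Finset (Fin m)} (h : Disjoint A B) :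
    sign R A B * sign R B A = (-1) ^ (A.card * B.card) := by
  rw [sign, sign, ← pow_add, inversions_swap h]

theorem sign_empty_left (A : Finset (Fin m)) : sign R ∅ A = 1 := by
  simp [sign, inversions]

theorem sign_empty_right (A : Finset (Fin m)) : sign R A ∅ = 1 := by
  simp [sign, inversions]

variable {M : Type} [AddCommGroup M] [Module R M]

/-- The linear map with given values on the basis. -/
noncomputable def lift (f : Finset (Fin m) → M) : ExteriorCoalgebra R m →ₗ[R] M :=
  Finsupp.lift M R (Finset (Fin m)) f

theorem lift_v (f : Finset (Fin m) → M) (τ : Finset (Fin m)) : lift f (v R τ) = f τ := by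
  refine (Finsupp.lift_apply _ _ _ _ _).trans ?_
  exact (Finsupp.sum_single_index (by simp)).trans (by simp)

theorem hom_ext {f g : ExteriorCoalgebra R m →ₗ[R] M}
    (h : ∀ τ : Finset (Fin m), f (v R τ) = g (v R τ)) : f = g :=
  Finsupp.lhom_ext' fun τ => LinearMap.ext_ring (h τ)

variable (R) in
/-- The diagonal for which the elements `v_i` are primitive, that is, the one determined by
`Δ(v ∧ w) = Δ v ∧ Δ w`:
`Δ v_τ = ∑ ± v_A ⊗ v_B`, the sum being over all decompositions `τ = A ⊔ B`, with the sign that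
occurs in `v_A ∧ v_B = ± v_τ`. -/
noncomputable def diagonal (τ : Finset (Fin m)) :
    ExteriorCoalgebra R m ⊗[R] ExteriorCoalgebra R m :=
  ∑ A ∈ τ.powerset, sign R A (τ \ A) • v R A ⊗ₜ[R] v R (τ \ A)

noncomputable instance : CoalgebraStruct R (ExteriorCoalgebra R m) where
  comul := lift (diagonal R)
  counit := lift fun τ => if τ = ∅ then 1 else 0

theorem comul_v (τ : Finset (Fin m)) :
    CoalgebraStruct.comul (R := R) (v R τ) = diagonal R τ := lift_v _ τ

theorem counit_v (τ : Finset (Fin m)) :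
    CoalgebraStruct.counit (R := R) (v R τ) = if τ = ∅ then 1 else 0 := lift_v _ τ

noncomputable instance : Coalgebra R (ExteriorCoalgebra R m) where
  coassoc := by
    refine hom_ext fun τ => ?_
    simp only [LinearMap.comp_apply, comul_v, diagonal, map_sum, map_smul, LinearMap.rTensor_tmul,
      LinearMap.lTensor_tmul, LinearEquiv.coe_coe, TensorProduct.sum_tmul, TensorProduct.tmul_sum,
      Finset.smul_sum, TensorProduct.tmul_smul, smul_smul, ← TensorProduct.smul_tmul',
      TensorProduct.assoc_tmul]
    rw [Finset.sum_sigma', Finset.sum_sigma']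
    refine Finset.sum_nbij' (fun p => ⟨p.2, p.1 \ p.2⟩) (fun p => ⟨p.1 ∪ p.2, p.1⟩) ?_ ?_ ?_ ?_ ?_
    · rintro ⟨A, B⟩ h
      simp only [Finset.mem_sigma, Finset.mem_powerset] at h ⊢
      exact ⟨h.2.trans h.1, Finset.sdiff_subset_sdiff h.1 le_rfl⟩
    · rintro ⟨A, B⟩ h
      simp only [Finset.mem_sigma, Finset.mem_powerset] at h ⊢
      exact ⟨Finset.union_subset h.1 (h.2.trans Finset.sdiff_subset), Finset.subset_union_left⟩
    · rintro ⟨A, B⟩ h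
      simp only [Finset.mem_sigma, Finset.mem_powerset] at h ⊢
      rw [Finset.union_sdiff_of_subset h.2]
    · rintro ⟨A, B⟩ h
      simp only [Finset.mem_sigma, Finset.mem_powerset] at h ⊢
      have : Disjoint A B := Finset.disjoint_of_subset_right h.2 Finset.disjoint_sdiff
      rw [Finset.union_sdiff_cancel_left this]
    · rintro ⟨A, B⟩ h
      simp only [Finset.mem_sigma, Finset.mem_powerset] at h ⊢
      have e1 : (τ \ B) \ (A \ B) = τ \ A := by
        ext x
        have := @h.2 x
        simp only [Finset.mem_sdiff]
        tauto
      have e2 : τ \ B = (A \ B) ∪ (τ \ A) := by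
        ext x
        have := @h.2 x
        have := @h.1 x
        simp only [Finset.mem_sdiff, Finset.mem_union]
        tauto
      have d1 : Disjoint B (A \ B) := Finset.disjoint_sdiff
      have d2 : Disjoint (A \ B) (τ \ A) := by
        rw [Finset.disjoint_left]
        intro x hx hx'
        simp only [Finset.mem_sdiff] at hx hx'
        exact hx'.2 hx.1
      rw [e1, e2, sign_union_right _ d2]
      congr 1
      nth_rewrite 1 [← Finset.union_sdiff_of_subset h.2]
      rw [sign_union_left _ d1]
      ring
  rTensor_counit_comp_comul := by
    refine hom_ext fun τ => ?_
    simp only [LinearMap.comp_apply, comul_v, diagonal, map_sum, map_smul, LinearMap.rTensor_tmul,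
      counit_v]
    rw [Finset.sum_eq_single ∅]
    · simp [sign_empty_left]
    · intro A _ hA
      simp [hA]
    · simp
  lTensor_counit_comp_comul := by
    refine hom_ext fun τ => ?_
    simp only [LinearMap.comp_apply, comul_v, diagonal, map_sum, map_smul, LinearMap.lTensor_tmul,
      counit_v]
    rw [Finset.sum_eq_single τ]
    · simp [sign_empty_right]
    · intro A hA hA'
      rw [if_neg, TensorProduct.tmul_zero, smul_zero]
      intro h
      rw [Finset.sdiff_eq_empty_iff_subset] at h
      exact hA' (Finset.Subset.antisymm (Finset.mem_powerset.1 hA) h)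
    · simp

/-- Multiplication by `v_i`: the map `v_τ ↦ v_i ∧ v_τ`. -/
noncomputable def wedge (i : Fin m) : ExteriorCoalgebra R m →ₗ[R] ExteriorCoalgebra R m :=
  lift fun τ => if i ∈ τ then 0 else sign R {i} τ • v R (insert i τ)

theorem wedge_v (i : Fin m) (τ : Finset (Fin m)) :
    wedge i (v R τ) = if i ∈ τ then 0 else sign R {i} τ • v R (insert i τ) := lift_v _ τ

theorem wedge_wedge_self (i : Fin m) (x : ExteriorCoalgebra R m) : wedge i (wedge i x) = 0 := by
  have : (wedge i ∘ₗ wedge i : ExteriorCoalgebra R m →ₗ[R] _) = 0 := by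
    refine hom_ext fun τ => ?_
    rw [LinearMap.comp_apply, wedge_v]
    split_ifs <;> simp [wedge_v]
  exact LinearMap.congr_fun this x

theorem wedge_wedge (i j : Fin m) (hij : i ≠ j) (x : ExteriorCoalgebra R m) :
    wedge i (wedge j x) = - wedge j (wedge i x) := by
  have : (wedge i ∘ₗ wedge j : ExteriorCoalgebra R m →ₗ[R] _) = - (wedge j ∘ₗ wedge i) := by
    refine hom_ext fun τ => ?_
    rw [LinearMap.comp_apply, LinearMap.neg_apply, LinearMap.comp_apply, wedge_v, wedge_v]
    by_cases hi : i ∈ τ <;> by_cases hj : j ∈ τ <;>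
      simp only [hi, hj, if_true, if_false, map_zero, map_smul, wedge_v, Finset.mem_insert, hij,
        hij.symm, or_true, or_false, smul_zero, neg_zero, smul_smul]
    have e : insert i (insert j τ) = insert j (insert i τ) := Finset.insert_comm i j τ
    rw [e, ← neg_smul]
    congr 1
    rw [Finset.insert_eq j τ, Finset.insert_eq i τ, sign_union_right _ (by simpa using hj),
      sign_union_right _ (by simpa using hi)]
    have s := sign_swap (R := R) (A := {i}) (B := {j}) (by simpa using hij)
    have t := sign_mul_self (R := R) ({j} : Finset (Fin m)) {i}
    simp at s
    linear_combination (sign R {j} τ * sign R {i} τ * sign R {j} {i}) * s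
      - (sign R {j} τ * sign R {i} τ * sign R {i} {j}) * t
  exact LinearMap.congr_fun this x

variable (R m) in
/-- The involution `v_τ ↦ (-1)^|τ| v_τ`. -/
noncomputable def parity : ExteriorCoalgebra R m →ₗ[R] ExteriorCoalgebra R m :=
  lift fun τ => ((-1 : R) ^ τ.card) • v R τ

theorem parity_v (τ : Finset (Fin m)) : parity R m (v R τ) = ((-1 : R) ^ τ.card) • v R τ :=
  lift_v _ τ

theorem comul_wedge (i : Fin m) (x : ExteriorCoalgebra R m) :
    Coalgebra.comul (R := R) (wedge i x) =
      TensorProduct.map (wedge i) LinearMap.id (Coalgebra.comul (R := R) x) +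
        TensorProduct.map (parity R m) (wedge i) (Coalgebra.comul (R := R) x) := by
  have : Coalgebra.comul (R := R) ∘ₗ wedge i =
      TensorProduct.map (wedge i) LinearMap.id ∘ₗ
        Coalgebra.comul (R := R) (A := ExteriorCoalgebra R m) +
      TensorProduct.map (parity R m) (wedge i) ∘ₗ
        Coalgebra.comul (R := R) (A := ExteriorCoalgebra R m) := by
    refine hom_ext fun τ => ?_
    simp only [LinearMap.comp_apply, LinearMap.add_apply, wedge_v, comul_v, diagonal, map_sum,
      map_smul, TensorProduct.map_tmul, LinearMap.id_apply, parity_v]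
    by_cases hi : i ∈ τ
    · rw [if_pos hi, map_zero]
      symm
      -- the terms for `A` in the first sum cancel those for `A ∪ {i}` in the second one
      have f1 : ∀ A ∈ τ.powerset, i ∈ A → sign R A (τ \ A) • (if i ∈ A then 0 else
          sign R {i} A • v R (insert i A)) ⊗ₜ[R] v R (τ \ A) = 0 := fun A _ hA => by simp [hA]
      have f2 : ∀ A ∈ τ.powerset, i ∉ A → sign R A (τ \ A) • (((-1 : R) ^ A.card) • v R A) ⊗ₜ[R]
          (if i ∈ τ \ A then 0 else sign R {i} (τ \ A) • v R (insert i (τ \ A))) = 0 :=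
        fun A _ hA => by simp [hA, hi]
      rw [← Finset.sum_filter_add_sum_filter_not τ.powerset (fun A => i ∈ A),
        ← Finset.sum_filter_add_sum_filter_not τ.powerset (fun A => i ∈ A)
          (fun A => sign R A (τ \ A) • (((-1 : R) ^ A.card) • v R A) ⊗ₜ[R] _),
        Finset.sum_eq_zero (fun A hA => f1 A (Finset.mem_filter.1 hA).1 (Finset.mem_filter.1 hA).2),
        Finset.sum_eq_zero (s := τ.powerset.filter fun A => ¬ i ∈ A)
          (fun A hA => f2 A (Finset.mem_filter.1 hA).1 (Finset.mem_filter.1 hA).2),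
        zero_add, add_zero, ← eq_neg_iff_add_eq_zero, ← Finset.sum_neg_distrib]
      refine Finset.sum_nbij' (fun A => insert i A) (fun A => A.erase i) ?_ ?_ ?_ ?_ ?_
      · intro A hA
        simp only [Finset.mem_filter, Finset.mem_powerset] at hA ⊢
        exact ⟨Finset.insert_subset hi hA.1, Finset.mem_insert_self _ _⟩
      · intro A hA
        simp only [Finset.mem_filter, Finset.mem_powerset] at hA ⊢
        exact ⟨(Finset.erase_subset _ _).trans hA.1, Finset.notMem_erase _ _⟩
      · intro A hA
        simp only [Finset.mem_filter] at hA
        exact Finset.erase_insert hA.2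
      · intro A hA
        simp only [Finset.mem_filter] at hA
        exact Finset.insert_erase hA.2
      · intro A hA
        simp only [Finset.mem_filter, Finset.mem_powerset] at hA
        have hiA : i ∉ A := hA.2
        have hi' : i ∉ τ \ insert i A := by simp
        rw [if_neg hiA, if_neg hi']
        have e1 : insert i (τ \ insert i A) = τ \ A := by
          ext x
          by_cases hx : x = i
          · subst hx; simp [hi, hiA]
          · simp [hx]
        have e2 : τ \ A = {i} ∪ (τ \ insert i A) := by rw [← e1, Finset.insert_eq]
        have d1 : Disjoint {i} (τ \ insert i A) := by simp
        have d2 : Disjoint {i} A := by simpa using hiA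
        rw [e1]
        simp only [TensorProduct.smul_tmul', TensorProduct.tmul_smul, smul_smul]
        rw [← TensorProduct.neg_tmul, ← neg_smul]
        congr 2
        rw [Finset.card_insert_of_notMem hiA, Finset.insert_eq i A, sign_union_left _ d2]
        conv_lhs => rw [e2]
        rw [sign_union_right _ d1, Finset.insert_eq i A]
        have s := sign_swap (R := R) d2
        have t := sign_mul_self (R := R) {i} (τ \ ({i} ∪ A))
        have t' := sign_mul_self (R := R) {i} A
        simp only [Finset.card_singleton, one_mul] at s
        have s' : sign R A {i} = (-1) ^ A.card * sign R {i} A := by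
          linear_combination (sign R {i} A) * s - (sign R A {i}) * t'
        rw [s', pow_succ]
        linear_combination (-1) ^ A.card * sign R A (τ \ ({i} ∪ A)) * t' - (-1) ^ A.card * sign R A (τ \ ({i} ∪ A)) * t
    · rw [if_neg hi, map_smul, comul_v, diagonal, Finset.powerset_insert, Finset.sum_union,
        Finset.sum_image, add_comm, smul_add, Finset.smul_sum, Finset.smul_sum]
      · congr 1
        · refine Finset.sum_congr rfl fun A hA => ?_
          rw [Finset.mem_powerset] at hA
          have hiA : i ∉ A := fun h => hi (hA h)
          have e : insert i τ \ insert i A = τ \ A := by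
            ext x
            by_cases hx : x = i
            · subst hx; simp [hi]
            · simp [hx]
          have e2 : sign R {i} τ = sign R {i} A * sign R {i} (τ \ A) := by
            rw [← sign_union_right _ Finset.disjoint_sdiff, Finset.union_sdiff_of_subset hA]
          rw [if_neg hiA, e, e2, Finset.insert_eq i A, sign_union_left _ (by simpa using hiA)]
          simp only [TensorProduct.smul_tmul', smul_smul]
          congr 2
          have t := sign_mul_self (R := R) {i} (τ \ A)
          linear_combination (sign R {i} A * sign R A (τ \ A)) * t
        · refine Finset.sum_congr rfl fun A hA => ?_
          rw [Finset.mem_powerset] at hA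
          have hiA : i ∉ A := fun h => hi (hA h)
          have hi' : i ∉ τ \ A := by simp [hi]
          have e : insert i τ \ A = insert i (τ \ A) := Finset.insert_sdiff_of_notMem _ hiA
          have e2 : sign R {i} τ = sign R {i} A * sign R {i} (τ \ A) := by
            rw [← sign_union_right _ Finset.disjoint_sdiff, Finset.union_sdiff_of_subset hA]
          have d : Disjoint {i} A := by simpa using hiA
          rw [if_neg hi', e, e2, Finset.insert_eq i (τ \ A),
            sign_union_right _ (Finset.disjoint_singleton_left.2 hi')]
          simp only [TensorProduct.smul_tmul', TensorProduct.tmul_smul, smul_smul]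
          congr 2
          have s := sign_swap (R := R) d
          simp only [Finset.card_singleton, one_mul] at s
          linear_combination (sign R {i} (τ \ A) * sign R A (τ \ A)) * s
      · intro A hA B hB hAB
        rw [Finset.mem_coe, Finset.mem_powerset] at hA hB
        have := congrArg (fun s => Finset.erase s i) hAB
        simpa [Finset.erase_insert (fun h => hi (hA h)), Finset.erase_insert (fun h => hi (hB h))]
          using this
      · rw [Finset.disjoint_left]
        intro A hA hA'
        rw [Finset.mem_powerset] at hA
        obtain ⟨B, _, rfl⟩ := Finset.mem_image.1 hA'
        exact hi (hA (Finset.mem_insert_self _ _))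
  exact LinearMap.congr_fun this x

end
end ExteriorCoalgebra

/-! ## The dgcs `K(Σ)` and `L(Σ)` -/

/-- The tensor product `K(Σ)` of the Stanley-Reisner coalgebra and the exterior coalgebra. It
carries the tensor product coalgebra structure (there are no signs in
`(x ⊗ y) ⊗ (x' ⊗ y') ↦ (x ⊗ x') ⊗ (y ⊗ y')` as the Stanley-Reisner coalgebra is concentrated in
even degrees). -/
abbrev KoszulCoalgebra (R : Type) [CommRing R] {m : ℕ} (S : SimplicialComplexOn m) : Type :=
  StanleyReisnerCoalgebra R S ⊗[R] ExteriorCoalgebra R m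

namespace KoszulCoalgebra

open StanleyReisnerCoalgebra (u lower)
open ExteriorCoalgebra (v wedge parity sign)

section

variable (R : Type) [CommRing R] {m : ℕ} (S : SimplicialComplexOn m)

/-- The part of degree `n`: here `u_α` has degree `2 (α_1 + ⋯ + α_m)` and `v_τ` has degree `|τ|`. -/
noncomputable def deg (n : ℕ) : Submodule R (KoszulCoalgebra R S) :=
  Submodule.span R {x | ∃ (α : Fin m →₀ ℕ) (τ : Finset (Fin m)), α.support ∈ S.faces ∧
    2 * (∑ i, α i) + τ.card = n ∧ x = u R S α ⊗ₜ[R] v R τ}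

/-- The differential `d(u_α ⊗ v_τ) = ∑_{α_i > 0} u_{α - i} ⊗ v_i ∧ v_τ`. -/
noncomputable def differential : KoszulCoalgebra R S →ₗ[R] KoszulCoalgebra R S :=
  ∑ i : Fin m, TensorProduct.map (lower i) (wedge i)

variable {R S} {M : Type} [AddCommGroup M] [Module R M]

theorem mem_deg {α : Fin m →₀ ℕ} {τ : Finset (Fin m)} (h : α.support ∈ S.faces) {n : ℕ}
    (hn : 2 * (∑ i, α i) + τ.card = n) : u R S α ⊗ₜ[R] v R τ ∈ deg R S n :=
  Submodule.subset_span ⟨α, τ, h, hn, rfl⟩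

theorem deg_le {n : ℕ} {N : Submodule R (KoszulCoalgebra R S)}
    (h : ∀ (α : Fin m →₀ ℕ) (τ : Finset (Fin m)), α.support ∈ S.faces →
      2 * (∑ i, α i) + τ.card = n → u R S α ⊗ₜ[R] v R τ ∈ N) : deg R S n ≤ N := by
  rw [deg, Submodule.span_le]
  rintro _ ⟨α, τ, hα, hn, rfl⟩
  exact h α τ hα hn

theorem hom_ext {f g : KoszulCoalgebra R S →ₗ[R] M}
    (h : ∀ (α : Fin m →₀ ℕ) (τ : Finset (Fin m)), α.support ∈ S.faces →
      f (u R S α ⊗ₜ[R] v R τ) = g (u R S α ⊗ₜ[R] v R τ)) : f = g := by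
  refine TensorProduct.curry_injective ?_
  refine StanleyReisnerCoalgebra.hom_ext fun α hα => ?_
  exact ExteriorCoalgebra.hom_ext fun τ => h α τ hα

/-- The linear map with given values on the basis. -/
noncomputable def lift (f : (Fin m →₀ ℕ) → Finset (Fin m) → M) : KoszulCoalgebra R S →ₗ[R] M :=
  TensorProduct.lift (StanleyReisnerCoalgebra.lift fun α => ExteriorCoalgebra.lift (f α))

theorem lift_tmul (f : (Fin m →₀ ℕ) → Finset (Fin m) → M) {α : Fin m →₀ ℕ}
    (h : α.support ∈ S.faces) (τ : Finset (Fin m)) : lift f (u R S α ⊗ₜ[R] v R τ) = f α τ := by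
  rw [lift, TensorProduct.lift.tmul, StanleyReisnerCoalgebra.lift_u _ h,
    ExteriorCoalgebra.lift_v]

theorem isInternal : DirectSum.IsInternal (deg R S) := by
  classical
  refine isInternal_of_proj _ (fun n => lift fun α τ =>
    if 2 * (∑ i, α i) + τ.card = n then u R S α ⊗ₜ[R] v R τ else 0) ?_ ?_ ?_
  · intro n x hx
    refine deg_le (N := LinearMap.eqLocus _ LinearMap.id) ?_ hx
    intro α τ hα hn
    rw [LinearMap.mem_eqLocus, lift_tmul _ hα, if_pos hn, LinearMap.id_apply]
  · intro n k hk x hx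
    refine deg_le (N := LinearMap.ker _) ?_ hx
    intro α τ hα hn
    rw [LinearMap.mem_ker, lift_tmul _ hα, if_neg (by omega)]
  · rw [eq_top_iff]
    have : (⨆ n, deg R S n).mkQ = 0 := hom_ext fun α τ hα => by
      simpa using Submodule.mem_iSup_of_mem _ (mem_deg hα rfl)
    intro x _
    simpa using LinearMap.congr_fun this x

theorem sum_sub_single {α : Fin m →₀ ℕ} {i : Fin m} (h : 0 < α i) :
    ∑ j, α j = ∑ j, (α - Finsupp.single i 1 : Fin m →₀ ℕ) j + 1 := by
  have e : α = (α - Finsupp.single i 1) + Finsupp.single i 1 :=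
    (tsub_add_cancel_of_le (by simpa using! h)).symm
  conv_lhs => rw [e]
  simp only [Finsupp.add_apply, Finset.sum_add_distrib]
  congr 1
  simp [Finsupp.single_apply]

theorem differential_tmul {α : Fin m →₀ ℕ} (h : α.support ∈ S.faces) (τ : Finset (Fin m)) :
    differential R S (u R S α ⊗ₜ[R] v R τ) = ∑ i : Fin m, if 0 < α i ∧ i ∉ τ then
      sign R {i} τ • u R S (α - Finsupp.single i 1) ⊗ₜ[R] v R (insert i τ) else 0 := by
  rw [differential, LinearMap.sum_apply]
  refine Finset.sum_congr rfl fun i _ => ?_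
  rw [TensorProduct.map_tmul, StanleyReisnerCoalgebra.lower_u h, ExteriorCoalgebra.wedge_v]
  by_cases h1 : 0 < α i <;> by_cases h2 : i ∈ τ <;> simp [h1, h2]

theorem differential_mem_of {N : Submodule R (KoszulCoalgebra R S)} {α : Fin m →₀ ℕ}
    (h : α.support ∈ S.faces) (τ : Finset (Fin m))
    (hN : ∀ i, 0 < α i → i ∉ τ → u R S (α - Finsupp.single i 1) ⊗ₜ[R] v R (insert i τ) ∈ N) :
    differential R S (u R S α ⊗ₜ[R] v R τ) ∈ N := by
  rw [differential_tmul h]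
  refine Submodule.sum_mem _ fun i _ => ?_
  split_ifs with hi
  · exact Submodule.smul_mem _ _ (hN i hi.1 hi.2)
  · exact zero_mem _

theorem comul_tmul {α : Fin m →₀ ℕ} (h : α.support ∈ S.faces) (τ : Finset (Fin m)) :
    Coalgebra.comul (R := R) (u R S α ⊗ₜ[R] v R τ) =
      ∑ p ∈ Finset.HasAntidiagonal.antidiagonal α, ∑ A ∈ τ.powerset, sign R A (τ \ A) •
        (u R S p.1 ⊗ₜ[R] v R A) ⊗ₜ[R] (u R S p.2 ⊗ₜ[R] v R (τ \ A)) := by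
  rw [TensorProduct.comul_tmul]
  erw [StanleyReisnerCoalgebra.comul_u h, ExteriorCoalgebra.comul_v]
  rw [StanleyReisnerCoalgebra.diagonal, ExteriorCoalgebra.diagonal, TensorProduct.sum_tmul, map_sum]
  refine Finset.sum_congr rfl fun p _ => ?_
  rw [TensorProduct.tmul_sum, map_sum]
  refine Finset.sum_congr rfl fun A _ => ?_
  rw [TensorProduct.tmul_smul, map_smul]
  rfl

theorem counit_tmul {α : Fin m →₀ ℕ} (h : α.support ∈ S.faces) (τ : Finset (Fin m)) :
    Coalgebra.counit (R := R) (u R S α ⊗ₜ[R] v R τ) = if α = 0 ∧ τ = ∅ then 1 else 0 := by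
  rw [TensorProduct.counit_tmul]
  erw [StanleyReisnerCoalgebra.counit_u h, ExteriorCoalgebra.counit_v]
  by_cases h1 : α = 0 <;> by_cases h2 : τ = ∅ <;> simp [h1, h2]

variable (R S) in
theorem degreeSign_eq : degreeSign (deg R S) isInternal =
    TensorProduct.map LinearMap.id (parity R m) := by
  refine hom_ext fun α τ h => ?_
  rw [degreeSign_of_mem _ isInternal (mem_deg h rfl), TensorProduct.map_tmul,
    ExteriorCoalgebra.parity_v, pow_add, pow_mul]
  simp

theorem differential_differential (x : KoszulCoalgebra R S) :
    differential R S (differential R S x) = 0 := by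
  have : differential R S ∘ₗ differential R S = 0 := by
    refine TensorProduct.ext' fun a b => ?_
    simp only [LinearMap.comp_apply, differential, LinearMap.sum_apply, map_sum,
      TensorProduct.map_tmul, LinearMap.zero_apply]
    rw [← Finset.sum_product', Finset.univ_product_univ]
    refine Finset.sum_involution (fun p _ => (p.2, p.1)) ?_ ?_ ?_ ?_
    · rintro ⟨i, j⟩ _
      by_cases hij : i = j
      · subst hij
        simp [ExteriorCoalgebra.wedge_wedge_self]
      · simp only
        rw [StanleyReisnerCoalgebra.lower_lower, ExteriorCoalgebra.wedge_wedge i j hij,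
          TensorProduct.tmul_neg]
        simp
    · rintro ⟨i, j⟩ _ h h'
      simp only [Prod.mk.injEq] at h'
      apply h
      simp [h'.1, ExteriorCoalgebra.wedge_wedge_self]
    · intro p _
      exact Finset.mem_univ _
    · intro p _
      rfl
  exact LinearMap.congr_fun this x

theorem comul_differential (x : KoszulCoalgebra R S) :
    Coalgebra.comul (R := R) (differential R S x) =
      TensorProduct.map (differential R S) LinearMap.id (Coalgebra.comul (R := R) x) +
        TensorProduct.map (degreeSign (deg R S) isInternal) (differential R S)
          (Coalgebra.comul (R := R) x) := by
  rw [degreeSign_eq]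
  have : Coalgebra.comul (R := R) ∘ₗ differential R S =
      TensorProduct.map (differential R S) LinearMap.id ∘ₗ Coalgebra.comul (R := R) +
      TensorProduct.map (TensorProduct.map LinearMap.id (parity R m)) (differential R S) ∘ₗ
        Coalgebra.comul (R := R) := by
    refine TensorProduct.ext' fun a b => ?_
    have key : ∀ (f g : StanleyReisnerCoalgebra R S →ₗ[R] StanleyReisnerCoalgebra R S)
        (f' g' : ExteriorCoalgebra R m →ₗ[R] ExteriorCoalgebra R m) (s t),
        TensorProduct.AlgebraTensorModule.tensorTensorTensorComm R R R R _ _ _ _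
          (TensorProduct.map f g s ⊗ₜ[R] TensorProduct.map f' g' t) =
        TensorProduct.map (TensorProduct.map f f') (TensorProduct.map g g')
          (TensorProduct.AlgebraTensorModule.tensorTensorTensorComm R R R R _ _ _ _
            (s ⊗ₜ[R] t)) := by
      intro f g f' g' s t
      induction s using TensorProduct.induction_on with
      | zero => simp
      | add s1 s2 h1 h2 => simp only [map_add, TensorProduct.add_tmul, h1, h2]
      | tmul s1 s2 =>
        induction t using TensorProduct.induction_on with
        | zero => simp
        | add t1 t2 h1 h2 => simp only [map_add, TensorProduct.tmul_add, h1, h2]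
        | tmul t1 t2 => rfl
    simp only [LinearMap.comp_apply, LinearMap.add_apply]
    have hd : differential R S (a ⊗ₜ[R] b) = ∑ i, lower i a ⊗ₜ[R] wedge i b := by
      simp [differential, LinearMap.sum_apply]
    have l : ∀ y, TensorProduct.map (differential R S) LinearMap.id y =
        ∑ i, TensorProduct.map (TensorProduct.map (lower i) (wedge i))
          (LinearMap.id (R := R) (M := KoszulCoalgebra R S)) y := fun y => by
      rw [← LinearMap.sum_apply]
      congr 1
      exact TensorProduct.ext' fun p q => by
        simp [differential, LinearMap.sum_apply, TensorProduct.sum_tmul]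
    have l' : ∀ y, TensorProduct.map (TensorProduct.map LinearMap.id (parity R m))
        (differential R S) y = ∑ i, TensorProduct.map (TensorProduct.map
          (LinearMap.id (R := R) (M := StanleyReisnerCoalgebra R S)) (parity R m))
          (TensorProduct.map (lower i) (wedge i)) y := fun y => by
      rw [← LinearMap.sum_apply]
      congr 1
      exact TensorProduct.ext' fun p q => by
        simp [differential, LinearMap.sum_apply, TensorProduct.tmul_sum]
    rw [hd, map_sum, l, l', ← Finset.sum_add_distrib]
    refine Finset.sum_congr rfl fun i _ => ?_
    rw [TensorProduct.comul_tmul, TensorProduct.comul_tmul, ExteriorCoalgebra.comul_wedge,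
      TensorProduct.tmul_add, map_add, ← key, ← TensorProduct.map_id, ← key,
      ← StanleyReisnerCoalgebra.comul_lower_left, ← StanleyReisnerCoalgebra.comul_lower_right]
  exact LinearMap.congr_fun this x

variable (R S) in
/-- The dgc `K(Σ)`. -/
noncomputable def dgc : DGCoalgebra R where
  carrier := KoszulCoalgebra R S
  deg := deg R S
  isInternal := isInternal
  d := differential R S
  d_mem n x hx := by
    refine deg_le (N := (deg R S n).comap (differential R S)) (fun α τ hα hn => ?_) hx
    rw [Submodule.mem_comap]
    refine differential_mem_of (R := R) (S := S) hα τ fun i hi hiτ => ?_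
    refine mem_deg (R := R) (StanleyReisnerCoalgebra.allowed_mono hα tsub_le_self) ?_
    rw [Finset.card_insert_of_notMem hiτ]
    have := sum_sub_single hi
    omega
  d_deg_zero x hx := by
    refine deg_le (N := LinearMap.ker (differential R S)) (fun α τ hα hn => ?_) hx
    rw [LinearMap.mem_ker, ← Submodule.mem_bot (R := R)]
    refine differential_mem_of (R := R) (S := S) hα τ fun i hi hiτ => ?_
    have := sum_sub_single hi
    omega
  d_d := differential_differential
  comul_mem n x hx := by
    refine deg_le (N := (tensorDegree (deg R S) n).comap
      (Coalgebra.comul (R := R) (A := KoszulCoalgebra R S))) (fun α τ hα hn => ?_) hx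
    rw [Submodule.mem_comap, comul_tmul hα]
    refine Submodule.sum_mem _ fun p hp => Submodule.sum_mem _ fun A hA =>
      Submodule.smul_mem _ _ ?_
    refine tmul_mem_tensorDegree ?_ (mem_deg (StanleyReisnerCoalgebra.allowed_fst hα hp) rfl)
      (mem_deg (StanleyReisnerCoalgebra.allowed_snd hα hp) rfl)
    rw [← hn, ← Finset.HasAntidiagonal.mem_antidiagonal.1 hp]
    have := Finset.card_sdiff_add_card_eq_card (Finset.mem_powerset.1 hA)
    simp only [Finsupp.add_apply, Finset.sum_add_distrib]
    omega
  counit_of_pos n hn x hx := by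
    refine deg_le (N := LinearMap.ker (Coalgebra.counit (R := R) (A := KoszulCoalgebra R S)))
      (fun α τ hα hn' => ?_) hx
    rw [LinearMap.mem_ker, counit_tmul hα, if_neg]
    rintro ⟨rfl, rfl⟩
    simp at hn'
    omega
  comul_d := comul_differential
  counit_d x := by
    have : Coalgebra.counit (R := R) ∘ₗ differential R S = 0 := by
      refine hom_ext fun α τ hα => ?_
      rw [LinearMap.zero_apply, LinearMap.comp_apply, ← LinearMap.mem_ker]
      refine differential_mem_of (R := R) (S := S) hα τ fun i hi hiτ => ?_
      rw [LinearMap.mem_ker, counit_tmul (StanleyReisnerCoalgebra.allowed_mono hα tsub_le_self),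
        if_neg]
      simp
    exact LinearMap.congr_fun this x

variable {S' : SimplicialComplexOn m}

variable (R) in
/-- The inclusion `K(Σ) → K(Σ')` for a subcomplex `Σ` of `Σ'`. -/
noncomputable def dgcMap (h : S ≤ S') : dgc R S ⟶ dgc R S' :=
  DGCoalgebra.Hom.mk (C := dgc R S) (D := dgc R S')
    (Coalgebra.TensorProduct.map (StanleyReisnerCoalgebra.map h)
      (CoalgHom.id R (ExteriorCoalgebra R m)))
    (fun n x hx => by
      refine deg_le (N := (deg R S' n).comap (Coalgebra.TensorProduct.map
        (StanleyReisnerCoalgebra.map h) (CoalgHom.id R (ExteriorCoalgebra R m))).toLinearMap)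
        (fun α τ hα hn => ?_) hx
      have e : (Coalgebra.TensorProduct.map (StanleyReisnerCoalgebra.map h)
        (CoalgHom.id R (ExteriorCoalgebra R m))).toLinearMap (u R S α ⊗ₜ[R] v R τ) =
          u R S' α ⊗ₜ[R] v R τ := congrArg (· ⊗ₜ[R] v R τ) (StanleyReisnerCoalgebra.map_u h hα)
      rw [Submodule.mem_comap, e]
      exact mem_deg (h hα) hn)
    (fun x => by
      have : (Coalgebra.TensorProduct.map (StanleyReisnerCoalgebra.map h)
          (CoalgHom.id R (ExteriorCoalgebra R m))).toLinearMap ∘ₗ differential R S =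
          differential R S' ∘ₗ (Coalgebra.TensorProduct.map (StanleyReisnerCoalgebra.map h)
          (CoalgHom.id R (ExteriorCoalgebra R m))).toLinearMap := by
        have e : ∀ (α : Fin m →₀ ℕ) (τ : Finset (Fin m)), α.support ∈ S.faces →
          (Coalgebra.TensorProduct.map (StanleyReisnerCoalgebra.map h)
          (CoalgHom.id R (ExteriorCoalgebra R m))).toLinearMap (u R S α ⊗ₜ[R] v R τ) =
          u R S' α ⊗ₜ[R] v R τ := fun α τ hα =>
            congrArg (· ⊗ₜ[R] v R τ) (StanleyReisnerCoalgebra.map_u h hα)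
        refine hom_ext fun α τ hα => ?_
        rw [LinearMap.comp_apply, LinearMap.comp_apply, e α τ hα, differential_tmul hα,
          differential_tmul (h hα), map_sum]
        refine Finset.sum_congr rfl fun i _ => ?_
        split_ifs
        · rw [map_smul, e _ _ (StanleyReisnerCoalgebra.allowed_mono hα tsub_le_self)]
        · simp
      exact LinearMap.congr_fun this x)

theorem dgcMap_tmul (h : S ≤ S') {α : Fin m →₀ ℕ} (hα : α.support ∈ S.faces)
    (τ : Finset (Fin m)) : (dgcMap R h).toCoalgHom (u R S α ⊗ₜ[R] v R τ) = u R S' α ⊗ₜ[R] v R τ :=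
  congrArg (· ⊗ₜ[R] v R τ) (StanleyReisnerCoalgebra.map_u h hα)

variable (R m) in
/-- `Σ ↦ K(Σ)` as a functor on the poset of simplicial complexes on `[m]`. -/
noncomputable def functor : SimplicialComplexOn m ⥤ DGCoalgebra R where
  obj S := dgc R S
  map f := dgcMap R (leOfHom f)
  map_id S := by
    refine DGCoalgebra.Hom.ext (CoalgHom.coe_linearMap_injective ?_)
    exact hom_ext fun α τ hα => dgcMap_tmul le_rfl hα τ
  map_comp f g := by
    refine DGCoalgebra.Hom.ext (CoalgHom.coe_linearMap_injective ?_)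
    exact hom_ext fun α τ hα => (dgcMap_tmul _ hα τ).trans
      ((dgcMap_tmul (leOfHom g) (leOfHom f hα) τ).symm.trans
        (congrArg _ (dgcMap_tmul (leOfHom f) hα τ).symm))

/-! ### The sub-dgc `L(Σ)` -/

variable (R S) in
/-- The submodule `L(Σ)` of `K(Σ)` spanned by the elements `u_σ ⊗ v_τ` with disjoint `σ ∈ Σ` and
`τ ⊆ [m]`, where `u_σ = u_α` for the indicator function `α` of `σ`. -/
noncomputable def subL : Submodule R (KoszulCoalgebra R S) :=
  Submodule.span R {x | ∃ σ τ : Finset (Fin m), σ ∈ S.faces ∧ Disjoint σ τ ∧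
    x = u R S (Finsupp.indicator σ fun _ _ => 1) ⊗ₜ[R] v R τ}

theorem eq_indicator {α : Fin m →₀ ℕ} (h : ∀ i, α i ≤ 1) :
    α = Finsupp.indicator α.support fun _ _ => 1 := by
  ext i
  have := h i
  by_cases hi : α i = 0
  · simp [Finsupp.indicator_apply, hi]
  · have : α i = 1 := by omega
    simp [Finsupp.indicator_apply, this]

theorem support_indicator (σ : Finset (Fin m)) :
    (Finsupp.indicator σ fun _ _ => (1 : ℕ)).support = σ := by
  ext i
  simp [Finsupp.indicator_apply]

theorem indicator_le_one (σ : Finset (Fin m)) (i : Fin m) :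
    (Finsupp.indicator σ fun _ _ => (1 : ℕ)) i ≤ 1 := by
  rw [Finsupp.indicator_apply]
  split_ifs <;> simp

theorem mem_subL {α : Fin m →₀ ℕ} {τ : Finset (Fin m)} (h : α.support ∈ S.faces)
    (h1 : ∀ i, α i ≤ 1) (hd : Disjoint α.support τ) : u R S α ⊗ₜ[R] v R τ ∈ subL R S :=
  Submodule.subset_span ⟨α.support, τ, h, hd, by rw [← eq_indicator h1]⟩

theorem subL_le {N : Submodule R (KoszulCoalgebra R S)}
    (h : ∀ (α : Fin m →₀ ℕ) (τ : Finset (Fin m)), α.support ∈ S.faces → (∀ i, α i ≤ 1) →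
      Disjoint α.support τ → u R S α ⊗ₜ[R] v R τ ∈ N) : subL R S ≤ N := by
  rw [subL, Submodule.span_le]
  rintro _ ⟨σ, τ, hσ, hd, rfl⟩
  exact h _ τ (by rwa [support_indicator]) (indicator_le_one σ) (by rwa [support_indicator])

open Classical in
variable (R S) in
/-- The projection of `K(Σ)` onto `L(Σ)` that sends all other basis elements to `0`. -/
noncomputable def projL : KoszulCoalgebra R S →ₗ[R] subL R S :=
  lift fun α τ => if h : α.support ∈ S.faces ∧ (∀ i, α i ≤ 1) ∧ Disjoint α.support τ then
    ⟨u R S α ⊗ₜ[R] v R τ, mem_subL h.1 h.2.1 h.2.2⟩ else 0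

theorem projL_coe (x : subL R S) : projL R S x = x := by
  have hle : subL R S ≤ LinearMap.eqLocus ((subL R S).subtype ∘ₗ projL R S) LinearMap.id := by
    refine subL_le fun α τ hα h1 hd => ?_
    rw [LinearMap.mem_eqLocus, LinearMap.comp_apply, projL, lift_tmul _ hα, dif_pos ⟨hα, h1, hd⟩]
    rfl
  exact Subtype.ext (hle x.2)

theorem isSubDGC : DGCoalgebra.IsSubDGC (dgc R S) (subL R S) (projL R S) where
  proj_coe := projL_coe
  proj_deg n x hx := by
    refine deg_le (N := (deg R S n).comap ((subL R S).subtype ∘ₗ projL R S))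
      (fun α τ hα hn => ?_) hx
    rw [Submodule.mem_comap, LinearMap.comp_apply, projL, lift_tmul _ hα]
    split_ifs
    · exact mem_deg hα hn
    · simp
  d_mem x hx := by
    refine subL_le (N := (subL R S).comap (differential R S)) (fun α τ hα h1 hd => ?_) hx
    rw [Submodule.mem_comap]
    refine differential_mem_of (R := R) (S := S) hα τ fun i hi hiτ => ?_
    refine mem_subL (R := R) (StanleyReisnerCoalgebra.allowed_mono hα tsub_le_self) (fun j => ?_) ?_
    · exact le_trans (tsub_le_self (a := α) j) (h1 j)
    · rw [Finset.disjoint_insert_right]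
      refine ⟨?_, Finset.disjoint_of_subset_left (Finsupp.support_mono tsub_le_self) hd⟩
      have := h1 i
      simp
      omega
  comul_mem x hx := by
    refine subL_le (N := (LinearMap.range (TensorProduct.map (subL R S).subtype
      (subL R S).subtype)).comap (Coalgebra.comul (R := R) (A := KoszulCoalgebra R S)))
      (fun α τ hα h1 hd => ?_) hx
    rw [Submodule.mem_comap, comul_tmul hα]
    refine Submodule.sum_mem _ fun p hp => Submodule.sum_mem _ fun A hA =>
      Submodule.smul_mem _ _ ?_
    have hA' := Finset.mem_powerset.1 hA
    have hp1 : p.1 ≤ α := by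
      rw [← Finset.HasAntidiagonal.mem_antidiagonal.1 hp]; exact le_self_add
    have hp2 : p.2 ≤ α := by
      rw [← Finset.HasAntidiagonal.mem_antidiagonal.1 hp]; exact le_add_self
    exact ⟨⟨_, mem_subL (R := R) (StanleyReisnerCoalgebra.allowed_mono hα hp1)
        (fun i => (hp1 i).trans (h1 i))
        (Finset.disjoint_of_subset_left (Finsupp.support_mono hp1)
          (Finset.disjoint_of_subset_right hA' hd))⟩ ⊗ₜ[R]
      ⟨_, mem_subL (R := R) (StanleyReisnerCoalgebra.allowed_mono hα hp2)
        (fun i => (hp2 i).trans (h1 i))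
        (Finset.disjoint_of_subset_left (Finsupp.support_mono hp2)
          (Finset.disjoint_of_subset_right Finset.sdiff_subset hd))⟩, rfl⟩

theorem dgcMap_subL (h : S ≤ S') (x : KoszulCoalgebra R S) (hx : x ∈ subL R S) :
    (dgcMap R h).toCoalgHom x ∈ subL R S' := by
  refine subL_le (N := (subL R S').comap (dgcMap R h).toCoalgHom.toLinearMap)
    (fun α τ hα h1 hd => ?_) hx
  have := dgcMap_tmul (R := R) h hα τ
  change (dgcMap R h).toCoalgHom (u R S α ⊗ₜ[R] v R τ) ∈ subL R S'
  rw [this]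
  exact mem_subL (h hα) h1 hd

variable (R m) in
/-- `Σ ↦ L(Σ)` as a functor on the poset of simplicial complexes on `[m]`. -/
noncomputable def functorL : SimplicialComplexOn m ⥤ DGCoalgebra R where
  obj S := (isSubDGC (R := R) (S := S)).dgc
  map f := isSubDGC.restrict isSubDGC (dgcMap R (leOfHom f)) (dgcMap_subL (leOfHom f))
  map_id S := by
    refine DGCoalgebra.Hom.ext (CoalgHom.coe_linearMap_injective (LinearMap.ext fun x => ?_))
    exact Subtype.ext (congrArg (fun f : dgc R S ⟶ dgc R S => f.toCoalgHom x.1)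
      ((functor R m).map_id S))
  map_comp {S1 S2 S3} f g := by
    refine DGCoalgebra.Hom.ext (CoalgHom.coe_linearMap_injective (LinearMap.ext fun x => ?_))
    exact Subtype.ext (congrArg (fun f : dgc R S1 ⟶ dgc R S3 => f.toCoalgHom x.1)
      ((functor R m).map_comp f g))

variable (R m) in
/-- The inclusion `L(Σ) → K(Σ)`. -/
noncomputable def inclusion : functorL R m ⟶ functor R m where
  app S := (isSubDGC (R := R) (S := S)).incl
  naturality S S' f := by
    refine DGCoalgebra.Hom.ext (CoalgHom.coe_linearMap_injective (LinearMap.ext fun x => ?_))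
    rfl

end
end KoszulCoalgebra

/-! ## Moment-angle complexes -/

/-- The moment-angle complex
`Z(Σ) = ⋃_{σ ∈ Σ} {z ∈ (D²)^m | z_i ∈ S¹ for i ∉ σ}`, where `S¹ ⊆ D² ⊆ ℂ`. -/
noncomputable def momentAngleComplex {m : ℕ} (S : SimplicialComplexOn m) : Set (Fin m → ℂ) :=
  ⋃ σ ∈ S.faces, {z | (∀ i, z i ∈ Metric.closedBall (0 : ℂ) 1) ∧
    ∀ i, i ∉ σ → z i ∈ Metric.sphere (0 : ℂ) 1}

theorem momentAngleComplex_mono {m : ℕ} {S S' : SimplicialComplexOn m} (h : S ≤ S') :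
    momentAngleComplex S ⊆ momentAngleComplex S' :=
  Set.biUnion_subset_biUnion_left h

/-- `Σ ↦ Z(Σ)` as a functor on the poset of simplicial complexes on `[m]`; the maps are the
inclusions. -/
noncomputable def momentAngleFunctor (m : ℕ) : SimplicialComplexOn m ⥤ TopCat.{0} where
  obj S := TopCat.of (momentAngleComplex S)
  map f := TopCat.ofHom ⟨Set.inclusion (momentAngleComplex_mono (leOfHom f)),
    continuous_inclusion _⟩

/-- The dgc `C(Z(Σ))` of normalized singular chains on `Z(Σ)`, as a functor of `Σ`. -/
noncomputable def momentAngleChains (R : Type) [CommRing R] (m : ℕ) :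
    SimplicialComplexOn m ⥤ DGCoalgebra R :=
  momentAngleFunctor m ⋙ TopCat.toSSet ⋙ NormalizedChains.functor R

end MomentAngleComplexes

/-!
# Moment-angle complexes and Koszul coalgebras

**The map.** Everything takes place in the Koszul coalgebra of the full complex on `[m]`, which
contains all `L(Σ)`, and in the singular chains on `ℂ^m`, which contain the chains on all `Z(Σ)`.
Multiplying a chain by the loop `s ↦ exp (2πis)` in the `i`-th coordinate is a prism operator
`circleOp i`; contracting the loop to the point `1` inside the disc gives an operator `diskOp i` of
degree `2` with `d (diskOp i c) = circleOp i c + diskOp i (d c)`. The comparison map `toChains`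
sends `u_σ ⊗ v_τ` to the chain obtained from the `0`-simplex `(1, …, 1)` by applying `diskOp i` for
`i ∈ σ` and `circleOp i` for `i ∈ τ`, in decreasing order of `i`. Let `E` be the map induced by
`z_i ↦ 1`. The Alexander-Whitney diagonal satisfies
`Δ (circleOp i c) = (circleOp i ⊗ E + (E ∘ sign) ⊗ circleOp i) (Δ c)`, and similarly without sign
for `diskOp i`, where the mixed terms vanish since they consist of degenerate simplices. As `E` is
the identity on the chains to which the operators for the index `i` are applied, these formulas
match the diagonals of `v_i ∧ x` and `u_i x` in `L`, so that `toChains` respects the diagonals.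

**Why it is a quasi-isomorphism.** Let `Z_k(Γ)` be the part of `Z(Γ)` whose first `k` coordinates
equal `1`, and let `L_k(Γ)` be spanned by the `u_σ ⊗ v_τ` without the first `k` variables. By
descending induction on `k`, the map `L_k(Γ) → C(Z_k(Γ))` is a quasi-isomorphism for all `Γ`
(`isQI_toChains`). For `k = m` both sides are free on one generator in degree `0`, or zero. In the
step, `Z_i(Γ)` is covered by the part with `|z_i| ≥ 1/2`, which retracts to `Z_{i+1}(Γ) × S¹`, and
the part `Z_{i+1}(star i Γ) × D²`; the intersection retracts to `Z_{i+1}(star i Γ) × S¹`. On the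
algebraic side, `L_i(Γ)` is the sum of `L_{i+1}(Γ) ⊗ ⟨1, v_i⟩` and
`L_{i+1}(star i Γ) ⊗ ⟨1, v_i, u_i⟩`, with intersection `L_{i+1}(star i Γ) ⊗ ⟨1, v_i⟩`. The
Mayer-Vietoris argument `IsQI.sup` reduces the claim to the pieces, where it follows from the
homotopy invariance of singular chains and from the case of a product with a circle
(`isQI_circleOver`), which follows from the Wang sequence of the covering `ℝ → S¹`
(`IsQI.cyclicCover`): simplices lift to the line, and the deck transformation is homotopic to the
identity.
That chains on two open sets compute the homology of their union (`isQI_small`) is proved by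
iterated subdivision; the version used here cones off from the midpoint of the first and the last
vertex, which, unlike the barycentre, is compatible with degenerate simplices.

**The inclusion.** `L(Σ) → K(Σ)` is a quasi-isomorphism because the basis elements with `α_i ≥ 2`,
or with `α_i = 1` and `i ∈ τ`, cancel in pairs; this is done for one index `i` at a time
(`isQI_subL`).
-/


/-! ### Quasi-isomorphisms in terms of elements -/

section ElementaryQuasiIso

variable {R : Type} [CommRing R] {M N P : Type} [AddCommGroup M] [Module R M] [AddCommGroup N]
  [Module R N] [AddCommGroup P] [Module R P]

/-- The restriction `A → B` of the linear map `f` to two submodules that are stable under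
endomorphisms `dM` and `dN` of square zero is a chain map and induces a bijection
`ker dM / im dM → ker dN / im dN`. No gradings occur: for graded modules and maps this amounts to an
isomorphism in every degree. -/
structure IsQI (dM : M →ₗ[R] M) (dN : N →ₗ[R] N) (f : M →ₗ[R] N) (A : Submodule R M)
    (B : Submodule R N) : Prop where
  map_mem : ∀ a ∈ A, f a ∈ B
  comm : ∀ a ∈ A, f (dM a) = dN (f a)
  d_left : ∀ a ∈ A, dM a ∈ A
  d_right : ∀ b ∈ B, dN b ∈ B
  inj : ∀ a ∈ A, dM a = 0 → ∀ b ∈ B, dN b = f a → ∃ a' ∈ A, dM a' = a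
  surj : ∀ b ∈ B, dN b = 0 → ∃ a ∈ A, dM a = 0 ∧ ∃ b' ∈ B, f a - b = dN b'

namespace IsQI

variable {dM : M →ₗ[R] M} {dN : N →ₗ[R] N} {dP : P →ₗ[R] P} {f : M →ₗ[R] N} {g : N →ₗ[R] P}

theorem comp {A : Submodule R M} {B : Submodule R N} {C : Submodule R P} (hg : IsQI dN dP g B C)
    (hf : IsQI dM dN f A B) : IsQI dM dP (g ∘ₗ f) A C where
  map_mem a ha := hg.map_mem _ (hf.map_mem a ha)
  comm a ha := by
    rw [LinearMap.comp_apply, hf.comm a ha, hg.comm _ (hf.map_mem a ha), LinearMap.comp_apply]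
  d_left := hf.d_left
  d_right := hg.d_right
  inj a ha h c hc hca := by
    obtain ⟨b, hb, hb'⟩ := hg.inj (f a) (hf.map_mem a ha) (by rw [← hf.comm a ha, h, map_zero])
      c hc hca
    exact hf.inj a ha h b hb hb'
  surj c hc h := by
    obtain ⟨b, hb, hb0, c', hc', e⟩ := hg.surj c hc h
    obtain ⟨a, ha, ha0, b', hb', e'⟩ := hf.surj b hb hb0
    refine ⟨a, ha, ha0, g b' + c', add_mem (hg.map_mem _ hb') hc', ?_⟩
    rw [map_add, ← hg.comm b' hb', ← e', ← e, map_sub, LinearMap.comp_apply]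
    abel

theorem trans {A : Submodule R M} {B B' : Submodule R N} (hf : IsQI dM dN f A B)
    (h : IsQI dN dN LinearMap.id B B') : IsQI dM dN f A B' := h.comp hf

/-- If `A' → A` and the composite `A' → A → B` are quasi-isomorphisms, then so is `A → B`. -/
theorem of_comp {A A' : Submodule R M} {B : Submodule R N} (h : IsQI dM dM LinearMap.id A' A)
    (hf : IsQI dM dN f A' B) (hmap : ∀ a ∈ A, f a ∈ B) (hcomm : ∀ a ∈ A, f (dM a) = dN (f a)) :
    IsQI dM dN f A B where
  map_mem := hmap
  comm := hcomm
  d_left := h.d_right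
  d_right := hf.d_right
  inj a ha h0 b hb hba := by
    obtain ⟨a', ha', h0', x, hx, e⟩ := h.surj a ha h0
    obtain ⟨y, hy, ey⟩ := hf.inj a' ha' h0' (b + f x) (add_mem hb (hmap x hx)) (by
      rw [map_add, hba, ← hcomm x hx, ← e, ← map_add]
      congr 1
      rw [LinearMap.id_apply]
      abel)
    refine ⟨y - x, sub_mem (h.map_mem y hy) hx, ?_⟩
    rw [map_sub, ey, ← e, LinearMap.id_apply]
    abel
  surj b hb h0 := by
    obtain ⟨a, ha, h0', b', hb', e⟩ := hf.surj b hb h0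
    exact ⟨a, h.map_mem a ha, h0', b', hb', e⟩

/-- A retraction up to homotopy onto a subcomplex shows that its inclusion is a
quasi-isomorphism. Here `g` is the retraction and `h` the homotopy. -/
theorem of_homotopy {A B : Submodule R N} (hAB : A ≤ B) (g h : N →ₗ[R] N)
    (hdA : ∀ a ∈ A, dN a ∈ A) (hdB : ∀ b ∈ B, dN b ∈ B) (hg : ∀ b ∈ B, g b ∈ A)
    (hgd : ∀ b, g (dN b) = dN (g b)) (hhA : ∀ a ∈ A, h a ∈ A) (hhB : ∀ b ∈ B, h b ∈ B)
    (hh : ∀ b, dN (h b) + h (dN b) = g b - b) : IsQI dN dN LinearMap.id A B where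
  map_mem a ha := hAB ha
  comm _ _ := rfl
  d_left := hdA
  d_right := hdB
  inj a ha h0 b hb hba := by
    refine ⟨g b - h a, sub_mem (hg b hb) (hhA a ha), ?_⟩
    have := hh a
    rw [h0, map_zero, add_zero] at this
    rw [map_sub, ← hgd, hba, this, LinearMap.id_apply]
    abel
  surj b hb h0 := by
    refine ⟨g b, hg b hb, by rw [← hgd, h0, map_zero], h b, hhB b hb, ?_⟩
    have := hh b
    rw [h0, map_zero, add_zero] at this
    rw [this, LinearMap.id_apply]

/-- The Mayer-Vietoris principle: a chain map that is a quasi-isomorphism on two subcomplexes and on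
their intersection is one on their sum. -/
theorem sup {A₁ A₂ A₁₂ : Submodule R M} {B₁ B₂ : Submodule R N} (h₁ : IsQI dM dN f A₁ B₁)
    (h₂ : IsQI dM dN f A₂ B₂) (h₁₂ : IsQI dM dN f A₁₂ (B₁ ⊓ B₂)) (hA : A₁ ⊓ A₂ = A₁₂)
    (hd : ∀ b, dN (dN b) = 0) (hd' : ∀ a, dM (dM a) = 0) :
    IsQI dM dN f (A₁ ⊔ A₂) (B₁ ⊔ B₂) where
  map_mem := by
    have : A₁ ⊔ A₂ ≤ (B₁ ⊔ B₂).comap f :=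
      sup_le (fun a ha => Submodule.mem_sup_left (h₁.map_mem a ha))
        fun a ha => Submodule.mem_sup_right (h₂.map_mem a ha)
    exact this
  comm := by
    have : A₁ ⊔ A₂ ≤ LinearMap.eqLocus (f ∘ₗ dM) (dN ∘ₗ f) := sup_le h₁.comm h₂.comm
    exact this
  d_left := by
    have : A₁ ⊔ A₂ ≤ (A₁ ⊔ A₂).comap dM :=
      sup_le (fun a ha => Submodule.mem_sup_left (h₁.d_left a ha))
        fun a ha => Submodule.mem_sup_right (h₂.d_left a ha)
    exact this
  d_right := by
    have : B₁ ⊔ B₂ ≤ (B₁ ⊔ B₂).comap dN :=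
      sup_le (fun a ha => Submodule.mem_sup_left (h₁.d_right a ha))
        fun a ha => Submodule.mem_sup_right (h₂.d_right a ha)
    exact this
  inj a ha h0 b hb hba := by
    obtain ⟨a₁, ha₁, a₂, ha₂, rfl⟩ := Submodule.mem_sup.1 ha
    obtain ⟨b₁, hb₁, b₂, hb₂, rfl⟩ := Submodule.mem_sup.1 hb
    rw [map_add, map_add] at hba
    rw [map_add] at h0
    have e₂ : dM a₁ = -dM a₂ := eq_neg_of_add_eq_zero_left h0
    have hx : dM a₁ ∈ A₁₂ := by
      rw [← hA]
      refine ⟨h₁.d_left _ ha₁, ?_⟩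
      rw [e₂]
      exact neg_mem (h₂.d_left _ ha₂)
    have ey : f a₁ - dN b₁ = -(f a₂ - dN b₂) := by
      rw [← sub_eq_zero]
      have : f a₁ + f a₂ - (dN b₁ + dN b₂) = 0 := by rw [hba, sub_self]
      rw [← this]; abel
    have hy : f a₁ - dN b₁ ∈ B₁ ⊓ B₂ := by
      refine ⟨sub_mem (h₁.map_mem _ ha₁) (h₁.d_right _ hb₁), ?_⟩
      rw [ey]
      exact neg_mem (sub_mem (h₂.map_mem _ ha₂) (h₂.d_right _ hb₂))
    obtain ⟨x, hx', ex⟩ := h₁₂.inj (dM a₁) hx (hd' _) _ hy (by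
      rw [map_sub, hd, sub_zero, h₁.comm _ ha₁])
    have hx1 : x ∈ A₁ ∧ x ∈ A₂ := by rwa [← hA] at hx'
    obtain ⟨α, hα, hα0, β, hβ, eβ⟩ := h₁₂.surj (f a₁ - dN b₁ - f x)
      (sub_mem hy (h₁₂.map_mem _ hx')) (by
        rw [map_sub, map_sub, hd, ← h₁.comm _ ha₁, ← h₁.comm _ hx1.1, ex, sub_zero, sub_self])
    have hα1 : α ∈ A₁ ∧ α ∈ A₂ := by rwa [← hA] at hα
    obtain ⟨c₁, hc₁, ec₁⟩ := h₁.inj (a₁ - x - α) (sub_mem (sub_mem ha₁ hx1.1) hα1.1)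
      (by rw [map_sub, map_sub, ex, hα0]; simp) (b₁ - β) (sub_mem hb₁ hβ.1) (by
        rw [map_sub, map_sub, map_sub, ← eβ]; abel)
    obtain ⟨c₂, hc₂, ec₂⟩ := h₂.inj (a₂ + x + α) (add_mem (add_mem ha₂ hx1.2) hα1.2)
      (by rw [map_add, map_add, ex, hα0, e₂]; simp) (b₂ + β) (add_mem hb₂ hβ.2) (by
        rw [map_add, map_add, map_add, ← eβ, ey]; abel)
    refine ⟨c₁ + c₂, Submodule.add_mem_sup hc₁ hc₂, ?_⟩
    rw [map_add, ec₁, ec₂]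
    abel
  surj b hb h0 := by
    obtain ⟨b₁, hb₁, b₂, hb₂, rfl⟩ := Submodule.mem_sup.1 hb
    rw [map_add] at h0
    have e₂ : dN b₁ = -dN b₂ := eq_neg_of_add_eq_zero_left h0
    have hx : dN b₁ ∈ B₁ ⊓ B₂ := by
      refine ⟨h₁.d_right _ hb₁, ?_⟩
      rw [e₂]
      exact neg_mem (h₂.d_right _ hb₂)
    obtain ⟨a, ha, ha0, y, hy, ey⟩ := h₁₂.surj _ hx (hd _)
    have ha1 : a ∈ A₁ ∧ a ∈ A₂ := by rwa [← hA] at ha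
    obtain ⟨a₁, ha₁, ea₁⟩ := h₁.inj a ha1.1 ha0 (b₁ + y) (add_mem hb₁ hy.1) (by
      rw [map_add, ← ey]; abel)
    obtain ⟨a₂, ha₂, ea₂⟩ := h₂.inj a ha1.2 ha0 (y - b₂) (sub_mem hy.2 hb₂) (by
      rw [map_sub, ← ey, e₂]; abel)
    obtain ⟨c₁, hc₁, hc₁0, z₁, hz₁, ez₁⟩ := h₁.surj (b₁ + y - f a₁)
      (sub_mem (add_mem hb₁ hy.1) (h₁.map_mem _ ha₁)) (by
        rw [map_sub, map_add, ← ey, ← h₁.comm _ ha₁, ea₁]; abel)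
    obtain ⟨c₂, hc₂, hc₂0, z₂, hz₂, ez₂⟩ := h₂.surj (b₂ - y + f a₂)
      (add_mem (sub_mem hb₂ hy.2) (h₂.map_mem _ ha₂)) (by
        rw [map_add, map_sub, ← ey, ← h₂.comm _ ha₂, ea₂, e₂]; abel)
    refine ⟨a₁ - a₂ + (c₁ + c₂), add_mem (sub_mem (Submodule.mem_sup_left ha₁)
      (Submodule.mem_sup_right ha₂)) (Submodule.add_mem_sup hc₁ hc₂), ?_, z₁ + z₂,
      Submodule.add_mem_sup hz₁ hz₂, ?_⟩
    · rw [map_add, map_sub, map_add, ea₁, ea₂, hc₁0, hc₂0]; simp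
    · rw [map_add dN, ← ez₁, ← ez₂, map_add, map_sub, map_add]; abel

end IsQI
end ElementaryQuasiIso

namespace DGCoalgebra

variable {R : Type} [CommRing R] {C D : DGCoalgebra R}

/-- The homogeneous component of degree `n`. -/
noncomputable def component (C : DGCoalgebra R) (n : ℕ) : C.carrier →ₗ[R] C.carrier :=
  (C.deg n).subtype ∘ₗ DirectSum.component R ℕ (fun n => C.deg n) n ∘ₗ
    (LinearEquiv.ofBijective (DirectSum.coeLinearMap C.deg) C.isInternal).symm.toLinearMap

theorem component_mem (n : ℕ) (x : C.carrier) : C.component n x ∈ C.deg n :=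
  Submodule.coe_mem _

theorem component_of_mem {k : ℕ} {x : C.carrier} (hx : x ∈ C.deg k) (n : ℕ) :
    C.component n x = if k = n then x else 0 := by
  have : (LinearEquiv.ofBijective (DirectSum.coeLinearMap C.deg) C.isInternal).symm x
      = DirectSum.lof R ℕ (fun i => C.deg i) k ⟨x, hx⟩ := by
    rw [LinearEquiv.symm_apply_eq]
    exact (DirectSum.coeLinearMap_lof C.deg k ⟨x, hx⟩).symm
  rw [component, LinearMap.comp_apply, LinearMap.comp_apply, LinearEquiv.coe_coe, this]
  split_ifs with h
  · subst h
    rw [DirectSum.component.lof_self]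
    rfl
  · rw [DirectSum.component.of, dif_neg h, map_zero]

theorem hom_ext_deg {M : Type} [AddCommGroup M] [Module R M] {f g : C.carrier →ₗ[R] M}
    (h : ∀ n, ∀ x ∈ C.deg n, f x = g x) : f = g := by
  refine LinearMap.ext fun x => ?_
  have hle : (⨆ n, C.deg n) ≤ LinearMap.eqLocus f g := iSup_le h
  refine hle ?_
  rw [C.isInternal.submodule_iSup_eq_top]
  trivial

theorem component_d (n : ℕ) (x : C.carrier) : C.component n (C.d x) = C.d (C.component (n + 1) x) := by
  have : C.component n ∘ₗ C.d = C.d ∘ₗ C.component (n + 1) := by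
    refine hom_ext_deg fun k y hy => ?_
    rw [LinearMap.comp_apply, LinearMap.comp_apply, component_of_mem hy]
    cases k with
    | zero => simp [C.d_deg_zero y hy]
    | succ k =>
      rw [component_of_mem (C.d_mem k y hy)]
      simp only [Nat.add_right_cancel_iff]
      split_ifs <;> simp
  exact LinearMap.congr_fun this x

theorem component_map (f : C ⟶ D) (n : ℕ) (x : C.carrier) :
    D.component n (f.toCoalgHom.toLinearMap x) = f.toCoalgHom.toLinearMap (C.component n x) := by
  have : D.component n ∘ₗ f.toCoalgHom.toLinearMap = f.toCoalgHom.toLinearMap ∘ₗ C.component n := by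
    refine hom_ext_deg fun k y hy => ?_
    rw [LinearMap.comp_apply, LinearMap.comp_apply, component_of_mem hy]
    refine (component_of_mem (f.map_deg k y hy) n).trans ?_
    split_ifs
    · rfl
    · simp
  exact LinearMap.congr_fun this x

/-- Quasi-isomorphisms of dgcs can be detected without reference to the grading. -/
theorem isQuasiIso_of_isQI (f : C ⟶ D) (h : IsQI C.d D.d f.toCoalgHom.toLinearMap ⊤ ⊤) :
    IsQuasiIso f := by
  have hinj : ∀ n, ∀ x ∈ C.deg n, C.d x = 0 → ∀ y, D.d y = f.toCoalgHom.toLinearMap x →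
      ∃ x' ∈ C.deg (n + 1), C.d x' = x := fun n x hx h0 y hy => by
    obtain ⟨x', -, e⟩ := h.inj x trivial h0 y trivial hy
    exact ⟨_, component_mem (n + 1) x', by
      rw [← component_d, e, component_of_mem hx, if_pos rfl]⟩
  have hsurj : ∀ n, ∀ y ∈ D.deg n, D.d y = 0 → ∃ x ∈ C.deg n, C.d x = 0 ∧ ∃ y' ∈ D.deg (n + 1),
      y = f.toCoalgHom.toLinearMap x + D.d y' := fun n y hy h0 => by
    obtain ⟨x, -, hx0, y', -, e⟩ := h.surj y trivial h0
    refine ⟨_, component_mem n x, ?_, -(D.component (n + 1) y'), neg_mem (component_mem _ _), ?_⟩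
    · cases n with
      | zero => exact C.d_deg_zero _ (component_mem 0 x)
      | succ n => rw [← component_d, hx0, map_zero]
    · rw [map_neg, ← component_d, ← e, map_sub, component_map, component_of_mem hy, if_pos rfl]
      abel
  have hd : ∀ (B : DGCoalgebra R) (n : ℕ), B.toChainComplex.d (n + 1) n =
      ModuleCat.ofHom (B.d.restrict (B.d_mem n)) := fun B n => by
    simp only [toChainComplex, ChainComplex.of_d]
  have hf : ∀ n, (mapChainComplex f).f n =
      ModuleCat.ofHom (f.toCoalgHom.toLinearMap.restrict (f.map_deg n)) := fun n => rfl
  -- the next differential of a cycle vanishes also on underlying elements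
  have hz : ∀ (B : DGCoalgebra R) (n : ℕ) {A : ModuleCat R} (z : A ⟶ B.toChainComplex.X n),
      z ≫ B.toChainComplex.d n ((ComplexShape.down ℕ).next n) = 0 ↔
        ∀ a, B.d (z.hom a).1 = 0 := fun B n A z => by
    cases n with
    | zero =>
      rw [ChainComplex.next_nat_zero]
      have e : B.toChainComplex.d 0 0 = 0 := B.toChainComplex.shape _ _ (by simp)
      rw [e]
      simp only [Limits.comp_zero, true_iff]
      exact fun a => B.d_deg_zero _ (z.hom a).2
    | succ n =>
      rw [ChainComplex.next_nat_succ, hd]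
      constructor
      · intro e a
        exact congrArg Subtype.val (congrArg (fun w => w.hom a) e)
      · intro e
        ext a : 2
        exact Subtype.ext (e a)
  refine ⟨fun n => ?_⟩
  rw [quasiIsoAt_iff_isIso_homologyMap]
  have h1 : Mono (HomologicalComplex.homologyMap (mapChainComplex f) n) := by
    rw [HomologicalComplex.mono_homologyMap_iff_up_to_refinements _ (n + 1) n
      ((ComplexShape.down ℕ).next n) (by simp) rfl]
    intro A x hx y hy
    rw [hz] at hx
    rw [hd, hf] at hy
    let Q : Submodule R (A × C.deg (n + 1)) :=
      LinearMap.eqLocus (x.hom ∘ₗ LinearMap.fst R A _)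
        ((C.d.restrict (C.d_mem n)) ∘ₗ LinearMap.snd R A _)
    refine ⟨ModuleCat.of R Q, ModuleCat.ofHom (LinearMap.fst R A _ ∘ₗ Q.subtype), ?_,
      ModuleCat.ofHom (LinearMap.snd R A _ ∘ₗ Q.subtype), ?_⟩
    · rw [ModuleCat.epi_iff_surjective]
      intro a
      obtain ⟨x', hx', e⟩ := hinj n _ (x.hom a).2 (hx a) (y.hom a).1
        (congrArg Subtype.val (congrArg (fun w => w.hom a) hy)).symm
      exact ⟨⟨(a, ⟨x', hx'⟩), Subtype.ext e.symm⟩, rfl⟩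
    · rw [hd]
      refine ModuleCat.hom_ext (LinearMap.ext fun q => ?_)
      exact q.2
  have h2 : Epi (HomologicalComplex.homologyMap (mapChainComplex f) n) := by
    rw [HomologicalComplex.epi_homologyMap_iff_up_to_refinements _ (n + 1) n
      ((ComplexShape.down ℕ).next n) (by simp) rfl]
    intro A y hy
    rw [hz] at hy
    let Z : Submodule R (C.deg n) := (LinearMap.ker C.d).comap (C.deg n).subtype
    let Q : Submodule R (A × Z × D.deg (n + 1)) :=
      LinearMap.eqLocus (y.hom ∘ₗ LinearMap.fst R A _)
        ((f.toCoalgHom.toLinearMap.restrict (f.map_deg n)) ∘ₗ Z.subtype ∘ₗ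
            LinearMap.fst R _ _ ∘ₗ LinearMap.snd R A _ +
          (D.d.restrict (D.d_mem n)) ∘ₗ LinearMap.snd R _ _ ∘ₗ LinearMap.snd R A _)
    refine ⟨ModuleCat.of R Q, ModuleCat.ofHom (LinearMap.fst R A _ ∘ₗ Q.subtype), ?_,
      ModuleCat.ofHom (Z.subtype ∘ₗ LinearMap.fst R _ _ ∘ₗ LinearMap.snd R A _ ∘ₗ Q.subtype), ?_,
      ModuleCat.ofHom (LinearMap.snd R _ _ ∘ₗ LinearMap.snd R A _ ∘ₗ Q.subtype), ?_⟩
    · rw [ModuleCat.epi_iff_surjective]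
      intro a
      obtain ⟨x, hx, hx0, y', hy', e⟩ := hsurj n _ (y.hom a).2 (hy a)
      exact ⟨⟨(a, ⟨⟨x, hx⟩, hx0⟩, ⟨y', hy'⟩), Subtype.ext e⟩, rfl⟩
    · exact (hz C n _).2 fun q => q.1.2.1.2
    · rw [hd, hf]
      refine ModuleCat.hom_ext (LinearMap.ext fun q => ?_)
      exact q.2
  exact isIso_of_mono_of_epi _

end DGCoalgebra

/-! ### The prism operator -/

section Prism

open Simplicial Opposite
open scoped TensorProduct

/-- A simplicial homotopy `Δ¹ × Y → X`. An `n`-simplex of `Δ¹` is a monotone map `[n] → [1]`; it is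
recorded by its cut `c`, so that `k ↦ 0` for `k < c` and `k ↦ 1` for `c ≤ k`. The cuts `n + 1` and
`0` describe the two ends of the homotopy. -/
structure SimplicialPrism (Y X : SSet.{0}) where
  app : ∀ n : ℕ, ℕ → Y _⦋n⦌ → X _⦋n⦌
  map_app : ∀ {n k : ℕ} (φ : ⦋k⦌ ⟶ ⦋n⦌) (c c' : ℕ),
    (∀ i : Fin (k + 1), (i : ℕ) < c' ↔ (φ.toOrderHom i : ℕ) < c) → ∀ y : Y _⦋n⦌,
      X.map φ.op (app n c y) = app k c' (Y.map φ.op y)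
  source : Y ⟶ X
  target : Y ⟶ X
  source_app : ∀ n (y : Y _⦋n⦌), source.app _ y = app n (n + 1) y
  target_app : ∀ n (y : Y _⦋n⦌), target.app _ y = app n 0 y

theorem predAbove_val {n : ℕ} (j : Fin n) (i : Fin (n + 1)) :
    (j.predAbove i : ℕ) = if j.1 < i.1 then i.1 - 1 else i.1 := by
  simp only [Fin.predAbove, Fin.lt_def, Fin.val_castSucc]
  split_ifs <;> simp

theorem map_op_congr {Y : SSet.{0}} {n k : ℕ} {f g : ⦋k⦌ ⟶ ⦋n⦌} (y : Y _⦋n⦌)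
    (h : ∀ i : Fin (k + 1), (f.toOrderHom i).1 = (g.toOrderHom i).1) :
    Y.map f.op y = Y.map g.op y := by
  have : f = g := by
    ext i : 3
    exact Fin.ext (h i)
  rw [this]

namespace SimplicialPrism

open NormalizedChains

variable {R : Type} [CommRing R] {Y X : SSet.{0}} (H : SimplicialPrism Y X)

theorem app_degenerate {n : ℕ} (b : Fin (n + 1)) (w : Y _⦋n⦌) {c : ℕ} (hc : c ≠ b + 1) :
    H.app (n + 1) c (Y.map (SimplexCategory.σ b).op w) ∈ X.degenerate (n + 1) := by
  refine ⟨n, Nat.lt_succ_self n, SimplexCategory.σ b, H.app n (if c ≤ b then c else c - 1) w, ?_⟩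
  refine H.map_app _ _ _ (fun i => ?_) w
  change _ ↔ (b.predAbove i : ℕ) < _
  rw [predAbove_val]
  split_ifs <;> omega

theorem sum_degenerate {n : ℕ} {y : Y _⦋n⦌} (hy : y ∈ Y.degenerate n) (j : Fin (n + 1)) :
    H.app (n + 1) (j + 1) (Y.map (SimplexCategory.σ j).op y) ∈ X.degenerate (n + 1) := by
  obtain ⟨k, rfl, a, z, hz⟩ := exists_σ hy
  obtain rfl : y = Y.map (SimplexCategory.σ a).op z := hz
  rw [map_map_op]
  by_cases hja : j.1 ≤ a.1
  · have e : Y.map (SimplexCategory.σ j ≫ SimplexCategory.σ a).op z =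
        Y.map (SimplexCategory.σ a.succ).op
          (Y.map (SimplexCategory.σ (⟨j.1, by omega⟩ : Fin (k + 1))).op z) := by
      rw [map_map_op]
      refine map_op_congr z fun i => ?_
      change (a.predAbove (j.predAbove i) : ℕ) =
        ((⟨j.1, by omega⟩ : Fin (k + 1)).predAbove (a.succ.predAbove i) : ℕ)
      simp only [predAbove_val, Fin.val_succ]
      split_ifs <;> omega
    rw [e]
    refine H.app_degenerate _ _ ?_
    simp only [Fin.val_succ]
    omega
  · have e : Y.map (SimplexCategory.σ j ≫ SimplexCategory.σ a).op z =
        Y.map (SimplexCategory.σ a.castSucc).op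
          (Y.map (SimplexCategory.σ (⟨j.1 - 1, by omega⟩ : Fin (k + 1))).op z) := by
      rw [map_map_op]
      refine map_op_congr z fun i => ?_
      change (a.predAbove (j.predAbove i) : ℕ) =
        ((⟨j.1 - 1, by omega⟩ : Fin (k + 1)).predAbove (a.castSucc.predAbove i) : ℕ)
      simp only [predAbove_val, Fin.val_castSucc]
      split_ifs <;> omega
    rw [e]
    refine H.app_degenerate _ _ ?_
    simp only [Fin.val_castSucc]
    omega

variable (R)

/-- The prism operator, that is, the shuffle product with the fundamental `1`-simplex of `Δ¹`,
followed by the homotopy. -/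
noncomputable def op : NormalizedChains R Y →ₗ[R] NormalizedChains R X :=
  lift (fun n y => ∑ j : Fin (n + 1), ((-1 : R) ^ (j : ℕ)) •
    of R (H.app (n + 1) (j + 1) (Y.map (SimplexCategory.σ j).op y)))
    fun n y hy => Finset.sum_eq_zero fun j _ => by
      rw [of_degenerate R (H.sum_degenerate hy j), smul_zero]

theorem op_of {n : ℕ} (y : Y _⦋n⦌) : H.op R (of R y) = ∑ j : Fin (n + 1), ((-1 : R) ^ (j : ℕ)) •
    of R (H.app (n + 1) (j + 1) (Y.map (SimplexCategory.σ j).op y)) :=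
  lift_of _ _ y

theorem op_mem (n : ℕ) (c : NormalizedChains R Y) (hc : c ∈ deg R Y n) :
    H.op R c ∈ deg R X (n + 1) := by
  refine deg_le (N := (deg R X (n + 1)).comap (H.op R)) (fun x => ?_) hc
  rw [Submodule.mem_comap, op_of]
  exact Submodule.sum_mem _ fun i _ => Submodule.smul_mem _ _ (of_mem R _)

/-- The prism operator of a homotopy that is constant in the direction of `Δ¹` vanishes on
normalized chains. -/
theorem op_eq_zero (h : ∀ n c c' (y : Y _⦋n⦌), H.app n c y = H.app n c' y) : H.op R = 0 := by
  refine hom_ext fun n y => ?_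
  rw [op_of]
  refine Finset.sum_eq_zero fun j _ => ?_
  rw [h (n + 1) (j + 1) (j + 2), of_degenerate R (H.app_degenerate j y (by omega)), smul_zero]

theorem counit_op (c : NormalizedChains R Y) : Coalgebra.counit (R := R) (H.op R c) = 0 := by
  have : Coalgebra.counit (R := R) ∘ₗ H.op R = 0 := by
    refine hom_ext fun n y => ?_
    rw [LinearMap.comp_apply, op_of, map_sum]
    refine Finset.sum_eq_zero fun j _ => ?_
    rw [map_smul]
    erw [counit_of]
    simp
  exact LinearMap.congr_fun this c

/-- The prism operator is a chain homotopy between the two ends. -/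
theorem differential_op (c : NormalizedChains R Y) :
    differential R X (H.op R c) + H.op R (differential R Y c) =
      map R H.target c - map R H.source c := by
  have : differential R X ∘ₗ H.op R + H.op R ∘ₗ differential R Y =
      map R H.target - map R H.source := by
    refine hom_ext fun n y => ?_
    simp only [LinearMap.add_apply, LinearMap.comp_apply, LinearMap.sub_apply, map_of,
      H.source_app, H.target_app, op_of, differential_of, map_sum, map_smul]
    have hy : Y.map (𝟙 ⦋n⦌ : ⦋n⦌ ⟶ ⦋n⦌).op y = y := by simp
    let b : ℕ → ℕ → NormalizedChains R X := fun i j =>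
      if h : i < n + 2 ∧ j < n + 1 then
        of R (X.map (SimplexCategory.δ (⟨i, h.1⟩ : Fin (n + 2))).op
          (H.app (n + 1) (j + 1) (Y.map (SimplexCategory.σ (⟨j, h.2⟩ : Fin (n + 1))).op y))) else 0
    have hb : ∑ x : Fin (n + 1), ((-1 : R) ^ (x : ℕ)) • boundary R (n + 1)
        (H.app (n + 1) (↑x + 1) (Y.map (SimplexCategory.σ x).op y)) =
        ∑ j ∈ Finset.range (n + 1), ∑ i ∈ Finset.range (n + 2), ((-1 : R) ^ (j + i)) • b i j := by
      rw [Finset.sum_range]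
      refine Finset.sum_congr rfl fun j _ => ?_
      rw [boundary, Finset.sum_range, Finset.smul_sum]
      refine Finset.sum_congr rfl fun i _ => ?_
      simp only [b]
      rw [dif_pos ⟨i.2, j.2⟩, smul_smul, ← pow_add]
      rfl
    have b1 : ∀ j, j < n + 1 → b j j = of R (H.app n j y) := fun j hj => by
      simp only [b]
      rw [dif_pos ⟨by omega, hj⟩, H.map_app _ _ j, map_map_op]
      · refine congrArg (fun w => of R (H.app n j w)) (Eq.trans ?_ hy)
        refine map_op_congr y fun i => ?_
        change (Fin.predAbove (⟨j, _⟩ : Fin (n + 1)) (Fin.succAbove (⟨j, _⟩ : Fin (n + 2)) i) : ℕ) = i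
        simp only [predAbove_val, succAbove_val]
        split_ifs <;> omega
      · intro i
        change _ ↔ (Fin.succAbove (⟨j, _⟩ : Fin (n + 2)) i : ℕ) < _
        simp only [succAbove_val]
        split_ifs <;> omega
    have b2 : ∀ j, j < n + 1 → b (j + 1) j = of R (H.app n (j + 1) y) := fun j hj => by
      simp only [b]
      rw [dif_pos ⟨by omega, hj⟩, H.map_app _ _ (j + 1), map_map_op]
      · refine congrArg (fun w => of R (H.app n (j + 1) w)) (Eq.trans ?_ hy)
        refine map_op_congr y fun i => ?_
        change (Fin.predAbove (⟨j, _⟩ : Fin (n + 1))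
          (Fin.succAbove (⟨j + 1, _⟩ : Fin (n + 2)) i) : ℕ) = i
        simp only [predAbove_val, succAbove_val]
        split_ifs <;> omega
      · intro i
        change _ ↔ (Fin.succAbove (⟨j + 1, _⟩ : Fin (n + 2)) i : ℕ) < _
        simp only [succAbove_val]
        split_ifs <;> omega
    rw [hb]
    -- the faces adjacent to the cut telescope, the others cancel against the second summand
    have hsplit : ∀ j ∈ Finset.range (n + 1),
        ∑ i ∈ Finset.range (n + 2), ((-1 : R) ^ (j + i)) • b i j =
        (∑ i ∈ Finset.range j, ((-1 : R) ^ (j + i)) • b i j) +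
          (of R (H.app n j y) - of R (H.app n (j + 1) y)) +
          ∑ k ∈ Finset.range (n - j), ((-1 : R) ^ (j + (j + 2 + k))) • b (j + 2 + k) j := by
      intro j hj
      rw [Finset.mem_range] at hj
      have e : n + 2 = j + 2 + (n - j) := by omega
      rw [e, Finset.sum_range_add, Finset.sum_range_succ, Finset.sum_range_succ, b1 j hj, b2 j hj]
      congr 1
      have e1 : ((-1 : R) ^ (j + j)) = 1 := by rw [← two_mul, pow_mul]; simp
      have e2 : ((-1 : R) ^ (j + (j + 1))) = -1 := by rw [← add_assoc, pow_succ, e1]; simp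
      rw [e1, e2, neg_smul, one_smul, one_smul]
      abel
    rw [Finset.sum_congr rfl hsplit, Finset.sum_add_distrib, Finset.sum_add_distrib,
      Finset.sum_range_sub']
    cases n with
    | zero => simp [boundary]
    | succ N =>
      let a : ℕ → ℕ → NormalizedChains R X := fun i j =>
        if h : i < N + 2 ∧ j < N + 1 then
          of R (H.app (N + 1) (j + 1) (Y.map (SimplexCategory.σ (⟨j, h.2⟩ : Fin (N + 1)) ≫
            SimplexCategory.δ (⟨i, h.1⟩ : Fin (N + 2))).op y)) else 0
      have ha : H.op R (boundary R (N + 1) y) = ∑ j ∈ Finset.range (N + 1),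
          ∑ i ∈ Finset.range (N + 2), ((-1 : R) ^ (i + j)) • a i j := by
        rw [Finset.sum_comm, boundary, map_sum, Finset.sum_range]
        refine Finset.sum_congr rfl fun i _ => ?_
        rw [map_smul, op_of, Finset.sum_range, Finset.smul_sum]
        refine Finset.sum_congr rfl fun j _ => ?_
        simp only [a]
        rw [dif_pos ⟨i.2, j.2⟩, smul_smul, ← pow_add, ← map_map_op]
        rfl
      have a1 : ∀ i j, i ≤ j → j < N + 1 → b i (j + 1) = a i j := fun i j hij hj => by
        simp only [a, b]
        rw [dif_pos ⟨by omega, by omega⟩, dif_pos ⟨by omega, by omega⟩, H.map_app _ _ (j + 1),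
          map_map_op]
        · refine congrArg (fun w => of R (H.app _ _ w)) (map_op_congr y fun k => ?_)
          change (Fin.predAbove (⟨j + 1, _⟩ : Fin (N + 2))
            (Fin.succAbove (⟨i, _⟩ : Fin (N + 3)) k) : ℕ) =
            (Fin.succAbove (⟨i, _⟩ : Fin (N + 2)) (Fin.predAbove (⟨j, _⟩ : Fin (N + 1)) k) : ℕ)
          simp only [predAbove_val, succAbove_val]
          split_ifs <;> omega
        · intro k
          change _ ↔ (Fin.succAbove (⟨i, _⟩ : Fin (N + 3)) k : ℕ) < _
          simp only [succAbove_val]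
          split_ifs <;> omega
      have a2 : ∀ k j, k < N + 1 - j → j < N + 1 → b (j + 2 + k) j = a (j + 1 + k) j :=
        fun k j hk hj => by
        simp only [a, b]
        rw [dif_pos ⟨by omega, by omega⟩, dif_pos ⟨by omega, by omega⟩, H.map_app _ _ (j + 1),
          map_map_op]
        · refine congrArg (fun w => of R (H.app _ _ w)) (map_op_congr y fun l => ?_)
          change (Fin.predAbove (⟨j, _⟩ : Fin (N + 2))
            (Fin.succAbove (⟨j + 2 + k, _⟩ : Fin (N + 3)) l) : ℕ) =
            (Fin.succAbove (⟨j + 1 + k, _⟩ : Fin (N + 2)) (Fin.predAbove (⟨j, _⟩ : Fin (N + 1)) l) : ℕ)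
          simp only [predAbove_val, succAbove_val]
          split_ifs <;> omega
        · intro l
          change _ ↔ (Fin.succAbove (⟨j + 2 + k, _⟩ : Fin (N + 3)) l : ℕ) < _
          simp only [succAbove_val]
          split_ifs <;> omega
      have hsplit' : ∀ j ∈ Finset.range (N + 1),
          ∑ i ∈ Finset.range (N + 2), ((-1 : R) ^ (i + j)) • a i j =
          (∑ i ∈ Finset.range (j + 1), ((-1 : R) ^ (i + j)) • a i j) +
          ∑ k ∈ Finset.range (N + 1 - j), ((-1 : R) ^ (j + 1 + k + j)) • a (j + 1 + k) j := by
        intro j hj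
        rw [Finset.mem_range] at hj
        have e : N + 2 = j + 1 + (N + 1 - j) := by omega
        rw [e, Finset.sum_range_add]
      change _ + H.op R (boundary R (N + 1) y) = _
      rw [ha, Finset.sum_congr rfl hsplit', Finset.sum_add_distrib]
      have c1 : ∑ j ∈ Finset.range (N + 1 + 1), ∑ i ∈ Finset.range j, ((-1 : R) ^ (j + i)) • b i j =
          - ∑ j ∈ Finset.range (N + 1), ∑ i ∈ Finset.range (j + 1), ((-1 : R) ^ (i + j)) • a i j := by
        rw [Finset.sum_range_succ', Finset.sum_range_zero, add_zero, ← Finset.sum_neg_distrib]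
        refine Finset.sum_congr rfl fun j hj => ?_
        rw [← Finset.sum_neg_distrib]
        refine Finset.sum_congr rfl fun i hi => ?_
        rw [Finset.mem_range] at hi hj
        rw [a1 i j (by omega) hj, ← neg_smul]
        congr 1
        rw [show j + 1 + i = i + j + 1 by omega, pow_succ]
        ring
      have c2 : ∑ j ∈ Finset.range (N + 1 + 1), ∑ k ∈ Finset.range (N + 1 - j),
            ((-1 : R) ^ (j + (j + 2 + k))) • b (j + 2 + k) j =
          - ∑ j ∈ Finset.range (N + 1), ∑ k ∈ Finset.range (N + 1 - j),
            ((-1 : R) ^ (j + 1 + k + j)) • a (j + 1 + k) j := by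
        rw [Finset.sum_range_succ, Nat.sub_self, Finset.sum_range_zero, add_zero,
          ← Finset.sum_neg_distrib]
        refine Finset.sum_congr rfl fun j hj => ?_
        rw [← Finset.sum_neg_distrib]
        refine Finset.sum_congr rfl fun k hk => ?_
        rw [Finset.mem_range] at hk hj
        rw [a2 k j hk hj, ← neg_smul]
        congr 1
        rw [show j + (j + 2 + k) = j + 1 + k + j + 1 by omega, pow_succ]
        ring
      rw [c1, c2]
      abel
  simpa using LinearMap.congr_fun this c

/-- The diagonal of a prism: as the `1`-simplex of `Δ¹` has the diagonal `0 ⊗ c + c ⊗ 1`, so has its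
product with any chain. -/
theorem comul_op (c : NormalizedChains R Y) :
    Coalgebra.comul (R := R) (H.op R c) =
      TensorProduct.map (H.op R) (map R H.target) (Coalgebra.comul (R := R) c) +
        TensorProduct.map (map R H.source ∘ₗ degreeSign (deg R Y) (isInternal R Y)) (H.op R)
          (Coalgebra.comul (R := R) c) := by
  have : Coalgebra.comul (R := R) ∘ₗ H.op R =
      TensorProduct.map (H.op R) (map R H.target) ∘ₗ Coalgebra.comul (R := R) +
        TensorProduct.map (map R H.source ∘ₗ degreeSign (deg R Y) (isInternal R Y)) (H.op R) ∘ₗ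
          Coalgebra.comul (R := R) := by
    refine hom_ext fun n y => ?_
    have ey : Coalgebra.comul (R := R) (of R y) = diagonal R n y := comul_of y
    have ex : ∀ {k : ℕ} (x : X _⦋k⦌), Coalgebra.comul (R := R) (of R x) = diagonal R k x :=
      fun x => comul_of x
    simp only [LinearMap.comp_apply, LinearMap.add_apply, op_of, map_sum, map_smul, ey, ex,
      diagonal_eq, TensorProduct.map_tmul, degreeSign_of_mem _ (isInternal R Y) (seg_degree R y _ _)]
    -- the terms of the prism over the face of `y` with vertices `a, …, a + l`
    let p : ℕ → ℕ → ℕ → NormalizedChains R X := fun a l j =>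
      if h : a + l ≤ n ∧ j < l + 1 then
        of R (H.app (l + 1) (j + 1) (Y.map (SimplexCategory.σ (⟨j, h.2⟩ : Fin (l + 1)) ≫
          SimplexCategory.subinterval a l h.1).op y)) else 0
    have hp : ∀ a l, a + l ≤ n → H.op R (seg R y a l) =
        ∑ j ∈ Finset.range (l + 1), ((-1 : R) ^ j) • p a l j := fun a l hl => by
      rw [seg, dif_pos hl, op_of, Finset.sum_range]
      refine Finset.sum_congr rfl fun j _ => ?_
      simp only [p]
      rw [dif_pos ⟨hl, j.2⟩, map_map_op]
    let x : Fin (n + 1) → X _⦋n + 1⦌ := fun j =>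
      H.app (n + 1) (j + 1) (Y.map (SimplexCategory.σ j).op y)
    have s1 : ∀ (j : Fin (n + 1)) k, k ≤ j.1 →
        seg R (x j) 0 k = map R H.source (seg R y 0 k) := fun j k hk => by
      rw [seg, dif_pos (by omega), seg, dif_pos (by omega), map_of, H.source_app, H.map_app _ _ (k + 1),
        map_map_op]
      · refine congrArg (fun w => of R (H.app _ _ w)) (map_op_congr y fun i => ?_)
        have hi : i.1 < k + 1 := i.2
        change (j.predAbove ⟨i.1 + 0, _⟩ : ℕ) = i.1 + 0
        rw [predAbove_val, if_neg (by simp; omega)]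
      · intro i
        change _ ↔ i.1 + 0 < _
        omega
    have s2 : ∀ (j : Fin (n + 1)) k, k ≤ j.1 →
        seg R (x j) k (n - k + 1) = p k (n - k) (j - k) := fun j k hk => by
      simp only [p]
      rw [seg, dif_pos (by omega), dif_pos (by omega), H.map_app _ _ (j - k + 1), map_map_op]
      · refine congrArg (fun w => of R (H.app _ _ w)) (map_op_congr y fun i => ?_)
        change (j.predAbove ⟨i.1 + k, _⟩ : ℕ) = (Fin.predAbove ⟨j.1 - k, _⟩ i : ℕ) + k
        rw [predAbove_val, predAbove_val]
        simp only
        split_ifs <;> omega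
      · intro i
        change _ ↔ i.1 + k < _
        omega
    have s3 : ∀ (j : Fin (n + 1)) k, j.1 ≤ k → k ≤ n →
        seg R (x j) 0 (k + 1) = p 0 k j := fun j k hk hkn => by
      simp only [p]
      rw [seg, dif_pos (by omega), dif_pos (by omega), H.map_app _ _ (j + 1), map_map_op]
      · refine congrArg (fun w => of R (H.app _ _ w)) (map_op_congr y fun i => ?_)
        change (j.predAbove ⟨i.1 + 0, _⟩ : ℕ) = (Fin.predAbove ⟨j.1, _⟩ i : ℕ) + 0
        rw [predAbove_val, predAbove_val]
        simp only [add_zero]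
      · intro i
        change _ ↔ i.1 + 0 < _
        omega
    have s4 : ∀ (j : Fin (n + 1)) k, j.1 ≤ k → k ≤ n →
        seg R (x j) (k + 1) (n - k) = map R H.target (seg R y k (n - k)) := fun j k hk hkn => by
      rw [seg, dif_pos (by omega), seg, dif_pos (by omega), map_of, H.target_app, H.map_app _ _ 0,
        map_map_op]
      · refine congrArg (fun w => of R (H.app _ _ w)) (map_op_congr y fun i => ?_)
        change (j.predAbove ⟨i.1 + (k + 1), _⟩ : ℕ) = i.1 + k
        rw [predAbove_val, if_pos (by simp; omega)]
        simp
      · intro i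
        change _ ↔ i.1 + (k + 1) < _
        omega
    have hx : ∀ j : Fin (n + 1), ∑ k ∈ Finset.range (n + 1 + 1),
        seg R (x j) 0 k ⊗ₜ[R] seg R (x j) k (n + 1 - k) =
        (∑ k ∈ Finset.range (j + 1),
          map R H.source (seg R y 0 k) ⊗ₜ[R] p k (n - k) (j - k)) +
        ∑ t ∈ Finset.range (n + 1 - j),
          p 0 (j + t) j ⊗ₜ[R] map R H.target (seg R y (j + t) (n - (j + t))) := fun j => by
      have e : n + 1 + 1 = j.1 + 1 + (n + 1 - j.1) := by omega
      have e' : Finset.range (n + 1 + 1) = Finset.range (j.1 + 1 + (n + 1 - j.1)) := by rw [← e]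
      rw [e', Finset.sum_range_add]
      congr 1
      · refine Finset.sum_congr rfl fun k hk => ?_
        rw [Finset.mem_range] at hk
        rw [s1 j k (by omega), show n + 1 - k = n - k + 1 by omega, s2 j k (by omega)]
      · refine Finset.sum_congr rfl fun t ht => ?_
        rw [Finset.mem_range] at ht
        rw [show j.1 + 1 + t = (j + t) + 1 by omega, s3 j _ (by omega) (by omega),
          show n + 1 - (j.1 + t + 1) = n - (j + t) by omega, s4 j _ (by omega) (by omega)]
    change ∑ j : Fin (n + 1), ((-1 : R) ^ (j : ℕ)) • (∑ k ∈ Finset.range (n + 1 + 1),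
        seg R (x j) 0 k ⊗ₜ[R] seg R (x j) k (n + 1 - k)) = _
    simp only [hx, smul_add, Finset.sum_add_distrib, Finset.smul_sum]
    rw [add_comm]
    congr 1
    · have : ∀ k ∈ Finset.range (n + 1), H.op R (seg R y 0 k) ⊗ₜ[R] map R H.target (seg R y k (n - k)) =
          ∑ j ∈ Finset.range (k + 1), ((-1 : R) ^ j) • p 0 k j ⊗ₜ[R]
            map R H.target (seg R y k (n - k)) := fun k hk => by
        rw [Finset.mem_range] at hk
        rw [hp 0 k (by omega), TensorProduct.sum_tmul]
        rfl
      rw [Finset.sum_congr rfl this]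
      rw [← Finset.sum_range (fun j => ∑ t ∈ Finset.range (n + 1 - j), ((-1 : R) ^ j) •
        (p 0 (j + t) j ⊗ₜ[R] map R H.target (seg R y (j + t) (n - (j + t))))),
        Finset.sum_sigma', Finset.sum_sigma']
      refine Finset.sum_nbij' (fun q => ⟨q.1 + q.2, q.1⟩) (fun q => ⟨q.2, q.1 - q.2⟩) ?_ ?_ ?_ ?_ ?_
      · rintro ⟨a, b⟩ h
        simp at h ⊢
        omega
      · rintro ⟨a, b⟩ h
        simp at h ⊢
        omega
      · rintro ⟨a, b⟩ h
        simp
      · rintro ⟨a, b⟩ h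
        simp at h ⊢
        omega
      · rintro ⟨a, b⟩ h
        rfl
    · have : ∀ k ∈ Finset.range (n + 1), map R H.source (((-1 : R) ^ k) • seg R y 0 k) ⊗ₜ[R]
            H.op R (seg R y k (n - k)) =
          ∑ j ∈ Finset.range (n - k + 1), ((-1 : R) ^ (k + j)) •
            map R H.source (seg R y 0 k) ⊗ₜ[R] p k (n - k) j := fun k hk => by
        rw [Finset.mem_range] at hk
        rw [hp k (n - k) (by omega), TensorProduct.tmul_sum]
        refine Finset.sum_congr rfl fun j _ => ?_
        rw [map_smul, TensorProduct.smul_tmul_smul, pow_add]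
      simp only [map_smul] at this
      rw [Finset.sum_congr rfl this]
      rw [← Finset.sum_range (fun j => ∑ k ∈ Finset.range (j + 1), ((-1 : R) ^ j) •
        (map R H.source (seg R y 0 k) ⊗ₜ[R] p k (n - k) (j - k))),
        Finset.sum_sigma', Finset.sum_sigma']
      refine Finset.sum_nbij' (fun q => ⟨q.2, q.1 - q.2⟩) (fun q => ⟨q.1 + q.2, q.1⟩) ?_ ?_ ?_ ?_ ?_
      · rintro ⟨a, b⟩ h
        simp at h ⊢
        omega
      · rintro ⟨a, b⟩ h
        simp at h ⊢
        omega
      · rintro ⟨a, b⟩ h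
        simp at h ⊢
        omega
      · rintro ⟨a, b⟩ h
        simp
      · rintro ⟨a, b⟩ h
        simp only [Finset.mem_sigma, Finset.mem_range] at h
        simp only
        rw [show b + (a - b) = a by omega]
  exact LinearMap.congr_fun this c

end SimplicialPrism
end Prism

/-! ### Singular chains with values in a subset -/

section SingularChains

open Simplicial Opposite
open scoped TensorProduct

/-- The singular simplicial set of a space. -/
noncomputable abbrev Sing (T : Type) [TopologicalSpace T] : SSet.{0} :=
  TopCat.toSSet.obj (TopCat.of T)

namespace Sing

variable {T T' T'' : Type} [TopologicalSpace T] [TopologicalSpace T'] [TopologicalSpace T'']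

/-- The continuous map underlying a singular simplex. -/
noncomputable def toMap {n : ℕ} (x : Sing T _⦋n⦌) : C(stdSimplex ℝ (Fin (n + 1)), T) :=
  TopCat.toSSetObjEquiv (TopCat.of T) (op ⦋n⦌) x

/-- The singular simplex given by a continuous map. -/
noncomputable def ofMap {n : ℕ} (σ : C(stdSimplex ℝ (Fin (n + 1)), T)) : Sing T _⦋n⦌ :=
  (TopCat.toSSetObjEquiv (TopCat.of T) (op ⦋n⦌)).symm σ

@[simp]
theorem toMap_ofMap {n : ℕ} (σ : C(stdSimplex ℝ (Fin (n + 1)), T)) : toMap (ofMap σ) = σ := rfl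

@[simp]
theorem ofMap_toMap {n : ℕ} (x : Sing T _⦋n⦌) : ofMap (toMap x) = x := rfl

theorem ext {n : ℕ} {x y : Sing T _⦋n⦌} (h : ∀ p, toMap x p = toMap y p) : x = y := by
  rw [← ofMap_toMap x, ← ofMap_toMap y, ContinuousMap.ext h]

theorem toMap_map {n k : ℕ} (φ : ⦋k⦌ ⟶ ⦋n⦌) (x : Sing T _⦋n⦌) (p : stdSimplex ℝ (Fin (k + 1))) :
    toMap ((Sing T).map φ.op x) p = toMap x (stdSimplex.map φ.toOrderHom p) := rfl

/-- The map of singular simplicial sets induced by a continuous map. -/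
noncomputable def map (g : C(T, T')) : Sing T ⟶ Sing T' := TopCat.toSSet.map (TopCat.ofHom g)

theorem toMap_map_app (g : C(T, T')) {n : ℕ} (x : Sing T _⦋n⦌) (p : stdSimplex ℝ (Fin (n + 1))) :
    toMap ((map g).app _ x) p = g (toMap x p) := rfl

/-- The coordinate of `Δ¹` on the standard simplex that corresponds to a cut. -/
noncomputable def cutCoord (c : ℕ) {n : ℕ} (p : stdSimplex ℝ (Fin (n + 1))) : ℝ :=
  ∑ k : Fin (n + 1), if c ≤ k then p k else 0

theorem continuous_cutCoord (c n : ℕ) : Continuous (cutCoord c (n := n)) := by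
  refine continuous_finsetSum _ fun k _ => ?_
  split_ifs
  · exact (continuous_apply k).comp continuous_subtype_val
  · exact continuous_const

theorem cutCoord_mem (c : ℕ) {n : ℕ} (p : stdSimplex ℝ (Fin (n + 1))) :
    cutCoord c p ∈ Set.Icc (0 : ℝ) 1 := by
  constructor
  · exact Finset.sum_nonneg fun k _ => by split_ifs <;> simp
  · rw [← stdSimplex.sum_eq_one p]
    exact Finset.sum_le_sum fun k _ => by split_ifs <;> simp

theorem cutCoord_zero {n : ℕ} (p : stdSimplex ℝ (Fin (n + 1))) : cutCoord 0 p = 1 := by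
  simp [cutCoord]

theorem cutCoord_last {n : ℕ} (p : stdSimplex ℝ (Fin (n + 1))) : cutCoord (n + 1) p = 0 := by
  refine Finset.sum_eq_zero fun k _ => if_neg ?_
  omega

theorem cutCoord_map {n k : ℕ} (φ : Fin (k + 1) → Fin (n + 1)) (c c' : ℕ)
    (h : ∀ i : Fin (k + 1), (i : ℕ) < c' ↔ (φ i : ℕ) < c) (p : stdSimplex ℝ (Fin (k + 1))) :
    cutCoord c (stdSimplex.map φ p) = cutCoord c' p := by
  classical
  simp only [cutCoord, stdSimplex.map_coe, FunOnFinite.linearMap_apply_apply]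
  have : ∀ i : Fin (k + 1), (if c' ≤ (i : ℕ) then p i else 0) = if c ≤ (φ i : ℕ) then p i else 0 := fun i => by
    have := h i
    split_ifs <;> first | rfl | omega
  simp only [this]
  rw [← Finset.sum_fiberwise Finset.univ φ (fun i => if c ≤ (φ i : ℕ) then p i else 0)]
  refine Finset.sum_congr rfl fun j _ => ?_
  split_ifs with hj
  · refine Finset.sum_congr rfl fun i hi => ?_
    rw [Finset.mem_filter] at hi
    rw [hi.2, if_pos hj]
  · symm
    refine Finset.sum_eq_zero fun i hi => ?_
    rw [Finset.mem_filter] at hi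
    rw [hi.2, if_neg hj]

/-- The slice of a map on `ℝ × T`. -/
def slice (H : C(ℝ × T, T')) (s : ℝ) : C(T, T') := H.comp ⟨fun x => (s, x), by fun_prop⟩

@[simp]
theorem slice_apply (H : C(ℝ × T, T')) (s : ℝ) (x : T) : slice H s x = H (s, x) := rfl

/-- The simplicial homotopy given by a homotopy of continuous maps. It is convenient to
parametrize homotopies by the real line instead of the unit interval; only the values over the
latter matter. -/
noncomputable def prism (H : C(ℝ × T, T')) : SimplicialPrism (Sing T) (Sing T') where
  app n c y := ofMap (H.comp ⟨fun p => (cutCoord c p, toMap y p),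
    (continuous_cutCoord c n).prodMk (toMap y).continuous⟩)
  map_app {n k} φ c c' h y := by
    refine ext fun p => ?_
    rw [toMap_map, toMap_ofMap, toMap_ofMap]
    change H (_, _) = H (_, _)
    rw [cutCoord_map _ c c' h, toMap_map]
  source := map (slice H 0)
  target := map (slice H 1)
  source_app n y := ext fun p => by
    rw [toMap_map_app, toMap_ofMap]
    change H (_, _) = H (_, _)
    rw [cutCoord_last]
  target_app n y := ext fun p => by
    rw [toMap_map_app, toMap_ofMap]
    change H (_, _) = H (_, _)
    rw [cutCoord_zero]

end Sing

open NormalizedChains Sing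

variable (R : Type) [CommRing R] {T T' T'' : Type} [TopologicalSpace T] [TopologicalSpace T']
  [TopologicalSpace T'']

/-- Normalized singular chains. -/
abbrev SingChains (T : Type) [TopologicalSpace T] : Type := NormalizedChains R (Sing T)

/-- The boundary operator of normalized singular chains. -/
noncomputable abbrev singD : SingChains R T →ₗ[R] SingChains R T := differential R (Sing T)

/-- The chain map induced by a continuous map. -/
noncomputable def pushChains (g : C(T, T')) : SingChains R T →ₗ[R] SingChains R T' :=
  NormalizedChains.map R (Sing.map g)

/-- The chain homotopy induced by a homotopy. -/
noncomputable def prismOp (H : C(ℝ × T, T')) : SingChains R T →ₗ[R] SingChains R T' :=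
  (Sing.prism H).op R

variable {R}

theorem pushChains_of (g : C(T, T')) {n : ℕ} (x : Sing T _⦋n⦌) :
    pushChains R g (of R x) = of R ((Sing.map g).app _ x) := map_of R _ x

theorem pushChains_singD (g : C(T, T')) (c : SingChains R T) :
    pushChains R g (singD R c) = singD R (pushChains R g c) := map_differential R _ c

theorem pushChains_comp (g : C(T', T'')) (f : C(T, T')) (c : SingChains R T) :
    pushChains R g (pushChains R f c) = pushChains R (g.comp f) c := by
  have : pushChains R g ∘ₗ pushChains R f = pushChains R (g.comp f) := by
    refine hom_ext fun n x => ?_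
    rw [LinearMap.comp_apply, pushChains_of, pushChains_of, pushChains_of]
    rfl
  exact LinearMap.congr_fun this c

theorem pushChains_id (c : SingChains R T) : pushChains R (ContinuousMap.id T) c = c := by
  have : pushChains R (ContinuousMap.id T) = LinearMap.id := by
    refine hom_ext fun n x => ?_
    rw [pushChains_of]
    rfl
  exact LinearMap.congr_fun this c

theorem comul_pushChains (g : C(T, T')) (c : SingChains R T) :
    Coalgebra.comul (R := R) (pushChains R g c) =
      TensorProduct.map (pushChains R g) (pushChains R g) (Coalgebra.comul (R := R) c) :=
  (LinearMap.congr_fun (coalgMap R (Sing.map g)).map_comp_comul c).symm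

theorem counit_pushChains (g : C(T, T')) (c : SingChains R T) :
    Coalgebra.counit (R := R) (pushChains R g c) = Coalgebra.counit (R := R) c :=
  LinearMap.congr_fun (coalgMap R (Sing.map g)).counit_comp c

theorem singD_prismOp (H : C(ℝ × T, T')) (c : SingChains R T) :
    singD R (prismOp R H c) + prismOp R H (singD R c) =
      pushChains R (slice H 1) c - pushChains R (slice H 0) c :=
  (Sing.prism H).differential_op R c

theorem comul_prismOp (H : C(ℝ × T, T')) (c : SingChains R T) :
    Coalgebra.comul (R := R) (prismOp R H c) =
      TensorProduct.map (prismOp R H) (pushChains R (slice H 1)) (Coalgebra.comul (R := R) c) +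
        TensorProduct.map (pushChains R (slice H 0) ∘ₗ degreeSign (deg R (Sing T))
          (isInternal R (Sing T))) (prismOp R H) (Coalgebra.comul (R := R) c) :=
  (Sing.prism H).comul_op R c

theorem counit_prismOp (H : C(ℝ × T, T')) (c : SingChains R T) :
    Coalgebra.counit (R := R) (prismOp R H c) = 0 := (Sing.prism H).counit_op R c

theorem prismOp_mem (H : C(ℝ × T, T')) {n : ℕ} {c : SingChains R T} (hc : c ∈ deg R (Sing T) n) :
    prismOp R H c ∈ deg R (Sing T') (n + 1) := (Sing.prism H).op_mem R n c hc

theorem prismOp_eq_zero (H : C(ℝ × T, T')) (h : ∀ s s' x, H (s, x) = H (s', x))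
    (c : SingChains R T) : prismOp R H c = 0 := by
  have : prismOp R H = 0 := (Sing.prism H).op_eq_zero R fun n c c' y => Sing.ext fun p => h _ _ _
  exact LinearMap.congr_fun this c

theorem pushChains_prismOp (g : C(T', T'')) (H : C(ℝ × T, T')) (c : SingChains R T) :
    pushChains R g (prismOp R H c) = prismOp R (g.comp H) c := by
  have : pushChains R g ∘ₗ prismOp R H = prismOp R (g.comp H) := by
    refine hom_ext fun n x => ?_
    rw [LinearMap.comp_apply, prismOp, prismOp, SimplicialPrism.op_of, SimplicialPrism.op_of,
      map_sum]
    refine Finset.sum_congr rfl fun j _ => ?_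
    rw [map_smul, pushChains_of]
    rfl
  exact LinearMap.congr_fun this c

theorem prismOp_pushChains (H : C(ℝ × T', T'')) (g : C(T, T')) (c : SingChains R T) :
    prismOp R H (pushChains R g c) =
      prismOp R (H.comp ⟨fun q => (q.1, g q.2), by fun_prop⟩) c := by
  have : prismOp R H ∘ₗ pushChains R g =
      prismOp R (H.comp ⟨fun q => (q.1, g q.2), by fun_prop⟩) := by
    refine hom_ext fun n x => ?_
    rw [LinearMap.comp_apply, pushChains_of, prismOp, prismOp, SimplicialPrism.op_of,
      SimplicialPrism.op_of]
    rfl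
  exact LinearMap.congr_fun this c

variable (R)

/-- The chains on `T` that are generated by the singular simplices with values in `A`. -/
noncomputable def chainsIn (A : Set T) : Submodule R (SingChains R T) :=
  Submodule.span R {c | ∃ (n : ℕ) (x : Sing T _⦋n⦌), (∀ p, toMap x p ∈ A) ∧ c = of R x}

variable {R}

theorem of_mem_chainsIn {A : Set T} {n : ℕ} {x : Sing T _⦋n⦌} (h : ∀ p, toMap x p ∈ A) :
    of R x ∈ chainsIn R A := Submodule.subset_span ⟨n, x, h, rfl⟩

theorem chainsIn_le {A : Set T} {N : Submodule R (SingChains R T)}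
    (h : ∀ (n : ℕ) (x : Sing T _⦋n⦌), (∀ p, toMap x p ∈ A) → of R x ∈ N) : chainsIn R A ≤ N := by
  rw [chainsIn, Submodule.span_le]
  rintro _ ⟨n, x, hx, rfl⟩
  exact h n x hx

theorem chainsIn_mono {A B : Set T} (h : A ⊆ B) : chainsIn R A ≤ chainsIn R B :=
  chainsIn_le fun _ _ hx => of_mem_chainsIn fun p => h (hx p)

theorem chainsIn_univ : chainsIn R (Set.univ : Set T) = ⊤ := by
  have : (chainsIn R (Set.univ : Set T)).mkQ = 0 := hom_ext fun n x => by
    simpa using of_mem_chainsIn (A := Set.univ) fun _ => trivial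
  rw [← Submodule.ker_mkQ (chainsIn R (Set.univ : Set T)), this, LinearMap.ker_zero]

/-- Two linear maps agree on the chains in `A` if they agree on the simplices in `A`. -/
theorem eqOn_chainsIn {M : Type} [AddCommGroup M] [Module R M] {A : Set T}
    {f g : SingChains R T →ₗ[R] M}
    (h : ∀ (n : ℕ) (x : Sing T _⦋n⦌), (∀ p, toMap x p ∈ A) → f (of R x) = g (of R x)) :
    ∀ c ∈ chainsIn R A, f c = g c :=
  chainsIn_le (N := LinearMap.eqLocus f g) h

theorem singD_mem {A : Set T} {c : SingChains R T} (hc : c ∈ chainsIn R A) :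
    singD R c ∈ chainsIn R A := by
  refine chainsIn_le (N := (chainsIn R A).comap (singD R)) (fun n x hx => ?_) hc
  rw [Submodule.mem_comap, singD, differential_of]
  cases n with
  | zero => exact zero_mem _
  | succ n =>
    exact Submodule.sum_mem _ fun i _ => Submodule.smul_mem _ _
      (of_mem_chainsIn fun p => hx _)

theorem pushChains_mem {g : C(T, T')} {A : Set T} {B : Set T'} (h : ∀ a ∈ A, g a ∈ B)
    {c : SingChains R T} (hc : c ∈ chainsIn R A) : pushChains R g c ∈ chainsIn R B := by
  refine chainsIn_le (N := (chainsIn R B).comap (pushChains R g)) (fun n x hx => ?_) hc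
  rw [Submodule.mem_comap, pushChains_of]
  exact of_mem_chainsIn fun p => h _ (hx p)

theorem prismOp_mem_chainsIn {H : C(ℝ × T, T')} {A : Set T} {B : Set T'}
    (h : ∀ s ∈ Set.Icc (0 : ℝ) 1, ∀ a ∈ A, H (s, a) ∈ B)
    {c : SingChains R T} (hc : c ∈ chainsIn R A) : prismOp R H c ∈ chainsIn R B := by
  refine chainsIn_le (N := (chainsIn R B).comap (prismOp R H)) (fun n x hx => ?_) hc
  rw [Submodule.mem_comap, prismOp, SimplicialPrism.op_of]
  exact Submodule.sum_mem _ fun i _ => Submodule.smul_mem _ _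
    (of_mem_chainsIn fun p => h _ (cutCoord_mem _ _) _ (hx _))

theorem pushChains_eq_self {g : C(T, T)} {A : Set T} (h : ∀ a ∈ A, g a = a)
    {c : SingChains R T} (hc : c ∈ chainsIn R A) : pushChains R g c = c := by
  refine eqOn_chainsIn (f := pushChains R g) (g := LinearMap.id) (fun n x hx => ?_) c hc
  rw [pushChains_of]
  exact congrArg (of R) (Sing.ext fun p => h _ (hx p))

/-- A deformation retraction of `B` onto `A`, or merely a homotopy that moves `B` into `A` and does
not leave `A` on the way, induces a quasi-isomorphism. -/
theorem isQI_of_deformation {A B : Set T} (hAB : A ⊆ B) (H : C(ℝ × T, T))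
    (h0 : ∀ x, H (0, x) = x) (h1 : ∀ b ∈ B, H (1, b) ∈ A)
    (hA : ∀ s ∈ Set.Icc (0 : ℝ) 1, ∀ a ∈ A, H (s, a) ∈ A)
    (hB : ∀ s ∈ Set.Icc (0 : ℝ) 1, ∀ b ∈ B, H (s, b) ∈ B) :
    IsQI (singD R) (singD R) LinearMap.id (chainsIn R A) (chainsIn R B) := by
  refine IsQI.of_homotopy (chainsIn_mono hAB) (pushChains R (slice H 1)) (prismOp R H)
    (fun a => singD_mem) (fun b => singD_mem) (fun b => pushChains_mem h1)
    (fun b => pushChains_singD _ b) (fun a => prismOp_mem_chainsIn hA)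
    (fun b => prismOp_mem_chainsIn hB) fun b => ?_
  have e : slice H 0 = ContinuousMap.id T := ContinuousMap.ext h0
  rw [singD_prismOp, e, pushChains_id]

open Classical in
variable (R) in
/-- The projection onto the chains in `A` that drops all simplices not contained in `A`. -/
noncomputable def restrictChains (A : Set T) : SingChains R T →ₗ[R] SingChains R T :=
  lift (fun _ x => if ∀ p, toMap x p ∈ A then of R x else 0) fun n x hx => by
    simp [of_degenerate R hx]

open Classical in
theorem restrictChains_of (A : Set T) {n : ℕ} (x : Sing T _⦋n⦌) :
    restrictChains R A (of R x) = if ∀ p, toMap x p ∈ A then of R x else 0 := lift_of _ _ x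

theorem restrictChains_eq_self {A : Set T} {c : SingChains R T} (hc : c ∈ chainsIn R A) :
    restrictChains R A c = c :=
  eqOn_chainsIn (f := restrictChains R A) (g := LinearMap.id)
    (fun n x hx => by rw [restrictChains_of, if_pos hx]; rfl) c hc

theorem chainsIn_inf (A B : Set T) : chainsIn R A ⊓ chainsIn R B = chainsIn R (A ∩ B) := by
  refine le_antisymm ?_ (le_inf (chainsIn_mono Set.inter_subset_left)
    (chainsIn_mono Set.inter_subset_right))
  rintro c ⟨hA, hB⟩
  rw [← restrictChains_eq_self hA]
  refine chainsIn_le (N := (chainsIn R (A ∩ B)).comap (restrictChains R A)) (fun n x hx => ?_) hB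
  rw [Submodule.mem_comap, restrictChains_of]
  split_ifs with h
  · exact of_mem_chainsIn fun p => ⟨h p, hx p⟩
  · exact zero_mem _

end SingularChains

/-! ### Subdivision of affine chains -/

section Subdivision

open Simplicial Opposite
open NormalizedChains

/-- The simplicial set whose `n`-simplices are all `(n + 1)`-tuples of elements of `K`. For convex
`K` they stand for the affine simplices with these vertices. -/
def Tuples (K : Type) : SSet.{0} where
  obj S := Fin (S.unop.len + 1) → K
  map f := TypeCat.ofHom fun v => v ∘ f.unop.toOrderHom

namespace Tuples

variable (R : Type) [CommRing R] {K K' : Type}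

/-- The normalized chain given by a tuple. -/
noncomputable def chain {n : ℕ} (v : Fin (n + 1) → K) : NormalizedChains R (Tuples K) :=
  of R (X := Tuples K) (n := n) v

/-- The map of simplicial sets induced by a map of vertices. -/
def map (g : K → K') : Tuples K ⟶ Tuples K' where
  app _ := TypeCat.ofHom fun v => g ∘ v
  naturality _ _ _ := rfl

/-- The chain map induced by a map of vertices. -/
noncomputable def push (g : K → K') :
    NormalizedChains R (Tuples K) →ₗ[R] NormalizedChains R (Tuples K') :=
  NormalizedChains.map R (map g)

/-- The boundary operator. -/
noncomputable abbrev dT : NormalizedChains R (Tuples K) →ₗ[R] NormalizedChains R (Tuples K) :=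
  differential R (Tuples K)

variable {R}

theorem push_chain (g : K → K') {n : ℕ} (v : Fin (n + 1) → K) :
    push R g (chain R v) = chain R (g ∘ v) := map_of R _ _

theorem push_dT (g : K → K') (c : NormalizedChains R (Tuples K)) :
    push R g (dT R c) = dT R (push R g c) := map_differential R _ c

theorem chain_mem {n : ℕ} (v : Fin (n + 1) → K) : chain R v ∈ deg R (Tuples K) n := of_mem R _

theorem dT_chain {n : ℕ} (v : Fin (n + 2) → K) :
    dT R (chain R v) = ∑ i : Fin (n + 2), ((-1 : R) ^ (i : ℕ)) • chain R (v ∘ i.succAbove) :=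
  differential_of (R := R) (X := Tuples K) (n := n + 1) v

theorem dT_chain_zero (v : Fin 1 → K) : dT R (chain R v) = 0 :=
  differential_of (R := R) (X := Tuples K) (n := 0) v

theorem counit_chain {n : ℕ} (v : Fin (n + 1) → K) :
    Coalgebra.counit (R := R) (chain R v) = if n = 0 then 1 else 0 :=
  counit_of (R := R) (X := Tuples K) (n := n) v

theorem hom_ext {M : Type} [AddCommGroup M] [Module R M]
    {f g : NormalizedChains R (Tuples K) →ₗ[R] M}
    (h : ∀ (n : ℕ) (v : Fin (n + 1) → K), f (chain R v) = g (chain R v)) : f = g :=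
  NormalizedChains.hom_ext h

theorem eqOn_deg {M : Type} [AddCommGroup M] [Module R M] {n : ℕ}
    {f g : NormalizedChains R (Tuples K) →ₗ[R] M}
    (h : ∀ v : Fin (n + 1) → K, f (chain R v) = g (chain R v)) :
    ∀ c ∈ deg R (Tuples K) n, f c = g c :=
  deg_le (N := LinearMap.eqLocus f g) h

theorem chain_eq_zero {n : ℕ} {v : Fin (n + 2) → K} (j : Fin (n + 1))
    (h : v j.castSucc = v j.succ) : chain R v = 0 := by
  refine of_degenerate R (X := Tuples K) ⟨n, Nat.lt_succ_self n, SimplexCategory.σ j,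
    (v ∘ j.succ.succAbove : Fin (n + 1) → K), ?_⟩
  refine funext fun i => ?_
  change v (j.succ.succAbove (j.predAbove i)) = v i
  by_cases hi : i = j.succ
  · subst hi
    rw [Fin.predAbove_succ_self, ← h]
    congr 1
    exact Fin.ext (by rw [succAbove_val]; simp)
  · congr 1
    refine Fin.ext ?_
    have : i.1 ≠ j.1 + 1 := fun e => hi (Fin.ext e)
    rw [succAbove_val, predAbove_val, Fin.val_succ]
    split_ifs <;> omega

variable (R)

theorem cone_degenerate (b : K) {n : ℕ} {v : Tuples K _⦋n⦌} (hv : v ∈ (Tuples K).degenerate n) :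
    chain R (Fin.cons b v : Fin (n + 2) → K) = 0 := by
  obtain ⟨k, rfl, j, w, hw⟩ := exists_σ hv
  obtain rfl : v = (Tuples K).map (SimplexCategory.σ j).op w := hw
  refine chain_eq_zero j.succ ?_
  rw [← Fin.succ_castSucc]
  erw [Fin.cons_succ, Fin.cons_succ]
  change w (j.predAbove j.castSucc) = w (j.predAbove j.succ)
  rw [Fin.predAbove_castSucc_self, Fin.predAbove_succ_self]

/-- The cone operator with apex `b`. -/
noncomputable def cone (b : K) : NormalizedChains R (Tuples K) →ₗ[R] NormalizedChains R (Tuples K) :=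
  lift (fun n v => chain R (Fin.cons b v : Fin (n + 2) → K)) fun _ _ hv => cone_degenerate R b hv

variable {R}

theorem cone_chain (b : K) {n : ℕ} (v : Fin (n + 1) → K) :
    cone R b (chain R v) = chain R (Fin.cons b v : Fin (n + 2) → K) :=
  lift_of (X := Tuples K) (n := n) _ _ v

theorem counit_cone (b : K) (c : NormalizedChains R (Tuples K)) :
    Coalgebra.counit (R := R) (cone R b c) = 0 := by
  have : Coalgebra.counit (R := R) ∘ₗ cone R b = 0 := by
    refine hom_ext fun n v => ?_
    rw [LinearMap.comp_apply, cone_chain, counit_chain]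
    simp
  exact LinearMap.congr_fun this c

theorem push_cone (g : K → K') (b : K) (c : NormalizedChains R (Tuples K)) :
    push R g (cone R b c) = cone R (g b) (push R g c) := by
  have : push R g ∘ₗ cone R b = cone R (g b) ∘ₗ push R g := by
    refine hom_ext fun n v => ?_
    rw [LinearMap.comp_apply, LinearMap.comp_apply, cone_chain, push_chain, push_chain, cone_chain]
    congr 1
    exact Fin.comp_cons g b v
  exact LinearMap.congr_fun this c

theorem dT_cone (b : K) (c : NormalizedChains R (Tuples K)) :
    dT R (cone R b c) = c - cone R b (dT R c) -
      Coalgebra.counit (R := R) c • chain R (fun _ : Fin 1 => b) := by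
  have : dT R ∘ₗ cone R b = LinearMap.id - cone R b ∘ₗ dT R -
      (Coalgebra.counit (R := R)).smulRight (chain R (fun _ : Fin 1 => b)) := by
    refine hom_ext fun n v => ?_
    simp only [LinearMap.comp_apply, LinearMap.sub_apply, LinearMap.id_apply,
      LinearMap.smulRight_apply, counit_chain]
    rw [cone_chain, dT_chain, Fin.sum_univ_succ]
    have e0 : (Fin.cons b v : Fin (n + 2) → K) ∘ Fin.succAbove 0 = v := by
      funext i; simp
    rw [e0]
    cases n with
    | zero =>
      rw [dT_chain_zero, Fin.sum_univ_one]
      have e1 : (Fin.cons b v : Fin 2 → K) ∘ Fin.succAbove (Fin.succ 0) = fun _ => b := by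
        funext i
        obtain rfl : i = 0 := Subsingleton.elim _ _
        rfl
      rw [e1]
      simp [sub_eq_add_neg]
    | succ n =>
      rw [dT_chain, map_sum]
      have e1 : ∀ i : Fin (n + 2), (Fin.cons b v : Fin (n + 3) → K) ∘ Fin.succAbove i.succ =
          Fin.cons b (v ∘ i.succAbove) := fun i => by
        funext k
        refine Fin.cases ?_ (fun k => ?_) k
        · simp
        · simp [Fin.succ_succAbove_succ]
      simp [e1, cone_chain, pow_succ, Finset.sum_neg_distrib, sub_eq_add_neg]
  exact LinearMap.congr_fun this c

/-- Simplices in the cone over a cone with the same apex are degenerate. -/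
theorem cone_cone_self (b : K) (c : NormalizedChains R (Tuples K)) : cone R b (cone R b c) = 0 := by
  have : cone R b ∘ₗ cone R b = 0 := by
    refine hom_ext fun n v => ?_
    rw [LinearMap.comp_apply, cone_chain, cone_chain]
    exact chain_eq_zero 0 rfl
  exact LinearMap.congr_fun this c

/-- The operator on affine chains of degree `n` given by `v ↦ F n v (Φ (d v))`. -/
noncomputable def recursionStep
    (F : ∀ n : ℕ, (Fin (n + 1) → K) → NormalizedChains R (Tuples K) → NormalizedChains R (Tuples K))
    (hF : ∀ (n : ℕ) (v : Fin (n + 1) → K), chain R v = 0 → F n v 0 = 0) (n : ℕ)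
    (Φ : NormalizedChains R (Tuples K) →ₗ[R] NormalizedChains R (Tuples K)) :
    NormalizedChains R (Tuples K) →ₗ[R] NormalizedChains R (Tuples K) :=
  lift (fun k v => if k = n then F k v (Φ (boundary R (X := Tuples K) k v)) else 0)
    (fun k v hv => by
      rw [boundary_degenerate R hv, map_zero, hF k v (of_degenerate R hv), ite_self])

theorem recursionStep_chain
    (F : ∀ n : ℕ, (Fin (n + 1) → K) → NormalizedChains R (Tuples K) → NormalizedChains R (Tuples K))
    (hF : ∀ (n : ℕ) (v : Fin (n + 1) → K), chain R v = 0 → F n v 0 = 0) (n : ℕ)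
    (Φ : NormalizedChains R (Tuples K) →ₗ[R] NormalizedChains R (Tuples K))
    (v : Fin (n + 1) → K) :
    recursionStep F hF n Φ (chain R v) = F n v (Φ (dT R (chain R v))) := by
  refine (lift_of (R := R) (X := Tuples K) (n := n) _ _ v).trans ?_
  rw [if_pos rfl]
  congr 2
  exact (differential_of (R := R) (X := Tuples K) (n := n) v).symm

/-- The operators that `v ↦ F n v (Φ (d v))` defines recursively, in each degree separately. -/
noncomputable def recursionAux
    (F : ∀ n : ℕ, (Fin (n + 1) → K) → NormalizedChains R (Tuples K) → NormalizedChains R (Tuples K))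
    (hF : ∀ (n : ℕ) (v : Fin (n + 1) → K), chain R v = 0 → F n v 0 = 0)
    (n : ℕ) : NormalizedChains R (Tuples K) →ₗ[R] NormalizedChains R (Tuples K) :=
  match n with
  | 0 => recursionStep F hF 0 0
  | n + 1 => recursionStep F hF (n + 1) (recursionAux F hF n)

/-- The linear operator `Φ` on affine chains with `Φ v = F v (Φ (d v))`. Such an operator
automatically descends to normalized chains. -/
noncomputable def recursion
    (F : ∀ n : ℕ, (Fin (n + 1) → K) → NormalizedChains R (Tuples K) → NormalizedChains R (Tuples K))
    (hF : ∀ (n : ℕ) (v : Fin (n + 1) → K), chain R v = 0 → F n v 0 = 0) :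
    NormalizedChains R (Tuples K) →ₗ[R] NormalizedChains R (Tuples K) :=
  lift (fun k v => recursionAux F hF k (chain R v)) fun k v hv => by
    have : chain R v = 0 := of_degenerate R hv
    rw [this, map_zero]

theorem recursion_chain
    (F : ∀ n : ℕ, (Fin (n + 1) → K) → NormalizedChains R (Tuples K) → NormalizedChains R (Tuples K))
    (hF : ∀ (n : ℕ) (v : Fin (n + 1) → K), chain R v = 0 → F n v 0 = 0) {n : ℕ}
    (v : Fin (n + 1) → K) :
    recursion F hF (chain R v) = F n v (recursion F hF (dT R (chain R v))) := by
  have e : ∀ {k : ℕ} (w : Fin (k + 1) → K),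
      recursion F hF (chain R w) = recursionAux F hF k (chain R w) := fun {k} w =>
    lift_of (R := R) (X := Tuples K) (n := k) _ _ w
  rw [e]
  cases n with
  | zero => rw [recursionAux, recursionStep_chain, dT_chain_zero, map_zero, map_zero]
  | succ n =>
    rw [recursionAux, recursionStep_chain]
    congr 1
    refine (eqOn_deg (fun w => e w) _ ?_).symm
    rw [dT_chain]
    exact Submodule.sum_mem _ fun i _ => Submodule.smul_mem _ _ (chain_mem _)

variable (R) in
/-- The subdivision operator: `v` is mapped to the cone on the subdivision of its boundary with
apex the midpoint between the first and the last vertex of `v`. Unlike barycentric subdivision it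
is compatible with degeneracies. -/
noncomputable def subdivision (mid : K → K → K) :
    NormalizedChains R (Tuples K) →ₗ[R] NormalizedChains R (Tuples K) :=
  recursion (fun n v z => if n = 0 then chain R v else cone R (mid (v 0) (v (Fin.last n))) z)
    fun n v h => by simp [h]

theorem subdivision_zero (mid : K → K → K) (v : Fin 1 → K) :
    subdivision R mid (chain R v) = chain R v := by
  rw [subdivision, recursion_chain, if_pos rfl]

theorem subdivision_succ (mid : K → K → K) {n : ℕ} (v : Fin (n + 2) → K) :
    subdivision R mid (chain R v) = cone R (mid (v 0) (v (Fin.last _)))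
      (subdivision R mid (dT R (chain R v))) := by
  rw [subdivision, recursion_chain, if_neg (Nat.succ_ne_zero n)]

variable (R) in
/-- The chain homotopy between the identity and the subdivision operator. -/
noncomputable def subdivisionHomotopy (mid : K → K → K) :
    NormalizedChains R (Tuples K) →ₗ[R] NormalizedChains R (Tuples K) :=
  recursion (fun n v z => if n = 0 then 0 else
    cone R (v 0) (subdivision R mid (chain R v) - chain R v - z)) fun n v h => by simp [h]

theorem subdivisionHomotopy_zero (mid : K → K → K) (v : Fin 1 → K) :
    subdivisionHomotopy R mid (chain R v) = 0 := by
  rw [subdivisionHomotopy, recursion_chain, if_pos rfl]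

theorem subdivisionHomotopy_succ (mid : K → K → K) {n : ℕ} (v : Fin (n + 2) → K) :
    subdivisionHomotopy R mid (chain R v) = cone R (v 0) (subdivision R mid (chain R v) -
      chain R v - subdivisionHomotopy R mid (dT R (chain R v))) := by
  rw [subdivisionHomotopy, recursion_chain, if_neg (Nat.succ_ne_zero n)]

theorem dT_mem {n : ℕ} (v : Fin (n + 2) → K) : dT R (chain R v) ∈ deg R (Tuples K) n :=
  differential_mem R (Tuples K) n _ (chain_mem v)

theorem counit_subdivision (mid : K → K → K) (c : NormalizedChains R (Tuples K)) :
    Coalgebra.counit (R := R) (subdivision R mid c) = Coalgebra.counit (R := R) c := by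
  have : Coalgebra.counit (R := R) ∘ₗ subdivision R mid =
      Coalgebra.counit (R := R) (A := NormalizedChains R (Tuples K)) := by
    refine hom_ext fun n v => ?_
    cases n with
    | zero => rw [LinearMap.comp_apply, subdivision_zero]
    | succ n =>
      rw [LinearMap.comp_apply, subdivision_succ, counit_cone, counit_chain, if_neg (by omega)]
  exact LinearMap.congr_fun this c

theorem dT_dT (c : NormalizedChains R (Tuples K)) : dT R (dT R c) = 0 :=
  differential_differential R _ c

theorem dT_subdivision (mid : K → K → K) (c : NormalizedChains R (Tuples K)) :
    dT R (subdivision R mid c) = subdivision R mid (dT R c) := by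
  have key : ∀ n, ∀ c ∈ deg R (Tuples K) n,
      (dT R ∘ₗ subdivision R mid) c = (subdivision R mid ∘ₗ dT R) c := by
    intro n
    induction n with
    | zero =>
      refine eqOn_deg fun v => ?_
      rw [LinearMap.comp_apply, LinearMap.comp_apply, subdivision_zero, dT_chain_zero, map_zero]
    | succ n ih =>
      refine eqOn_deg fun v => ?_
      have h := ih _ (dT_mem v)
      simp only [LinearMap.comp_apply] at h ⊢
      rw [subdivision_succ, dT_cone, h, dT_dT, counit_subdivision, counit_differential]
      simp
  have : dT R ∘ₗ subdivision R mid = subdivision R mid ∘ₗ dT R :=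
    hom_ext fun n v => key n _ (chain_mem v)
  exact LinearMap.congr_fun this c

theorem counit_subdivisionHomotopy (mid : K → K → K) (c : NormalizedChains R (Tuples K)) :
    Coalgebra.counit (R := R) (subdivisionHomotopy R mid c) = 0 := by
  have : Coalgebra.counit (R := R) ∘ₗ subdivisionHomotopy R mid = 0 := by
    refine hom_ext fun n v => ?_
    cases n with
    | zero => rw [LinearMap.comp_apply, subdivisionHomotopy_zero, map_zero, LinearMap.zero_apply]
    | succ n =>
      rw [LinearMap.comp_apply, subdivisionHomotopy_succ, counit_cone, LinearMap.zero_apply]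
  exact LinearMap.congr_fun this c

theorem dT_subdivisionHomotopy (mid : K → K → K) (c : NormalizedChains R (Tuples K)) :
    dT R (subdivisionHomotopy R mid c) + subdivisionHomotopy R mid (dT R c) =
      subdivision R mid c - c := by
  have key : ∀ n, ∀ c ∈ deg R (Tuples K) n,
      (dT R ∘ₗ subdivisionHomotopy R mid + subdivisionHomotopy R mid ∘ₗ dT R) c =
        (subdivision R mid - LinearMap.id :
          NormalizedChains R (Tuples K) →ₗ[R] NormalizedChains R (Tuples K)) c := by
    intro n
    induction n with
    | zero =>
      refine eqOn_deg fun v => ?_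
      simp [subdivision_zero, subdivisionHomotopy_zero, dT_chain_zero]
    | succ n ih =>
      refine eqOn_deg fun v => ?_
      have h := ih _ (dT_mem v)
      simp only [LinearMap.comp_apply, LinearMap.add_apply, LinearMap.sub_apply,
        LinearMap.id_apply, dT_dT, map_zero, add_zero] at h ⊢
      rw [subdivisionHomotopy_succ, dT_cone]
      simp only [map_sub, dT_subdivision, h, counit_subdivision, counit_subdivisionHomotopy]
      simp
  have : dT R ∘ₗ subdivisionHomotopy R mid + subdivisionHomotopy R mid ∘ₗ dT R =
      subdivision R mid - LinearMap.id := hom_ext fun n v => key n _ (chain_mem v)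
  exact LinearMap.congr_fun this c

theorem push_subdivision {mid : K → K → K} {mid' : K' → K' → K'} (g : K → K')
    (hg : ∀ a b, g (mid a b) = mid' (g a) (g b)) (c : NormalizedChains R (Tuples K)) :
    push R g (subdivision R mid c) = subdivision R mid' (push R g c) := by
  have key : ∀ n, ∀ c ∈ deg R (Tuples K) n,
      (push R g ∘ₗ subdivision R mid) c = (subdivision R mid' ∘ₗ push R g) c := by
    intro n
    induction n with
    | zero =>
      refine eqOn_deg fun v => ?_
      simp [subdivision_zero, push_chain]
    | succ n ih =>
      refine eqOn_deg fun v => ?_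
      have h := ih _ (dT_mem v)
      simp only [LinearMap.comp_apply] at h ⊢
      rw [subdivision_succ, push_cone, h, push_chain, subdivision_succ, push_dT, push_chain, hg]
      rfl
  have : push R g ∘ₗ subdivision R mid = subdivision R mid' ∘ₗ push R g :=
    hom_ext fun n v => key n _ (chain_mem v)
  exact LinearMap.congr_fun this c

theorem push_subdivisionHomotopy {mid : K → K → K} {mid' : K' → K' → K'} (g : K → K')
    (hg : ∀ a b, g (mid a b) = mid' (g a) (g b)) (c : NormalizedChains R (Tuples K)) :
    push R g (subdivisionHomotopy R mid c) = subdivisionHomotopy R mid' (push R g c) := by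
  have key : ∀ n, ∀ c ∈ deg R (Tuples K) n,
      (push R g ∘ₗ subdivisionHomotopy R mid) c = (subdivisionHomotopy R mid' ∘ₗ push R g) c := by
    intro n
    induction n with
    | zero =>
      refine eqOn_deg fun v => ?_
      simp [subdivisionHomotopy_zero, push_chain]
    | succ n ih =>
      refine eqOn_deg fun v => ?_
      have h := ih _ (dT_mem v)
      simp only [LinearMap.comp_apply] at h ⊢
      rw [subdivisionHomotopy_succ, push_cone, map_sub, map_sub, map_sub, h, push_subdivision g hg,
        push_chain, subdivisionHomotopy_succ, push_dT, push_chain, ← map_sub,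
        Function.comp_apply]
  have : push R g ∘ₗ subdivisionHomotopy R mid = subdivisionHomotopy R mid' ∘ₗ push R g :=
    hom_ext fun n v => key n _ (chain_mem v)
  exact LinearMap.congr_fun this c

section Mesh

variable [PseudoMetricSpace K]

variable (R) in
/-- The span of the `n`-simplices whose consecutive vertices are at most `M` apart. -/
noncomputable def fine (n : ℕ) (M : ℝ) : Submodule R (NormalizedChains R (Tuples K)) :=
  Submodule.span R {c | ∃ w : Fin (n + 1) → K,
    (∀ i : Fin n, dist (w i.castSucc) (w i.succ) ≤ M) ∧ c = chain R w}

variable (R) in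
/-- The subspace of `fine R n M` spanned by simplices with a prescribed first vertex. -/
noncomputable def fineAt (n : ℕ) (M : ℝ) (p : K) : Submodule R (NormalizedChains R (Tuples K)) :=
  Submodule.span R {c | ∃ w : Fin (n + 1) → K, w 0 = p ∧
    (∀ i : Fin n, dist (w i.castSucc) (w i.succ) ≤ M) ∧ c = chain R w}

theorem fineAt_le (n : ℕ) (M : ℝ) (p : K) : fineAt R n M p ≤ fine R n M :=
  Submodule.span_mono fun _ ⟨w, _, h, e⟩ => ⟨w, h, e⟩

theorem cone_fineAt {n : ℕ} {M : ℝ} {p : K} (b : K) (hb : dist b p ≤ M)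
    {c : NormalizedChains R (Tuples K)} (hc : c ∈ fineAt R n M p) :
    cone R b c ∈ fineAt R (n + 1) M b := by
  have hle : fineAt R n M p ≤ (fineAt R (n + 1) M b).comap (cone R b) := by
    rw [fineAt, Submodule.span_le]
    rintro _ ⟨w, rfl, hw, rfl⟩
    change cone R b (chain R w) ∈ fineAt R (n + 1) M b
    rw [cone_chain]
    refine Submodule.subset_span ⟨_, rfl, fun i => ?_, rfl⟩
    refine Fin.cases ?_ (fun i => ?_) i
    · exact hb
    · rw [Fin.cons_succ, ← Fin.succ_castSucc, Fin.cons_succ]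
      exact hw i
  exact hle hc

/-- Subdivision halves the distance between consecutive vertices. Indeed, the vertices of a simplex
in the subdivision of `v` are midpoints of `v a` and `v b` for shrinking intervals `[a, b]`. -/
theorem subdivision_fineAt {mid : K → K → K} (hmid : ∀ a, mid a a = a)
    (h1 : ∀ a b c, dist (mid a c) (mid b c) ≤ dist a b / 2)
    (h2 : ∀ a b c, dist (mid a b) (mid a c) ≤ dist b c / 2) {n : ℕ} {M : ℝ}
    {v : Fin (n + 1) → K} (hv : ∀ i : Fin n, dist (v i.castSucc) (v i.succ) ≤ M) :
    subdivision R mid (chain R v) ∈ fineAt R n (M / 2) (mid (v 0) (v (Fin.last n))) := by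
  induction n with
  | zero =>
    rw [subdivision_zero]
    exact Submodule.subset_span ⟨v, (hmid _).symm, fun i => i.elim0, rfl⟩
  | succ n ih =>
    rw [subdivision_succ, dT_chain, map_sum, map_sum]
    refine Submodule.sum_mem _ fun i _ => ?_
    rw [map_smul, map_smul]
    refine Submodule.smul_mem _ _ ?_
    by_cases hi0 : i = 0
    · subst hi0
      refine cone_fineAt _ ?_ (ih fun j => ?_)
      · have := hv 0
        have e : (v ∘ Fin.succAbove 0) (Fin.last n) = v (Fin.last (n + 1)) := by simp
        rw [e]
        refine (h1 _ _ _).trans (div_le_div_of_nonneg_right ?_ zero_le_two)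
        simpa using this
      · have := hv j.succ
        simpa using this
    by_cases hil : i = Fin.last (n + 1)
    · subst hil
      refine cone_fineAt _ ?_ (ih fun j => ?_)
      · have := hv (Fin.last n)
        rw [dist_comm] at this
        have e : (v ∘ Fin.succAbove (Fin.last (n + 1))) 0 = v 0 := by
          rw [Function.comp_apply, Fin.succAbove_last, Fin.castSucc_zero]
        rw [e]
        refine (h2 _ _ _).trans (div_le_div_of_nonneg_right ?_ zero_le_two)
        rw [Function.comp_apply, Fin.succAbove_last]
        simpa using this
      · have := hv j.castSucc
        simpa using this
    · -- omitting an inner vertex does not change the apex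
      have e0 : (v ∘ i.succAbove) 0 = v 0 := by
        rw [Function.comp_apply, Fin.succAbove_ne_zero_zero hi0]
      have el : (v ∘ i.succAbove) (Fin.last n) = v (Fin.last (n + 1)) := by
        rw [Function.comp_apply, Fin.succAbove_ne_last_last hil]
      cases n with
      | zero =>
        exfalso
        have h2 : i.1 < 2 := i.2
        have h3 : i.1 ≠ 0 := fun e => hi0 (Fin.ext e)
        have h4 : i.1 ≠ 1 := fun e => hil (Fin.ext e)
        omega
      | succ n =>
        rw [subdivision_succ, e0, el, cone_cone_self]
        exact zero_mem _

theorem subdivision_fine {mid : K → K → K} (hmid : ∀ a, mid a a = a)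
    (h1 : ∀ a b c, dist (mid a c) (mid b c) ≤ dist a b / 2)
    (h2 : ∀ a b c, dist (mid a b) (mid a c) ≤ dist b c / 2) {n : ℕ} {M : ℝ}
    {c : NormalizedChains R (Tuples K)} (hc : c ∈ fine R n M) :
    subdivision R mid c ∈ fine R n (M / 2) := by
  have hle : fine R n M ≤ (fine R n (M / 2)).comap (subdivision R mid) := by
    rw [fine, Submodule.span_le]
    rintro _ ⟨w, hw, rfl⟩
    exact fineAt_le _ _ _ (subdivision_fineAt hmid h1 h2 hw)
  exact hle hc

end Mesh
end Tuples
end Subdivision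

/-! ### Small singular simplices -/

section SmallSimplices

open Simplicial Opposite
open NormalizedChains Sing

/-- The standard simplex of dimension `n`. -/
abbrev StdSimplex (n : ℕ) : Type := stdSimplex ℝ (Fin (n + 1))

namespace StdSimplex

/-- The midpoint of two points of a simplex. -/
noncomputable def mid {n : ℕ} (p q : StdSimplex n) : StdSimplex n :=
  ⟨midpoint ℝ p.1 q.1, (convex_stdSimplex ℝ _).midpoint_mem p.2 q.2⟩

theorem mid_self {n : ℕ} (p : StdSimplex n) : mid p p = p := Subtype.ext (midpoint_self ℝ p.1)

theorem dist_mid_left {n : ℕ} (a b c : StdSimplex n) : dist (mid a c) (mid b c) ≤ dist a b / 2 := by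
  have := dist_midpoint_midpoint_le a.1 c.1 b.1 c.1
  rw [dist_self, add_zero] at this
  exact this

theorem dist_mid_right {n : ℕ} (a b c : StdSimplex n) : dist (mid a b) (mid a c) ≤ dist b c / 2 := by
  have := dist_midpoint_midpoint_le a.1 b.1 a.1 c.1
  rw [dist_self, zero_add] at this
  exact this

/-- The affine map between simplices with prescribed values on the vertices. -/
noncomputable def comb {k n : ℕ} (w : Fin (k + 1) → StdSimplex n) : C(StdSimplex k, StdSimplex n) where
  toFun p := ⟨∑ j, p j • (w j).1, (convex_stdSimplex ℝ _).sum_mem (fun j _ => p.2.1 j) p.2.2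
    fun j _ => (w j).2⟩
  continuous_toFun := by
    refine Continuous.subtype_mk (continuous_finsetSum _ fun j _ => ?_) _
    exact ((continuous_apply j).comp continuous_subtype_val).smul continuous_const

theorem comb_coe {k n : ℕ} (w : Fin (k + 1) → StdSimplex n) (p : StdSimplex k) :
    (comb w p).1 = ∑ j, p j • (w j).1 := rfl

theorem comb_map {l k n : ℕ} (φ : Fin (l + 1) → Fin (k + 1)) (w : Fin (k + 1) → StdSimplex n)
    (p : StdSimplex l) : comb (w ∘ φ) p = comb w (stdSimplex.map φ p) := by
  classical
  refine Subtype.ext ?_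
  rw [comb_coe, comb_coe]
  have e : ∀ j, (stdSimplex.map φ p) j = ∑ i with φ i = j, p i := fun j => by
    rw [stdSimplex.map_coe, FunOnFinite.linearMap_apply_apply]
  simp only [e, Finset.sum_smul]
  rw [← Finset.sum_fiberwise Finset.univ φ]
  refine Finset.sum_congr rfl fun j _ => Finset.sum_congr rfl fun i hi => ?_
  rw [Function.comp_apply, (Finset.mem_filter.1 hi).2]

theorem map_comb {k n l : ℕ} (φ : Fin (n + 1) → Fin (l + 1)) (w : Fin (k + 1) → StdSimplex n)
    (p : StdSimplex k) : stdSimplex.map φ (comb w p) = comb (stdSimplex.map φ ∘ w) p := by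
  refine Subtype.ext ?_
  rw [comb_coe]
  change FunOnFinite.linearMap ℝ ℝ φ (comb w p).1 = _
  rw [comb_coe, map_sum]
  refine Finset.sum_congr rfl fun j _ => ?_
  rw [map_smul]
  rfl

theorem comb_vertex {n : ℕ} (p : StdSimplex n) : comb stdSimplex.vertex p = p := by
  refine Subtype.ext ?_
  rw [comb_coe]
  funext i
  simp [Finset.sum_apply, Pi.single_apply]
  rfl

theorem map_mid {n l : ℕ} (φ : Fin (n + 1) → Fin (l + 1)) (p q : StdSimplex n) :
    stdSimplex.map φ (mid p q) = mid (stdSimplex.map φ p) (stdSimplex.map φ q) := by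
  refine Subtype.ext ?_
  change FunOnFinite.linearMap ℝ ℝ φ (midpoint ℝ p.1 q.1) =
    midpoint ℝ (FunOnFinite.linearMap ℝ ℝ φ p.1) (FunOnFinite.linearMap ℝ ℝ φ q.1)
  rw [midpoint_eq_smul_add, midpoint_eq_smul_add, map_smul, map_add]

theorem dist_comb_le {k n : ℕ} {w : Fin (k + 1) → StdSimplex n} {M : ℝ}
    (hw : ∀ i : Fin k, dist (w i.castSucc) (w i.succ) ≤ M) (p : StdSimplex k) :
    dist (comb w p) (w 0) ≤ k * M := by
  rcases Nat.eq_zero_or_pos k with rfl | hk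
  · have h0 : comb w p = w 0 := by
      refine Subtype.ext ?_
      have := stdSimplex.sum_eq_one p
      rw [Fin.sum_univ_one] at this
      rw [comb_coe, Fin.sum_univ_one, this, one_smul]
    simp [h0]
  have hM : 0 ≤ M := dist_nonneg.trans (hw ⟨0, hk⟩)
  have h1 : ∀ (j : ℕ) (hj : j < k + 1), dist (w ⟨j, hj⟩) (w 0) ≤ j * M := by
    intro j
    induction j with
    | zero => intro hj; simp
    | succ j ih =>
      intro hj
      have h2 := hw ⟨j, by omega⟩
      have h3 := ih (by omega)
      rw [dist_comm] at h2
      refine (dist_triangle _ _ _).trans ((add_le_add h2 h3).trans ?_)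
      push_cast
      linarith
  have : ∑ j, p j • (w j).1 ∈ Metric.closedBall (w 0).1 (k * M) := by
    refine (convex_closedBall _ _).sum_mem (fun j _ => p.2.1 j) p.2.2 fun j _ => ?_
    refine (h1 j.1 j.2).trans ?_
    have : (j.1 : ℝ) ≤ k := by exact_mod_cast Nat.lt_succ_iff.1 j.2
    exact mul_le_mul_of_nonneg_right this hM
  exact this

theorem dist_le_one {n : ℕ} (p q : StdSimplex n) : dist p q ≤ 1 := by
  refine (dist_pi_le_iff zero_le_one).2 fun i => ?_
  have h1 := stdSimplex.le_one p i
  have h2 := stdSimplex.le_one q i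
  have h3 := stdSimplex.zero_le p i
  have h4 := stdSimplex.zero_le q i
  change |p i - q i| ≤ 1
  rw [abs_le]
  constructor <;> linarith

end StdSimplex

open Tuples StdSimplex

variable {R : Type} [CommRing R] {T : Type} [TopologicalSpace T]

/-- The realization of affine simplices in a singular simplex as singular simplices. -/
noncomputable def affineSimplices {n : ℕ} (σ : C(StdSimplex n, T)) :
    Tuples (StdSimplex n) ⟶ Sing T where
  app S := TypeCat.ofHom fun w =>
    (TopCat.toSSetObjEquiv (TopCat.of T) S).symm (σ.comp (comb (k := S.unop.len) w))
  naturality S S' f := by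
    ext w
    refine Sing.ext (n := S'.unop.len) fun p => ?_
    exact congrArg σ (comb_map (k := S.unop.len) (l := S'.unop.len) f.unop.toOrderHom w p)

variable (R) in
/-- The chain map from affine chains in a singular simplex to singular chains. -/
noncomputable def realize {n : ℕ} (σ : C(StdSimplex n, T)) :
    NormalizedChains R (Tuples (StdSimplex n)) →ₗ[R] SingChains R T :=
  NormalizedChains.map R (affineSimplices σ)

theorem realize_chain {n k : ℕ} (σ : C(StdSimplex n, T)) (w : Fin (k + 1) → StdSimplex n) :
    realize R σ (chain R w) = of R (ofMap (σ.comp (comb w))) :=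
  map_of R (affineSimplices σ) (X := Tuples (StdSimplex n)) (n := k) w

theorem realize_dT {n : ℕ} (σ : C(StdSimplex n, T)) (c) :
    realize R σ (dT R c) = singD R (realize R σ c) := map_differential R _ c

theorem realize_push {k n : ℕ} (σ : C(StdSimplex n, T)) (φ : Fin (k + 1) → Fin (n + 1)) (c) :
    realize R σ (push R (stdSimplex.map φ) c) =
      realize R (σ.comp ⟨stdSimplex.map φ, stdSimplex.continuous_map φ⟩) c := by
  have : realize R σ ∘ₗ push R (stdSimplex.map φ) =
      realize R (σ.comp ⟨stdSimplex.map φ, stdSimplex.continuous_map φ⟩) := by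
    refine Tuples.hom_ext fun l w => ?_
    rw [LinearMap.comp_apply, push_chain, realize_chain, realize_chain]
    refine congrArg (of R) (Sing.ext fun p => ?_)
    exact congrArg σ (map_comb φ w p).symm
  exact LinearMap.congr_fun this c

theorem realize_mem {n : ℕ} {σ : C(StdSimplex n, T)} {A : Set T} (h : ∀ p, σ p ∈ A) (c) :
    realize R σ c ∈ chainsIn R A := by
  have : (chainsIn R A).mkQ ∘ₗ realize R σ = 0 := by
    refine Tuples.hom_ext fun l w => ?_
    rw [LinearMap.comp_apply, realize_chain, LinearMap.zero_apply, Submodule.mkQ_apply,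
      Submodule.Quotient.mk_eq_zero]
    exact of_mem_chainsIn fun p => h _
  rw [← Submodule.Quotient.mk_eq_zero, ← Submodule.mkQ_apply]
  exact LinearMap.congr_fun this c

variable (R) in
/-- Operators on the affine chains of all standard simplices that are natural with respect to the
simplicial structure. -/
structure AffineOperator where
  /-- the operator on the affine chains of the `n`-simplex -/
  op : ∀ n : ℕ, NormalizedChains R (Tuples (StdSimplex n)) →ₗ[R]
    NormalizedChains R (Tuples (StdSimplex n))
  push_op : ∀ {k n : ℕ} (φ : Fin (k + 1) → Fin (n + 1)) (c),
    push R (stdSimplex.map φ) (op k c) = op n (push R (stdSimplex.map φ) c)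

namespace AffineOperator

variable (R) in
/-- The affine chain given by the simplex itself. -/
noncomputable def fundamental (n : ℕ) : NormalizedChains R (Tuples (StdSimplex n)) :=
  chain R stdSimplex.vertex

theorem push_fundamental {k n : ℕ} (φ : Fin (k + 1) → Fin (n + 1)) :
    push R (stdSimplex.map φ) (fundamental R k) = chain R (stdSimplex.vertex ∘ φ) := by
  rw [fundamental, push_chain]
  congr 1
  funext i
  exact stdSimplex.map_vertex φ i

variable (Φ : AffineOperator R)

/-- The operator on singular chains induced by an operator on affine chains. -/
noncomputable def transfer : SingChains R T →ₗ[R] SingChains R T :=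
  lift (fun n x => realize R (toMap x) (Φ.op n (fundamental R n))) fun n x hx => by
    obtain ⟨k, rfl, j, y, hy⟩ := exists_σ hx
    obtain rfl : x = (Sing T).map (SimplexCategory.σ j).op y := hy
    have e : toMap ((Sing T).map (SimplexCategory.σ j).op y) = (toMap y).comp
      ⟨stdSimplex.map (SimplexCategory.σ j).toOrderHom, stdSimplex.continuous_map _⟩ := rfl
    rw [e, ← realize_push, Φ.push_op, push_fundamental, chain_eq_zero j, map_zero, map_zero]
    change stdSimplex.vertex (j.predAbove j.castSucc) = stdSimplex.vertex (j.predAbove j.succ)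
    rw [Fin.predAbove_castSucc_self, Fin.predAbove_succ_self]

theorem transfer_of {n : ℕ} (x : Sing T _⦋n⦌) :
    Φ.transfer (of R x) = realize R (toMap x) (Φ.op n (fundamental R n)) := lift_of _ _ x

theorem transfer_singD {n : ℕ} (x : Sing T _⦋n⦌) :
    Φ.transfer (singD R (of R x)) = realize R (toMap x) (Φ.op n (dT R (fundamental R n))) := by
  rw [differential_of]
  cases n with
  | zero =>
    rw [fundamental, dT_chain_zero]
    change Φ.transfer 0 = _
    rw [map_zero, map_zero, map_zero]
  | succ n =>
    rw [fundamental, dT_chain]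
    simp only [boundary, map_sum, map_smul]
    refine Finset.sum_congr rfl fun i _ => ?_
    rw [transfer_of, ← push_fundamental, ← Φ.push_op, realize_push]
    rfl

theorem transfer_mem {A : Set T} {c : SingChains R T} (hc : c ∈ chainsIn R A) :
    Φ.transfer c ∈ chainsIn R A := by
  refine chainsIn_le (N := (chainsIn R A).comap Φ.transfer) (fun n x hx => ?_) hc
  rw [Submodule.mem_comap, transfer_of]
  exact realize_mem hx _

/-- A chain map on affine chains induces a chain map. -/
theorem singD_transfer (h : ∀ n c, dT R (Φ.op n c) = Φ.op n (dT R c)) (c : SingChains R T) :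
    singD R (Φ.transfer c) = Φ.transfer (singD R c) := by
  have : singD R ∘ₗ Φ.transfer (T := T) = Φ.transfer ∘ₗ singD R := by
    refine NormalizedChains.hom_ext fun n x => ?_
    rw [LinearMap.comp_apply, LinearMap.comp_apply, transfer_singD, transfer_of, ← realize_dT, h]
  exact LinearMap.congr_fun this c

/-- A homotopy on affine chains induces a homotopy. -/
theorem singD_transfer_add {Θ Φ : AffineOperator R}
    (h : ∀ n c, dT R (Θ.op n c) + Θ.op n (dT R c) = Φ.op n c - c) (c : SingChains R T) :
    singD R (Θ.transfer c) + Θ.transfer (singD R c) = Φ.transfer c - c := by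
  have : singD R ∘ₗ Θ.transfer (T := T) + Θ.transfer ∘ₗ singD R = Φ.transfer - LinearMap.id := by
    refine NormalizedChains.hom_ext fun n x => ?_
    rw [LinearMap.add_apply, LinearMap.comp_apply, LinearMap.comp_apply, transfer_singD,
      transfer_of, ← realize_dT, ← map_add, h, map_sub, LinearMap.sub_apply, transfer_of,
      LinearMap.id_apply, fundamental, realize_chain]
    congr 2
    exact Sing.ext fun p => congrArg (toMap x) (comb_vertex p)
  exact LinearMap.congr_fun this c

variable (R) in
/-- The iterated subdivision. -/
noncomputable def iterate (r : ℕ) : AffineOperator R where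
  op n := (subdivision R mid) ^ r
  push_op {k n} φ c := by
    induction r generalizing c with
    | zero => rfl
    | succ r ih =>
      rw [pow_succ, pow_succ, Module.End.mul_apply, Module.End.mul_apply, ih,
        push_subdivision _ (map_mid φ)]

theorem dT_iterate (r n : ℕ) (c) :
    dT R ((iterate R r).op n c) = (iterate R r).op n (dT R c) := by
  change dT R (((subdivision R mid) ^ r) c) = ((subdivision R mid) ^ r) (dT R c)
  induction r generalizing c with
  | zero => rfl
  | succ r ih =>
    rw [pow_succ, Module.End.mul_apply, Module.End.mul_apply, ih, dT_subdivision]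

variable (R) in
/-- The homotopy between the identity and the iterated subdivision. -/
noncomputable def iterateHomotopy (r : ℕ) : AffineOperator R where
  op n := ∑ s ∈ Finset.range r, subdivisionHomotopy R mid ∘ₗ ((subdivision R mid) ^ s)
  push_op {k n} φ c := by
    simp only [LinearMap.sum_apply, map_sum, LinearMap.comp_apply]
    refine Finset.sum_congr rfl fun s _ => ?_
    rw [push_subdivisionHomotopy _ (map_mid φ)]
    exact congrArg _ ((iterate R s).push_op φ c)

theorem dT_iterateHomotopy (r n : ℕ) (c) :
    dT R ((iterateHomotopy R r).op n c) + (iterateHomotopy R r).op n (dT R c) =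
      (iterate R r).op n c - c := by
  simp only [iterateHomotopy, LinearMap.sum_apply, map_sum, LinearMap.comp_apply]
  rw [← Finset.sum_add_distrib]
  have : ∀ s, dT R (subdivisionHomotopy R mid (((subdivision R mid) ^ s) c)) +
      subdivisionHomotopy R mid (((subdivision R mid) ^ s) (dT R c)) =
      ((subdivision R mid) ^ (s + 1)) c - ((subdivision R mid) ^ s) c := fun s => by
    have e : ((subdivision R mid) ^ s) (dT R c) = dT R (((subdivision R mid) ^ s) c) :=
      (dT_iterate s n c).symm
    rw [e, dT_subdivisionHomotopy, pow_succ', Module.End.mul_apply]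
  simp only [this]
  exact Finset.sum_range_sub (fun s => ((subdivision R mid) ^ s) c) r

theorem iterate_fine (r n : ℕ) : (iterate R r).op n (fundamental R n) ∈ fine R n ((1 / 2) ^ r) := by
  change ((subdivision R mid) ^ r) (fundamental R n) ∈ fine R n ((1 / 2) ^ r)
  induction r with
  | zero =>
    rw [pow_zero]
    exact Submodule.subset_span ⟨_, fun i => dist_le_one _ _, rfl⟩
  | succ r ih =>
    rw [pow_succ (1 / 2 : ℝ), mul_one_div, pow_succ', Module.End.mul_apply]
    exact subdivision_fine mid_self dist_mid_left dist_mid_right ih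

end AffineOperator

open AffineOperator

theorem realize_fine {n : ℕ} {σ : C(StdSimplex n, T)} {U' V' X U V : Set T}
    (hU' : IsOpen U') (hV' : IsOpen V') (hX : X ⊆ U' ∪ V') (hU : X ∩ U' ⊆ U) (hV : X ∩ V' ⊆ V)
    (hσ : ∀ p, σ p ∈ X) : ∃ δ : ℝ, 0 < δ ∧ ∀ M : ℝ, n * M < δ → ∀ c ∈ fine R n M,
      realize R σ c ∈ chainsIn R U ⊔ chainsIn R V := by
  obtain ⟨δ, hδ, h⟩ := lebesgue_number_lemma_of_metric (s := Set.univ)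
    (c := fun b : Bool => cond b (σ ⁻¹' U') (σ ⁻¹' V')) (isCompact_univ (X := StdSimplex n))
    (by
      rintro (_ | _)
      · exact hV'.preimage σ.continuous
      · exact hU'.preimage σ.continuous)
    (fun p _ => by
      rcases hX (hσ p) with hp | hp
      · exact Set.mem_iUnion.2 ⟨true, hp⟩
      · exact Set.mem_iUnion.2 ⟨false, hp⟩)
  refine ⟨δ, hδ, fun M hM => ?_⟩
  have hle : fine R n M ≤ (chainsIn R U ⊔ chainsIn R V).comap (realize R σ) := by
    rw [fine, Submodule.span_le]
    rintro _ ⟨w, hw, rfl⟩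
    change realize R σ (chain R w) ∈ chainsIn R U ⊔ chainsIn R V
    rw [realize_chain]
    have hb : ∀ p, comb w p ∈ Metric.ball (w 0) δ := fun p => (dist_comb_le hw p).trans_lt hM
    obtain ⟨b, hb'⟩ := h (w 0) trivial
    cases b with
    | false => exact Submodule.mem_sup_right (of_mem_chainsIn fun p => hV ⟨hσ _, hb' (hb p)⟩)
    | true => exact Submodule.mem_sup_left (of_mem_chainsIn fun p => hU ⟨hσ _, hb' (hb p)⟩)
  exact hle

theorem exists_iterate_mem {U' V' X U V : Set T}
    (hU' : IsOpen U') (hV' : IsOpen V') (hX : X ⊆ U' ∪ V') (hU : X ∩ U' ⊆ U) (hV : X ∩ V' ⊆ V)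
    {c : SingChains R T} (hc : c ∈ chainsIn R X) :
    ∃ r₀, ∀ r ≥ r₀, (iterate R r).transfer c ∈ chainsIn R U ⊔ chainsIn R V := by
  induction hc using Submodule.span_induction with
  | mem c hc =>
    obtain ⟨n, x, hx, rfl⟩ := hc
    obtain ⟨δ, hδ, h⟩ := realize_fine (R := R) (σ := toMap x) hU' hV' hX hU hV hx
    have ht : Filter.Tendsto (fun r : ℕ => (n : ℝ) * (1 / 2) ^ r) Filter.atTop (nhds 0) := by
      have := (tendsto_pow_atTop_nhds_zero_of_lt_one (r := (1 / 2 : ℝ)) (by norm_num)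
        (by norm_num)).const_mul (n : ℝ)
      rwa [mul_zero] at this
    obtain ⟨r₀, hr₀⟩ := Filter.eventually_atTop.1 (ht.eventually (gt_mem_nhds hδ))
    refine ⟨r₀, fun r hr => ?_⟩
    rw [transfer_of]
    exact h _ (hr₀ r hr) _ (iterate_fine r n)
  | zero => exact ⟨0, fun r _ => by rw [map_zero]; exact zero_mem _⟩
  | add c c' _ _ h h' =>
    obtain ⟨r, h⟩ := h
    obtain ⟨r', h'⟩ := h'
    refine ⟨max r r', fun s hs => ?_⟩
    rw [map_add]
    exact add_mem (h s (le_of_max_le_left hs)) (h' s (le_of_max_le_right hs))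
  | smul a c _ h =>
    obtain ⟨r, h⟩ := h
    refine ⟨r, fun s hs => ?_⟩
    rw [map_smul]
    exact Submodule.smul_mem _ _ (h s hs)

/-- Excision: chains that are small with respect to a cover by two sets with interiors covering the
whole set have the same homology as all chains. -/
theorem isQI_small {U' V' X U V : Set T}
    (hU' : IsOpen U') (hV' : IsOpen V') (hX : X ⊆ U' ∪ V') (hU : X ∩ U' ⊆ U) (hV : X ∩ V' ⊆ V)
    (hUX : U ⊆ X) (hVX : V ⊆ X) :
    IsQI (singD R) (singD R) LinearMap.id (chainsIn R U ⊔ chainsIn R V) (chainsIn R X) := by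
  have hle : chainsIn R U ⊔ chainsIn R V ≤ chainsIn R X :=
    sup_le (chainsIn_mono hUX) (chainsIn_mono hVX)
  have hsup : ∀ f : SingChains R T →ₗ[R] SingChains R T,
      (∀ A : Set T, ∀ c ∈ chainsIn R A, f c ∈ chainsIn R A) →
      ∀ c ∈ chainsIn R U ⊔ chainsIn R V, f c ∈ chainsIn R U ⊔ chainsIn R V := by
    intro f hf c hc
    obtain ⟨a, ha, b, hb, rfl⟩ := Submodule.mem_sup.1 hc
    rw [map_add]
    exact Submodule.add_mem_sup (hf _ a ha) (hf _ b hb)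
  refine ⟨fun a ha => hle ha, fun a _ => rfl, hsup _ fun A c => singD_mem, fun b => singD_mem,
    fun a ha hda b hb hab => ?_, fun b hb hdb => ?_⟩
  · obtain ⟨r, hr⟩ := exists_iterate_mem hU' hV' hX hU hV hb
    have h1 := singD_transfer_add (dT_iterateHomotopy r) a
    have h2 := singD_transfer _ (dT_iterate r) b
    rw [hda, map_zero, add_zero] at h1
    refine ⟨(iterate R r).transfer b - (iterateHomotopy R r).transfer a,
      sub_mem (hr r le_rfl) (hsup _ (fun A c => transfer_mem _) a ha), ?_⟩
    rw [map_sub, h1, h2, hab, LinearMap.id_apply]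
    abel
  · obtain ⟨r, hr⟩ := exists_iterate_mem hU' hV' hX hU hV hb
    have h1 := singD_transfer_add (dT_iterateHomotopy r) b
    have h2 := singD_transfer _ (dT_iterate r) b
    rw [hdb, map_zero] at h1 h2
    refine ⟨(iterate R r).transfer b, hr r le_rfl, h2, (iterateHomotopy R r).transfer b,
      transfer_mem _ hb, ?_⟩
    rw [LinearMap.id_apply, ← h1, add_zero]

end SmallSimplices

/-! ### Products with a circle -/

section CircleAlgebra

variable {R : Type} [CommRing R] {M N : Type} [AddCommGroup M] [Module R M] [AddCommGroup N]
  [Module R N] {dM : M →ₗ[R] M} {dN : N →ₗ[R] N} {f : M →ₗ[R] N}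

/-- The Wang sequence of an infinite cyclic covering `q : B → B'` with deck transformation `t`, in
terms of elements. If `t` is homotopic to the identity via `D` and if `A → B` is a
quasi-isomorphism, then so is `A ⊕ V A → B'`, where `V` is an operator of degree `1` that corresponds
to `q ∘ D`. The linear map `ρ` selects the second component of `A ⊕ V A`. -/
theorem IsQI.cyclicCover {A : Submodule R M} {B B' : Submodule R N} (V ρ : M →ₗ[R] M)
    (q t D : N →ₗ[R] N) (h : IsQI dM dN f A B) (hV : ∀ a ∈ A, dM (V a) = - V (dM a))
    (hρ : ∀ a ∈ A, ρ a = 0) (hρV : ∀ a ∈ A, ρ (V a) = a) (hfV : ∀ a ∈ A, f (V a) = q (D (f a)))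
    (hqf : ∀ a ∈ A, q (f a) = f a) (hqd : ∀ x, q (dN x) = dN (q x))
    (htd : ∀ x, t (dN x) = dN (t x)) (hdd : ∀ x, dN (dN x) = 0)
    (hD : ∀ x, dN (D x) + D (dN x) = t x - x) (hDB : ∀ x ∈ B, D x ∈ B) (htB : ∀ x ∈ B, t x ∈ B)
    (hqB : ∀ x ∈ B, q x ∈ B') (hqt : ∀ x, q (t x) = q x) (hlift : ∀ y ∈ B', ∃ x ∈ B, q x = y)
    (hker : ∀ x ∈ B, q x = 0 → ∃ y ∈ B, x = y - t y) (hinj : ∀ x ∈ B, t x = x → x = 0) :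
    IsQI dM dN f (A ⊔ A.map V) B' := by
  have hqB' : ∀ a ∈ A, f a ∈ B' := fun a ha => hqf a ha ▸ hqB _ (h.map_mem a ha)
  have split : ∀ x ∈ A ⊔ A.map V, ∃ a ∈ A, ∃ b ∈ A, x = a + V b := by
    intro x hx
    obtain ⟨a, ha, _, ⟨b, hb, rfl⟩, rfl⟩ := Submodule.mem_sup.1 hx
    exact ⟨a, ha, b, hb, rfl⟩
  have mk : ∀ a ∈ A, ∀ b ∈ A, a + V b ∈ A ⊔ A.map V := fun a ha b hb =>
    Submodule.add_mem_sup ha (Submodule.mem_map_of_mem hb)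
  have hDf : ∀ a ∈ A, dN (D (f a)) = t (f a) - f a - D (f (dM a)) := fun a ha => by
    rw [h.comm a ha, ← hD]
    abel
  have hdV : ∀ a ∈ A, ∀ b ∈ A, dM (a + V b) = dM a + V (- dM b) := fun a _ b hb => by
    rw [map_add, hV b hb, map_neg]
  refine ⟨?_, ?_, ?_, ?_, ?_, ?_⟩
  · intro x hx
    obtain ⟨a, ha, b, hb, rfl⟩ := split x hx
    rw [map_add, hfV b hb]
    exact add_mem (hqB' a ha) (hqB _ (hDB _ (h.map_mem b hb)))
  · intro x hx
    obtain ⟨a, ha, b, hb, rfl⟩ := split x hx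
    rw [hdV a ha b hb, map_add, map_add, map_add, h.comm a ha, hfV _ (neg_mem (h.d_left b hb)),
      hfV b hb, ← hqd, hDf b hb, map_sub, map_sub, hqt, sub_self, zero_sub, map_neg, map_neg,
      map_neg]
  · intro x hx
    obtain ⟨a, ha, b, hb, rfl⟩ := split x hx
    rw [hdV a ha b hb]
    exact mk _ (h.d_left a ha) _ (neg_mem (h.d_left b hb))
  · intro y hy
    obtain ⟨x, hx, rfl⟩ := hlift y hy
    rw [← hqd]
    exact hqB _ (h.d_right x hx)
  · intro x hx hdx y hy hyx
    obtain ⟨a, ha, b, hb, rfl⟩ := split x hx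
    have hdb : dM b = 0 := by
      have := congrArg ρ hdx
      rw [hdV a ha b hb, map_add, hρ _ (h.d_left a ha), hρV _ (neg_mem (h.d_left b hb)),
        map_zero, zero_add, neg_eq_zero] at this
      exact this
    have hda : dM a = 0 := by
      rwa [hdV a ha b hb, hdb, neg_zero, map_zero, add_zero] at hdx
    obtain ⟨x, hx, rfl⟩ := hlift y hy
    obtain ⟨z, hz, ez⟩ := hker (f a + D (f b) - dN x)
      (sub_mem (add_mem (h.map_mem a ha) (hDB _ (h.map_mem b hb))) (h.d_right x hx))
      (by rw [map_sub, map_add, hqf a ha, ← hfV b hb, hqd, hyx, map_add, sub_self])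
    have hDb : dN (D (f b)) = t (f b) - f b := by
      rw [hDf b hb, hdb, map_zero, map_zero, sub_zero]
    have e1 : f b = - dN z := by
      have h1 : dN (f a) = 0 := by rw [← h.comm a ha, hda, map_zero]
      have h2 := congrArg dN ez
      rw [map_sub, map_add, hdd, h1, hDb, map_sub, ← htd] at h2
      refine eq_neg_of_add_eq_zero_left (hinj _ (add_mem (h.map_mem b hb) (h.d_right z hz)) ?_)
      rw [map_add]
      have h3 : t (f b) - f b = dN z - t (dN z) := by rw [← h2]; abel
      rw [← sub_eq_zero, ← sub_eq_zero.2 h3]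
      abel
    obtain ⟨b', hb', eb'⟩ := h.inj b hb hdb (- z) (neg_mem hz) (by rw [map_neg, e1])
    obtain ⟨a₁, ha₁, hda₁, g, hg, eg⟩ := h.surj (f b' + z) (add_mem (h.map_mem b' hb') hz)
      (by rw [map_add, ← h.comm b' hb', eb', e1, neg_add_cancel])
    have hb'' : b' - a₁ ∈ A := sub_mem hb' ha₁
    have hdb'' : dM (b' - a₁) = b := by rw [map_sub, eb', hda₁, sub_zero]
    have hz' : z = - f (b' - a₁) - dN g := by rw [← eg, map_sub]; abel
    have key := hDf _ hb''
    rw [hdb''] at key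
    obtain ⟨a', ha', ea'⟩ := h.inj a ha hda (x + D (f (b' - a₁)) - (g - t g))
      (sub_mem (add_mem hx (hDB _ (h.map_mem _ hb''))) (sub_mem hg (htB g hg))) (by
        rw [map_sub dN, map_add, key, map_sub dN, ← htd]
        have e2 : f a = z - t z - D (f b) + dN x := by rw [← ez]; abel
        rw [e2, hz']
        simp only [map_sub, map_neg]
        abel)
    refine ⟨a' + V (- (b' - a₁)), mk _ ha' _ (neg_mem hb''), ?_⟩
    rw [hdV a' ha' _ (neg_mem hb''), ea', map_neg dM, hdb'', neg_neg]
  · intro y hy hdy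
    obtain ⟨x, hx, rfl⟩ := hlift y hy
    obtain ⟨e, he, ee⟩ := hker (dN x) (h.d_right x hx) (by rw [hqd, hdy])
    have hde : dN e = 0 := by
      refine hinj _ (h.d_right e he) ?_
      have := congrArg dN ee
      rw [hdd, map_sub, ← htd] at this
      exact (sub_eq_zero.1 this.symm).symm
    obtain ⟨b, hb, hdb, g, hg, eg⟩ := h.surj e he hde
    have hDb := hDf b hb
    rw [hdb, map_zero, map_zero, sub_zero] at hDb
    have he' : e = f b - dN g := by rw [← eg]; abel
    obtain ⟨a, ha, hda, k, hk, ek⟩ := h.surj (x + D (f b) + (g - t g))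
      (add_mem (add_mem hx (hDB _ (h.map_mem b hb))) (sub_mem hg (htB g hg))) (by
        rw [map_add, map_add, ee, hDb, map_sub dN, ← htd, he', map_sub]
        abel)
    refine ⟨a + V (- b), mk a ha _ (neg_mem hb), by
      rw [hdV a ha _ (neg_mem hb), hda, map_neg dM, hdb, neg_zero, neg_zero, map_zero, add_zero],
      q k, hqB k hk, ?_⟩
    have := congrArg q ek
    rw [map_sub, map_add, map_add, map_sub, hqt, sub_self, add_zero, hqf a ha, ← hfV b hb,
      hqd] at this
    rw [← this, map_add, map_neg, map_neg]
    abel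

end CircleAlgebra

section CircleTopology

open Simplicial Opposite
open NormalizedChains Sing

theorem prismOp_congr {R : Type} [CommRing R] {T T' : Type} [TopologicalSpace T]
    [TopologicalSpace T'] {H H' : C(ℝ × T, T')} {A : Set T}
    (h : ∀ s, ∀ a ∈ A, H (s, a) = H' (s, a)) {c : SingChains R T} (hc : c ∈ chainsIn R A) :
    prismOp R H c = prismOp R H' c := by
  refine eqOn_chainsIn (fun n x hx => ?_) c hc
  rw [prismOp, prismOp, SimplicialPrism.op_of, SimplicialPrism.op_of]
  refine Finset.sum_congr rfl fun j _ => ?_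
  congr 2
  exact Sing.ext fun p => h _ _ (hx _)

instance (n : ℕ) : LocallyPathConnectedSpace (StdSimplex n) :=
  (convex_stdSimplex ℝ _).locallyPathConnectedSpace

instance (n : ℕ) : ContractibleSpace (StdSimplex n) :=
  (convex_stdSimplex ℝ (Fin (n + 1))).contractibleSpace ⟨_, single_mem_stdSimplex ℝ 0⟩

/-- The covering of the circle by the real line. -/
noncomputable def circ (s : ℝ) : ℂ := Complex.exp (2 * Real.pi * s * Complex.I)

theorem continuous_circ : Continuous circ := by
  unfold circ
  fun_prop

theorem norm_circ (s : ℝ) : ‖circ s‖ = 1 := by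
  have : circ s = Complex.exp ((2 * Real.pi * s : ℝ) * Complex.I) := by
    rw [circ]
    push_cast
    rfl
  rw [this, Complex.norm_exp_ofReal_mul_I]

theorem circ_eq_iff {s s' : ℝ} : circ s = circ s' ↔ ∃ N : ℤ, s = s' + N := by
  rw [circ, circ, Complex.exp_eq_exp_iff_exists_int]
  refine exists_congr fun N => ?_
  have h : (2 * Real.pi * Complex.I : ℂ) ≠ 0 := Complex.two_pi_I_ne_zero
  constructor
  · intro e
    have e1 : (2 * Real.pi * Complex.I : ℂ) * s = (2 * Real.pi * Complex.I) * (s' + N) := by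
      linear_combination e
    exact_mod_cast mul_left_cancel₀ h e1
  · rintro rfl
    push_cast
    ring

theorem circ_add_one (s : ℝ) : circ (s + 1) = circ s := circ_eq_iff.2 ⟨1, by simp⟩

theorem circ_zero : circ 0 = 1 := by simp [circ]

theorem circ_one : circ 1 = 1 := by rw [← zero_add (1 : ℝ), circ_add_one, circ_zero]

/-- Two lifts of a map to the circle differ by an integer. -/
theorem lift_unique {n : ℕ} {θ θ' : C(StdSimplex n, ℝ)} (h : ∀ p, circ (θ p) = circ (θ' p)) :
    ∃ N : ℤ, ∀ p, θ p = θ' p + N := by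
  have hc : Continuous fun p => θ p - θ' p := by fun_prop
  have hi : ∀ p, ∃ N : ℤ, θ p - θ' p = N := fun p => by
    obtain ⟨N, hN⟩ := circ_eq_iff.1 (h p)
    exact ⟨N, by rw [hN]; ring⟩
  choose N hN using hi
  have hN' : Continuous N := by
    refine Int.isClosedEmbedding_coe_real.continuous_iff.2 ?_
    have e : ((↑) : ℤ → ℝ) ∘ N = fun p => θ p - θ' p := funext fun p => (hN p).symm
    rw [e]
    exact hc
  refine ⟨N (stdSimplex.vertex 0), fun p => ?_⟩
  rw [← PreconnectedSpace.constant (inferInstance : PreconnectedSpace (StdSimplex n)) hN'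
    (x := p), ← hN]
  ring

/-- Maps from a simplex to the circle lift to the real line. -/
theorem exists_lift {n : ℕ} (g : C(StdSimplex n, ℂ)) (hg : ∀ p, ‖g p‖ = 1) :
    ∃ θ : C(StdSimplex n, ℝ), (∀ p, circ (θ p) = g p) ∧ θ (stdSimplex.vertex 0) ∈ Set.Ico 0 1 := by
  let g' : C(StdSimplex n, Circle) := ⟨fun p => ⟨g p, by simp [Submonoid.unitSphere, hg p]⟩,
    by fun_prop⟩
  obtain ⟨F, ⟨-, hF⟩, -⟩ := Circle.isCoveringMap_exp.existsUnique_continuousMap_lifts g'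
    (stdSimplex.vertex 0) _ (Circle.exp_arg _)
  have h1 : ∀ p, circ (F p / (2 * Real.pi)) = g p := fun p => by
    have := congrArg (fun z : Circle => (z : ℂ)) (congrFun hF p)
    simp only [Function.comp_apply, Circle.coe_exp] at this
    rw [circ, ← show _ = g p from this]
    congr 1
    have : (Real.pi : ℂ) ≠ 0 := by exact_mod_cast Real.pi_ne_zero
    push_cast
    field_simp
  let k : ℤ := ⌊F (stdSimplex.vertex 0) / (2 * Real.pi)⌋
  refine ⟨⟨fun p => F p / (2 * Real.pi) - k, by fun_prop⟩, fun p => ?_, ?_, ?_⟩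
  · rw [← h1]
    exact circ_eq_iff.2 ⟨-k, by simp [sub_eq_add_neg]⟩
  · exact Int.fract_nonneg _
  · exact Int.fract_lt_one _

variable {m : ℕ}

/-- The map that sets one coordinate to `1`. -/
noncomputable def setOne (i : Fin m) : C(Fin m → ℂ, Fin m → ℂ) :=
  ⟨fun z => Function.update z i 1, by fun_prop⟩

/-- The map that winds the real line in one coordinate around the circle. -/
noncomputable def wrap (i : Fin m) : C(Fin m → ℂ, Fin m → ℂ) :=
  ⟨fun z => Function.update z i (circ (z i).re), by
    have := continuous_circ
    fun_prop⟩

/-- The homotopy that translates one coordinate by a real number. -/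
noncomputable def shift (i : Fin m) : C(ℝ × (Fin m → ℂ), Fin m → ℂ) :=
  ⟨fun q => Function.update q.2 i (q.2 i + q.1), by fun_prop⟩

/-- The homotopy that lets one coordinate run through the circle. -/
noncomputable def circleLoop (i : Fin m) : C(ℝ × (Fin m → ℂ), Fin m → ℂ) :=
  ⟨fun q => Function.update q.2 i (circ q.1), by
    have := continuous_circ
    fun_prop⟩

theorem wrap_apply (i : Fin m) (z : Fin m → ℂ) :
    wrap i z = Function.update z i (circ (z i).re) := rfl

theorem shift_apply (i : Fin m) (s : ℝ) (z : Fin m → ℂ) :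
    shift i (s, z) = Function.update z i (z i + s) := rfl

theorem circleLoop_apply (i : Fin m) (s : ℝ) (z : Fin m → ℂ) :
    circleLoop i (s, z) = Function.update z i (circ s) := rfl

variable {R : Type} [CommRing R] (i : Fin m)

/-- The points with real `i`-th coordinate whose other coordinates are those of a point in `Y`. -/
def lineOver (Y : Set (Fin m → ℂ)) : Set (Fin m → ℂ) :=
  {z | Function.update z i 1 ∈ Y ∧ (z i).im = 0}

/-- The points with `i`-th coordinate on the circle whose other coordinates are those of a point in
`Y`. -/
def circleOver (Y : Set (Fin m → ℂ)) : Set (Fin m → ℂ) :=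
  {z | Function.update z i 1 ∈ Y ∧ ‖z i‖ = 1}

variable {i} {Y : Set (Fin m → ℂ)}

theorem update_real_mem {z : Fin m → ℂ} (hz : Function.update z i 1 ∈ Y) (s : ℝ) :
    Function.update z i (s : ℂ) ∈ lineOver i Y := by
  constructor
  · rwa [Function.update_idem]
  · rw [Function.update_self, Complex.ofReal_im]

theorem wrap_mem {z : Fin m → ℂ} (hz : z ∈ lineOver i Y) : wrap i z ∈ circleOver i Y := by
  constructor
  · change Function.update (Function.update z i _) i 1 ∈ Y
    rw [Function.update_idem]
    exact hz.1
  · change ‖Function.update z i _ i‖ = 1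
    rw [Function.update_self, norm_circ]

theorem shift_mem (s : ℝ) {z : Fin m → ℂ} (hz : z ∈ lineOver i Y) :
    shift i (s, z) ∈ lineOver i Y := by
  have : z i + s = ((z i).re + s : ℝ) := by
    apply Complex.ext <;> simp [hz.2]
  change Function.update z i (z i + s) ∈ _
  rw [this]
  exact update_real_mem hz.1 _

open Classical in
/-- The lift of a simplex in `circleOver i Y` to `lineOver i Y` whose initial vertex has `i`-th
coordinate in `[0, 1)`. -/
noncomputable def liftSimplex (i : Fin m) {n : ℕ} (x : Sing (Fin m → ℂ) _⦋n⦌) :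
    Sing (Fin m → ℂ) _⦋n⦌ :=
  if h : ∀ p, ‖toMap x p i‖ = 1 then
    ofMap ⟨fun p => Function.update (toMap x p) i
      (((exists_lift ⟨fun p => toMap x p i, by fun_prop⟩ h).choose p : ℝ) : ℂ), by fun_prop⟩
  else x

theorem liftSimplex_spec {n : ℕ} {x : Sing (Fin m → ℂ) _⦋n⦌} (h : ∀ p, ‖toMap x p i‖ = 1) :
    ∃ θ : C(StdSimplex n, ℝ), (∀ p, circ (θ p) = toMap x p i) ∧
      θ (stdSimplex.vertex 0) ∈ Set.Ico 0 1 ∧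
      ∀ p, toMap (liftSimplex i x) p = Function.update (toMap x p) i ((θ p : ℝ) : ℂ) := by
  have hs := (exists_lift ⟨fun p => toMap x p i, by fun_prop⟩ h).choose_spec
  refine ⟨_, hs.1, hs.2, fun p => ?_⟩
  rw [liftSimplex, dif_pos h]
  rfl

/-- The chosen lift is determined by its characteristic properties. -/
theorem liftSimplex_eq {n : ℕ} {x y : Sing (Fin m → ℂ) _⦋n⦌} (h : ∀ p, ‖toMap x p i‖ = 1)
    (θ : C(StdSimplex n, ℝ)) (hθ : ∀ p, circ (θ p) = toMap x p i)
    (h0 : θ (stdSimplex.vertex 0) ∈ Set.Ico 0 1)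
    (hy : ∀ p, toMap y p = Function.update (toMap x p) i ((θ p : ℝ) : ℂ)) :
    liftSimplex i x = y := by
  obtain ⟨θ', h1, h2, h3⟩ := liftSimplex_spec h
  obtain ⟨N, hN⟩ := lift_unique (θ := θ') (θ' := θ) fun p => (h1 p).trans (hθ p).symm
  have hN0 : N = 0 := by
    have := hN (stdSimplex.vertex 0)
    have l1 : (-1 : ℝ) < N := by linarith [h0.1, h0.2, h2.1, h2.2]
    have l2 : (N : ℝ) < 1 := by linarith [h0.1, h0.2, h2.1, h2.2]
    have l3 : (-1 : ℤ) < N := by exact_mod_cast l1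
    have l4 : N < 1 := by exact_mod_cast l2
    omega
  refine Sing.ext fun p => ?_
  rw [h3, hy, hN, hN0, Int.cast_zero, add_zero]

theorem liftSimplex_degenerate {n : ℕ} {x : Sing (Fin m → ℂ) _⦋n⦌}
    (hx : x ∈ (Sing (Fin m → ℂ)).degenerate n) :
    liftSimplex i x ∈ (Sing (Fin m → ℂ)).degenerate n := by
  by_cases h : ∀ p, ‖toMap x p i‖ = 1
  swap
  · rwa [liftSimplex, dif_neg h]
  obtain ⟨k, rfl, j, y, hy⟩ := exists_σ hx
  obtain rfl : x = (Sing _).map (SimplexCategory.σ j).op y := hy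
  have hy : ∀ p, ‖toMap y p i‖ = 1 := fun p => by
    have := h (stdSimplex.map (SimplexCategory.δ j.castSucc).toOrderHom p)
    rw [toMap_map, stdSimplex.map_comp_apply] at this
    have e : (SimplexCategory.σ j).toOrderHom ∘ (SimplexCategory.δ j.castSucc).toOrderHom = id := by
      have := SimplexCategory.δ_comp_σ_self (i := j)
      exact congrArg (fun f => (f.toOrderHom : Fin (k + 1) → Fin (k + 1))) this
    rwa [e, stdSimplex.map_id_apply] at this
  obtain ⟨θ, h1, h2, h3⟩ := liftSimplex_spec hy
  have : liftSimplex i ((Sing _).map (SimplexCategory.σ j).op y) =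
      (Sing _).map (SimplexCategory.σ j).op (liftSimplex i y) := by
    refine liftSimplex_eq h (θ.comp ⟨stdSimplex.map (SimplexCategory.σ j).toOrderHom,
      stdSimplex.continuous_map _⟩) (fun p => ?_) ?_ fun p => ?_
    · rw [ContinuousMap.comp_apply, h1, toMap_map]
      rfl
    · rw [ContinuousMap.comp_apply]
      change θ (stdSimplex.map _ (stdSimplex.vertex 0)) ∈ _
      rw [stdSimplex.map_vertex]
      have : (SimplexCategory.σ j).toOrderHom 0 = 0 := by
        change j.predAbove 0 = 0
        exact Fin.ext (by rw [predAbove_val]; simp)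
      rwa [this]
    · rw [toMap_map, toMap_map, h3]
      rfl
  rw [this]
  exact ⟨k, Nat.lt_succ_self k, SimplexCategory.σ j, _, rfl⟩

variable (R) in
/-- The linear extension of `liftSimplex`. -/
noncomputable def liftChains (i : Fin m) : SingChains R (Fin m → ℂ) →ₗ[R] SingChains R (Fin m → ℂ) :=
  lift (fun _ x => of R (liftSimplex i x)) fun _ _ hx => of_degenerate R (liftSimplex_degenerate hx)

theorem liftChains_of {n : ℕ} (x : Sing (Fin m → ℂ) _⦋n⦌) :
    liftChains R i (of R x) = of R (liftSimplex i x) := lift_of _ _ x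

theorem liftChains_mem {c : SingChains R (Fin m → ℂ)} (hc : c ∈ chainsIn R (circleOver i Y)) :
    liftChains R i c ∈ chainsIn R (lineOver i Y) := by
  refine chainsIn_le (N := (chainsIn R (lineOver i Y)).comap (liftChains R i))
    (fun n x hx => ?_) hc
  rw [Submodule.mem_comap, liftChains_of]
  obtain ⟨θ, -, -, h⟩ := liftSimplex_spec fun p => (hx p).2
  refine of_mem_chainsIn fun p => ?_
  rw [h]
  exact update_real_mem (hx p).1 _

theorem wrap_liftChains {c : SingChains R (Fin m → ℂ)} (hc : c ∈ chainsIn R (circleOver i Y)) :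
    pushChains R (wrap i) (liftChains R i c) = c := by
  refine eqOn_chainsIn (f := pushChains R (wrap i) ∘ₗ liftChains R i) (g := LinearMap.id)
    (fun n x hx => ?_) c hc
  rw [LinearMap.comp_apply, liftChains_of, pushChains_of]
  obtain ⟨θ, h1, -, h⟩ := liftSimplex_spec fun p => (hx p).2
  refine congrArg (of R) (Sing.ext fun p => ?_)
  rw [toMap_map_app, h, wrap_apply, Function.update_self, Complex.ofReal_re, h1, Function.update_idem, Function.update_eq_self]

variable (i) in
/-- The deck transformation. -/
noncomputable def deck : C(Fin m → ℂ, Fin m → ℂ) := slice (shift i) 1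

theorem deck_apply (z : Fin m → ℂ) : deck i z = Function.update z i (z i + 1) := by
  change Function.update z i (z i + ((1 : ℝ) : ℂ)) = _
  rw [Complex.ofReal_one]

theorem wrap_deck : (wrap i).comp (deck i) = wrap i := by
  refine ContinuousMap.ext fun z => ?_
  rw [ContinuousMap.comp_apply, deck_apply]
  change Function.update (Function.update z i _) i (circ (Function.update z i _ i).re) =
    Function.update z i (circ (z i).re)
  rw [Function.update_self, Function.update_idem, Complex.add_re, Complex.one_re, circ_add_one]

/-- Translates by an integer differ by elements in the image of `1 - t`. -/
theorem translate_sub_mem (N : ℤ) {c : SingChains R (Fin m → ℂ)}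
    (hc : c ∈ chainsIn R (lineOver i Y)) :
    ∃ y ∈ chainsIn R (lineOver i Y), pushChains R (slice (shift i) N) c - c =
      y - pushChains R (deck i) y := by
  have hmem : ∀ s : ℝ, pushChains R (slice (shift i) s) c ∈ chainsIn R (lineOver i Y) :=
    fun s => pushChains_mem (fun a ha => shift_mem s ha) hc
  have hadd : ∀ s : ℝ, pushChains R (deck i) (pushChains R (slice (shift i) s) c) =
      pushChains R (slice (shift i) (s + 1)) c := fun s => by
    rw [pushChains_comp]
    congr 1
    congr 1
    refine ContinuousMap.ext fun z => ?_
    rw [ContinuousMap.comp_apply, deck_apply, slice_apply, slice_apply, shift_apply, shift_apply,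
      Function.update_self, Function.update_idem, Complex.ofReal_add, Complex.ofReal_one, add_assoc]
  induction N using Int.induction_on with
  | zero =>
    refine ⟨0, zero_mem _, ?_⟩
    rw [map_zero, sub_zero, sub_eq_zero, Int.cast_zero]
    have e : slice (shift i) 0 = ContinuousMap.id _ := ContinuousMap.ext fun z => by
      change Function.update z i (z i + ((0 : ℝ) : ℂ)) = z
      rw [Complex.ofReal_zero, add_zero, Function.update_eq_self]
    rw [e, pushChains_id]
  | succ N ih =>
    obtain ⟨y, hy, e⟩ := ih
    refine ⟨y - pushChains R (slice (shift i) (N : ℤ)) c, sub_mem hy (hmem _), ?_⟩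
    rw [map_sub, hadd, Int.cast_add, Int.cast_one, sub_sub_sub_comm, ← e]
    abel
  | pred N ih =>
    obtain ⟨y, hy, e⟩ := ih
    refine ⟨y + pushChains R (slice (shift i) ((-(N : ℤ) - 1 : ℤ) : ℝ)) c,
      add_mem hy (hmem _), ?_⟩
    rw [map_add, hadd, add_sub_add_comm, ← e]
    have e2 : (((-(N : ℤ) - 1 : ℤ) : ℝ) + 1) = ((-(N : ℤ) : ℤ) : ℝ) := by push_cast; ring
    rw [e2]
    abel

/-- A chain differs from the lift of its projection by an element in the image of `1 - t`. -/
theorem sub_lift_mem {c : SingChains R (Fin m → ℂ)} (hc : c ∈ chainsIn R (lineOver i Y)) :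
    ∃ y ∈ chainsIn R (lineOver i Y), c - liftChains R i (pushChains R (wrap i) c) =
      y - pushChains R (deck i) y := by
  have hle : chainsIn R (lineOver i Y) ≤ ((chainsIn R (lineOver i Y)).map
      (LinearMap.id - pushChains R (deck i))).comap
        (LinearMap.id - liftChains R i ∘ₗ pushChains R (wrap i)) := by
    refine chainsIn_le fun n x hx => ?_
    let x' : Sing (Fin m → ℂ) _⦋n⦌ := (Sing.map (wrap i)).app _ x
    have hx' : ∀ p, toMap x' p ∈ circleOver i Y := fun p => wrap_mem (hx p)
    obtain ⟨θ, h1, -, h3⟩ := liftSimplex_spec fun p => (hx' p).2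
    have e1 : ∀ p, toMap x' p = Function.update (toMap x p) i (circ (toMap x p i).re) := fun p => rfl
    obtain ⟨N, hN⟩ := lift_unique (θ := ⟨fun p => (toMap x p i).re, by fun_prop⟩) (θ' := θ)
      fun p => by
        rw [h1, e1, Function.update_self]
        rfl
    obtain ⟨y, hy, e⟩ := translate_sub_mem N (liftChains_mem (R := R) (of_mem_chainsIn hx'))
    refine ⟨y, hy, ?_⟩
    change y - pushChains R (deck i) y = of R x - liftChains R i (pushChains R (wrap i) (of R x))
    rw [← e, pushChains_of, liftChains_of, pushChains_of]
    congr 2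
    refine (Sing.ext fun p => ?_)
    rw [toMap_map_app, slice_apply, h3, e1, Function.update_idem, shift_apply, Function.update_self, Function.update_idem]
    have h4 : toMap x p i = ((toMap x p i).re : ℂ) := by
      apply Complex.ext <;> simp [(hx p).2]
    have h5 : ((θ p : ℝ) : ℂ) + ((N : ℝ) : ℂ) = toMap x p i := by
      rw [h4, ← Complex.ofReal_add]
      exact congrArg _ (hN p).symm
    rw [h5, Function.update_eq_self]
  obtain ⟨y, hy, e⟩ := hle hc
  exact ⟨y, hy, e.symm⟩

open Classical in
variable (R) in
/-- The projection onto the simplices whose initial vertex has `i`-th coordinate with real part less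
than `k`. -/
noncomputable def cutOff (i : Fin m) (k : ℤ) :
    SingChains R (Fin m → ℂ) →ₗ[R] SingChains R (Fin m → ℂ) :=
  lift (fun _ x => if (toMap x (stdSimplex.vertex 0) i).re < k then of R x else 0) fun n x hx => by
    simp [of_degenerate R hx]

open Classical in
theorem cutOff_of (k : ℤ) {n : ℕ} (x : Sing (Fin m → ℂ) _⦋n⦌) :
    cutOff R i k (of R x) = if (toMap x (stdSimplex.vertex 0) i).re < k then of R x else 0 :=
  lift_of _ _ x

theorem deck_cutOff (k : ℤ) (c : SingChains R (Fin m → ℂ)) :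
    cutOff R i (k + 1) (pushChains R (deck i) c) = pushChains R (deck i) (cutOff R i k c) := by
  have : cutOff R i (k + 1) ∘ₗ pushChains R (deck i) = pushChains R (deck i) ∘ₗ cutOff R i k := by
    refine NormalizedChains.hom_ext fun n x => ?_
    rw [LinearMap.comp_apply, LinearMap.comp_apply, pushChains_of, cutOff_of, cutOff_of,
      toMap_map_app, deck_apply, Function.update_self]
    have : (toMap x (stdSimplex.vertex 0) i + 1).re < ((k + 1 : ℤ) : ℝ) ↔
        (toMap x (stdSimplex.vertex 0) i).re < k := by
      push_cast
      rw [Complex.add_re, Complex.one_re]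
      exact add_lt_add_iff_right 1
    simp only [this]
    split_ifs
    · rw [pushChains_of]
    · rw [map_zero]
  exact LinearMap.congr_fun this c

theorem exists_cutOff (c : SingChains R (Fin m → ℂ)) :
    ∃ K : ℕ, ∀ k : ℕ, K ≤ k → cutOff R i k c = c ∧ cutOff R i (-k) c = 0 := by
  have hc : c ∈ chainsIn R Set.univ := by rw [chainsIn_univ]; trivial
  induction hc using Submodule.span_induction with
  | mem c hc =>
    obtain ⟨n, x, -, rfl⟩ := hc
    obtain ⟨K, hK⟩ := exists_nat_gt |(toMap x (stdSimplex.vertex 0) i).re|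
    refine ⟨K, fun k hk => ?_⟩
    have hk' : (K : ℝ) ≤ k := by exact_mod_cast hk
    rw [cutOff_of, cutOff_of, if_pos, if_neg]
    · exact ⟨rfl, rfl⟩
    · push_cast
      linarith [neg_abs_le (toMap x (stdSimplex.vertex 0) i).re]
    · push_cast
      linarith [le_abs_self (toMap x (stdSimplex.vertex 0) i).re]
  | zero => exact ⟨0, fun k _ => by simp⟩
  | add c c' _ _ h h' =>
    obtain ⟨K, h⟩ := h
    obtain ⟨K', h'⟩ := h'
    refine ⟨max K K', fun k hk => ?_⟩
    obtain ⟨h1, h2⟩ := h k (le_of_max_le_left hk)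
    obtain ⟨h1', h2'⟩ := h' k (le_of_max_le_right hk)
    rw [map_add, map_add, h1, h2, h1', h2', add_zero]
    exact ⟨rfl, rfl⟩
  | smul a c _ h =>
    obtain ⟨K, h⟩ := h
    refine ⟨K, fun k hk => ?_⟩
    obtain ⟨h1, h2⟩ := h k hk
    rw [map_smul, map_smul, h1, h2, smul_zero]
    exact ⟨rfl, rfl⟩

/-- No nonzero chain is invariant under the deck transformation. -/
theorem eq_zero_of_deck {c : SingChains R (Fin m → ℂ)} (h : pushChains R (deck i) c = c) :
    c = 0 := by
  obtain ⟨K, hK⟩ := exists_cutOff (i := i) c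
  have key : ∀ k : ℕ, cutOff R i (-(K : ℤ) + k) c = 0 := fun k => by
    induction k with
    | zero =>
      rw [Nat.cast_zero, add_zero]
      exact (hK K le_rfl).2
    | succ k ih =>
      have := deck_cutOff (R := R) (i := i) (-(K : ℤ) + k) c
      rw [h, ih, map_zero] at this
      rw [Nat.cast_succ, ← add_assoc]
      exact this
  have := key (K + K)
  rw [Nat.cast_add, neg_add_cancel_left] at this
  rw [← (hK K le_rfl).1, this]

/-- If `f` is a quasi-isomorphism from `A` to the chains on `Y`, then it is one from `A ⊕ V A` to the
chains on the product of `Y` with a circle in the `i`-th coordinate, where `V` corresponds to letting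
the `i`-th coordinate run through the circle. -/
theorem isQI_circleOver {M : Type} [AddCommGroup M] [Module R M] {dM : M →ₗ[R] M}
    {f : M →ₗ[R] SingChains R (Fin m → ℂ)} {A : Submodule R M} (V ρ : M →ₗ[R] M)
    (hY : ∀ z ∈ Y, z i = 1) (h : IsQI dM (singD R) f A (chainsIn R Y))
    (hV : ∀ a ∈ A, dM (V a) = - V (dM a)) (hρ : ∀ a ∈ A, ρ a = 0) (hρV : ∀ a ∈ A, ρ (V a) = a)
    (hfV : ∀ a ∈ A, f (V a) = prismOp R (circleLoop i) (f a)) :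
    IsQI dM (singD R) f (A ⊔ A.map V) (chainsIn R (circleOver i Y)) := by
  have hYl : Y ⊆ lineOver i Y := fun z hz => by
    have h1 : Function.update z i 1 = z := by rw [← hY z hz, Function.update_eq_self]
    exact ⟨by rwa [h1], by rw [hY z hz, Complex.one_im]⟩
  -- the contraction of the real line to the point `1`
  let H : C(ℝ × (Fin m → ℂ), Fin m → ℂ) :=
    ⟨fun p => Function.update p.2 i ((1 - p.1) * p.2 i + p.1), by fun_prop⟩
  have hH : ∀ s z, H (s, z) = Function.update z i ((1 - s) * z i + s) := fun s z => rfl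
  have hline : IsQI (singD R) (singD R) LinearMap.id (chainsIn R Y) (chainsIn R (lineOver i Y)) := by
    refine isQI_of_deformation hYl H (fun z => ?_) (fun z hz => ?_) (fun s _ z hz => ?_)
      fun s _ z hz => ?_
    · rw [hH, Complex.ofReal_zero, sub_zero, one_mul, add_zero, Function.update_eq_self]
    · rw [hH, Complex.ofReal_one, sub_self, zero_mul, zero_add]
      exact hz.1
    · have e : (1 - s : ℂ) * 1 + s = 1 := by ring
      rw [hH, hY z hz, e, ← hY z hz, Function.update_eq_self]
      exact hz
    · have e : (1 - s : ℂ) * z i + s = ((1 - s) * (z i).re + s : ℝ) := by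
        apply Complex.ext <;> simp [hz.2]
      rw [hH, e]
      exact update_real_mem hz.1 _
  have hwrap : ∀ z ∈ Y, wrap i z = z := fun z hz => by
    change Function.update z i (circ (z i).re) = z
    rw [hY z hz, Complex.one_re, circ_one, ← hY z hz, Function.update_eq_self]
  refine IsQI.cyclicCover V ρ (pushChains R (wrap i)) (pushChains R (deck i))
    (prismOp R (shift i)) (h.trans hline) hV hρ hρV (fun a ha => ?_)
    (fun a ha => pushChains_eq_self hwrap (h.map_mem a ha)) (fun x => pushChains_singD _ x)
    (fun x => pushChains_singD _ x) (fun x => differential_differential R _ x) (fun x => ?_)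
    (fun x hx => prismOp_mem_chainsIn (fun s _ z hz => shift_mem s hz) hx)
    (fun x hx => pushChains_mem (fun z hz => shift_mem 1 hz) hx)
    (fun x hx => pushChains_mem (fun z hz => wrap_mem hz) hx)
    (fun x => by rw [pushChains_comp, wrap_deck])
    (fun y hy => ⟨_, liftChains_mem hy, wrap_liftChains hy⟩) (fun x hx hx0 => ?_)
    fun x _ hx => eq_zero_of_deck hx
  · rw [hfV a ha, pushChains_prismOp]
    refine prismOp_congr (fun s z hz => ?_) (h.map_mem a ha)
    rw [ContinuousMap.comp_apply, shift_apply, wrap_apply, circleLoop_apply, Function.update_self, Function.update_idem, hY z hz, Complex.add_re, Complex.one_re,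
      Complex.ofReal_re, add_comm, circ_add_one]
  · have e : slice (shift i) 0 = ContinuousMap.id _ := ContinuousMap.ext fun z => by
      change Function.update z i (z i + ((0 : ℝ) : ℂ)) = z
      rw [Complex.ofReal_zero, add_zero, Function.update_eq_self]
    rw [singD_prismOp, e, pushChains_id]
    rfl
  · obtain ⟨y, hy, e⟩ := sub_lift_mem hx
    rw [hx0, map_zero, sub_zero] at e
    exact ⟨y, hy, e⟩

end CircleTopology

/-! ### Operators on Koszul coalgebras -/

section KoszulOperators

open scoped TensorProduct

variable {R : Type} [CommRing R] {m : ℕ}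

namespace StanleyReisnerCoalgebra

variable {S : SimplicialComplexOn m}

theorem lower_apply_u {α : Fin m →₀ ℕ} (h : α.support ∈ S.faces) {i : Fin m} (hi : α i ≠ 0) :
    lower i (u R S α) = u R S (α - Finsupp.single i 1) := by
  rw [lower_u h, if_pos (Nat.pos_of_ne_zero hi)]

theorem lower_eq_zero {α : Fin m →₀ ℕ} (h : α.support ∈ S.faces) {i : Fin m} (hi : α i = 0) :
    lower i (u R S α) = 0 := by
  rw [lower_u h, if_neg (by omega)]

end StanleyReisnerCoalgebra

namespace ExteriorCoalgebra

theorem sign_singleton_eq_one {i : Fin m} {τ : Finset (Fin m)} (h : ∀ j ∈ τ, i < j) :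
    sign R {i} τ = 1 := by
  rw [sign, inversions, Finset.card_eq_zero.2, pow_zero]
  rw [Finset.filter_eq_empty_iff]
  rintro ⟨a, b⟩ hp
  rw [Finset.mem_product, Finset.mem_singleton] at hp
  have := h b hp.2
  rw [hp.1]
  exact not_lt.2 this.le

/-- The contraction with the dual of `v_i`. -/
noncomputable def contract (i : Fin m) : ExteriorCoalgebra R m →ₗ[R] ExteriorCoalgebra R m :=
  lift fun τ => if i ∈ τ then sign R {i} (τ.erase i) • v R (τ.erase i) else 0

theorem contract_v (i : Fin m) (τ : Finset (Fin m)) : contract i (v R τ) =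
    if i ∈ τ then sign R {i} (τ.erase i) • v R (τ.erase i) else 0 := lift_v _ τ

theorem contract_wedge (i : Fin m) (τ : Finset (Fin m)) :
    contract i (wedge i (v R τ)) = if i ∈ τ then 0 else v R τ := by
  rw [wedge_v]
  split_ifs with h
  · rw [map_zero]
  · rw [map_smul, contract_v, if_pos (Finset.mem_insert_self i τ), Finset.erase_insert h, smul_smul,
      sign_mul_self, one_smul]

theorem wedge_contract (i : Fin m) (τ : Finset (Fin m)) :
    wedge i (contract i (v R τ)) = if i ∈ τ then v R τ else 0 := by
  rw [contract_v]
  split_ifs with h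
  · rw [map_smul, wedge_v, if_neg (Finset.notMem_erase i τ), Finset.insert_erase h, smul_smul,
      sign_mul_self, one_smul]
  · rw [map_zero]

theorem eq_wedge {i : Fin m} {τ : Finset (Fin m)} (h : i ∈ τ) :
    v R τ = wedge i (contract i (v R τ)) := by
  rw [wedge_contract, if_pos h]

theorem contract_wedge_of_ne {i j : Fin m} (hij : i ≠ j) (x : ExteriorCoalgebra R m) :
    contract i (wedge j x) = - wedge j (contract i x) := by
  have : (contract i ∘ₗ wedge j : ExteriorCoalgebra R m →ₗ[R] _) = - (wedge j ∘ₗ contract i) := by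
    refine hom_ext fun τ => ?_
    rw [LinearMap.neg_apply, LinearMap.comp_apply, LinearMap.comp_apply]
    by_cases hi : i ∈ τ
    · rw [eq_wedge (R := R) hi]
      generalize contract i (v R τ) = y
      have e : contract i ∘ₗ wedge i ∘ₗ wedge j = wedge j ∘ₗ contract i ∘ₗ
          (wedge i : ExteriorCoalgebra R m →ₗ[R] _) := by
        refine hom_ext fun τ => ?_
        rw [LinearMap.comp_apply, LinearMap.comp_apply, LinearMap.comp_apply, LinearMap.comp_apply,
          contract_wedge, wedge_v j]
        by_cases hj : j ∈ τ
        · by_cases hi : i ∈ τ <;> simp [hi, hj, wedge_v j]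
        · rw [if_neg hj, map_smul, map_smul, contract_wedge]
          by_cases hi : i ∈ τ <;> simp [hi, hj, hij, wedge_v j]
      have := LinearMap.congr_fun e y
      simp only [LinearMap.comp_apply] at this
      rw [wedge_wedge j i hij.symm, map_neg, this]
    · rw [contract_v i τ, if_neg hi, map_zero, neg_zero, wedge_v]
      split_ifs with hj
      · rw [map_zero]
      · rw [map_smul, contract_v, if_neg, smul_zero]
        rw [Finset.mem_insert, not_or]
        exact ⟨hij, hi⟩
  exact LinearMap.congr_fun this x

end ExteriorCoalgebra

namespace KoszulCoalgebra

open StanleyReisnerCoalgebra (u lower lower_u lower_eq_zero lower_apply_u)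
open ExteriorCoalgebra (v wedge parity sign contract)

variable {S : SimplicialComplexOn m}

variable (R S) in
/-- The span of the basis elements `u_α ⊗ v_τ` that satisfy a condition. -/
noncomputable def spanOf (P : (Fin m →₀ ℕ) → Finset (Fin m) → Prop) :
    Submodule R (KoszulCoalgebra R S) :=
  Submodule.span R {x | ∃ α τ, α.support ∈ S.faces ∧ P α τ ∧ x = u R S α ⊗ₜ[R] v R τ}

theorem mem_spanOf {P : (Fin m →₀ ℕ) → Finset (Fin m) → Prop} {α : Fin m →₀ ℕ}
    {τ : Finset (Fin m)} (h : α.support ∈ S.faces) (hP : P α τ) :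
    u R S α ⊗ₜ[R] v R τ ∈ spanOf R S P := Submodule.subset_span ⟨α, τ, h, hP, rfl⟩

theorem spanOf_le {P : (Fin m →₀ ℕ) → Finset (Fin m) → Prop}
    {N : Submodule R (KoszulCoalgebra R S)}
    (h : ∀ α τ, α.support ∈ S.faces → P α τ → u R S α ⊗ₜ[R] v R τ ∈ N) : spanOf R S P ≤ N := by
  rw [spanOf, Submodule.span_le]
  rintro _ ⟨α, τ, hα, hP, rfl⟩
  exact h α τ hα hP

theorem eqOn_spanOf {P : (Fin m →₀ ℕ) → Finset (Fin m) → Prop} {M : Type} [AddCommGroup M]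
    [Module R M] {f g : KoszulCoalgebra R S →ₗ[R] M}
    (h : ∀ α τ, α.support ∈ S.faces → P α τ → f (u R S α ⊗ₜ[R] v R τ) = g (u R S α ⊗ₜ[R] v R τ)) :
    ∀ x ∈ spanOf R S P, f x = g x :=
  spanOf_le (N := LinearMap.eqLocus f g) h

/-- Exterior multiplication by `v_i`. -/
noncomputable def wedgeK (i : Fin m) : KoszulCoalgebra R S →ₗ[R] KoszulCoalgebra R S :=
  TensorProduct.map LinearMap.id (wedge i)

/-- Contraction with the dual of `v_i`. -/
noncomputable def contractK (i : Fin m) : KoszulCoalgebra R S →ₗ[R] KoszulCoalgebra R S :=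
  TensorProduct.map LinearMap.id (contract i)

theorem differential_wedgeK (i : Fin m) (x : KoszulCoalgebra R S) :
    differential R S (wedgeK i x) = - wedgeK i (differential R S x) := by
  have : differential R S ∘ₗ wedgeK i = - (wedgeK i ∘ₗ differential R S) := by
    refine TensorProduct.ext' fun a b => ?_
    simp only [LinearMap.neg_apply, LinearMap.comp_apply, wedgeK, TensorProduct.map_tmul,
      differential, LinearMap.sum_apply, map_sum, LinearMap.id_apply]
    rw [← Finset.sum_neg_distrib]
    refine Finset.sum_congr rfl fun j _ => ?_
    by_cases hij : j = i
    · subst hij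
      simp [ExteriorCoalgebra.wedge_wedge_self]
    · rw [ExteriorCoalgebra.wedge_wedge j i hij, TensorProduct.tmul_neg]
  exact LinearMap.congr_fun this x

/-! ### The inclusion of the small model -/

/-- The map `u_α ↦ u_{α + i}` if `α_i > 0`, and `u_α ↦ 0` otherwise. -/
noncomputable def raisePos (i : Fin m) : StanleyReisnerCoalgebra R S →ₗ[R] StanleyReisnerCoalgebra R S :=
  StanleyReisnerCoalgebra.lift fun α => if α i = 0 then 0 else u R S (α + Finsupp.single i 1)

theorem support_add_single {α : Fin m →₀ ℕ} {i : Fin m} (hi : α i ≠ 0) :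
    (α + Finsupp.single i 1).support = α.support := by
  ext j
  by_cases hj : j = i
  · subst hj
    simp [hi]
  · simp [Ne.symm hj]

theorem raisePos_u {α : Fin m →₀ ℕ} (h : α.support ∈ S.faces) (i : Fin m) : raisePos i (u R S α) =
    if α i = 0 then 0 else u R S (α + Finsupp.single i 1) := StanleyReisnerCoalgebra.lift_u _ h

theorem lower_raisePos {α : Fin m →₀ ℕ} (h : α.support ∈ S.faces) (i : Fin m) :
    lower i (raisePos i (u R S α)) = if α i = 0 then 0 else u R S α := by
  rw [raisePos_u h]
  split_ifs with hi
  · rw [map_zero]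
  · rw [lower_apply_u (by rwa [support_add_single hi]) (by simp), add_tsub_cancel_right]

theorem raisePos_lower {α : Fin m →₀ ℕ} (h : α.support ∈ S.faces) (i : Fin m) :
    raisePos i (lower i (u R S α)) = if α i ≤ 1 then 0 else u R S α := by
  by_cases h0 : α i = 0
  · rw [lower_eq_zero h h0, map_zero, if_pos (by omega)]
  · rw [lower_apply_u h h0, raisePos_u (StanleyReisnerCoalgebra.allowed_mono h tsub_le_self),
      tsub_add_cancel_of_le (by simpa using! Nat.pos_of_ne_zero h0)]
    have : (α - Finsupp.single i 1 : Fin m →₀ ℕ) i = 0 ↔ α i ≤ 1 := by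
      simp
      omega
    simp only [this]

theorem lower_raisePos_of_ne {i j : Fin m} (hij : i ≠ j) (x : StanleyReisnerCoalgebra R S) :
    lower j (raisePos i x) = raisePos i (lower j x) := by
  have : (lower j ∘ₗ raisePos i : StanleyReisnerCoalgebra R S →ₗ[R] _) = raisePos i ∘ₗ lower j := by
    refine StanleyReisnerCoalgebra.hom_ext fun α h => ?_
    rw [LinearMap.comp_apply, LinearMap.comp_apply, raisePos_u h]
    have hv : (α - Finsupp.single j 1 : Fin m →₀ ℕ) i = α i := by
      simp [hij.symm]
    have hv' : (α + Finsupp.single i 1 : Fin m →₀ ℕ) j = α j := by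
      simp [hij]
    by_cases hj : α j = 0
    · rw [lower_eq_zero h hj, map_zero]
      split_ifs with hi
      · rw [map_zero]
      · rw [lower_eq_zero (by rwa [support_add_single hi]) (by rw [hv', hj])]
    · rw [lower_apply_u h hj, raisePos_u (StanleyReisnerCoalgebra.allowed_mono h tsub_le_self), hv]
      split_ifs with hi
      · rw [map_zero]
      · rw [lower_apply_u (by rwa [support_add_single hi]) (by rwa [hv']),
          tsub_add_eq_add_tsub (by simpa using! Nat.pos_of_ne_zero hj)]
  exact LinearMap.congr_fun this x

/-- A chain homotopy that removes the basis elements `u_α ⊗ v_τ` with `α_i ≥ 2`, or with `α_i = 1`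
and `i ∈ τ`. -/
noncomputable def reduction (i : Fin m) : KoszulCoalgebra R S →ₗ[R] KoszulCoalgebra R S :=
  TensorProduct.map (raisePos i) (contract i)

theorem differential_reduction {α : Fin m →₀ ℕ} (h : α.support ∈ S.faces) (τ : Finset (Fin m))
    (i : Fin m) : differential R S (reduction i (u R S α ⊗ₜ[R] v R τ)) +
      reduction i (differential R S (u R S α ⊗ₜ[R] v R τ)) =
        if α i = 0 ∨ (α i = 1 ∧ i ∉ τ) then 0 else u R S α ⊗ₜ[R] v R τ := by
  simp only [reduction, differential, LinearMap.sum_apply, map_sum, TensorProduct.map_tmul]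
  rw [← Finset.sum_add_distrib, Finset.sum_eq_single i]
  · rw [lower_raisePos h, raisePos_lower h, ExteriorCoalgebra.wedge_contract,
      ExteriorCoalgebra.contract_wedge]
    by_cases h0 : α i = 0
    · simp [h0]
    by_cases hτ : i ∈ τ
    · simp [h0, hτ]
    · by_cases h1 : α i = 1
      · simp [h1, hτ]
      · have : ¬ α i ≤ 1 := by omega
        simp [h0, h1, hτ, this]
  · intro j _ hj
    rw [lower_raisePos_of_ne hj.symm, ExteriorCoalgebra.contract_wedge_of_ne hj.symm,
      TensorProduct.tmul_neg, add_neg_cancel]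
  · intro hi
    exact absurd (Finset.mem_univ i) hi

variable (R S) in
/-- The span of the basis elements `u_α ⊗ v_τ` that look like those of `L(Σ)` in the first `k`
coordinates. -/
noncomputable def partialL (k : ℕ) : Submodule R (KoszulCoalgebra R S) :=
  spanOf R S fun α τ => ∀ j : Fin m, j.1 < k → α j = 0 ∨ (α j = 1 ∧ j ∉ τ)

theorem partialL_zero : partialL R S 0 = ⊤ := by
  have : (partialL R S 0).mkQ = 0 := hom_ext fun α τ h => by
    rw [LinearMap.zero_apply, Submodule.mkQ_apply, Submodule.Quotient.mk_eq_zero]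
    exact mem_spanOf h fun j hj => absurd hj (Nat.not_lt_zero _)
  rw [← Submodule.ker_mkQ (partialL R S 0), this, LinearMap.ker_zero]

theorem partialL_last : partialL R S m = subL R S := by
  refine le_antisymm (spanOf_le fun α τ h hP => ?_) (subL_le fun α τ h h1 hd => ?_)
  · refine mem_subL h (fun i => ?_) (Finset.disjoint_left.2 fun i hi => ?_)
    · rcases hP i i.2 with h0 | h0 <;> omega
    · rcases hP i i.2 with h0 | h0
      · exact absurd h0 (Finsupp.mem_support_iff.1 hi)
      · exact h0.2
  · refine mem_spanOf h fun j _ => ?_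
    by_cases h0 : α j = 0
    · exact Or.inl h0
    · have := h1 j
      exact Or.inr ⟨by omega, Finset.disjoint_left.1 hd (Finsupp.mem_support_iff.2 h0)⟩

theorem differential_partialL {k : ℕ} {x : KoszulCoalgebra R S} (hx : x ∈ partialL R S k) :
    differential R S x ∈ partialL R S k := by
  refine spanOf_le (N := (partialL R S k).comap (differential R S)) (fun α τ h hP => ?_) hx
  refine differential_mem_of (N := partialL R S k) h τ fun i hi hiτ => ?_
  refine mem_spanOf (StanleyReisnerCoalgebra.allowed_mono h tsub_le_self) fun j hj => ?_
  have hPj := hP j hj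
  by_cases hij : i = j
  · subst hij
    left
    simp
    omega
  · have e : (α - Finsupp.single i 1 : Fin m →₀ ℕ) j = α j := by
      simp [hij]
    rw [e, Finset.mem_insert, not_or]
    exact hPj.imp id fun h => ⟨h.1, Ne.symm hij, h.2⟩

end KoszulCoalgebra

/-- A subcomplex is quasi-isomorphic to the whole complex if a homotopy compresses the latter into
the former. -/
theorem IsQI.of_compression {M : Type} [AddCommGroup M] [Module R M] {d : M →ₗ[R] M}
    {A B : Submodule R M} (hAB : A ≤ B) (η : M →ₗ[R] M) (hdd : ∀ x, d (d x) = 0)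
    (hdA : ∀ a ∈ A, d a ∈ A) (hdB : ∀ b ∈ B, d b ∈ B) (hA : ∀ a ∈ A, η a ∈ A)
    (hB : ∀ b ∈ B, η b ∈ B) (h : ∀ b ∈ B, b + (d (η b) + η (d b)) ∈ A) :
    IsQI d d LinearMap.id A B := by
  refine IsQI.of_homotopy hAB (LinearMap.id + (d ∘ₗ η + η ∘ₗ d)) η hdA hdB h (fun b => ?_) hA hB
    fun b => ?_
  · simp only [LinearMap.add_apply, LinearMap.comp_apply, LinearMap.id_apply, map_add, hdd,
      map_zero, add_zero, zero_add]
  · simp only [LinearMap.add_apply, LinearMap.comp_apply, LinearMap.id_apply]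
    abel

namespace KoszulCoalgebra

open StanleyReisnerCoalgebra (u lower lower_u lower_eq_zero lower_apply_u)
open ExteriorCoalgebra (v wedge parity sign contract)

variable {S : SimplicialComplexOn m}

theorem isQI_partialL (k : ℕ) (hk : k < m) : IsQI (differential R S) (differential R S)
    LinearMap.id (partialL R S (k + 1)) (partialL R S k) := by
  have hle : partialL R S (k + 1) ≤ partialL R S k :=
    spanOf_le fun α τ h hP => mem_spanOf h fun j hj => hP j (by omega)
  let i : Fin m := ⟨k, hk⟩
  refine IsQI.of_compression hle (- reduction i) differential_differential
    (fun a => differential_partialL) (fun b => differential_partialL) (fun a ha => ?_)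
    (fun b hb => ?_) fun b hb => ?_
  · refine spanOf_le (N := (partialL R S (k + 1)).comap (- reduction i)) (fun α τ h hP => ?_) ha
    have : reduction i (u R S α ⊗ₜ[R] v R τ) = 0 := by
      rw [reduction, TensorProduct.map_tmul, raisePos_u h, ExteriorCoalgebra.contract_v]
      rcases hP i (Nat.lt_succ_self k) with h0 | h0
      · rw [if_pos h0, TensorProduct.zero_tmul]
      · rw [if_neg h0.2, TensorProduct.tmul_zero]
    rw [Submodule.mem_comap, LinearMap.neg_apply, this, neg_zero]
    exact zero_mem _
  · refine spanOf_le (N := (partialL R S k).comap (- reduction i)) (fun α τ h hP => ?_) hb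
    rw [Submodule.mem_comap, LinearMap.neg_apply]
    refine neg_mem ?_
    rw [reduction, TensorProduct.map_tmul, raisePos_u h, ExteriorCoalgebra.contract_v]
    split_ifs with h0 hτ hτ
    · rw [TensorProduct.zero_tmul]
      exact zero_mem _
    · rw [TensorProduct.zero_tmul]
      exact zero_mem _
    · rw [TensorProduct.tmul_smul]
      refine Submodule.smul_mem _ _ (mem_spanOf (by rwa [support_add_single h0]) fun j hj => ?_)
      have hij : i ≠ j := fun e => by
        rw [← e] at hj
        exact lt_irrefl _ hj
      have e : (α + Finsupp.single i 1 : Fin m →₀ ℕ) j = α j := by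
        simp [hij]
      rw [e]
      exact (hP j hj).imp id fun h => ⟨h.1, fun h' => h.2 (Finset.mem_of_mem_erase h')⟩
    · rw [TensorProduct.tmul_zero]
      exact zero_mem _
  · refine spanOf_le (N := (partialL R S (k + 1)).comap (LinearMap.id +
      (differential R S ∘ₗ (- reduction i) + (- reduction i) ∘ₗ differential R S)))
      (fun α τ h hP => ?_) hb
    simp only [Submodule.mem_comap, LinearMap.add_apply, LinearMap.comp_apply, LinearMap.neg_apply,
      LinearMap.id_apply, map_neg]
    rw [← neg_add, differential_reduction h]
    split_ifs with h0
    · rw [neg_zero, add_zero]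
      refine mem_spanOf h fun j hj => ?_
      rcases Nat.lt_succ_iff_lt_or_eq.1 hj with hj | hj
      · exact hP j hj
      · have : j = i := Fin.ext hj
        rwa [this]
    · rw [add_neg_cancel]
      exact zero_mem _

/-- The inclusion `L(Σ) → K(Σ)` is a quasi-isomorphism. -/
theorem isQI_subL : IsQI (differential R S) (differential R S) LinearMap.id (subL R S) ⊤ := by
  have : ∀ k ≤ m, IsQI (differential R S) (differential R S) LinearMap.id (partialL R S k) ⊤ := by
    intro k
    induction k with
    | zero =>
      intro _
      rw [partialL_zero]
      exact ⟨fun _ h => h, fun _ _ => rfl, fun _ _ => trivial, fun _ _ => trivial,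
        fun a _ _ b _ h => ⟨b, trivial, h⟩, fun b _ h => ⟨b, trivial, h, 0, trivial, by simp⟩⟩
    | succ k ih => exact fun hk => (isQI_partialL k hk).trans (ih (by omega))
  rw [← partialL_last]
  exact this m le_rfl

end KoszulCoalgebra

end KoszulOperators

/-! ### Singular chains from basis elements of the small model -/

section SlotOperators

open Simplicial Opposite
open scoped TensorProduct
open NormalizedChains Sing

variable {R : Type} [CommRing R] {T T' : Type} [TopologicalSpace T] [TopologicalSpace T'] {m : ℕ}

variable (R T) in
/-- The sign involution on singular chains. -/
noncomputable abbrev signS : SingChains R T →ₗ[R] SingChains R T :=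
  degreeSign (deg R (Sing T)) (isInternal R (Sing T))

theorem signS_of_degree {g : SingChains R T →ₗ[R] SingChains R T'} (k : ℕ)
    (hg : ∀ n, ∀ c ∈ deg R (Sing T) n, g c ∈ deg R (Sing T') (n + k)) (c : SingChains R T) :
    signS R T' (g c) = ((-1 : R) ^ k) • g (signS R T c) := by
  have : signS R T' ∘ₗ g = ((-1 : R) ^ k) • (g ∘ₗ signS R T) := by
    refine NormalizedChains.hom_ext fun n x => ?_
    rw [LinearMap.smul_apply, LinearMap.comp_apply, LinearMap.comp_apply,
      degreeSign_of_mem _ _ (hg n _ (of_mem R x)), degreeSign_of_mem _ _ (of_mem R x), map_smul,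
      smul_smul, pow_add, mul_comm]
  exact LinearMap.congr_fun this c

theorem signS_signS (c : SingChains R T) : signS R T (signS R T c) = c := by
  have : signS R T ∘ₗ signS R T = LinearMap.id := by
    refine NormalizedChains.hom_ext fun n x => ?_
    rw [LinearMap.comp_apply, degreeSign_of_mem _ _ (of_mem R x), map_smul,
      degreeSign_of_mem _ _ (of_mem R x), smul_smul, ← mul_pow]
    simp
  exact LinearMap.congr_fun this c

theorem pushChains_deg (g : C(T, T')) {n : ℕ} {c : SingChains R T} (hc : c ∈ deg R (Sing T) n) :
    pushChains R g c ∈ deg R (Sing T') n := NormalizedChains.map_mem R _ n c hc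

theorem signS_pushChains (g : C(T, T')) (c : SingChains R T) :
    signS R T' (pushChains R g c) = pushChains R g (signS R T c) := by
  rw [signS_of_degree 0 fun n c hc => pushChains_deg g hc, pow_zero, one_smul]

/-- The operator that multiplies a chain by a circle in the `i`-th coordinate. -/
noncomputable def circleOp (R : Type) [CommRing R] (i : Fin m) :
    SingChains R (Fin m → ℂ) →ₗ[R] SingChains R (Fin m → ℂ) :=
  prismOp R (circleLoop i)

/-- The contraction of a loop around the circle inside the disc. -/
noncomputable def diskHomotopy (i : Fin m) : C(ℝ × (ℝ × (Fin m → ℂ)), Fin m → ℂ) :=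
  ⟨fun q => Function.update q.2.2 i ((1 - q.1) + q.1 * circ q.2.1), by
    have := continuous_circ
    fun_prop⟩

/-- The operator that multiplies a chain by a disc in the `i`-th coordinate. The disc is written
as a double homotopy, whence two prism operators. -/
noncomputable def diskOp (R : Type) [CommRing R] (i : Fin m) :
    SingChains R (Fin m → ℂ) →ₗ[R] SingChains R (Fin m → ℂ) :=
  prismOp R (diskHomotopy i) ∘ₗ prismOp R (ContinuousMap.id _)

theorem circleOp_mem_deg (i : Fin m) {n : ℕ} {c : SingChains R (Fin m → ℂ)}
    (hc : c ∈ deg R (Sing _) n) : circleOp R i c ∈ deg R (Sing _) (n + 1) := prismOp_mem _ hc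

theorem diskOp_mem_deg (i : Fin m) {n : ℕ} {c : SingChains R (Fin m → ℂ)}
    (hc : c ∈ deg R (Sing _) n) : diskOp R i c ∈ deg R (Sing _) (n + 2) :=
  prismOp_mem _ (prismOp_mem _ hc)

theorem circleOp_mem {i : Fin m} {A B : Set (Fin m → ℂ)}
    (h : ∀ a ∈ A, ∀ w : ℂ, ‖w‖ = 1 → Function.update a i w ∈ B) {c : SingChains R (Fin m → ℂ)}
    (hc : c ∈ chainsIn R A) : circleOp R i c ∈ chainsIn R B :=
  prismOp_mem_chainsIn (fun s _ a ha => h a ha _ (norm_circ s)) hc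

theorem diskOp_mem {i : Fin m} {A B : Set (Fin m → ℂ)}
    (h : ∀ a ∈ A, ∀ w : ℂ, ‖w‖ ≤ 1 → Function.update a i w ∈ B) {c : SingChains R (Fin m → ℂ)}
    (hc : c ∈ chainsIn R A) : diskOp R i c ∈ chainsIn R B := by
  refine prismOp_mem_chainsIn (A := Prod.snd ⁻¹' A) (fun s hs q hq => h _ hq _ ?_)
    (prismOp_mem_chainsIn (B := Prod.snd ⁻¹' A) (fun s _ a ha => ha) hc)
  have h1 : ‖(1 - s : ℂ)‖ = 1 - s := by
    rw [← Complex.ofReal_one, ← Complex.ofReal_sub, Complex.norm_real, Real.norm_of_nonneg]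
    linarith [hs.2]
  have h2 : ‖(s * circ q.1 : ℂ)‖ = s := by
    rw [norm_mul, norm_circ, mul_one, Complex.norm_real, Real.norm_of_nonneg hs.1]
  calc ‖(1 - s : ℂ) + s * circ q.1‖ ≤ ‖(1 - s : ℂ)‖ + ‖(s * circ q.1 : ℂ)‖ := norm_add_le _ _
    _ = 1 := by rw [h1, h2]; ring

theorem slice_circleLoop_zero (i : Fin m) : slice (circleLoop i) 0 = setOne i :=
  ContinuousMap.ext fun z => by rw [slice_apply, circleLoop_apply, circ_zero]; rfl

theorem slice_circleLoop_one (i : Fin m) : slice (circleLoop i) 1 = setOne i :=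
  ContinuousMap.ext fun z => by rw [slice_apply, circleLoop_apply, circ_one]; rfl

theorem singD_circleOp (i : Fin m) (c : SingChains R (Fin m → ℂ)) :
    singD R (circleOp R i c) = - circleOp R i (singD R c) := by
  have := singD_prismOp (circleLoop i) c
  rw [slice_circleLoop_zero, slice_circleLoop_one, sub_self] at this
  exact eq_neg_of_add_eq_zero_left this

theorem comul_circleOp (i : Fin m) (c : SingChains R (Fin m → ℂ)) :
    Coalgebra.comul (R := R) (circleOp R i c) =
      TensorProduct.map (circleOp R i) (pushChains R (setOne i)) (Coalgebra.comul (R := R) c) +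
      TensorProduct.map (pushChains R (setOne i) ∘ₗ signS R _) (circleOp R i)
        (Coalgebra.comul (R := R) c) := by
  have := comul_prismOp (circleLoop i) c
  rwa [slice_circleLoop_zero, slice_circleLoop_one] at this

theorem diskHomotopy_apply (i : Fin m) (a b : ℝ) (z : Fin m → ℂ) :
    diskHomotopy i (a, (b, z)) = Function.update z i ((1 - a) + a * circ b) := rfl

theorem slice_diskHomotopy_one (i : Fin m) : slice (diskHomotopy i) 1 = circleLoop i :=
  ContinuousMap.ext fun ⟨b, z⟩ => by
    rw [slice_apply, diskHomotopy_apply, circleLoop_apply, Complex.ofReal_one, sub_self, zero_add,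
      one_mul]

theorem slice_diskHomotopy_zero (i : Fin m) :
    slice (diskHomotopy i) 0 = (setOne i).comp ContinuousMap.snd :=
  ContinuousMap.ext fun ⟨b, z⟩ => by
    rw [slice_apply, diskHomotopy_apply, Complex.ofReal_zero, sub_zero, zero_mul, add_zero]
    rfl

/-- The ends of the inner homotopy are mapped to the point `1` of the disc. -/
theorem prismOp_diskHomotopy_slice (i : Fin m) {s : ℝ} (hs : circ s = 1)
    (c : SingChains R (Fin m → ℂ)) :
    prismOp R (diskHomotopy i) (pushChains R (slice (ContinuousMap.id _) s) c) = 0 := by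
  rw [prismOp_pushChains]
  refine prismOp_eq_zero _ (fun a a' z => ?_) c
  change diskHomotopy i (a, (s, z)) = diskHomotopy i (a', (s, z))
  rw [diskHomotopy_apply, diskHomotopy_apply, hs, mul_one, mul_one, sub_add_cancel, sub_add_cancel]

theorem singD_diskOp (i : Fin m) (c : SingChains R (Fin m → ℂ)) :
    singD R (diskOp R i c) = circleOp R i c + diskOp R i (singD R c) := by
  have h1 := singD_prismOp (diskHomotopy i) (prismOp R (ContinuousMap.id _) c)
  have h2 := singD_prismOp (ContinuousMap.id (ℝ × (Fin m → ℂ))) c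
  have h3 : prismOp R (ContinuousMap.snd : C(ℝ × (Fin m → ℂ), _)) c = 0 :=
    prismOp_eq_zero _ (fun _ _ _ => rfl) c
  rw [← eq_sub_iff_add_eq] at h2
  rw [h2, map_sub, map_sub, prismOp_diskHomotopy_slice i circ_one,
    prismOp_diskHomotopy_slice i circ_zero, slice_diskHomotopy_one, slice_diskHomotopy_zero,
    pushChains_prismOp, ← pushChains_comp, pushChains_prismOp, ContinuousMap.comp_id,
    ContinuousMap.comp_id, h3, map_zero, sub_zero, sub_zero, zero_sub, ← sub_eq_add_neg,
    sub_eq_iff_eq_add] at h1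
  exact h1

theorem comul_diskOp (i : Fin m) (c : SingChains R (Fin m → ℂ)) :
    Coalgebra.comul (R := R) (diskOp R i c) =
      TensorProduct.map (diskOp R i) (pushChains R (setOne i)) (Coalgebra.comul (R := R) c) +
      TensorProduct.map (pushChains R (setOne i)) (diskOp R i) (Coalgebra.comul (R := R) c) := by
  rw [diskOp, LinearMap.comp_apply, comul_prismOp, comul_prismOp, map_add, map_add]
  have hc : ∀ (f g : SingChains R (ℝ × (Fin m → ℂ)) →ₗ[R] SingChains R (Fin m → ℂ))
      (f' g' : SingChains R (Fin m → ℂ) →ₗ[R] SingChains R (ℝ × (Fin m → ℂ))) t,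
      TensorProduct.map f g (TensorProduct.map f' g' t) =
        TensorProduct.map (f ∘ₗ f') (g ∘ₗ g') t := fun f g f' g' t => by
    rw [TensorProduct.map_comp, LinearMap.comp_apply]
  rw [hc, hc, hc, hc]
  have e1 : pushChains R (slice (diskHomotopy i) 1) ∘ₗ pushChains R (slice (ContinuousMap.id _) 1) =
      pushChains R (setOne i) := by
    refine LinearMap.ext fun x => ?_
    rw [LinearMap.comp_apply, pushChains_comp, slice_diskHomotopy_one]
    congr 1
    rw [← slice_circleLoop_one]
    rfl
  have e2 : prismOp R (diskHomotopy i) ∘ₗ pushChains R (slice (ContinuousMap.id _) 0) ∘ₗ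
      signS R (Fin m → ℂ) = 0 :=
    LinearMap.ext fun x => prismOp_diskHomotopy_slice i circ_zero _
  have e3 : prismOp R (diskHomotopy i) ∘ₗ pushChains R (slice (ContinuousMap.id _) 1) = 0 :=
    LinearMap.ext fun x => prismOp_diskHomotopy_slice i circ_one _
  have e4 : (pushChains R (slice (diskHomotopy i) 0) ∘ₗ signS R (ℝ × (Fin m → ℂ))) ∘ₗ
      pushChains R (slice (ContinuousMap.id _) 0) ∘ₗ signS R (Fin m → ℂ) =
      pushChains R (setOne i) := by
    refine LinearMap.ext fun x => ?_
    simp only [LinearMap.comp_apply]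
    rw [signS_pushChains, signS_signS, pushChains_comp, slice_diskHomotopy_zero]
    rfl
  rw [e1, e2, e3, e4]
  simp

theorem counit_circleOp (i : Fin m) (c : SingChains R (Fin m → ℂ)) :
    Coalgebra.counit (R := R) (circleOp R i c) = 0 := counit_prismOp _ c

theorem counit_diskOp (i : Fin m) (c : SingChains R (Fin m → ℂ)) :
    Coalgebra.counit (R := R) (diskOp R i c) = 0 := counit_prismOp _ _

/-- If the operators `op' j` differ from `op j` only for `j = i`, and if `op j` is the identity for
`j ≤ i`, then their composites differ by `op' i`. -/
theorem foldr_eq_apply {M : Type} {op op' : Fin m → M → M} {i : Fin m} {b : M} {l : List (Fin m)}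
    (hl : l.Pairwise (· < ·)) (hi : i ∈ l) (h : ∀ j ≤ i, ∀ x, op j x = x)
    (h' : ∀ j < i, ∀ x, op' j x = x) (h'' : ∀ j, i < j → ∀ x, op' j x = op j x) :
    l.foldr op' b = op' i (l.foldr op b) := by
  induction l with
  | nil => simp at hi
  | cons a l ih =>
    rw [List.pairwise_cons] at hl
    rw [List.foldr_cons, List.foldr_cons]
    rcases List.mem_cons.1 hi with rfl | hi
    · rw [h _ le_rfl]
      congr 1
      exact List.foldr_ext _ _ _ fun j hj x => h'' j (hl.1 j hj) x
    · have := hl.1 i hi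
      rw [h _ this.le, h' _ this, ih hl.2 hi]

variable (R m) in
/-- The `0`-simplex at the point `(1, …, 1)`. -/
noncomputable def basePoint : SingChains R (Fin m → ℂ) :=
  of R (ofMap (n := 0) (ContinuousMap.const _ 1))

variable (R) in
/-- The operator in the `i`-th coordinate that belongs to the basis element `u_α ⊗ v_τ`. -/
noncomputable def slotOp (α : Fin m →₀ ℕ) (τ : Finset (Fin m)) (i : Fin m) :
    SingChains R (Fin m → ℂ) →ₗ[R] SingChains R (Fin m → ℂ) :=
  if i ∈ τ then circleOp R i else if α i ≠ 0 then diskOp R i else LinearMap.id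

theorem slotOp_eq_id {α : Fin m →₀ ℕ} {τ : Finset (Fin m)} {i : Fin m} (h : i ∉ τ) (h' : α i = 0) :
    slotOp R α τ i = LinearMap.id := by
  rw [slotOp, if_neg h, if_neg (not_not.2 h')]

variable (R) in
/-- The product of circles in the coordinates in `τ` and of discs in the coordinates in the support
of `α`. -/
noncomputable def productChain (α : Fin m →₀ ℕ) (τ : Finset (Fin m)) : SingChains R (Fin m → ℂ) :=
  (List.finRange m).foldr (fun i c => slotOp R α τ i c) (basePoint R m)

theorem productChain_insert {α : Fin m →₀ ℕ} {τ : Finset (Fin m)} {i : Fin m}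
    (hα : ∀ j ≤ i, α j = 0) (hτ : ∀ j ≤ i, j ∉ τ) :
    productChain R α (insert i τ) = circleOp R i (productChain R α τ) := by
  have e : slotOp R α (insert i τ) i = circleOp R i := if_pos (Finset.mem_insert_self i τ)
  rw [productChain, foldr_eq_apply (List.pairwise_lt_finRange m) (List.mem_finRange i)
    (op := fun i c => slotOp R α τ i c)]
  · rw [e]
    rfl
  · intro j hj x
    rw [slotOp_eq_id (hτ j hj) (hα j hj), LinearMap.id_apply]
  · intro j hj x
    rw [slotOp_eq_id _ (hα j hj.le), LinearMap.id_apply]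
    rw [Finset.mem_insert, not_or]
    exact ⟨hj.ne, hτ j hj.le⟩
  · intro j hj x
    have : j ∈ insert i τ ↔ j ∈ τ := by
      rw [Finset.mem_insert, or_iff_right hj.ne']
    simp only [slotOp, this]

theorem productChain_add_single {α : Fin m →₀ ℕ} {τ : Finset (Fin m)} {i : Fin m}
    (hα : ∀ j ≤ i, α j = 0) (hτ : ∀ j ≤ i, j ∉ τ) :
    productChain R (α + Finsupp.single i 1) τ = diskOp R i (productChain R α τ) := by
  have e : slotOp R (α + Finsupp.single i 1) τ i = diskOp R i := by
    rw [slotOp, if_neg (hτ i le_rfl), if_pos (by simp)]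
  have e' : ∀ j, j ≠ i → (α + Finsupp.single i 1 : Fin m →₀ ℕ) j = α j := fun j hj => by
    simp [hj.symm]
  rw [productChain, foldr_eq_apply (List.pairwise_lt_finRange m) (List.mem_finRange i)
    (op := fun i c => slotOp R α τ i c)]
  · rw [e]
    rfl
  · intro j hj x
    rw [slotOp_eq_id (hτ j hj) (hα j hj), LinearMap.id_apply]
  · intro j hj x
    rw [slotOp_eq_id (hτ j hj.le) (by rw [e' j hj.ne, hα j hj.le]), LinearMap.id_apply]
  · intro j hj x
    simp only [slotOp, e' j hj.ne']

theorem productChain_mem_deg {α : Fin m →₀ ℕ} {τ : Finset (Fin m)} (hα : ∀ i, α i ≤ 1)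
    (hd : Disjoint α.support τ) :
    productChain R α τ ∈ deg R (Sing (Fin m → ℂ)) (2 * (∑ i, α i) + τ.card) := by
  have key : ∀ l : List (Fin m), l.foldr (fun i c => slotOp R α τ i c) (basePoint R m) ∈
      deg R (Sing (Fin m → ℂ)) (l.map fun i => 2 * α i + if i ∈ τ then 1 else 0).sum := by
    intro l
    induction l with
    | nil => exact of_mem R _
    | cons i l ih =>
      rw [List.foldr_cons, List.map_cons, List.sum_cons, add_comm]
      by_cases h1 : i ∈ τ
      · have h0 : α i = 0 := by
          by_contra h
          exact Finset.disjoint_left.1 hd (Finsupp.mem_support_iff.2 h) h1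
        rw [slotOp, if_pos h1, h0, if_pos h1]
        exact circleOp_mem_deg i ih
      · by_cases h0 : α i = 0
        · rw [slotOp_eq_id h1 h0, h0, if_neg h1]
          exact ih
        · have h2 : α i = 1 := by
            have := hα i
            omega
          rw [slotOp, if_neg h1, if_pos h0, h2, if_neg h1]
          exact diskOp_mem_deg i ih
  have := key (List.finRange m)
  rw [← Fin.sum_univ_def, Finset.sum_add_distrib, ← Finset.mul_sum, Finset.sum_ite_mem,
    Finset.univ_inter, Finset.sum_const, smul_eq_mul, mul_one] at this
  exact this

theorem productChain_mem (α : Fin m →₀ ℕ) (τ : Finset (Fin m)) :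
    productChain R α τ ∈ chainsIn R {z | ∀ j, α j = 0 → j ∉ τ → z j = 1} := by
  have key : ∀ l : List (Fin m), l.foldr (fun i c => slotOp R α τ i c) (basePoint R m) ∈
      chainsIn R {z | ∀ j, α j = 0 → j ∉ τ → z j = 1} := by
    intro l
    induction l with
    | nil => exact of_mem_chainsIn fun p j _ _ => rfl
    | cons i l ih =>
      rw [List.foldr_cons]
      have hu : ¬ (α i = 0 ∧ i ∉ τ) → ∀ z : Fin m → ℂ, (∀ j, α j = 0 → j ∉ τ → z j = 1) →
          ∀ w, ∀ j, α j = 0 → j ∉ τ → Function.update z i w j = 1 := by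
        intro h z hz w j h1 h2
        rw [Function.update_of_ne, hz j h1 h2]
        rintro rfl
        exact h ⟨h1, h2⟩
      by_cases h1 : i ∈ τ
      · rw [slotOp, if_pos h1]
        exact circleOp_mem (B := {z | ∀ j, α j = 0 → j ∉ τ → z j = 1})
          (fun z hz w _ => hu (fun h => h.2 h1) z hz w) ih
      · by_cases h0 : α i = 0
        · rw [slotOp_eq_id h1 h0]
          exact ih
        · rw [slotOp, if_neg h1, if_pos h0]
          exact diskOp_mem (B := {z | ∀ j, α j = 0 → j ∉ τ → z j = 1})
            (fun z hz w _ => hu (fun h => h0 h.1) z hz w) ih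
  exact key _

end SlotOperators

/-! ### The comparison map -/

section Comparison

open Simplicial Opposite
open scoped TensorProduct

variable {R : Type} [CommRing R] {m : ℕ}

namespace KoszulCoalgebra

open StanleyReisnerCoalgebra (u lower lower_u lower_eq_zero)
open ExteriorCoalgebra (v wedge wedge_v sign parity contract)

section General

variable {S : SimplicialComplexOn m}

theorem tensorTensorTensorComm_map
    (f g : StanleyReisnerCoalgebra R S →ₗ[R] StanleyReisnerCoalgebra R S)
    (f' g' : ExteriorCoalgebra R m →ₗ[R] ExteriorCoalgebra R m)
    (s : StanleyReisnerCoalgebra R S ⊗[R] StanleyReisnerCoalgebra R S)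
    (t : ExteriorCoalgebra R m ⊗[R] ExteriorCoalgebra R m) :
    TensorProduct.AlgebraTensorModule.tensorTensorTensorComm R R R R _ _ _ _
      (TensorProduct.map f g s ⊗ₜ[R] TensorProduct.map f' g' t) =
    TensorProduct.map (TensorProduct.map f f') (TensorProduct.map g g')
      (TensorProduct.AlgebraTensorModule.tensorTensorTensorComm R R R R _ _ _ _ (s ⊗ₜ[R] t)) := by
  induction s using TensorProduct.induction_on with
  | zero => simp
  | add s1 s2 h1 h2 => simp only [map_add, TensorProduct.add_tmul, h1, h2]
  | tmul s1 s2 =>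
    induction t using TensorProduct.induction_on with
    | zero => simp
    | add t1 t2 h1 h2 => simp only [map_add, TensorProduct.tmul_add, h1, h2]
    | tmul t1 t2 => rfl

variable (R S) in
/-- The sign involution of the Koszul coalgebra. -/
noncomputable abbrev signK : KoszulCoalgebra R S →ₗ[R] KoszulCoalgebra R S :=
  TensorProduct.map LinearMap.id (parity R m)

theorem comul_wedgeK (i : Fin m) (x : KoszulCoalgebra R S) :
    Coalgebra.comul (R := R) (wedgeK i x) =
      TensorProduct.map (wedgeK i) LinearMap.id (Coalgebra.comul (R := R) x) +
        TensorProduct.map (signK R S) (wedgeK i) (Coalgebra.comul (R := R) x) := by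
  have : Coalgebra.comul (R := R) ∘ₗ wedgeK i =
      TensorProduct.map (wedgeK i) LinearMap.id ∘ₗ
        Coalgebra.comul (R := R) (A := KoszulCoalgebra R S) +
      TensorProduct.map (signK R S) (wedgeK i) ∘ₗ Coalgebra.comul (R := R) := by
    refine TensorProduct.ext' fun a b => ?_
    simp only [LinearMap.comp_apply, LinearMap.add_apply]
    have hi : (LinearMap.id : KoszulCoalgebra R S →ₗ[R] _) =
      TensorProduct.map LinearMap.id LinearMap.id := TensorProduct.map_id.symm
    rw [hi, wedgeK, TensorProduct.map_tmul, TensorProduct.comul_tmul, TensorProduct.comul_tmul,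
      ExteriorCoalgebra.comul_wedge, TensorProduct.tmul_add, map_add, signK,
      ← tensorTensorTensorComm_map, ← tensorTensorTensorComm_map, TensorProduct.map_id]
    rfl
  exact LinearMap.congr_fun this x

theorem counit_wedgeK (i : Fin m) (x : KoszulCoalgebra R S) :
    Coalgebra.counit (R := R) (wedgeK i x) = 0 := by
  have : Coalgebra.counit (R := R) ∘ₗ wedgeK (S := S) i = 0 := by
    refine hom_ext fun α τ hα => ?_
    rw [LinearMap.zero_apply, LinearMap.comp_apply, wedgeK, TensorProduct.map_tmul, wedge_v]
    split_ifs
    · simp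
    · rw [TensorProduct.tmul_smul, map_smul, LinearMap.id_apply, counit_tmul hα, if_neg, smul_zero]
      exact fun h => Finset.insert_ne_empty _ _ h.2
  exact LinearMap.congr_fun this x

theorem spanOf_mono {P Q : (Fin m →₀ ℕ) → Finset (Fin m) → Prop} (h : ∀ α τ, P α τ → Q α τ) :
    spanOf R S P ≤ spanOf R S Q :=
  spanOf_le fun _ _ hα hP => mem_spanOf hα (h _ _ hP)

open Classical in
theorem spanOf_inf (P Q : (Fin m →₀ ℕ) → Finset (Fin m) → Prop) :
    spanOf R S P ⊓ spanOf R S Q = spanOf R S fun α τ => P α τ ∧ Q α τ := by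
  refine le_antisymm ?_ (le_inf (spanOf_mono fun _ _ h => h.1) (spanOf_mono fun _ _ h => h.2))
  rintro x ⟨hP, hQ⟩
  -- the projection onto the basis elements with the property `P`
  let p : KoszulCoalgebra R S →ₗ[R] KoszulCoalgebra R S :=
    lift fun α τ => if P α τ then u R S α ⊗ₜ[R] v R τ else 0
  have hp : p x = x := eqOn_spanOf (f := p) (g := LinearMap.id) (fun α τ hα h => by
    rw [lift_tmul _ hα, if_pos h]; rfl) x hP
  rw [← hp]
  refine spanOf_le (N := (spanOf R S fun α τ => P α τ ∧ Q α τ).comap p) (fun α τ hα h => ?_) hQ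
  rw [Submodule.mem_comap, lift_tmul _ hα]
  split_ifs with h'
  · exact mem_spanOf hα ⟨h', h⟩
  · exact zero_mem _

theorem spanOf_sup (P Q : (Fin m →₀ ℕ) → Finset (Fin m) → Prop) :
    spanOf R S P ⊔ spanOf R S Q = spanOf R S fun α τ => P α τ ∨ Q α τ := by
  refine le_antisymm (sup_le (spanOf_mono fun _ _ => Or.inl) (spanOf_mono fun _ _ => Or.inr))
    (spanOf_le fun α τ hα h => ?_)
  rcases h with h | h
  · exact Submodule.mem_sup_left (mem_spanOf hα h)
  · exact Submodule.mem_sup_right (mem_spanOf hα h)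

end General

/-- The simplicial complex of all subsets of `[m]`. -/
def fullComplex (m : ℕ) : SimplicialComplexOn m :=
  ⟨Set.univ, Set.mem_univ _, fun _ _ => Set.mem_univ _⟩

theorem mem_fullComplex (σ : Finset (Fin m)) : σ ∈ (fullComplex m).faces := Set.mem_univ σ

/-- The map `u_α ↦ u_{α + i}`. -/
noncomputable def raise (i : Fin m) : StanleyReisnerCoalgebra R (fullComplex m) →ₗ[R]
    StanleyReisnerCoalgebra R (fullComplex m) :=
  StanleyReisnerCoalgebra.lift fun α => u R _ (α + Finsupp.single i 1)

theorem raise_u (i : Fin m) (α : Fin m →₀ ℕ) :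
    raise i (u R (fullComplex m) α) = u R _ (α + Finsupp.single i 1) :=
  StanleyReisnerCoalgebra.lift_u _ (mem_fullComplex _)

theorem lower_raise (i : Fin m) (x : StanleyReisnerCoalgebra R (fullComplex m)) :
    lower i (raise i x) = x := by
  have : lower i ∘ₗ raise (R := R) i = LinearMap.id := by
    refine StanleyReisnerCoalgebra.hom_ext fun α _ => ?_
    rw [LinearMap.comp_apply, raise_u, lower_u (mem_fullComplex _), if_pos (by simp),
      add_tsub_cancel_right]
    rfl
  exact LinearMap.congr_fun this x

theorem lower_raise_of_ne {i j : Fin m} (hij : j ≠ i)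
    (x : StanleyReisnerCoalgebra R (fullComplex m)) :
    lower j (raise i x) = raise i (lower j x) := by
  have : lower j ∘ₗ raise (R := R) i = raise i ∘ₗ lower j := by
    refine StanleyReisnerCoalgebra.hom_ext fun α _ => ?_
    have e : (α + Finsupp.single i 1 : Fin m →₀ ℕ) j = α j := by simp [hij]
    rw [LinearMap.comp_apply, LinearMap.comp_apply, raise_u, lower_u (mem_fullComplex _),
      lower_u (mem_fullComplex _), e]
    split_ifs with h
    · rw [raise_u, tsub_add_eq_add_tsub]
      simpa using! h
    · rw [map_zero]
  exact LinearMap.congr_fun this x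

theorem comul_raise {i : Fin m} {α : Fin m →₀ ℕ} (hα : α i = 0) :
    Coalgebra.comul (R := R) (raise i (u R (fullComplex m) α)) =
      TensorProduct.map (raise i) LinearMap.id (Coalgebra.comul (R := R) (u R _ α)) +
      TensorProduct.map LinearMap.id (raise i) (Coalgebra.comul (R := R) (u R _ α)) := by
  have hle : ∀ {β : Fin m →₀ ℕ}, 0 < β i → Finsupp.single i 1 ≤ β := fun {β} hβ => by
    simpa using! hβ
  rw [raise_u]
  erw [StanleyReisnerCoalgebra.comul_u (mem_fullComplex _),
    StanleyReisnerCoalgebra.comul_u (mem_fullComplex _)]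
  simp only [StanleyReisnerCoalgebra.diagonal, map_sum, TensorProduct.map_tmul, raise_u,
    LinearMap.id_apply]
  rw [← Finset.sum_filter_add_sum_filter_not _ fun p => 0 < p.1 i]
  congr 1
  · refine Finset.sum_nbij' (fun p => (p.1 - Finsupp.single i 1, p.2))
      (fun p => (p.1 + Finsupp.single i 1, p.2)) ?_ ?_ ?_ ?_ ?_
    · rintro ⟨a, b⟩ hp
      simp at hp ⊢
      rw [tsub_add_eq_add_tsub (hle hp.2), hp.1, add_tsub_cancel_right]
    · rintro ⟨a, b⟩ hp
      simp at hp ⊢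
      rw [add_right_comm, hp]
    · rintro ⟨a, b⟩ hp
      simp at hp ⊢
      rw [tsub_add_cancel_of_le (hle hp.2)]
    · rintro ⟨a, b⟩ hp
      simp
    · rintro ⟨a, b⟩ hp
      simp at hp ⊢
      rw [tsub_add_cancel_of_le (hle hp.2)]
  · have hpos : ∀ {a b : Fin m →₀ ℕ}, a + b = α + Finsupp.single i 1 → a i = 0 → 0 < b i := by
      intro a b h h'
      have := DFunLike.congr_fun h i
      simp at this
      omega
    refine Finset.sum_nbij' (fun p => (p.1, p.2 - Finsupp.single i 1))
      (fun p => (p.1, p.2 + Finsupp.single i 1)) ?_ ?_ ?_ ?_ ?_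
    · rintro ⟨a, b⟩ hp
      simp at hp ⊢
      rw [← add_tsub_assoc_of_le (hle (hpos hp.1 hp.2)), hp.1, add_tsub_cancel_right]
    · rintro ⟨a, b⟩ hp
      simp at hp ⊢
      refine ⟨by rw [← add_assoc, hp], ?_⟩
      have := DFunLike.congr_fun hp i
      simp at this
      omega
    · rintro ⟨a, b⟩ hp
      simp at hp ⊢
      rw [tsub_add_cancel_of_le (hle (hpos hp.1 hp.2))]
    · rintro ⟨a, b⟩ hp
      simp
    · rintro ⟨a, b⟩ hp
      simp at hp ⊢
      rw [tsub_add_cancel_of_le (hle (hpos hp.1 hp.2))]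

/-- The map `u_α ⊗ v_τ ↦ u_{α + i} ⊗ v_τ`. -/
noncomputable def raiseK (i : Fin m) :
    KoszulCoalgebra R (fullComplex m) →ₗ[R] KoszulCoalgebra R (fullComplex m) :=
  TensorProduct.map (raise i) LinearMap.id

theorem raiseK_tmul (i : Fin m) (α : Fin m →₀ ℕ) (τ : Finset (Fin m)) :
    raiseK i (u R (fullComplex m) α ⊗ₜ[R] v R τ) = u R _ (α + Finsupp.single i 1) ⊗ₜ[R] v R τ := by
  rw [raiseK, TensorProduct.map_tmul, raise_u, LinearMap.id_apply]

theorem comul_raiseK {i : Fin m} {α : Fin m →₀ ℕ} (hα : α i = 0) (τ : Finset (Fin m)) :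
    Coalgebra.comul (R := R) (raiseK i (u R (fullComplex m) α ⊗ₜ[R] v R τ)) =
      TensorProduct.map (raiseK i) LinearMap.id
        (Coalgebra.comul (R := R) (u R (fullComplex m) α ⊗ₜ[R] v R τ)) +
      TensorProduct.map LinearMap.id (raiseK i)
        (Coalgebra.comul (R := R) (u R (fullComplex m) α ⊗ₜ[R] v R τ)) := by
  have hi : (LinearMap.id : KoszulCoalgebra R (fullComplex m) →ₗ[R] _) =
    TensorProduct.map LinearMap.id LinearMap.id := TensorProduct.map_id.symm
  rw [hi, raiseK, TensorProduct.map_tmul, TensorProduct.comul_tmul, TensorProduct.comul_tmul,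
    comul_raise hα, TensorProduct.add_tmul, map_add, ← tensorTensorTensorComm_map,
    ← tensorTensorTensorComm_map, TensorProduct.map_id]
  rfl

theorem counit_raiseK (i : Fin m) (x : KoszulCoalgebra R (fullComplex m)) :
    Coalgebra.counit (R := R) (raiseK i x) = 0 := by
  have : Coalgebra.counit (R := R) ∘ₗ raiseK (R := R) i = 0 := by
    refine hom_ext fun α τ _ => ?_
    rw [LinearMap.comp_apply, raiseK_tmul, counit_tmul (mem_fullComplex _), if_neg]
    · rfl
    · rintro ⟨h, -⟩
      have := DFunLike.congr_fun h i
      simp at this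
  exact LinearMap.congr_fun this x

theorem contractK_raiseK (i : Fin m) (x : KoszulCoalgebra R (fullComplex m)) :
    contractK i (raiseK i x) = raiseK i (contractK i x) := by
  have : contractK i ∘ₗ raiseK (R := R) i = raiseK i ∘ₗ contractK i :=
    TensorProduct.ext' fun a b => rfl
  exact LinearMap.congr_fun this x

theorem differential_raiseK {i : Fin m} {α : Fin m →₀ ℕ} (hα : α i = 0) (τ : Finset (Fin m)) :
    differential R _ (raiseK i (u R (fullComplex m) α ⊗ₜ[R] v R τ)) =
      wedgeK i (u R (fullComplex m) α ⊗ₜ[R] v R τ) +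
        raiseK i (differential R _ (u R (fullComplex m) α ⊗ₜ[R] v R τ)) := by
  simp only [differential, LinearMap.sum_apply, map_sum, raiseK, wedgeK, TensorProduct.map_tmul,
    LinearMap.id_apply]
  rw [← Finset.add_sum_erase _ _ (Finset.mem_univ i), ← Finset.add_sum_erase _
    (fun j => raise i (lower j (u R (fullComplex m) α)) ⊗ₜ[R] wedge j (v R τ)) (Finset.mem_univ i),
    lower_raise, lower_eq_zero (mem_fullComplex _) hα, map_zero, TensorProduct.zero_tmul, zero_add]
  congr 1
  refine Finset.sum_congr rfl fun j hj => ?_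
  rw [lower_raise_of_ne (Finset.ne_of_mem_erase hj)]

/-! ### The filtration of the small model -/

/-- The basis elements `u_σ ⊗ v_τ` with `σ ∈ Γ`, `σ ∩ τ = ∅` and without the first `k` variables. -/
structure IsSmall (k : ℕ) (Γ : Set (Finset (Fin m))) (α : Fin m →₀ ℕ) (τ : Finset (Fin m)) :
    Prop where
  le_one : ∀ i, α i ≤ 1
  disjoint : Disjoint α.support τ
  mem : α.support ∈ Γ
  zero_of_lt : ∀ j : Fin m, j.1 < k → α j = 0
  notMem_of_lt : ∀ j : Fin m, j.1 < k → j ∉ τ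

/-- The subsets `σ` with `σ ∪ {i} ∈ Γ`: the link of `i` in `Γ`, joined with the vertex `i`. -/
def star (i : Fin m) (Γ : Set (Finset (Fin m))) : Set (Finset (Fin m)) := {σ | insert i σ ∈ Γ}

theorem mem_star {i : Fin m} {Γ : Set (Finset (Fin m))} {σ : Finset (Fin m)} :
    σ ∈ star i Γ ↔ insert i σ ∈ Γ := Iff.rfl

theorem star_subset (i : Fin m) {Γ : Set (Finset (Fin m))} (hΓ : IsLowerSet Γ) : star i Γ ⊆ Γ :=
  fun _ h => hΓ (Finset.subset_insert _ _) h

theorem isLowerSet_star (i : Fin m) {Γ : Set (Finset (Fin m))} (hΓ : IsLowerSet Γ) :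
    IsLowerSet (star i Γ) := fun _ _ h => hΓ (Finset.insert_subset_insert i h)

variable (R) in
/-- The part of `L` spanned by the elements `u_σ ⊗ v_τ` with `σ ∈ Γ` that do not contain the first
`k` variables. For `k = 0` and the set `Γ` of simplices of `Σ`, this is the image of `L(Σ)`. -/
noncomputable def smallPart (k : ℕ) (Γ : Set (Finset (Fin m))) :
    Submodule R (KoszulCoalgebra R (fullComplex m)) :=
  spanOf R (fullComplex m) (IsSmall k Γ)

variable {Γ : Set (Finset (Fin m))} {k : ℕ} {i : Fin m}

theorem IsSmall.zero {α : Fin m →₀ ℕ} {τ : Finset (Fin m)} (h : IsSmall (i + 1) Γ α τ) :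
    ∀ j ≤ i, α j = 0 := fun j hj => h.zero_of_lt j (Nat.lt_succ_of_le hj)

theorem IsSmall.notMem {α : Fin m →₀ ℕ} {τ : Finset (Fin m)} (h : IsSmall (i + 1) Γ α τ) :
    ∀ j ≤ i, j ∉ τ := fun j hj => h.notMem_of_lt j (Nat.lt_succ_of_le hj)

theorem IsSmall.wedgeK_tmul {α : Fin m →₀ ℕ} {τ : Finset (Fin m)} (h : IsSmall (i + 1) Γ α τ) :
    wedgeK i (u R (fullComplex m) α ⊗ₜ[R] v R τ) = u R _ α ⊗ₜ[R] v R (insert i τ) := by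
  rw [wedgeK, TensorProduct.map_tmul, wedge_v, if_neg (h.notMem i le_rfl),
    ExteriorCoalgebra.sign_singleton_eq_one, one_smul, LinearMap.id_apply]
  exact fun j hj => lt_of_not_ge fun hji => h.notMem j hji hj

theorem IsSmall.differential_mem (hΓ : IsLowerSet Γ) {α : Fin m →₀ ℕ} {τ : Finset (Fin m)}
    (h : IsSmall k Γ α τ) {j : Fin m} (hj : 0 < α j) :
    IsSmall k Γ (α - Finsupp.single j 1) (insert j τ) where
  le_one i := le_trans (tsub_le_self (a := α) i) (h.le_one i)
  disjoint := by
    rw [Finset.disjoint_insert_right]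
    refine ⟨?_, Finset.disjoint_of_subset_left (Finsupp.support_mono tsub_le_self) h.disjoint⟩
    have := h.le_one j
    simp
    omega
  mem := hΓ (Finsupp.support_mono tsub_le_self) h.mem
  zero_of_lt i hi := by
    have := tsub_le_self (a := α) (b := Finsupp.single j 1) i
    rw [h.zero_of_lt i hi] at this
    exact Nat.eq_zero_of_le_zero this
  notMem_of_lt i hi := by
    rw [Finset.mem_insert, not_or]
    refine ⟨?_, h.notMem_of_lt i hi⟩
    rintro rfl
    exact hj.ne' (h.zero_of_lt i hi)

theorem differential_smallPart (hΓ : IsLowerSet Γ) {x : KoszulCoalgebra R (fullComplex m)}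
    (hx : x ∈ smallPart R k Γ) : differential R _ x ∈ smallPart R k Γ := by
  refine spanOf_le (N := (smallPart R k Γ).comap (differential R _)) (fun α τ hα h => ?_) hx
  rw [Submodule.mem_comap]
  exact differential_mem_of hα τ fun j hj _ =>
    mem_spanOf (mem_fullComplex _) (h.differential_mem hΓ hj)

theorem IsSmall.of_succ {α : Fin m →₀ ℕ} {τ : Finset (Fin m)} (h : IsSmall (k + 1) Γ α τ) :
    IsSmall k Γ α τ :=
  ⟨h.le_one, h.disjoint, h.mem, fun j hj => h.zero_of_lt j (by omega),
    fun j hj => h.notMem_of_lt j (by omega)⟩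

theorem IsSmall.insert {α : Fin m →₀ ℕ} {τ : Finset (Fin m)} (h : IsSmall (i + 1) Γ α τ) :
    IsSmall i Γ α (insert i τ) where
  le_one := h.le_one
  disjoint := by
    rw [Finset.disjoint_insert_right]
    exact ⟨by simp [h.zero i le_rfl], h.disjoint⟩
  mem := h.mem
  zero_of_lt := h.of_succ.zero_of_lt
  notMem_of_lt j hj := by
    rw [Finset.mem_insert, not_or]
    exact ⟨by rintro rfl; exact lt_irrefl _ hj, h.of_succ.notMem_of_lt j hj⟩

theorem support_add_single_eq (α : Fin m →₀ ℕ) (i : Fin m) :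
    (α + Finsupp.single i 1).support = insert i α.support := by
  ext j
  by_cases h : j = i
  · simp [h]
  · simp [h]

theorem IsSmall.add_single {α : Fin m →₀ ℕ} {τ : Finset (Fin m)}
    (h : IsSmall (i + 1) (star i Γ) α τ) : IsSmall i (star i Γ) (α + Finsupp.single i 1) τ where
  le_one j := by
    by_cases hj : j = i
    · subst hj
      simp [h.zero j le_rfl]
    · simpa [Ne.symm hj] using h.le_one j
  disjoint := by
    rw [support_add_single_eq, Finset.disjoint_insert_left]
    exact ⟨h.notMem i le_rfl, h.disjoint⟩
  mem := by
    have := h.mem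
    rw [mem_star] at this ⊢
    rwa [support_add_single_eq, Finset.insert_idem]
  zero_of_lt j hj := by
    have : j ≠ i := by rintro rfl; exact lt_irrefl _ hj
    simpa [this.symm] using h.of_succ.zero_of_lt j hj
  notMem_of_lt := h.of_succ.notMem_of_lt

theorem raiseK_mem {x : KoszulCoalgebra R (fullComplex m)}
    (hx : x ∈ smallPart R (i + 1) (star i Γ)) : raiseK i x ∈ smallPart R i (star i Γ) := by
  refine spanOf_le (N := (smallPart R i (star i Γ)).comap (raiseK i)) (fun α τ _ h => ?_) hx
  rw [Submodule.mem_comap, raiseK_tmul]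
  exact mem_spanOf (mem_fullComplex _) h.add_single

theorem smallPart_succ_le : smallPart R (k + 1) Γ ≤ smallPart R k Γ :=
  spanOf_mono fun _ _ h => h.of_succ

theorem IsSmall.succ_of_ne {α : Fin m →₀ ℕ} {τ : Finset (Fin m)} (h : IsSmall i Γ α τ)
    (h0 : α i = 0) (hi : i ∉ τ) : IsSmall (i + 1) Γ α τ := by
  refine ⟨h.le_one, h.disjoint, h.mem, fun j hj => ?_, fun j hj => ?_⟩ <;>
    rcases (Nat.lt_succ_iff.1 hj).lt_or_eq with hj | hj
  · exact h.zero_of_lt j hj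
  · rwa [Fin.ext hj]
  · exact h.notMem_of_lt j hj
  · rwa [Fin.ext hj]

theorem IsSmall.erase {α : Fin m →₀ ℕ} {τ : Finset (Fin m)} (h : IsSmall k Γ α τ) :
    IsSmall k Γ α (τ.erase i) :=
  ⟨h.le_one, Finset.disjoint_of_subset_right (Finset.erase_subset _ _) h.disjoint, h.mem,
    h.zero_of_lt, fun j hj hj' => h.notMem_of_lt j hj (Finset.mem_of_mem_erase hj')⟩

/-- The basis elements that do not contain `u_i`. -/
theorem smallPart_sup_map_wedgeK :
    smallPart R (i + 1) Γ ⊔ (smallPart R (i + 1) Γ).map (wedgeK i) =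
      spanOf R (fullComplex m) fun α τ => IsSmall i Γ α τ ∧ α i = 0 := by
  refine le_antisymm (sup_le (spanOf_mono fun α τ h => ⟨h.of_succ, h.zero i le_rfl⟩) ?_)
    (spanOf_le fun α τ _ h => ?_)
  · rw [Submodule.map_le_iff_le_comap]
    refine spanOf_le fun α τ _ h => ?_
    rw [Submodule.mem_comap, h.wedgeK_tmul]
    exact mem_spanOf (mem_fullComplex _) ⟨h.insert, h.zero i le_rfl⟩
  · by_cases hi : i ∈ τ
    · have h' := h.1.erase (i := i) |>.succ_of_ne h.2 (Finset.notMem_erase i τ)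
      refine Submodule.mem_sup_right ⟨_, mem_spanOf (mem_fullComplex _) h', ?_⟩
      rw [h'.wedgeK_tmul, Finset.insert_erase hi]
    · exact Submodule.mem_sup_left (mem_spanOf (mem_fullComplex _) (h.1.succ_of_ne h.2 hi))

theorem smallPart_star_le : smallPart R i (star i Γ) ≤
    (smallPart R (i + 1) (star i Γ) ⊔ (smallPart R (i + 1) (star i Γ)).map (wedgeK i)) ⊔
      (smallPart R (i + 1) (star i Γ)).map (raiseK i) := by
  refine spanOf_le fun α τ _ h => ?_
  by_cases h0 : α i = 0
  · refine Submodule.mem_sup_left ?_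
    rw [smallPart_sup_map_wedgeK]
    exact mem_spanOf (mem_fullComplex _) ⟨h, h0⟩
  · have hle : Finsupp.single i 1 ≤ α := by simpa using! Nat.pos_of_ne_zero h0
    have e := tsub_add_cancel_of_le hle
    have hi : i ∉ τ := Finset.disjoint_left.1 h.disjoint (Finsupp.mem_support_iff.2 h0)
    have h1 : α i ≤ 1 := h.le_one i
    have h' : IsSmall i (star i Γ) (α - Finsupp.single i 1) τ := by
      refine ⟨fun j => le_trans (tsub_le_self (a := α) j) (h.le_one j),
        Finset.disjoint_of_subset_left (Finsupp.support_mono tsub_le_self) h.disjoint, ?_,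
        fun j hj => ?_, h.notMem_of_lt⟩
      · have := h.mem
        rw [mem_star] at this ⊢
        rwa [← support_add_single_eq, e, ← Finset.insert_eq_of_mem (Finsupp.mem_support_iff.2 h0)]
      · simp [h.zero_of_lt j hj]
    refine Submodule.mem_sup_right ⟨_, mem_spanOf (mem_fullComplex _) (h'.succ_of_ne ?_ hi), ?_⟩
    · simp
      omega
    · rw [raiseK_tmul, e]

theorem smallPart_eq (hΓ : IsLowerSet Γ) : smallPart R i Γ =
    (smallPart R (i + 1) Γ ⊔ (smallPart R (i + 1) Γ).map (wedgeK i)) ⊔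
      smallPart R i (star i Γ) := by
  rw [smallPart_sup_map_wedgeK, smallPart, smallPart, spanOf_sup]
  congr 1
  ext α τ
  constructor
  · intro h
    by_cases h0 : α i = 0
    · exact Or.inl ⟨h, h0⟩
    · refine Or.inr ⟨h.le_one, h.disjoint, ?_, h.zero_of_lt, h.notMem_of_lt⟩
      rw [mem_star, Finset.insert_eq_of_mem (Finsupp.mem_support_iff.2 h0)]
      exact h.mem
  · rintro (h | h)
    · exact h.1
    · exact ⟨h.le_one, h.disjoint, star_subset i hΓ h.mem, h.zero_of_lt, h.notMem_of_lt⟩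

theorem smallPart_inf (hΓ : IsLowerSet Γ) :
    (smallPart R (i + 1) Γ ⊔ (smallPart R (i + 1) Γ).map (wedgeK i)) ⊓ smallPart R i (star i Γ) =
      smallPart R (i + 1) (star i Γ) ⊔ (smallPart R (i + 1) (star i Γ)).map (wedgeK i) := by
  rw [smallPart_sup_map_wedgeK, smallPart_sup_map_wedgeK, smallPart, spanOf_inf]
  congr 1
  ext α τ
  constructor
  · rintro ⟨h, h'⟩
    exact ⟨h', h.2⟩
  · rintro ⟨h, h'⟩
    exact ⟨⟨⟨h.le_one, h.disjoint, star_subset i hΓ h.mem, h.zero_of_lt, h.notMem_of_lt⟩, h'⟩, h⟩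

theorem contractK_smallPart {x : KoszulCoalgebra R (fullComplex m)}
    (hx : x ∈ smallPart R (i + 1) Γ) : contractK i x = 0 :=
  eqOn_spanOf (f := contractK i) (g := 0) (fun α τ _ h => by
    rw [contractK, TensorProduct.map_tmul, ExteriorCoalgebra.contract_v,
      if_neg (h.notMem i le_rfl), TensorProduct.tmul_zero, LinearMap.zero_apply]) x hx

theorem contractK_wedgeK {x : KoszulCoalgebra R (fullComplex m)}
    (hx : x ∈ smallPart R (i + 1) Γ) : contractK i (wedgeK i x) = x :=
  eqOn_spanOf (f := contractK i ∘ₗ wedgeK i) (g := LinearMap.id) (fun α τ _ h => by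
    rw [LinearMap.comp_apply, wedgeK, contractK, TensorProduct.map_tmul, TensorProduct.map_tmul,
      ExteriorCoalgebra.contract_wedge, if_neg (h.notMem i le_rfl)]
    rfl) x hx

theorem differential_raiseK_of_mem {x : KoszulCoalgebra R (fullComplex m)}
    (hx : x ∈ smallPart R (i + 1) Γ) :
    differential R _ (raiseK i x) = wedgeK i x + raiseK i (differential R _ x) :=
  eqOn_spanOf (f := differential R _ ∘ₗ raiseK i) (g := wedgeK i + raiseK i ∘ₗ differential R _)
    (fun _ τ _ h => differential_raiseK (h.zero i le_rfl) τ) x hx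

/-- The elements `u_i v_τ` cancel against the elements `v_i v_τ`. -/
theorem isQI_smallPart_star (hΓ : IsLowerSet Γ) : IsQI (differential R _) (differential R _)
    LinearMap.id (smallPart R (i + 1) (star i Γ)) (smallPart R i (star i Γ)) := by
  have hS := isLowerSet_star i hΓ
  set η : KoszulCoalgebra R (fullComplex m) →ₗ[R] KoszulCoalgebra R (fullComplex m) :=
    -(raiseK i ∘ₗ contractK i) with hη
  have e0 : ∀ x ∈ smallPart R (i + 1) (star i Γ), η x = 0 := fun x hx => by
    rw [hη, LinearMap.neg_apply, LinearMap.comp_apply, contractK_smallPart hx, map_zero, neg_zero]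
  have e1 : ∀ x ∈ smallPart R (i + 1) (star i Γ), η (wedgeK i x) = - raiseK i x := fun x hx => by
    rw [hη, LinearMap.neg_apply, LinearMap.comp_apply, contractK_wedgeK hx]
  have e2 : ∀ x ∈ smallPart R (i + 1) (star i Γ), η (raiseK i x) = 0 := fun x hx => by
    rw [hη, LinearMap.neg_apply, LinearMap.comp_apply, contractK_raiseK, contractK_smallPart hx,
      map_zero, map_zero, neg_zero]
  refine IsQI.of_compression smallPart_succ_le η differential_differential
    (fun a => differential_smallPart hS) (fun a => differential_smallPart hS)
    (fun a ha => by rw [e0 a ha]; exact zero_mem _) (fun b hb => ?_) fun b hb => ?_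
  · have : smallPart R i (star i Γ) ≤ (smallPart R i (star i Γ)).comap η := by
      refine smallPart_star_le.trans (sup_le (sup_le ?_ ?_) ?_)
      · intro x hx
        rw [Submodule.mem_comap, e0 x hx]
        exact zero_mem _
      · rintro _ ⟨x, hx, rfl⟩
        rw [Submodule.mem_comap, e1 x hx]
        exact neg_mem (raiseK_mem hx)
      · rintro _ ⟨x, hx, rfl⟩
        rw [Submodule.mem_comap, e2 x hx]
        exact zero_mem _
    exact this hb
  · have : smallPart R i (star i Γ) ≤ (smallPart R (i + 1) (star i Γ)).comap
        (LinearMap.id + (differential R _ ∘ₗ η + η ∘ₗ differential R _)) := by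
      refine smallPart_star_le.trans (sup_le (sup_le ?_ ?_) ?_)
      · intro x hx
        simp only [Submodule.mem_comap, LinearMap.add_apply, LinearMap.comp_apply,
          LinearMap.id_apply]
        rw [e0 x hx, e0 _ (differential_smallPart hS hx), map_zero, add_zero, add_zero]
        exact hx
      · rintro _ ⟨x, hx, rfl⟩
        simp only [Submodule.mem_comap, LinearMap.add_apply, LinearMap.comp_apply,
          LinearMap.id_apply]
        rw [e1 x hx, differential_wedgeK, map_neg, map_neg, e1 _ (differential_smallPart hS hx),
          differential_raiseK_of_mem hx, neg_neg]
        convert zero_mem (smallPart R (i + 1) (star i Γ)) using 1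
        abel
      · rintro _ ⟨x, hx, rfl⟩
        simp only [Submodule.mem_comap, LinearMap.add_apply, LinearMap.comp_apply,
          LinearMap.id_apply]
        rw [e2 x hx, map_zero, differential_raiseK_of_mem hx, map_add, e1 x hx,
          e2 _ (differential_smallPart hS hx)]
        convert zero_mem (smallPart R (i + 1) (star i Γ)) using 1
        abel
    exact this hb

/-! ### Multiplicative properties of the comparison map -/

open NormalizedChains Sing

variable (R m) in
/-- The map that sends `u_σ ⊗ v_τ` to the product of the discs in the coordinates in `σ` and the
circles in the coordinates in `τ`. -/
noncomputable def toChains : KoszulCoalgebra R (fullComplex m) →ₗ[R] SingChains R (Fin m → ℂ) :=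
  lift (productChain R)

theorem toChains_tmul (α : Fin m →₀ ℕ) (τ : Finset (Fin m)) :
    toChains R m (u R _ α ⊗ₜ[R] v R τ) = productChain R α τ := lift_tmul _ (mem_fullComplex _) τ

theorem toChains_wedgeK {x : KoszulCoalgebra R (fullComplex m)}
    (hx : x ∈ smallPart R (i + 1) Γ) : toChains R m (wedgeK i x) = circleOp R i (toChains R m x) :=
  eqOn_spanOf (f := toChains R m ∘ₗ wedgeK i) (g := circleOp R i ∘ₗ toChains R m)
    (fun α τ _ h => by
      rw [LinearMap.comp_apply, LinearMap.comp_apply, h.wedgeK_tmul, toChains_tmul, toChains_tmul,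
        productChain_insert h.zero h.notMem]) x hx

theorem toChains_raiseK {x : KoszulCoalgebra R (fullComplex m)}
    (hx : x ∈ smallPart R (i + 1) Γ) : toChains R m (raiseK i x) = diskOp R i (toChains R m x) :=
  eqOn_spanOf (f := toChains R m ∘ₗ raiseK i) (g := diskOp R i ∘ₗ toChains R m)
    (fun α τ _ h => by
      rw [LinearMap.comp_apply, LinearMap.comp_apply, raiseK_tmul, toChains_tmul, toChains_tmul,
        productChain_add_single h.zero h.notMem]) x hx

theorem pushChains_toChains {x : KoszulCoalgebra R (fullComplex m)}
    (hx : x ∈ smallPart R (i + 1) Γ) :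
    pushChains R (setOne i) (toChains R m x) = toChains R m x :=
  eqOn_spanOf (f := pushChains R (setOne i) ∘ₗ toChains R m) (g := toChains R m)
    (fun α τ _ h => by
      rw [LinearMap.comp_apply, toChains_tmul]
      refine pushChains_eq_self (fun z hz => ?_) (productChain_mem α τ)
      have := hz i (h.zero i le_rfl) (h.notMem i le_rfl)
      exact (congrArg (Function.update z i) this.symm).trans (Function.update_eq_self i z)) x hx

theorem signK_tmul (α : Fin m →₀ ℕ) (τ : Finset (Fin m)) :
    signK R (fullComplex m) (u R _ α ⊗ₜ[R] v R τ) =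
      ((-1 : R) ^ (2 * (∑ i, α i) + τ.card)) • u R _ α ⊗ₜ[R] v R τ := by
  rw [signK, ← degreeSign_eq, degreeSign_of_mem _ isInternal (mem_deg (mem_fullComplex _) rfl)]

theorem signK_mem {x : KoszulCoalgebra R (fullComplex m)} (hx : x ∈ smallPart R k Γ) :
    signK R _ x ∈ smallPart R k Γ := by
  refine spanOf_le (N := (smallPart R k Γ).comap (signK R _)) (fun α τ hα h => ?_) hx
  rw [Submodule.mem_comap, signK_tmul]
  exact Submodule.smul_mem _ _ (mem_spanOf hα h)

theorem signS_toChains {x : KoszulCoalgebra R (fullComplex m)} (hx : x ∈ smallPart R k Γ) :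
    signS R _ (toChains R m x) = toChains R m (signK R _ x) :=
  eqOn_spanOf (f := signS R _ ∘ₗ toChains R m) (g := toChains R m ∘ₗ signK R _)
    (fun α τ _ h => by
      rw [LinearMap.comp_apply, LinearMap.comp_apply, signK_tmul, map_smul, toChains_tmul]
      exact degreeSign_of_mem _ _ (productChain_mem_deg h.le_one h.disjoint)) x hx

/-- The diagonal of the small model. -/
theorem comul_smallPart {x : KoszulCoalgebra R (fullComplex m)}
    (hx : x ∈ smallPart R k Set.univ) : Coalgebra.comul (R := R) x ∈
      Submodule.span R {t | ∃ a ∈ smallPart R k Set.univ, ∃ b ∈ smallPart R k Set.univ,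
        t = a ⊗ₜ[R] b} := by
  refine spanOf_le (N := (Submodule.span R {t | ∃ a ∈ smallPart R k Set.univ,
    ∃ b ∈ smallPart R k Set.univ, t = a ⊗ₜ[R] b}).comap (Coalgebra.comul (R := R)))
    (fun α τ hα h => ?_) hx
  rw [Submodule.mem_comap, comul_tmul hα]
  refine Submodule.sum_mem _ fun p hp => Submodule.sum_mem _ fun A hA =>
    Submodule.smul_mem _ _ (Submodule.subset_span ⟨_, ?_, _, ?_, rfl⟩)
  all_goals
    refine mem_spanOf (mem_fullComplex _) ?_
  · have hp1 : p.1 ≤ α := by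
      rw [← Finset.HasAntidiagonal.mem_antidiagonal.1 hp]; exact le_self_add
    exact ⟨fun i => (hp1 i).trans (h.le_one i), Finset.disjoint_of_subset_left
      (Finsupp.support_mono hp1) (Finset.disjoint_of_subset_right (Finset.mem_powerset.1 hA)
        h.disjoint), trivial,
      fun j hj => Nat.eq_zero_of_le_zero ((hp1 j).trans (h.zero_of_lt j hj).le),
      fun j hj hj' => h.notMem_of_lt j hj (Finset.mem_powerset.1 hA hj')⟩
  · have hp2 : p.2 ≤ α := by
      rw [← Finset.HasAntidiagonal.mem_antidiagonal.1 hp]; exact le_add_self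
    exact ⟨fun i => (hp2 i).trans (h.le_one i), Finset.disjoint_of_subset_left
      (Finsupp.support_mono hp2) (Finset.disjoint_of_subset_right Finset.sdiff_subset
        h.disjoint), trivial,
      fun j hj => Nat.eq_zero_of_le_zero ((hp2 j).trans (h.zero_of_lt j hj).le),
      fun j hj hj' => h.notMem_of_lt j hj (Finset.sdiff_subset hj')⟩

theorem map_comul_congr {N : Type} [AddCommGroup N] [Module R N]
    {f g f' g' : KoszulCoalgebra R (fullComplex m) →ₗ[R] N}
    (hf : ∀ x ∈ smallPart R k Set.univ, f x = f' x) (hg : ∀ x ∈ smallPart R k Set.univ, g x = g' x)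
    {x : KoszulCoalgebra R (fullComplex m)} (hx : x ∈ smallPart R k Set.univ) :
    TensorProduct.map f g (Coalgebra.comul (R := R) x) =
      TensorProduct.map f' g' (Coalgebra.comul (R := R) x) := by
  have : Submodule.span R {t | ∃ a ∈ smallPart R k Set.univ, ∃ b ∈ smallPart R k Set.univ,
      t = a ⊗ₜ[R] b} ≤ LinearMap.eqLocus (TensorProduct.map f g) (TensorProduct.map f' g') := by
    rw [Submodule.span_le]
    rintro _ ⟨a, ha, b, hb, rfl⟩
    change TensorProduct.map f g (a ⊗ₜ[R] b) = TensorProduct.map f' g' (a ⊗ₜ[R] b)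
    rw [TensorProduct.map_tmul, TensorProduct.map_tmul, hf a ha, hg b hb]
  exact this (comul_smallPart hx)

theorem map_map {M N P : Type} [AddCommGroup M] [Module R M] [AddCommGroup N] [Module R N]
    [AddCommGroup P] [Module R P] (f g : N →ₗ[R] P) (f' g' : M →ₗ[R] N) (t : M ⊗[R] M) :
    TensorProduct.map f g (TensorProduct.map f' g' t) =
      TensorProduct.map (f ∘ₗ f') (g ∘ₗ g') t := by
  rw [TensorProduct.map_comp, LinearMap.comp_apply]

theorem smallPart_univ_le : smallPart R i Set.univ ≤
    (smallPart R (i + 1) Set.univ ⊔ (smallPart R (i + 1) Set.univ).map (wedgeK i)) ⊔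
      (smallPart R (i + 1) Set.univ).map (raiseK i) :=
  smallPart_star_le (R := R) (i := i) (Γ := Set.univ)

theorem comul_raiseK_of_mem {x : KoszulCoalgebra R (fullComplex m)}
    (hx : x ∈ smallPart R (i + 1) Γ) : Coalgebra.comul (R := R) (raiseK i x) =
      TensorProduct.map (raiseK i) LinearMap.id (Coalgebra.comul (R := R) x) +
        TensorProduct.map LinearMap.id (raiseK i) (Coalgebra.comul (R := R) x) :=
  eqOn_spanOf (f := Coalgebra.comul (R := R) ∘ₗ raiseK i)
    (g := TensorProduct.map (raiseK i) LinearMap.id ∘ₗ Coalgebra.comul (R := R) +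
      TensorProduct.map LinearMap.id (raiseK i) ∘ₗ Coalgebra.comul (R := R))
    (fun _ τ _ h => comul_raiseK (h.zero i le_rfl) τ) x hx

theorem smallPart_last_le {N : Submodule R (KoszulCoalgebra R (fullComplex m))}
    (h : ∅ ∈ Γ → u R (fullComplex m) 0 ⊗ₜ[R] v R ∅ ∈ N) : smallPart R m Γ ≤ N := by
  refine spanOf_le fun α τ _ hs => ?_
  have h1 : α = 0 := Finsupp.ext fun j => hs.zero_of_lt j j.2
  have h2 : τ = ∅ := Finset.eq_empty_of_forall_notMem fun j => hs.notMem_of_lt j j.2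
  subst h1 h2
  exact h (by simpa using hs.mem)

theorem toChains_one : toChains R m (u R _ 0 ⊗ₜ[R] v R ∅) = basePoint R m := by
  rw [toChains_tmul, productChain]
  have : ∀ l : List (Fin m), l.foldr (fun i c => slotOp R 0 ∅ i c) (basePoint R m) =
      basePoint R m := fun l => by
    induction l with
    | nil => rfl
    | cons i l ih => rw [List.foldr_cons, ih, slotOp_eq_id (by simp) (by simp)]; rfl
  exact this _

theorem comul_basePoint :
    Coalgebra.comul (R := R) (basePoint R m) = basePoint R m ⊗ₜ[R] basePoint R m := by
  refine (comul_of _).trans ?_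
  rw [diagonal, Fin.sum_univ_one]
  congr 1

theorem counit_basePoint : Coalgebra.counit (R := R) (basePoint R m) = 1 :=
  (counit_of _).trans (if_pos rfl)

theorem comul_toChains_aux (k : ℕ) (hk : k ≤ m) : ∀ x ∈ smallPart R (m - k) Set.univ,
    Coalgebra.comul (R := R) (toChains R m x) =
      TensorProduct.map (toChains R m) (toChains R m) (Coalgebra.comul (R := R) x) ∧
    Coalgebra.counit (R := R) (toChains R m x) = Coalgebra.counit (R := R) x := by
  suffices h : smallPart R (m - k) Set.univ ≤ LinearMap.eqLocus
      (Coalgebra.comul (R := R) ∘ₗ toChains R m)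
      (TensorProduct.map (toChains R m) (toChains R m) ∘ₗ Coalgebra.comul (R := R)) ⊓
      LinearMap.eqLocus (Coalgebra.counit (R := R) ∘ₗ toChains R m) (Coalgebra.counit (R := R)) from
    fun x hx => h hx
  induction k with
  | zero =>
    refine smallPart_last_le fun _ => ⟨?_, ?_⟩
    · rw [SetLike.mem_coe, LinearMap.mem_eqLocus, LinearMap.comp_apply, LinearMap.comp_apply, toChains_one,
        comul_basePoint, comul_tmul (mem_fullComplex _)]
      simp [toChains_one, ExteriorCoalgebra.sign_empty_left]
    · rw [SetLike.mem_coe, LinearMap.mem_eqLocus, LinearMap.comp_apply, toChains_one, counit_basePoint,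
        counit_tmul (mem_fullComplex _), if_pos ⟨rfl, rfl⟩]
  | succ k ih =>
    obtain ⟨i, hi⟩ : ∃ i : Fin m, i.1 = m - (k + 1) := ⟨⟨m - (k + 1), by omega⟩, rfl⟩
    have ih' := ih (by omega)
    rw [show m - k = i + 1 by omega] at ih'
    rw [← hi]
    refine smallPart_univ_le.trans (sup_le (sup_le ih' ?_) ?_)
    · rintro _ ⟨x, hx, rfl⟩
      have hc : Coalgebra.comul (R := R) (toChains R m x) =
        TensorProduct.map (toChains R m) (toChains R m) (Coalgebra.comul (R := R) x) := (ih' hx).1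
      refine ⟨?_, ?_⟩
      · rw [SetLike.mem_coe, LinearMap.mem_eqLocus, LinearMap.comp_apply, LinearMap.comp_apply, toChains_wedgeK hx,
          comul_circleOp, hc, comul_wedgeK, map_add, map_map, map_map, map_map, map_map]
        congr 1
        · refine map_comul_congr (k := i + 1) (fun y hy => ?_) (fun y hy => ?_) hx
          · exact (toChains_wedgeK hy).symm
          · exact pushChains_toChains hy
        · refine map_comul_congr (k := i + 1) (fun y hy => ?_) (fun y hy => ?_) hx
          · simp only [LinearMap.comp_apply]
            rw [signS_toChains hy, pushChains_toChains (signK_mem hy)]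
          · exact (toChains_wedgeK hy).symm
      · rw [SetLike.mem_coe, LinearMap.mem_eqLocus, LinearMap.comp_apply, toChains_wedgeK hx, counit_circleOp,
          counit_wedgeK]
    · rintro _ ⟨x, hx, rfl⟩
      have hc : Coalgebra.comul (R := R) (toChains R m x) =
        TensorProduct.map (toChains R m) (toChains R m) (Coalgebra.comul (R := R) x) := (ih' hx).1
      refine ⟨?_, ?_⟩
      · rw [SetLike.mem_coe, LinearMap.mem_eqLocus, LinearMap.comp_apply, LinearMap.comp_apply, toChains_raiseK hx,
          comul_diskOp, hc, comul_raiseK_of_mem hx, map_add, map_map, map_map, map_map, map_map]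
        congr 1
        · refine map_comul_congr (k := i + 1) (fun y hy => ?_) (fun y hy => ?_) hx
          · exact (toChains_raiseK hy).symm
          · exact pushChains_toChains hy
        · refine map_comul_congr (k := i + 1) (fun y hy => ?_) (fun y hy => ?_) hx
          · exact pushChains_toChains hy
          · exact (toChains_raiseK hy).symm
      · rw [SetLike.mem_coe, LinearMap.mem_eqLocus, LinearMap.comp_apply, toChains_raiseK hx, counit_diskOp,
          counit_raiseK]

/-- The comparison map respects the diagonals, even though discs and circles are multiplied by prism
operators: the terms that would spoil this contain simplices degenerate in one coordinate. -/
theorem comul_toChains {x : KoszulCoalgebra R (fullComplex m)} (hx : x ∈ smallPart R 0 Set.univ) :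
    Coalgebra.comul (R := R) (toChains R m x) =
      TensorProduct.map (toChains R m) (toChains R m) (Coalgebra.comul (R := R) x) := by
  have := comul_toChains_aux m le_rfl x
  rw [Nat.sub_self] at this
  exact (this hx).1

theorem counit_toChains {x : KoszulCoalgebra R (fullComplex m)}
    (hx : x ∈ smallPart R 0 Set.univ) :
    Coalgebra.counit (R := R) (toChains R m x) = Coalgebra.counit (R := R) x := by
  have := comul_toChains_aux m le_rfl x
  rw [Nat.sub_self] at this
  exact (this hx).2

end KoszulCoalgebra

end Comparison

/-! ### The comparison map is a quasi-isomorphism -/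

section MainInduction

open Simplicial
open scoped TensorProduct
open Sing

variable {R : Type} [CommRing R] {m : ℕ}

open Classical in
/-- The indices of the coordinates that do not lie on the unit circle. -/
noncomputable def nonUnit (z : Fin m → ℂ) : Finset (Fin m) := Finset.univ.filter fun j => ‖z j‖ ≠ 1

theorem mem_nonUnit {z : Fin m → ℂ} {j : Fin m} : j ∈ nonUnit z ↔ ‖z j‖ ≠ 1 := by
  simp [nonUnit]

theorem insert_nonUnit_update (z : Fin m → ℂ) (i : Fin m) (w : ℂ) :
    insert i (nonUnit (Function.update z i w)) = insert i (nonUnit z) := by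
  ext j
  by_cases h : j = i
  · simp [h]
  · simp [h, mem_nonUnit]

/-- The points of the moment-angle complex of `Γ` whose first `k` coordinates are equal to `1`. -/
def partialMomentAngle (k : ℕ) (Γ : Set (Finset (Fin m))) : Set (Fin m → ℂ) :=
  {z | (∀ j : Fin m, j.1 < k → z j = 1) ∧ (∀ j, ‖z j‖ ≤ 1) ∧ nonUnit z ∈ Γ}

variable {Γ : Set (Finset (Fin m))} {i : Fin m}

theorem update_mem_partialMomentAngle {k : ℕ} (hi : k ≤ i.1) {z : Fin m → ℂ}
    (hz : z ∈ partialMomentAngle k Γ) {w : ℂ} (hw : ‖w‖ ≤ 1)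
    (h : nonUnit (Function.update z i w) ∈ Γ) : Function.update z i w ∈ partialMomentAngle k Γ := by
  refine ⟨fun j hj => ?_, fun j => ?_, h⟩
  · rw [Function.update_of_ne]
    · exact hz.1 j hj
    · rintro rfl
      omega
  · by_cases hj : j = i
    · subst hj
      rwa [Function.update_self]
    · rw [Function.update_of_ne hj]
      exact hz.2.1 j

theorem nonUnit_update_of_norm_eq_one (z : Fin m → ℂ) (i : Fin m) {w : ℂ} (hw : ‖w‖ = 1) :
    nonUnit (Function.update z i w) ⊆ nonUnit z := by
  intro j hj
  rw [mem_nonUnit] at hj ⊢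
  by_cases h : j = i
  · subst h
    rw [Function.update_self] at hj
    exact absurd hw hj
  · rwa [Function.update_of_ne h] at hj

theorem partialMomentAngle_succ_subset {k : ℕ} :
    partialMomentAngle (k + 1) Γ ⊆ partialMomentAngle k Γ :=
  fun _ h => ⟨fun j hj => h.1 j (by omega), h.2⟩

theorem circleOver_partialMomentAngle (hΓ : IsLowerSet Γ) :
    circleOver i (partialMomentAngle (i + 1) Γ) =
      partialMomentAngle i Γ ∩ {z | ‖z i‖ = 1} := by
  ext z
  constructor
  · rintro ⟨h, h1⟩
    refine ⟨?_, h1⟩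
    have := update_mem_partialMomentAngle (i := i) (w := z i) le_rfl
      (partialMomentAngle_succ_subset h) h1.le ?_
    · rwa [Function.update_idem, Function.update_eq_self] at this
    · exact hΓ (nonUnit_update_of_norm_eq_one _ i h1) h.2.2
  · rintro ⟨h, h1⟩
    refine ⟨?_, h1⟩
    have := update_mem_partialMomentAngle (i := i) (w := 1) le_rfl h (by simp)
      (hΓ (nonUnit_update_of_norm_eq_one z i (by simp)) h.2.2)
    refine ⟨fun j hj => ?_, this.2⟩
    rcases (Nat.lt_succ_iff.1 hj).lt_or_eq with hj | hj
    · exact this.1 j hj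
    · rw [Fin.ext hj, Function.update_self]

/-- The part of the moment-angle complex over an annulus in the `i`-th coordinate. -/
def annulusPart (i : Fin m) (Γ : Set (Finset (Fin m))) : Set (Fin m → ℂ) :=
  partialMomentAngle i Γ ∩ {z | 1 / 2 ≤ ‖z i‖}

/-- The radial deformation of the annulus `1 / 2 ≤ |z| ≤ 1` in the `i`-th coordinate. -/
noncomputable def radial (i : Fin m) : C(ℝ × (Fin m → ℂ), Fin m → ℂ) :=
  ⟨fun q => Function.update q.2 i
      (((1 - q.1 + q.1 / max ‖q.2 i‖ (1 / 2) : ℝ) : ℂ) * q.2 i), by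
    have : ∀ q : ℝ × (Fin m → ℂ), max ‖q.2 i‖ (1 / 2) ≠ 0 := fun q =>
      (lt_of_lt_of_le (by norm_num) (le_max_right _ _)).ne'
    fun_prop (disch := exact this)⟩

theorem radial_apply (i : Fin m) (s : ℝ) (z : Fin m → ℂ) : radial i (s, z) =
    Function.update z i (((1 - s + s / max ‖z i‖ (1 / 2) : ℝ) : ℂ) * z i) := rfl

theorem norm_radial {s r : ℝ} {w : ℂ} (hs : s ∈ Set.Icc (0 : ℝ) 1) (hr : ‖w‖ = r)
    (h : 1 / 2 ≤ r) : ‖((1 - s + s / max ‖w‖ (1 / 2) : ℝ) : ℂ) * w‖ = (1 - s) * r + s := by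
  have hr0 : 0 < r := by linarith
  have h0 : 0 ≤ 1 - s + s / r := add_nonneg (by linarith [hs.2]) (div_nonneg hs.1 hr0.le)
  rw [norm_mul, hr, max_eq_left h, Complex.norm_real, Real.norm_of_nonneg h0, add_mul,
    div_mul_cancel₀ _ hr0.ne']

theorem isQI_annulusPart (hΓ : IsLowerSet Γ) : IsQI (singD R) (singD R) LinearMap.id
    (chainsIn R (circleOver i (partialMomentAngle (i + 1) Γ))) (chainsIn R (annulusPart i Γ)) := by
  rw [circleOver_partialMomentAngle hΓ]
  have key : ∀ s ∈ Set.Icc (0 : ℝ) 1, ∀ z ∈ annulusPart i Γ,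
      radial i (s, z) ∈ partialMomentAngle i Γ ∧ ‖radial i (s, z) i‖ = (1 - s) * ‖z i‖ + s := by
    rintro s hs z ⟨hz, h⟩
    have hn := norm_radial hs (w := z i) rfl h
    have h1 := hz.2.1 i
    rw [radial_apply, Function.update_self]
    refine ⟨update_mem_partialMomentAngle le_rfl hz ?_ (hΓ ?_ hz.2.2), hn⟩
    · rw [hn]
      nlinarith [hs.1, hs.2]
    · intro j hj
      rw [mem_nonUnit] at hj ⊢
      by_cases hji : j = i
      · subst hji
        rw [Function.update_self, hn] at hj
        intro h'
        rw [h'] at hj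
        exact hj (by ring)
      · rwa [Function.update_of_ne hji] at hj
  have hsub : partialMomentAngle i Γ ∩ ({z | ‖z i‖ = 1}) ⊆ annulusPart i Γ := by
    rintro z ⟨hz, h⟩
    refine ⟨hz, ?_⟩
    have h' : ‖z i‖ = 1 := h
    change 1 / 2 ≤ ‖z i‖
    rw [h']
    norm_num
  refine isQI_of_deformation hsub (radial i) (fun z => ?_) (fun z hz => ?_)
    (fun s hs z hz => ?_) (fun s hs z hz => ?_)
  · rw [radial_apply, sub_zero, zero_div, add_zero, Complex.ofReal_one, one_mul,
      Function.update_eq_self]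
  · obtain ⟨h, h'⟩ := key 1 (by simp) z hz
    exact ⟨h, h'.trans (by ring)⟩
  · obtain ⟨h, h'⟩ := key s hs z (hsub hz)
    have h1 : ‖z i‖ = 1 := hz.2
    exact ⟨h, h'.trans (by rw [h1]; ring)⟩
  · obtain ⟨h, h'⟩ := key s hs z hz
    refine ⟨h, ?_⟩
    have h2 : 1 / 2 ≤ ‖z i‖ := hz.2
    refine le_of_le_of_eq ?_ h'.symm
    nlinarith [hs.1, hs.2]

/-- The straight-line deformation of the `i`-th coordinate to `1`. -/
noncomputable def lineToOne (i : Fin m) : C(ℝ × (Fin m → ℂ), Fin m → ℂ) :=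
  ⟨fun q => Function.update q.2 i ((1 - q.1) * q.2 i + q.1), by fun_prop⟩

theorem lineToOne_apply (i : Fin m) (s : ℝ) (z : Fin m → ℂ) :
    lineToOne i (s, z) = Function.update z i ((1 - s) * z i + s) := rfl

open KoszulCoalgebra

theorem update_mem_star {z : Fin m → ℂ} (hz : z ∈ partialMomentAngle i (star i Γ)) {w : ℂ}
    (hw : ‖w‖ ≤ 1) : Function.update z i w ∈ partialMomentAngle i (star i Γ) := by
  refine update_mem_partialMomentAngle le_rfl hz hw ?_
  have := hz.2.2
  rw [mem_star] at this ⊢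
  rwa [insert_nonUnit_update]

theorem isQI_diskPart : IsQI (singD R) (singD R) LinearMap.id
    (chainsIn R (partialMomentAngle (i + 1) (star i Γ)))
    (chainsIn R (partialMomentAngle i (star i Γ))) := by
  have key : ∀ s ∈ Set.Icc (0 : ℝ) 1, ∀ z ∈ partialMomentAngle i (star i Γ),
      lineToOne i (s, z) ∈ partialMomentAngle i (star i Γ) := by
    intro s hs z hz
    rw [lineToOne_apply]
    refine update_mem_star hz ?_
    have h1 : ‖(1 - s : ℂ)‖ = 1 - s := by
      rw [← Complex.ofReal_one, ← Complex.ofReal_sub, Complex.norm_real, Real.norm_of_nonneg]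
      linarith [hs.2]
    have h2 : ‖(s : ℂ)‖ = s := by rw [Complex.norm_real, Real.norm_of_nonneg hs.1]
    calc ‖(1 - s : ℂ) * z i + s‖ ≤ ‖(1 - s : ℂ) * z i‖ + ‖(s : ℂ)‖ := norm_add_le _ _
      _ = (1 - s) * ‖z i‖ + s := by rw [norm_mul, h1, h2]
      _ ≤ 1 := by nlinarith [hs.1, hs.2, hz.2.1 i]
  have hone : ∀ s, ∀ z ∈ partialMomentAngle (i + 1) (star i Γ), lineToOne i (s, z) = z := by
    intro s z hz
    rw [lineToOne_apply]
    have := hz.1 i (Nat.lt_succ_self _)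
    rw [this, mul_one, sub_add_cancel, ← this, Function.update_eq_self]
  refine isQI_of_deformation partialMomentAngle_succ_subset (lineToOne i) (fun z => ?_)
    (fun z hz => ?_) (fun s _ z hz => by rwa [hone s z hz]) key
  · rw [lineToOne_apply, Complex.ofReal_zero, sub_zero, one_mul, add_zero, Function.update_eq_self]
  · have := key 1 (by simp) z hz
    refine ⟨fun j hj => ?_, this.2⟩
    rcases (Nat.lt_succ_iff.1 hj).lt_or_eq with hj | hj
    · exact this.1 j hj
    · rw [Fin.ext hj, lineToOne_apply, Function.update_self]
      simp

/-- The inductive step for the part over the annulus. -/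
theorem isQI_toChains_annulus (hΓ : IsLowerSet Γ)
    (h : IsQI (differential R _) (singD R) (toChains R m) (smallPart R (i + 1) Γ)
      (chainsIn R (partialMomentAngle (i + 1) Γ))) :
    IsQI (differential R _) (singD R) (toChains R m)
      (smallPart R (i + 1) Γ ⊔ (smallPart R (i + 1) Γ).map (wedgeK i))
      (chainsIn R (annulusPart i Γ)) :=
  (isQI_circleOver (wedgeK i) (contractK i) (fun _ hz => hz.1 i (Nat.lt_succ_self _)) h
    (fun a _ => differential_wedgeK i a) (fun _ => contractK_smallPart)
    (fun _ => contractK_wedgeK) (fun _ => toChains_wedgeK)).trans (isQI_annulusPart hΓ)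

/-- The inductive step for the part over the disc. -/
theorem isQI_toChains_disk (hΓ : IsLowerSet Γ)
    (h : IsQI (differential R _) (singD R) (toChains R m) (smallPart R (i + 1) (star i Γ))
      (chainsIn R (partialMomentAngle (i + 1) (star i Γ)))) :
    IsQI (differential R _) (singD R) (toChains R m) (smallPart R i (star i Γ))
      (chainsIn R (partialMomentAngle i (star i Γ))) := by
  have hsub := partialMomentAngle_succ_subset (Γ := star i Γ) (k := i.1)
  have hmap : smallPart R i (star i Γ) ≤
      (chainsIn R (partialMomentAngle i (star i Γ))).comap (toChains R m) := by
    refine smallPart_star_le.trans (sup_le (sup_le ?_ ?_) ?_)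
    · exact fun a ha => chainsIn_mono hsub (h.map_mem a ha)
    · rintro _ ⟨a, ha, rfl⟩
      rw [Submodule.mem_comap, toChains_wedgeK ha]
      exact circleOp_mem (fun _ hz w hw => update_mem_star (hsub hz) hw.le) (h.map_mem a ha)
    · rintro _ ⟨a, ha, rfl⟩
      rw [Submodule.mem_comap, toChains_raiseK ha]
      exact diskOp_mem (fun _ hz w hw => update_mem_star (hsub hz) hw) (h.map_mem a ha)
  have hcomm : smallPart R i (star i Γ) ≤
      LinearMap.eqLocus (toChains R m ∘ₗ differential R _) (singD R ∘ₗ toChains R m) := by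
    refine smallPart_star_le.trans (sup_le (sup_le h.comm ?_) ?_)
    · rintro _ ⟨a, ha, rfl⟩
      rw [LinearMap.mem_eqLocus, LinearMap.comp_apply, LinearMap.comp_apply, differential_wedgeK,
        map_neg, toChains_wedgeK ha, toChains_wedgeK (h.d_left a ha), h.comm a ha, singD_circleOp]
    · rintro _ ⟨a, ha, rfl⟩
      rw [LinearMap.mem_eqLocus, LinearMap.comp_apply, LinearMap.comp_apply,
        differential_raiseK_of_mem ha, map_add, toChains_wedgeK ha, toChains_raiseK ha,
        toChains_raiseK (h.d_left a ha), h.comm a ha, singD_diskOp]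
  exact (isQI_smallPart_star hΓ).of_comp (h.trans isQI_diskPart) hmap hcomm

theorem isQI_toChains_step (hΓ : IsLowerSet Γ)
    (h : ∀ Γ : Set (Finset (Fin m)), IsLowerSet Γ → IsQI (differential R _) (singD R)
      (toChains R m) (smallPart R (i + 1) Γ) (chainsIn R (partialMomentAngle (i + 1) Γ))) :
    IsQI (differential R _) (singD R) (toChains R m) (smallPart R i Γ)
      (chainsIn R (partialMomentAngle i Γ)) := by
  have hS := isLowerSet_star i hΓ
  have hsub : partialMomentAngle i (star i Γ) ⊆ partialMomentAngle i Γ :=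
    fun z hz => ⟨hz.1, hz.2.1, star_subset i hΓ hz.2.2⟩
  have e : annulusPart i Γ ∩ partialMomentAngle i (star i Γ) = annulusPart i (star i Γ) := by
    ext z
    constructor
    · rintro ⟨⟨_, h1⟩, h2⟩
      exact ⟨h2, h1⟩
    · rintro ⟨h2, h1⟩
      exact ⟨⟨hsub h2, h1⟩, h2⟩
  have h12 := isQI_toChains_annulus (i := i) hS (h _ hS)
  rw [← e, ← chainsIn_inf] at h12
  have := (isQI_toChains_annulus hΓ (h Γ hΓ)).sup (isQI_toChains_disk hΓ (h _ hS)) h12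
    (smallPart_inf hΓ) (NormalizedChains.differential_differential R _)
    differential_differential
  rw [← smallPart_eq hΓ] at this
  -- the annulus and the disc overlap, hence their chains generate the homology of the union
  refine this.trans (isQI_small (U' := {z | 1 / 2 < ‖z i‖})
    (V' := {z | ‖z i‖ < 1}) ?_ ?_ ?_ ?_ ?_ Set.inter_subset_left hsub)
  · exact isOpen_lt continuous_const (by fun_prop)
  · exact isOpen_lt (by fun_prop) continuous_const
  · intro z _
    rcases lt_or_ge (1 / 2) ‖z i‖ with h' | h'
    · exact Or.inl h'
    · exact Or.inr (lt_of_le_of_lt h' (by norm_num))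
  · rintro z ⟨hz, h'⟩
    exact ⟨hz, (show 1 / 2 < ‖z i‖ from h').le⟩
  · rintro z ⟨hz, h'⟩
    refine ⟨hz.1, hz.2.1, ?_⟩
    rw [mem_star, Finset.insert_eq_of_mem (mem_nonUnit.2 (ne_of_lt h'))]
    exact hz.2.2

theorem nonUnit_one : nonUnit (1 : Fin m → ℂ) = ∅ := by
  refine Finset.eq_empty_of_forall_notMem fun j => ?_
  rw [mem_nonUnit, not_not, Pi.one_apply, norm_one]

theorem basePoint_mem (hΓ : ∅ ∈ Γ) : basePoint R m ∈ chainsIn R (partialMomentAngle m Γ) := by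
  refine of_mem_chainsIn fun p => ⟨fun j _ => rfl, fun j => (norm_one (α := ℂ)).le, ?_⟩
  exact (congrArg (· ∈ Γ) nonUnit_one).mpr hΓ

theorem eq_one_of_mem_partialMomentAngle {z : Fin m → ℂ} (h : z ∈ partialMomentAngle m Γ) :
    z = 1 := funext fun j => h.1 j j.2

/-- Normalized chains at a point are multiples of the `0`-simplex. -/
theorem eq_smul_basePoint {c : SingChains R (Fin m → ℂ)}
    (hc : c ∈ chainsIn R (partialMomentAngle m Γ)) :
    c = Coalgebra.counit (R := R) c • basePoint R m := by
  refine eqOn_chainsIn (f := LinearMap.id)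
    (g := (Coalgebra.counit (R := R)).smulRight (basePoint R m)) (fun n x hx => ?_) c hc
  rw [LinearMap.smulRight_apply, LinearMap.id_apply]
  erw [NormalizedChains.counit_of]
  have hx1 : ∀ p, toMap x p = 1 := fun p => eq_one_of_mem_partialMomentAngle (hx p)
  cases n with
  | zero =>
    rw [if_pos rfl, one_smul]
    exact congrArg (NormalizedChains.of R) (Sing.ext fun p => hx1 p)
  | succ n =>
    rw [if_neg (Nat.succ_ne_zero n), zero_smul]
    have e : x = (Sing (Fin m → ℂ)).map (SimplexCategory.const ⦋n + 1⦌ ⦋0⦌ 0).op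
        (ofMap (n := 0) (ContinuousMap.const _ 1)) := Sing.ext fun p => hx1 p
    rw [e]
    refine NormalizedChains.of_map R _ (fun h => ?_) _
    have := @h 0 1 rfl
    simp at this

theorem eq_zero_of_empty_notMem (hΓ : ∅ ∉ Γ) {c : SingChains R (Fin m → ℂ)}
    (hc : c ∈ chainsIn R (partialMomentAngle m Γ)) : c = 0 := by
  refine (Submodule.mem_bot R).1 (chainsIn_le (N := ⊥) (fun n x hx => ?_) hc)
  have h := hx ⟨_, single_mem_stdSimplex ℝ 0⟩
  have h' := h.2.2
  rw [eq_one_of_mem_partialMomentAngle h, nonUnit_one] at h'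
  exact absurd h' hΓ

/-- The beginning of the induction: both sides are free on one generator or `0`. -/
theorem isQI_toChains_last (hΓ : IsLowerSet Γ) : IsQI (differential R _) (singD R)
      (toChains R m) (smallPart R m Γ) (chainsIn R (partialMomentAngle m Γ)) where
  map_mem a ha := by
    refine smallPart_last_le (N := (chainsIn R _).comap (toChains R m)) (fun h => ?_) ha
    rw [Submodule.mem_comap, toChains_one]
    exact basePoint_mem h
  comm a ha := by
    refine smallPart_last_le (N := LinearMap.eqLocus (toChains R m ∘ₗ differential R _)
      (singD R ∘ₗ toChains R m)) (fun _ => ?_) ha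
    rw [LinearMap.mem_eqLocus, LinearMap.comp_apply, LinearMap.comp_apply, toChains_one,
      differential_tmul (mem_fullComplex _)]
    refine Eq.trans ?_ (NormalizedChains.differential_of _).symm
    simp [NormalizedChains.boundary]
  d_left a := differential_smallPart hΓ
  d_right b := singD_mem
  inj a ha _ b _ hb := by
    have e : a = Coalgebra.counit (R := R) a •
        StanleyReisnerCoalgebra.u R (fullComplex m) 0 ⊗ₜ[R] ExteriorCoalgebra.v R ∅ :=
      smallPart_last_le (N := LinearMap.eqLocus LinearMap.id ((Coalgebra.counit (R := R)).smulRight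
        (StanleyReisnerCoalgebra.u R (fullComplex m) 0 ⊗ₜ[R] ExteriorCoalgebra.v R ∅)))
        (fun _ => by
          rw [LinearMap.mem_eqLocus, LinearMap.smulRight_apply, counit_tmul (mem_fullComplex _),
            if_pos ⟨rfl, rfl⟩, one_smul]
          rfl) ha
    have h0 : Coalgebra.counit (R := R) (singD R b) = 0 :=
      (NormalizedChains.dgc R (Sing (Fin m → ℂ))).counit_d b
    rw [hb, e, map_smul, map_smul, toChains_one, counit_basePoint, smul_eq_mul, mul_one] at h0
    exact ⟨0, zero_mem _, by rw [e, h0, zero_smul, map_zero]⟩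
  surj b hb _ := by
    by_cases h : ∅ ∈ Γ
    · refine ⟨Coalgebra.counit (R := R) b •
        StanleyReisnerCoalgebra.u R (fullComplex m) 0 ⊗ₜ[R] ExteriorCoalgebra.v R ∅,
        Submodule.smul_mem _ _ (mem_spanOf (mem_fullComplex _)
          ⟨by simp, by simp, by simpa using h, by simp, by simp⟩), ?_, 0, zero_mem _, ?_⟩
      · rw [map_smul, differential_tmul (mem_fullComplex _)]
        simp
      · rw [map_smul, toChains_one, map_zero, sub_eq_zero]
        exact (eq_smul_basePoint hb).symm
    · refine ⟨0, zero_mem _, map_zero _, 0, zero_mem _, ?_⟩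
      rw [eq_zero_of_empty_notMem h hb, map_zero, map_zero, sub_zero]

/-- The comparison map is a quasi-isomorphism onto the chains in the moment-angle complex, by
induction on the number `k` of coordinates that may differ from `1`. -/
theorem isQI_toChains (k : ℕ) (hk : k ≤ m) : ∀ Γ : Set (Finset (Fin m)), IsLowerSet Γ →
    IsQI (differential R _) (singD R) (toChains R m) (smallPart R (m - k) Γ)
      (chainsIn R (partialMomentAngle (m - k) Γ)) := by
  induction k with
  | zero => exact fun Γ hΓ => isQI_toChains_last hΓ
  | succ k ih =>
    intro Γ hΓ
    obtain ⟨i, hi⟩ : ∃ i : Fin m, i.1 = m - (k + 1) := ⟨⟨m - (k + 1), by omega⟩, rfl⟩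
    have ih' := ih (by omega)
    rw [show m - k = i + 1 by omega] at ih'
    rw [← hi]
    exact isQI_toChains_step hΓ ih'

end MainInduction

/-! ### The quasi-isomorphism `Ψ` -/

section Conclusion

open Simplicial Opposite
open scoped TensorProduct
open Sing NormalizedChains

variable {R : Type} [CommRing R]

/-- A chain map that is bijective is a quasi-isomorphism. -/
theorem IsQI.of_bijective {M N : Type} [AddCommGroup M] [Module R M] [AddCommGroup N] [Module R N]
    {dM : M →ₗ[R] M} {dN : N →ₗ[R] N} {f : M →ₗ[R] N} {A : Submodule R M} {B : Submodule R N}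
    (hd : ∀ a ∈ A, dM a ∈ A) (hcomm : ∀ a ∈ A, f (dM a) = dN (f a))
    (hinj : ∀ a ∈ A, f a = 0 → a = 0) (hB : A.map f = B) : IsQI dM dN f A B := by
  subst hB
  refine ⟨fun a ha => ⟨a, ha, rfl⟩, hcomm, hd, ?_, ?_, ?_⟩
  · rintro _ ⟨a, ha, rfl⟩
    exact ⟨dM a, hd a ha, hcomm a ha⟩
  · rintro a ha - _ ⟨b, hb, rfl⟩ h
    refine ⟨b, hb, sub_eq_zero.1 (hinj _ (sub_mem (hd b hb) ha) ?_)⟩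
    rw [map_sub, hcomm b hb, h, sub_self]
  · rintro _ ⟨a, ha, rfl⟩ h
    exact ⟨a, ha, hinj _ (hd a ha) ((hcomm a ha).trans h), 0, zero_mem _, by simp⟩

section Subspaces

variable {T : Type} [TopologicalSpace T] (A : Set T)

/-- The inclusion of a subspace. -/
def subspaceIncl : C(A, T) := ⟨Subtype.val, continuous_subtype_val⟩

/-- A singular simplex with values in the subset `A`, considered as a singular simplex of `A`. -/
noncomputable def corestrict {n : ℕ} (x : Sing T _⦋n⦌) (h : ∀ p, toMap x p ∈ A) : Sing A _⦋n⦌ :=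
  ofMap ⟨fun p => ⟨toMap x p, h p⟩, (toMap x).continuous.subtype_mk h⟩

theorem corestrict_degenerate {n : ℕ} {x : Sing T _⦋n⦌} (hx : x ∈ (Sing T).degenerate n)
    (h : ∀ p, toMap x p ∈ A) : corestrict A x h ∈ (Sing A).degenerate n := by
  obtain ⟨k, rfl, j, y, hy⟩ := exists_σ hx
  obtain rfl : x = (Sing T).map (SimplexCategory.σ j).op y := hy
  have hy : y = (Sing T).map (SimplexCategory.δ j.castSucc).op
      ((Sing T).map (SimplexCategory.σ j).op y) := by
    rw [← Functor.map_comp_apply, ← op_comp, SimplexCategory.δ_comp_σ_self, op_id,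
      Functor.map_id_apply]
  have h' : ∀ p, toMap y p ∈ A := fun p => by
    rw [hy, toMap_map]
    exact h _
  exact ⟨k, Nat.lt_succ_self k, SimplexCategory.σ j, corestrict A y h', rfl⟩

open Classical in
variable (R) in
/-- The map from chains on the whole space to chains on a subspace that sends all simplices not
contained in the subspace to `0`. This is not a chain map. -/
noncomputable def corestrictChains : SingChains R T →ₗ[R] SingChains R A :=
  NormalizedChains.lift (fun _ x => if h : ∀ p, toMap x p ∈ A then of R (corestrict A x h) else 0)
    fun n x hx => by
      split_ifs with h
      · exact of_degenerate R (corestrict_degenerate A hx h)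
      · rfl

open Classical in
theorem corestrictChains_of {n : ℕ} (x : Sing T _⦋n⦌) : corestrictChains R A (of R x) =
    if h : ∀ p, toMap x p ∈ A then of R (corestrict A x h) else 0 := lift_of _ _ x

theorem corestrictChains_comp :
    corestrictChains R A ∘ₗ pushChains R (subspaceIncl A) = LinearMap.id := by
  refine NormalizedChains.hom_ext fun n x => ?_
  rw [LinearMap.comp_apply, pushChains_of, corestrictChains_of, 
    dif_pos (show ∀ p, toMap ((Sing.map (subspaceIncl A)).app _ x) p ∈ A from
      fun p => (toMap x p).2)]
  rfl

theorem corestrictChains_push (c : SingChains R A) :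
    corestrictChains R A (pushChains R (subspaceIncl A) c) = c :=
  LinearMap.congr_fun (corestrictChains_comp A) c

theorem push_corestrictChains {c : SingChains R T} (hc : c ∈ chainsIn R A) :
    pushChains R (subspaceIncl A) (corestrictChains R A c) = c :=
  eqOn_chainsIn (f := pushChains R (subspaceIncl A) ∘ₗ corestrictChains R A) (g := LinearMap.id)
    (fun n x hx => by
      rw [LinearMap.comp_apply, corestrictChains_of, dif_pos hx, pushChains_of]
      rfl) c hc

theorem push_subspaceIncl_mem (c : SingChains R A) :
    pushChains R (subspaceIncl A) c ∈ chainsIn R A := by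
  have h : (⊤ : Submodule R (SingChains R A)) ≤
      (chainsIn R A).comap (pushChains R (subspaceIncl A)) := by
    rw [← chainsIn_univ]
    refine chainsIn_le fun n x _ => ?_
    rw [Submodule.mem_comap, pushChains_of]
    exact of_mem_chainsIn fun p => (toMap x p).2
  exact h trivial

theorem corestrictChains_deg {n : ℕ} {c : SingChains R T} (hc : c ∈ deg R (Sing T) n) :
    corestrictChains R A c ∈ deg R (Sing A) n := by
  refine deg_le (N := (deg R (Sing A) n).comap (corestrictChains R A)) (fun x => ?_) hc
  rw [Submodule.mem_comap, corestrictChains_of]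
  split_ifs
  · exact of_mem R _
  · exact zero_mem _

theorem singD_corestrictChains {c : SingChains R T} (hc : c ∈ chainsIn R A) :
    corestrictChains R A (singD R c) = singD R (corestrictChains R A c) := by
  conv_lhs => rw [← push_corestrictChains A hc, ← pushChains_singD, corestrictChains_push]

theorem isQI_corestrictChains :
    IsQI (singD R) (singD R) (corestrictChains R A) (chainsIn R A) ⊤ := by
  refine IsQI.of_bijective (fun _ => singD_mem) (fun _ => singD_corestrictChains A)
    (fun c hc h => ?_) (eq_top_iff.2 fun c _ => ⟨_, push_subspaceIncl_mem A c, ?_⟩)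
  · rw [← push_corestrictChains A hc, h, map_zero]
  · exact corestrictChains_push A c

end Subspaces

namespace KoszulCoalgebra

open StanleyReisnerCoalgebra (u)
open ExteriorCoalgebra (v)

variable {m : ℕ} (S : SimplicialComplexOn m)

theorem le_fullComplex : S ≤ fullComplex m := fun _ _ => mem_fullComplex _

theorem isLowerSet_faces : IsLowerSet S.faces := fun _ _ h h' => S.down_closed h' h

variable (R) in
/-- The inclusion of `K(Σ)` in the Koszul coalgebra of the full complex. -/
noncomputable abbrev extend : KoszulCoalgebra R S →ₗ[R] KoszulCoalgebra R (fullComplex m) :=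
  (dgcMap R (le_fullComplex S)).toCoalgHom.toLinearMap

theorem extend_tmul {α : Fin m →₀ ℕ} (hα : α.support ∈ S.faces) (τ : Finset (Fin m)) :
    extend R S (u R S α ⊗ₜ[R] v R τ) = u R (fullComplex m) α ⊗ₜ[R] v R τ :=
  dgcMap_tmul (le_fullComplex S) hα τ

theorem extend_injective : Function.Injective (extend R S) := by
  have : lift (fun α τ => u R S α ⊗ₜ[R] v R τ) ∘ₗ extend R S = LinearMap.id := by
    refine hom_ext fun α τ hα => ?_
    rw [LinearMap.comp_apply, extend_tmul S hα, lift_tmul _ (mem_fullComplex _)]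
    rfl
  exact Function.LeftInverse.injective fun x => LinearMap.congr_fun this x

theorem map_extend_subL : (subL R S).map (extend R S) = smallPart R 0 S.faces := by
  refine le_antisymm ?_ (spanOf_le fun α τ _ h => ?_)
  · rw [Submodule.map_le_iff_le_comap]
    refine subL_le fun α τ hα h1 hd => ?_
    rw [Submodule.mem_comap, extend_tmul S hα]
    exact mem_spanOf (mem_fullComplex _) ⟨h1, hd, hα, by simp, by simp⟩
  · exact ⟨_, mem_subL h.mem h.le_one h.disjoint, extend_tmul S h.mem τ⟩

theorem isQI_extend : IsQI (differential R S) (differential R _) (extend R S) (subL R S)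
    (smallPart R 0 S.faces) :=
  IsQI.of_bijective isSubDGC.d_mem (fun a _ => (dgcMap R (le_fullComplex S)).map_d a)
    (fun _ _ h => extend_injective S (h.trans (map_zero _).symm)) (map_extend_subL S)

theorem smallPart_mono {k : ℕ} {Γ Γ' : Set (Finset (Fin m))} (h : Γ ⊆ Γ') :
    smallPart R k Γ ≤ smallPart R k Γ' :=
  spanOf_mono fun _ _ hs => ⟨hs.le_one, hs.disjoint, h hs.mem, hs.zero_of_lt, hs.notMem_of_lt⟩

theorem toChains_mem_deg {x : KoszulCoalgebra R (fullComplex m)}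
    (hx : x ∈ smallPart R 0 Set.univ) {n : ℕ} (hn : x ∈ deg R (fullComplex m) n) :
    toChains R m x ∈ NormalizedChains.deg R (Sing (Fin m → ℂ)) n := by
  have h : x ∈ spanOf R (fullComplex m)
      fun α τ => IsSmall 0 Set.univ α τ ∧ 2 * (∑ i, α i) + τ.card = n := by
    rw [← spanOf_inf]
    exact ⟨hx, hn⟩
  refine spanOf_le (N := (NormalizedChains.deg R (Sing (Fin m → ℂ)) n).comap (toChains R m))
    (fun α τ _ h => ?_) h
  rw [Submodule.mem_comap, toChains_tmul, ← h.2]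
  exact productChain_mem_deg h.1.le_one h.1.disjoint

theorem partialMomentAngle_zero :
    partialMomentAngle 0 S.faces = momentAngleComplex S := by
  ext z
  rw [momentAngleComplex, Set.mem_iUnion₂]
  constructor
  · rintro ⟨-, h1, h2⟩
    refine ⟨_, h2, fun i => mem_closedBall_zero_iff.2 (h1 i), fun i hi => ?_⟩
    rw [mem_nonUnit, not_not] at hi
    exact mem_sphere_zero_iff_norm.2 hi
  · rintro ⟨σ, hσ, h1, h2⟩
    refine ⟨by simp, fun i => mem_closedBall_zero_iff.1 (h1 i), S.down_closed hσ fun i hi => ?_⟩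
    by_contra h
    exact mem_nonUnit.1 hi (mem_sphere_zero_iff_norm.1 (h2 i h))

variable (R) in
/-- The comparison map on `L(Σ)`, with values in the chains on `ℂ^m`. -/
noncomputable def smallToChains : subL R S →ₗ[R] SingChains R (Fin m → ℂ) :=
  toChains R m ∘ₗ extend R S ∘ₗ (subL R S).subtype

theorem extend_mem (x : subL R S) : extend R S x ∈ smallPart R 0 S.faces := by
  rw [← map_extend_subL]
  exact ⟨x, x.2, rfl⟩

theorem extend_mem_univ (x : subL R S) : extend R S x ∈ smallPart R 0 Set.univ :=
  smallPart_mono (Set.subset_univ _) (extend_mem S x)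

theorem isQI_subtype : IsQI ((isSubDGC (R := R) (S := S)).dgc.d) (differential R S)
    (subL R S).subtype ⊤ (subL R S) :=
  IsQI.of_bijective (fun _ _ => trivial) (fun _ _ => rfl) (fun _ _ h => Subtype.ext h)
    ((Submodule.map_top _).trans (Submodule.range_subtype _))

theorem isQI_smallToChains : IsQI ((isSubDGC (R := R) (S := S)).dgc.d) (singD R)
    (smallToChains R S) ⊤ (chainsIn R (momentAngleComplex S)) := by
  have h := isQI_toChains (R := R) m le_rfl S.faces (isLowerSet_faces S)
  rw [Nat.sub_self, partialMomentAngle_zero] at h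
  exact h.comp ((isQI_extend S).comp (isQI_subtype S))

theorem smallToChains_mem (x : subL R S) :
    smallToChains R S x ∈ chainsIn R (momentAngleComplex S) :=
  (isQI_smallToChains S).map_mem x trivial

variable (R) in
/-- The linear map underlying `Ψ(Σ)`. -/
noncomputable def psiLinear : subL R S →ₗ[R] SingChains R (momentAngleComplex S) :=
  corestrictChains R (momentAngleComplex S) ∘ₗ smallToChains R S

theorem push_psiLinear (x : subL R S) :
    pushChains R (subspaceIncl (momentAngleComplex S)) (psiLinear R S x) = smallToChains R S x :=
  push_corestrictChains _ (smallToChains_mem S x)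

theorem isQI_psiLinear : IsQI ((isSubDGC (R := R) (S := S)).dgc.d) (singD R)
    (psiLinear R S) ⊤ ⊤ :=
  (isQI_corestrictChains _).comp (isQI_smallToChains S)

theorem comul_psiLinear (x : subL R S) :
    TensorProduct.map (psiLinear R S) (psiLinear R S)
      (DGCoalgebra.IsSubDGC.comul (C := dgc R S) (subL R S) (projL R S) x) =
      Coalgebra.comul (R := R) (psiLinear R S x) := by
  refine DGCoalgebra.IsSubDGC.eq_of_map_eq (DGCoalgebra.IsSubDGC.map_injective
    (corestrictChains_comp (R := R) (momentAngleComplex S))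
    (corestrictChains_comp (R := R) (momentAngleComplex S))) ?_
  rw [← comul_pushChains, push_psiLinear]
  have e : pushChains R (subspaceIncl (momentAngleComplex S)) ∘ₗ psiLinear R S =
      smallToChains R S := LinearMap.ext (push_psiLinear S)
  have key : ∀ t : subL R S ⊗[R] subL R S,
      TensorProduct.map (pushChains R (subspaceIncl (momentAngleComplex S)))
        (pushChains R (subspaceIncl (momentAngleComplex S)))
        (TensorProduct.map (psiLinear R S) (psiLinear R S) t) =
      TensorProduct.map (toChains R m) (toChains R m) (TensorProduct.map (extend R S) (extend R S)
        (TensorProduct.map (subL R S).subtype (subL R S).subtype t)) := fun t => by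
    rw [map_map, map_map, map_map, e]
    rfl
  have h1 := (isSubDGC (R := R) (S := S)).map_comul x
  have h2 := LinearMap.congr_fun (dgcMap R (le_fullComplex S)).toCoalgHom.map_comp_comul x.1
  refine (key _).trans (Eq.trans ?_ (comul_toChains (extend_mem_univ S x)).symm)
  exact congrArg (TensorProduct.map (toChains R m) (toChains R m))
    ((congrArg (TensorProduct.map (extend R S) (extend R S)) h1).trans h2)

theorem counit_psiLinear (x : subL R S) : Coalgebra.counit (R := R) (psiLinear R S x) =
    Coalgebra.counit (R := R) (A := KoszulCoalgebra R S) x := by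
  rw [← counit_pushChains (subspaceIncl (momentAngleComplex S)), push_psiLinear]
  refine (counit_toChains (extend_mem_univ S x)).trans ?_
  exact LinearMap.congr_fun (dgcMap R (le_fullComplex S)).toCoalgHom.counit_comp x.1

variable (R) in
/-- The morphism of dgcs `Ψ(Σ)`. -/
noncomputable def psiApp : (isSubDGC (R := R) (S := S)).dgc ⟶
    NormalizedChains.dgc R (Sing (momentAngleComplex S)) :=
  letI := (isSubDGC (R := R) (S := S)).coalgebra
  DGCoalgebra.Hom.mk (C := (isSubDGC (R := R) (S := S)).dgc)
    (D := NormalizedChains.dgc R (Sing (momentAngleComplex S)))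
    { psiLinear R S with
      counit_comp := LinearMap.ext (counit_psiLinear S)
      map_comp_comul := LinearMap.ext (comul_psiLinear S) }
    (fun n x hx => corestrictChains_deg _ (toChains_mem_deg (extend_mem_univ S x)
      ((dgcMap R (le_fullComplex S)).map_deg n x.1 hx)))
    (fun x => (isQI_psiLinear S).comm x trivial)

theorem isQuasiIso_psiApp : DGCoalgebra.IsQuasiIso (psiApp R S) :=
  DGCoalgebra.isQuasiIso_of_isQI _ (isQI_psiLinear S)

theorem isQuasiIso_inclusion : DGCoalgebra.IsQuasiIso ((inclusion R m).app S) :=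
  DGCoalgebra.isQuasiIso_of_isQI _ (isQI_subL.comp (isQI_subtype S))

variable {S} in
theorem extend_comp_dgcMap {S' : SimplicialComplexOn m} (hS : S ≤ S') :
    extend R S' ∘ₗ (dgcMap R hS).toCoalgHom.toLinearMap = extend R S := by
  refine hom_ext fun α τ hα => ?_
  rw [extend_tmul S hα, ← extend_tmul S' (hS hα)]
  exact congrArg (extend R S') (dgcMap_tmul hS hα τ)

variable {S} in
theorem psiLinear_naturality {S' : SimplicialComplexOn m} (hS : S ≤ S') (x : subL R S)
    (x' : subL R S') (hx : (dgcMap R hS).toCoalgHom.toLinearMap x.1 = x'.1)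
    (g : C(momentAngleComplex S, momentAngleComplex S'))
    (hg : (subspaceIncl (momentAngleComplex S')).comp g = subspaceIncl (momentAngleComplex S)) :
    psiLinear R S' x' = pushChains R g (psiLinear R S x) := by
  refine Function.LeftInverse.injective
    (corestrictChains_push (R := R) (momentAngleComplex S')) ?_
  rw [push_psiLinear, pushChains_comp, hg, push_psiLinear]
  refine congrArg (toChains R m) ((congrArg (extend R S') hx.symm).trans ?_)
  exact LinearMap.congr_fun (extend_comp_dgcMap hS) x.1

variable (R m) in
/-- The natural transformation `Ψ`. -/
noncomputable def psi : functorL R m ⟶ momentAngleChains R m where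
  app S := psiApp R S
  naturality S S' f := by
    refine DGCoalgebra.Hom.ext (CoalgHom.coe_linearMap_injective (LinearMap.ext fun x => ?_))
    exact psiLinear_naturality (leOfHom f) x ⟨_, dgcMap_subL (leOfHom f) x.1 x.2⟩ rfl
      ⟨Set.inclusion (momentAngleComplex_mono (leOfHom f)), continuous_inclusion _⟩ rfl

end KoszulCoalgebra

end Conclusion

theorem theorem2 (m : ℕ) :
    (DGCoalgebra.NaturallyQuasiIsomorphic (momentAngleChains ℤ m) (KoszulCoalgebra.functor ℤ m) ∧
      DGCoalgebra.NaturallyQuasiIsomorphic (momentAngleChains ℤ m) (KoszulCoalgebra.functorL ℤ m) ∧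
      DGCoalgebra.NaturallyQuasiIsomorphic (KoszulCoalgebra.functorL ℤ m)
        (KoszulCoalgebra.functor ℤ m)) ∧
    (∀ S : SimplicialComplexOn m,
      DGCoalgebra.IsQuasiIso ((KoszulCoalgebra.inclusion ℤ m).app S)) ∧
    (∃ Ψ : KoszulCoalgebra.functorL ℤ m ⟶ momentAngleChains ℤ m,
      ∀ S : SimplicialComplexOn m, DGCoalgebra.IsQuasiIso (Ψ.app S)) := by
  have hL : DGCoalgebra.NaturallyQuasiIsomorphic (KoszulCoalgebra.functorL ℤ m)
      (KoszulCoalgebra.functor ℤ m) :=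
    .rel _ _ ⟨KoszulCoalgebra.inclusion ℤ m, KoszulCoalgebra.isQuasiIso_inclusion⟩
  have hΨ : DGCoalgebra.NaturallyQuasiIsomorphic (momentAngleChains ℤ m)
      (KoszulCoalgebra.functorL ℤ m) :=
    .symm _ _ (.rel _ _ ⟨KoszulCoalgebra.psi ℤ m, KoszulCoalgebra.isQuasiIso_psiApp⟩)
  exact ⟨⟨.trans _ _ _ hΨ hL, hΨ, hL⟩, KoszulCoalgebra.isQuasiIso_inclusion,
    KoszulCoalgebra.psi ℤ m, KoszulCoalgebra.isQuasiIso_psiApp⟩
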